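/- **Setting.** Let $n\ge 1$, $\alpha\in(0,1)$, and let $\Omega\subset\mathbb R^n$ be a bounded domain of class $C^{4,\alpha}$ with outer unit normal $\nu$ (also regarded as the horizontal vector $(\nu,0)\in\mathbb R^{n+1}$). Put $\mathcal C=\Omega\times(0,\infty)$, with points $X=(x,y)$, and $\partial_L\mathcal C=\partial\Omega\times(0,\infty)$. Let $f\in C^{2,\alpha}(\mathbb R)$ (the second derivative being locally Hölder), and let $g=g(y,t)$, $y>0$, $t\in\mathbb R$, be continuous in $y$ and locally Lipschitz in $t$. Write $g_u$ for the derivative of $g$ in its second variable (where it does not exist, put $g_u=0$). Let $a\in C((0,\infty)\times[0,\infty))\cap C^1((0,\infty)\times(0,\infty))$ be such that, for all $y>0$, $t\ge0$ (with $t\,a_t:=0$ at $t=0$), $$a(y,t)>0,\qquad a(y,t)+t\,a_t(y,t)>0,\qquad t\,|a_t(y,t)|\le C\,a(y,t)$$ for a constant $C>0$ independent of $y,t$, and $\lim_{t\to0^+}t\,a_t(y,t)=0$ for every $y>0$. For $y>0$ and $\eta\in\mathbb R^{n+1}$ let $$\mathcal B(y,\eta)_{ij}=a(y,|\eta|)\,\delta_{ij}+\frac{a_t(y,|\eta|)}{|\eta|}\,\eta_i\eta_j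 ,\qquad i,j=1,\dots,n+1,$$ where the last term is $0$ if $\eta=0$. A function $v$ on $\mathcal C$ has trace $v_0\in L^2(\Omega)$ on $\Omega\times\{0\}$ if $v(\cdot,y)\to v_0$ in $L^2(\Omega)$ as $y\to0^+$; we then write $v(\cdot,0)=v_0$. **Solutions.** Consider the problem $$\operatorname{div}(a(y,|\nabla u|)\nabla u)=g(y,u)\ \text{in }\mathcal C,\qquad \partial_\nu u=0\ \text{on }\partial_L\mathcal C,\qquad -a(y,|\nabla u|)\,\partial_yu=f(u)\ \text{on }\Omega\times\{0\}.$$ A solution is a function $u\in C(\overline{\mathcal C})\cap C^2(\overline\Omega\times(0,\infty))$ with $\partial_\nu u=0$ on $\partial_L\mathcal C$ such that all entries of $\nabla_xu$ and $D^2_xu$ have traces in $L^2(\Omega)$ on $\Omega\times\{0\}$, such that for every $R>0$ $$a(y,|\nabla u|)\big(|\nabla u|^2+|D_x^2u|^2+|\nabla_xu_y|^2+|D^3_xu|^2+|D^2_xu_y|^2\big)\in L^1(\Omega\times(0,R))$$ (the third derivatives being weak derivatives of $D_x^2u$), and such that $$\int_{\mathcal C}a(y,|\nabla u|)\nabla u\cdot\nabla\varphi+\int_{\mathcal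 C}g(y,u)\varphi=\int_\Omega f(u(x,0))\,\varphi(x,0)\,dx\qquad\text{for all }\varphi\in\mathcal A,$$ the integrals being convergent. Here $\mathcal A$ is the set of $\varphi\in W^{1,1}_{\rm loc}(\mathcal C)$ with bounded support in $y$, with $a(y,|\nabla u|)|\nabla\varphi|^2\in L^1(\mathcal C)$, and with a trace $\varphi(\cdot,0)\in L^2(\Omega)$. The solution $u$ is stable if for all $\varphi\in\mathcal A$ one has $g_u(y,u)\varphi^2\in L^1(\mathcal C)$ and $$\int_{\mathcal C}\langle\mathcal B(y,\nabla u)\nabla\varphi,\nabla\varphi\rangle+\int_{\mathcal C}g_u(y,u)\varphi^2-\int_\Omega f'(u(x,0))\,\varphi(x,0)^2\,dx\ge0 .$$ **Theorem.** Let $u$ be a stable solution. Then for every $\psi\in C^1(\overline{\mathcal C})$ with bounded support in $y$ and with $\psi_{x_j}\in\mathcal A$ for $j=1,\dots,n$, the three integrals below converge absolutely and $$\int_{\mathcal C}\Big[\sum_{j=1}^n\langle\mathcal B(y,\nabla u)\nabla u_{x_j},\nabla u_{x_j}\rangle-\langle\mathcal B(y,\nabla u)\nabla|\nabla_xu|,\nabla|\nabla_xu|\rangle\Big]\psi^2-\int_{\partial_L\mathcal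 C}a(y,|\nabla u|)\,\big(\nabla u\cdot\partial_\nu(\nabla u)\big)\,\psi^2\le\int_{\mathcal C}\langle\mathcal B(y,\nabla u)\nabla\psi,\nabla\psi\rangle\,|\nabla_xu|^2 .$$ -/

import Mathlib

open MeasureTheory Set Filter Topology
open scoped NNReal ENNReal ContDiff Matrix RealInnerProductSpace

noncomputable section

/-! ## Domains, outer normals, cylinders -/

/-- The horizontal space `ℝⁿ` (variable `x`); points of the cylinder are pairs `(x, y)`. -/
abbrev Hor (n : ℕ) : Type := EuclideanSpace ℝ (Fin n)

/-- The space `ℝⁿ⁺¹` in which full gradients `(∂_{x_1}, …, ∂_{x_n}, ∂_y)` take their values. -/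
abbrev Full (n : ℕ) : Type := EuclideanSpace ℝ (Fin (n + 1))

/-- A bounded domain (nonempty, open, connected) of class `C^{k,α}`: near each boundary point it is
a strict sublevel set of a `C^{k,α}` function without critical points. -/
structure IsHolderDomain {n : ℕ} (k : ℕ) (α : ℝ≥0) (Ω : Set (Hor n)) : Prop where
  isOpen : IsOpen Ω
  isConnected : IsConnected Ω
  isBounded : Bornology.IsBounded Ω
  boundary : ∀ p ∈ frontier Ω, ∃ r > (0 : ℝ), ∃ ρ : Hor n → ℝ,
    ContDiffOn ℝ k ρ (Metric.ball p r) ∧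
    (∃ C : ℝ≥0, HolderOnWith C α (iteratedFDeriv ℝ k ρ) (Metric.ball p r)) ∧
    (∀ x ∈ Metric.ball p r, fderiv ℝ ρ x ≠ 0) ∧
    Ω ∩ Metric.ball p r = {x ∈ Metric.ball p r | ρ x < 0}

/-- `ν` is the outer unit normal to `Ω` at the boundary point `x`: directions forming an obtuse
angle with `ν` enter `Ω`, and those forming an acute angle leave `closure Ω`. -/
def IsOuterUnitNormal {n : ℕ} (Ω : Set (Hor n)) (x ν : Hor n) : Prop :=
  ‖ν‖ = 1 ∧ ∀ v : Hor n,
    (⟪v, ν⟫ < 0 → ∀ᶠ t : ℝ in 𝓝[>] 0, x + t • v ∈ Ω) ∧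
    (0 < ⟪v, ν⟫ → ∀ᶠ t : ℝ in 𝓝[>] 0, x + t • v ∉ closure Ω)

/-- There is at most one outer unit normal at a point. -/
theorem IsOuterUnitNormal.unique {n : ℕ} {Ω : Set (Hor n)} {x ν₁ ν₂ : Hor n}
    (h₁ : IsOuterUnitNormal Ω x ν₁) (h₂ : IsOuterUnitNormal Ω x ν₂) : ν₁ = ν₂ := by
  by_contra hne
  have hlt : ⟪ν₁, ν₂⟫ < 1 := by
    rcases lt_or_eq_of_le (real_inner_le_norm ν₁ ν₂) with h | h
    · simpa [h₁.1, h₂.1] using h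
    · rw [h₁.1, h₂.1, one_mul] at h
      exact absurd ((inner_eq_one_iff_of_norm_eq_one h₁.1 h₂.1).1 h) hne
  have e₁ : ⟪ν₂ - ν₁, ν₁⟫ < 0 := by
    rw [inner_sub_left, real_inner_self_eq_norm_sq, h₁.1, real_inner_comm]; linarith
  have e₂ : 0 < ⟪ν₂ - ν₁, ν₂⟫ := by
    rw [inner_sub_left, real_inner_self_eq_norm_sq, h₂.1]; linarith
  obtain ⟨t, ht₁, ht₂⟩ := (((h₁.2 _).1 e₁).and ((h₂.2 _).2 e₂)).exists
  exact ht₂ (subset_closure ht₁)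

open Classical in
/-- The outer unit normal of `Ω` at `x` (the vector `0` where there is none). -/
def outerNormal {n : ℕ} (Ω : Set (Hor n)) (x : Hor n) : Hor n :=
  if h : ∃ ν, IsOuterUnitNormal Ω x ν then h.choose else 0

/-- The open half-cylinder `𝒞 = Ω × (0, ∞)`. -/
def cyl {n : ℕ} (Ω : Set (Hor n)) : Set (Hor n × ℝ) := Ω ×ˢ Ioi 0

/-- The set `closure Ω × (0, ∞)`, the cylinder with its lateral boundary. -/
def latCyl {n : ℕ} (Ω : Set (Hor n)) : Set (Hor n × ℝ) := closure Ω ×ˢ Ioi 0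

/-- The closed half-cylinder `closure Ω × [0, ∞)`. -/
def closedCyl {n : ℕ} (Ω : Set (Hor n)) : Set (Hor n × ℝ) := closure Ω ×ˢ Ici 0

/-- Surface measure on the lateral boundary `∂Ω × (0, ∞)`: the `(n-1)`-dimensional
surface measure (Hausdorff measure, normalized as Lebesgue measure) on `∂Ω`, times `dy`. -/
def latMeasure {n : ℕ} (Ω : Set (Hor n)) : Measure (Hor n × ℝ) :=
  ((Measure.euclideanHausdorffMeasure (n - 1)).restrict (frontier Ω)).prod
    (volume.restrict (Ioi 0))

/-! ## Derivatives -/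

/-- The coordinate vectors of `ℝⁿ × ℝ`: indices `j.castSucc` are the `x_j`, the last one is `y`. -/
def coordVec {n : ℕ} : Fin (n + 1) → Hor n × ℝ :=
  Fin.lastCases ((0 : Hor n), (1 : ℝ)) (fun j => (EuclideanSpace.single j (1 : ℝ), 0))

/-- Partial derivative of `v` relative to the set `S`
(the ordinary partial derivative at interior points of `S`, its one-sided version on `∂S`). -/
def pd {n : ℕ} (S : Set (Hor n × ℝ)) (v : Hor n × ℝ → ℝ) (i : Fin (n + 1)) (X : Hor n × ℝ) : ℝ :=
  fderivWithin ℝ v S X (coordVec i)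

/-- The full gradient `∇ v`. -/
def grad {n : ℕ} (S : Set (Hor n × ℝ)) (v : Hor n × ℝ → ℝ) (X : Hor n × ℝ) : Full n :=
  WithLp.toLp 2 fun i => pd S v i X

/-- The horizontal gradient `∇_x v`. -/
def gradX {n : ℕ} (S : Set (Hor n × ℝ)) (v : Hor n × ℝ → ℝ) (X : Hor n × ℝ) : Hor n :=
  WithLp.toLp 2 fun j => pd S v (Fin.castSucc j) X

/-- The derivative of `v` in the horizontal direction `ν`. -/
def dirDeriv {n : ℕ} (S : Set (Hor n × ℝ)) (v : Hor n × ℝ → ℝ) (ν : Hor n) (X : Hor n × ℝ) : ℝ :=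
  fderivWithin ℝ v S X (ν, 0)

/-- `φ ∈ W^{1,1}_loc(Ω × (0,∞))` with weak gradient `G`. -/
structure HasWeakGrad {n : ℕ} (Ω : Set (Hor n)) (φ : Hor n × ℝ → ℝ) (G : Hor n × ℝ → Full n) :
    Prop where
  locInt : LocallyIntegrableOn φ (cyl Ω)
  locInt_grad : LocallyIntegrableOn G (cyl Ω)
  integral_eq : ∀ η : Hor n × ℝ → ℝ, ContDiff ℝ ∞ η → HasCompactSupport η →
    tsupport η ⊆ cyl Ω → ∀ i : Fin (n + 1),
      ∫ X in cyl Ω, φ X * fderiv ℝ η X (coordVec i) = - ∫ X in cyl Ω, G X i * η X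

/-- `φ₀ ∈ L²(Ω)` is the trace of `φ` on `Ω × {0}`: `φ(·, y) → φ₀` in `L²(Ω)` as `y → 0⁺`. The limit
ignores null sets of `y`, so that it depends only on the a.e. class of `φ`. -/
def HasBottomTrace {n : ℕ} (Ω : Set (Hor n)) (φ : Hor n × ℝ → ℝ) (φ₀ : Hor n → ℝ) : Prop :=
  MemLp φ₀ 2 (volume.restrict Ω) ∧
  Tendsto (fun y : ℝ => eLpNorm (fun x => φ (x, y) - φ₀ x) 2 (volume.restrict Ω))
    (𝓝[>] 0 ⊓ ae volume) (𝓝 0)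

/-! ## Structural assumptions on the data -/

/-- The structural assumptions on the diffusion coefficient `a(y,t)`. At `t = 0` the products
`t * a_t` vanish. -/
structure IsDiffusion (a : ℝ → ℝ → ℝ) : Prop where
  cont : ContinuousOn (Function.uncurry a) (Ioi 0 ×ˢ Ici 0)
  contDiff : ContDiffOn ℝ 1 (Function.uncurry a) (Ioi 0 ×ˢ Ioi 0)
  pos : ∀ y > 0, ∀ t ≥ 0, 0 < a y t
  elliptic : ∀ y > 0, ∀ t ≥ 0, 0 < a y t + t * deriv (a y) t
  bound : ∃ C > 0, ∀ y > 0, ∀ t ≥ 0, t * |deriv (a y) t| ≤ C * a y t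
  limit : ∀ y > 0, Tendsto (fun t => t * deriv (a y) t) (𝓝[>] 0) (𝓝 0)

/-- `g(y,t)` is continuous in `y > 0` and locally Lipschitz in `t`. -/
structure IsInnerReaction (g : ℝ → ℝ → ℝ) : Prop where
  cont : ∀ t, ContinuousOn (fun y => g y t) (Ioi 0)
  lip : ∀ y > 0, LocallyLipschitz (g y)

/-- `f ∈ C^{2,α}(ℝ)` (locally Hölder second derivative). -/
structure IsBoundaryReaction (α : ℝ≥0) (f : ℝ → ℝ) : Prop where
  contDiff : ContDiff ℝ 2 f
  holder : ∀ R : ℝ, ∃ C : ℝ≥0, HolderOnWith C α (iteratedDeriv 2 f) (Icc (-R) R)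

/-- The symmetric matrix `ℬ(y,η)_{ij} = a(y,|η|) δ_{ij} + a_t(y,|η|)/|η| η_i η_j`,
the last term being zero for `η = 0`. -/
def matB {n : ℕ} (a : ℝ → ℝ → ℝ) (y : ℝ) (η : Full n) : Matrix (Fin (n + 1)) (Fin (n + 1)) ℝ :=
  Matrix.of fun i j =>
    a y ‖η‖ * (if i = j then 1 else 0) +
      (if η = 0 then 0 else deriv (a y) ‖η‖ / ‖η‖ * η i * η j)

/-- `⟨ℬ(y,η) ξ, ζ⟩`. -/
def formB {n : ℕ} (a : ℝ → ℝ → ℝ) (y : ℝ) (η ξ ζ : Full n) : ℝ :=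
  ∑ i, (matB a y η *ᵥ (fun j => ξ j)) i * ζ i

/-! ## Solutions and stable solutions -/

section Solutions

variable {n : ℕ} (Ω : Set (Hor n)) (a g : ℝ → ℝ → ℝ) (f : ℝ → ℝ) (u : Hor n × ℝ → ℝ)

/-- The gradient of `u`, up to the lateral boundary. -/
def gradU (X : Hor n × ℝ) : Full n := grad (latCyl Ω) u X

/-- The first derivatives `u_{X_i}`, up to the lateral boundary. -/
def uD (i : Fin (n + 1)) (X : Hor n × ℝ) : ℝ := pd (latCyl Ω) u i X

/-- The second derivatives `u_{X_i X_k}`, up to the lateral boundary. -/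
def uDD (i k : Fin (n + 1)) (X : Hor n × ℝ) : ℝ := pd (latCyl Ω) (uD Ω u i) k X

/-- The weight `a(y, |∇u|)`. -/
def wt (X : Hor n × ℝ) : ℝ := a X.2 ‖gradU Ω u X‖

/-- The regularity required of a solution `u`. -/
structure IsRegularSol : Prop where
  cont : ContinuousOn u (closedCyl Ω)
  contDiff : ContDiffOn ℝ 2 u (latCyl Ω)
  /-- `∇_x u` and `D²_x u` have `L²` traces on `Ω × {0}`. -/
  trace_one : ∀ j : Fin n, ∃ w, HasBottomTrace Ω (uD Ω u j.castSucc) w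
  trace_two : ∀ i j : Fin n, ∃ w, HasBottomTrace Ω (uDD Ω u i.castSucc j.castSucc) w
  neumann : ∀ x ∈ frontier Ω, ∀ y > 0, dirDeriv (latCyl Ω) u (outerNormal Ω x) (x, y) = 0
  /-- `T i j` is the weak gradient of `u_{x_i x_j}`; its components are the derivatives
  that make up `D³_x u` and `D²_x u_y`. -/
  energy : ∃ T : Fin n → Fin n → Hor n × ℝ → Full n,
    (∀ i j, HasWeakGrad Ω (uDD Ω u i.castSucc j.castSucc) (T i j)) ∧
    ∀ R > 0, IntegrableOn (fun X => wt Ω a u X *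
      (‖gradU Ω u X‖ ^ 2
        + ∑ i : Fin n, ∑ j : Fin n, uDD Ω u i.castSucc j.castSucc X ^ 2
        + ∑ i : Fin n, uDD Ω u i.castSucc (Fin.last n) X ^ 2
        + ∑ i : Fin n, ∑ j : Fin n, ‖T i j X‖ ^ 2)) (Ω ×ˢ Ioo 0 R)

/-- `φ` is a test function (an element of the class `𝒜` associated with `a` and `u`),
with weak gradient `G` and trace `φ₀` on `Ω × {0}`. -/
structure IsTest (φ : Hor n × ℝ → ℝ) (G : Hor n × ℝ → Full n) (φ₀ : Hor n → ℝ) : Prop where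
  weakGrad : HasWeakGrad Ω φ G
  bddSupport : ∃ R : ℝ, ∀ᵐ X ∂(volume.restrict (cyl Ω)), R ≤ X.2 → φ X = 0
  energy : IntegrableOn (fun X => wt Ω a u X * ‖G X‖ ^ 2) (cyl Ω)
  trace : HasBottomTrace Ω φ φ₀

/-- `u` is a solution of the boundary reaction-diffusion problem: it has the required regularity
and the weak formulation holds, the integrals in it being convergent
(for the two integrals not listed this is automatic). -/
structure IsSolution : Prop where
  regular : IsRegularSol Ω a u
  weak : ∀ φ G φ₀, IsTest Ω a u φ G φ₀ →
    IntegrableOn (fun X => g X.2 (u X) * φ X) (cyl Ω) ∧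
    (∫ X in cyl Ω, wt Ω a u X * ⟪gradU Ω u X, G X⟫) + (∫ X in cyl Ω, g X.2 (u X) * φ X)
      = ∫ x in Ω, f (u (x, 0)) * φ₀ x

/-- `u` is a stable solution: a solution whose second variation `I(φ)` is a well-defined
nonnegative number for all test functions `φ`. -/
structure IsStableSolution : Prop where
  solution : IsSolution Ω a g f u
  stable : ∀ φ G φ₀, IsTest Ω a u φ G φ₀ →
    IntegrableOn (fun X => deriv (g X.2) (u X) * φ X ^ 2) (cyl Ω) ∧
    0 ≤ (∫ X in cyl Ω, formB a X.2 (gradU Ω u X) (G X) (G X))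
      + (∫ X in cyl Ω, deriv (g X.2) (u X) * φ X ^ 2)
      - ∫ x in Ω, deriv f (u (x, 0)) * φ₀ x ^ 2

/-! ## The terms of the inequality -/

/-- `∑_j ⟨ℬ ∇u_{x_j}, ∇u_{x_j}⟩ - ⟨ℬ ∇|∇_x u|, ∇|∇_x u|⟩`. The function `|∇_x u|` is locally
Lipschitz in the cylinder, so its gradient exists almost everywhere. -/
def geomTerm (X : Hor n × ℝ) : ℝ :=
  (∑ j : Fin n, formB a X.2 (gradU Ω u X)
      (grad (latCyl Ω) (uD Ω u j.castSucc) X) (grad (latCyl Ω) (uD Ω u j.castSucc) X))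
    - formB a X.2 (gradU Ω u X)
        (grad (latCyl Ω) (fun Z => ‖gradX (latCyl Ω) u Z‖) X)
        (grad (latCyl Ω) (fun Z => ‖gradX (latCyl Ω) u Z‖) X)

/-- `∇u · ∂_ν(∇u)` at points of the lateral boundary. -/
def normalTerm (X : Hor n × ℝ) : ℝ :=
  ∑ i : Fin (n + 1), uD Ω u i X * dirDeriv (latCyl Ω) (uD Ω u i) (outerNormal Ω X.1) X

end Solutions

end

open MeasureTheory Set Filter Topology
open scoped NNReal ENNReal ContDiff Matrix RealInnerProductSpace

/-! The inequality is the difference of two facts about the quadratic form of the second variation.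
The first is stability, tested with `|∇ₓu| ψ`. The second is the linearized equation: differentiate
the equation in `x_j`, test with `u_{x_j} ψ²` and sum over `j`. Expanding `⟨ℬ∇(|∇ₓu|ψ), ∇(|∇ₓu|ψ)⟩`
and using `∑ u_{x_j}∇u_{x_j} = |∇ₓu| ∇|∇ₓu|`, the mixed terms in `ψ∇ψ` are those of the linearized
equation. The reaction terms with `g_u` and `f'` coincide as well. What is left is the geometric
term, the lateral boundary term and `⟨ℬ∇ψ,∇ψ⟩|∇ₓu|²`. The pointwise algebra is
`IsRegularSol.formB_grad_norm_mul`, the linearized equation is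
`IsStableSolution.linearizedForm_eq_zero`.

The equation cannot be differentiated naively, since `u` has only limited regularity and `g` is only
locally Lipschitz. For smooth compactly supported `Ψ` one tests the weak formulation with `φ =
div_x(Ψ∇ₓu)` and moves one horizontal derivative back. In the reaction terms the divergence theorem
on horizontal slices gives `-∫ g_u|∇ₓu|²Ψ` and `-∫ f'|∇ₓu|²Ψ`; no boundary term appears because
`∇ₓu·ν = 0`. In the diffusion term `a∇u·∇φ` differs by `-∑⟨ℬ∇u_{x_j},∇(u_{x_j}Ψ)⟩` from the
horizontal divergence of the field with components `a∇u·∇(u_{x_j}Ψ)`. By the Neumann condition the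
normal component of this field is `a (∇u·∂_ν∇u) Ψ`, which is the lateral term
(`IsRegularSol.inner_diffusionField`).

Four points need care. The coefficient `a` need not be differentiable where `∇u = 0`, but the flux
`a(y,|η|)η` is differentiable in `η` everywhere, with derivative `ℬ`; hence all integrations by
parts use functions that are differentiable in one horizontal direction only (`IsLineTest`). The
derivative `g_u` exists only almost everywhere, but the preimage under `u(·,y)` of a null set is
null outside the critical set, where `∇ₓu` vanishes anyway (`preimage_null_of_fderiv_ne_zero`). The
lateral integral has to converge down to `y = 0`: the Neumann condition, differentiated along the
boundary, bounds `∇u·∂_ν∇u` by a multiple of `|∇ₓu|²`, and a field transversal to the boundary shows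
that `a|∇ₓu|²` is integrable there (`IsRegularSol.integrable_normalTerm`). Finally, the linearized
equation passes from smooth `Ψ` to `ψ²` by translating into the cylinder and mollifying
(`IsHolderDomain.exists_approx`).

The divergence theorem with Hausdorff measure on the boundary is proved for continuous fields with
integrable weak divergence (`IsHolderDomain.integral_div`). It holds up to a relative error in
charts where the boundary is nearly flat, and the error tends to zero with the size of the charts.
-/

noncomputable section

/-! ### Test functions differentiable in one direction only. -/

section LineTests

variable {E : Type*} [NormedAddCommGroup E] [NormedSpace ℝ E]

/-- `ζ` is a continuous function with compact support in `U` that has a bounded measurable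
derivative `ζ'` in the direction `e`. -/
structure IsLineTest [MeasurableSpace E] (μ : Measure E) (U : Set E) (e : E) (ζ ζ' : E → ℝ) :
    Prop where
  cont : Continuous ζ
  compact : HasCompactSupport ζ
  sub : tsupport ζ ⊆ U
  deriv : ∀ X, HasLineDerivAt ℝ ζ (ζ' X) X e
  meas : AEStronglyMeasurable ζ' μ
  bdd : ∃ C, ∀ X, |ζ' X| ≤ C

theorem HasLineDerivAt.eq_zero_of_notMem_tsupport {ζ : E → ℝ} {d : ℝ} {X e : E}
    (h : HasLineDerivAt ℝ ζ d X e) (hX : X ∉ tsupport ζ) : d = 0 := by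
  have h0 : HasLineDerivAt ℝ ζ 0 X e := by
    have : HasFDerivAt ζ (0 : E →L[ℝ] ℝ) X :=
      (hasFDerivAt_const (0 : ℝ) X).congr_of_eventuallyEq
        (notMem_tsupport_iff_eventuallyEq.1 hX)
    simpa using this.hasLineDerivAt e
  exact h.unique h0

variable [MeasurableSpace E] {μ : Measure E} {U : Set E} {e : E} {ζ ζ' : E → ℝ}

theorem IsLineTest.deriv_eq_zero (h : IsLineTest μ U e ζ ζ') {X : E} (hX : X ∉ tsupport ζ) :
    ζ' X = 0 :=
  (h.deriv X).eq_zero_of_notMem_tsupport hX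

theorem IsLineTest.bdd_fun (h : IsLineTest μ U e ζ ζ') : ∃ C, ∀ X, |ζ X| ≤ C := by
  obtain ⟨C, hC⟩ := h.compact.exists_bound_of_continuous h.cont
  exact ⟨C, fun X => by simpa using hC X⟩

omit [NormedSpace ℝ E] in
/-- Products with locally integrable functions are integrable. -/
theorem integrable_mul_of_tsupport_subset [BorelSpace E] {h k : E → ℝ} {K : Set E}
    (hh : LocallyIntegrableOn h U μ) (hK : IsCompact K) (hKU : K ⊆ U)
    (hk : AEStronglyMeasurable k μ) (hbdd : ∃ C, ∀ X, |k X| ≤ C) (hsupp : ∀ X ∉ K, k X = 0) :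
    Integrable (fun X => h X * k X) μ := by
  have h1 : IntegrableOn h K μ := hh.integrableOn_compact_subset hKU hK
  obtain ⟨C, hC⟩ := hbdd
  have h2 : IntegrableOn (fun X => h X * k X) K μ :=
    h1.mul_bdd hk.restrict (ae_of_all _ fun X => by simpa using hC X)
  rwa [integrableOn_iff_integrable_of_support_subset] at h2
  intro X hX
  by_contra hXK
  exact hX (by simp [hsupp X hXK])

theorem IsLineTest.of_contDiff [BorelSpace E] {η : E → ℝ} (hη : ContDiff ℝ 1 η)
    (hc : HasCompactSupport η) (hs : tsupport η ⊆ U) :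
    IsLineTest μ U e η (fun X => fderiv ℝ η X e) := by
  have hcont : Continuous (fun X => fderiv ℝ η X e) :=
    (hη.continuous_fderiv one_ne_zero).clm_apply continuous_const
  refine ⟨hη.continuous, hc, hs, fun X => ?_, ?_, ?_⟩
  · exact ((hη.differentiable one_ne_zero) X).hasFDerivAt.hasLineDerivAt e
  · exact (hcont.stronglyMeasurable_of_hasCompactSupport
      (hc.fderiv_apply (𝕜 := ℝ) e)).aestronglyMeasurable
  · obtain ⟨C, hC⟩ := (hc.fderiv_apply (𝕜 := ℝ) e).exists_bound_of_continuous hcont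
    exact ⟨C, fun X => by simpa using hC X⟩

omit [MeasurableSpace E] in
theorem HasLineDerivAt.fun_mul {p q : E → ℝ} {p' q' : ℝ} {X : E}
    (hp : HasLineDerivAt ℝ p p' X e) (hq : HasLineDerivAt ℝ q q' X e) :
    HasLineDerivAt ℝ (fun Z => p Z * q Z) (p' * q X + p X * q') X e := by
  unfold HasLineDerivAt at *
  simpa using HasDerivAt.fun_mul hp hq

/-- Multiplication of a test function by a function with a locally bounded derivative. -/
theorem IsLineTest.mul_left [BorelSpace E] [SecondCountableTopology E]
    (hU : IsOpen U) (h : IsLineTest μ U e ζ ζ') {F F' : E → ℝ}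
    (hF : ContinuousOn F U) (hF' : ∀ X ∈ U, HasLineDerivAt ℝ F (F' X) X e)
    (hm : AEStronglyMeasurable F' (μ.restrict U))
    (hb : ∀ K ⊆ U, IsCompact K → ∃ C, ∀ X ∈ K, |F' X| ≤ C) :
    IsLineTest μ U e (fun X => F X * ζ X) (fun X => F' X * ζ X + F X * ζ' X) := by
  have hts : tsupport (fun X => F X * ζ X) ⊆ tsupport ζ :=
    closure_mono (fun X hX hz => hX (by simp [hz]))
  have hz : ∀ X ∉ tsupport ζ, ζ X = 0 := fun X hX => image_eq_zero_of_notMem_tsupport hX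
  have hz' : ∀ X ∉ tsupport ζ, ζ' X = 0 := fun X hX => h.deriv_eq_zero hX
  refine ⟨?_, ?_, hts.trans h.sub, fun X => ?_, ?_, ?_⟩
  · exact ((hF.mul h.cont.continuousOn)).continuous_of_tsupport_subset hU (hts.trans h.sub)
  · exact h.compact.mono (fun X hX hz => hX (by simp [hz]))
  · by_cases hX : X ∈ tsupport ζ
    · exact (hF' X (h.sub hX)).fun_mul (h.deriv X)
    · rw [hz X hX, hz' X hX]
      have hev : (fun Z => F Z * ζ Z) =ᶠ[𝓝 X] fun _ => 0 := by
        filter_upwards [notMem_tsupport_iff_eventuallyEq.1 hX] with Z hZ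
        simp [hZ]
      have : HasFDerivAt (fun Z => F Z * ζ Z) (0 : E →L[ℝ] ℝ) X :=
        (hasFDerivAt_const (0 : ℝ) X).congr_of_eventuallyEq hev
      simpa using this.hasLineDerivAt e
  · have h1 : AEStronglyMeasurable (fun X => F' X * ζ X + F X * ζ' X) (μ.restrict U) :=
      (hm.mul h.cont.aestronglyMeasurable).add
        ((hF.aestronglyMeasurable hU.measurableSet).mul h.meas.restrict)
    -- Off `U` both `ζ` and `ζ'` vanish, so measurability of `F'` on `U` is enough.
    have h2 : (fun X => F' X * ζ X + F X * ζ' X)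
        = U.indicator (fun X => F' X * ζ X + F X * ζ' X) := by
      ext X
      by_cases hX : X ∈ U
      · simp [hX]
      · have : X ∉ tsupport ζ := fun hh => hX (h.sub hh)
        simp [hX, hz X this, hz' X this]
    rw [h2]
    exact (aestronglyMeasurable_indicator_iff hU.measurableSet).2 h1
  · obtain ⟨C₁, h₁⟩ := hb _ h.sub h.compact
    obtain ⟨C₂, h₂⟩ := h.bdd_fun
    obtain ⟨C₃, h₃⟩ := h.compact.exists_bound_of_continuousOn (hF.mono h.sub)
    obtain ⟨C₄, h₄⟩ := h.bdd
    refine ⟨|C₁| * |C₂| + |C₃| * |C₄|, fun X => ?_⟩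
    by_cases hX : X ∈ tsupport ζ
    · refine (abs_add_le _ _).trans (add_le_add ?_ ?_)
      · rw [abs_mul]
        exact mul_le_mul ((h₁ X hX).trans (le_abs_self _)) ((h₂ X).trans (le_abs_self _))
          (abs_nonneg _) (abs_nonneg _)
      · rw [abs_mul]
        exact mul_le_mul ((h₃ X hX).trans (le_abs_self _)) ((h₄ X).trans (le_abs_self _))
          (abs_nonneg _) (abs_nonneg _)
    · simp only [hz X hX, hz' X hX, mul_zero, add_zero, abs_zero]
      positivity

variable [BorelSpace E] [FiniteDimensional ℝ E] [μ.IsAddHaarMeasure]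

/-- Integration by parts for classical line derivatives against test functions. -/
theorem IsLineTest.integral_by_parts (hU : IsOpen U) (h : IsLineTest μ U e ζ ζ') {p p' : E → ℝ}
    (hp : ContinuousOn p U) (hpd : ∀ X ∈ U, HasLineDerivAt ℝ p (p' X) X e)
    (hp' : LocallyIntegrableOn p' U μ) :
    ∫ X in U, p X * ζ' X ∂μ = - ∫ X in U, p' X * ζ X ∂μ := by
  have hpl : LocallyIntegrableOn p U μ := hp.locallyIntegrableOn hU.measurableSet
  have hz : ∀ X ∉ tsupport ζ, ζ X = 0 := fun X hX => image_eq_zero_of_notMem_tsupport hX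
  have hz' : ∀ X ∉ tsupport ζ, ζ' X = 0 := fun X hX => h.deriv_eq_zero hX
  rw [setIntegral_eq_integral_of_forall_compl_eq_zero
      (fun X hX => by rw [hz' X (fun hh => hX (h.sub hh)), mul_zero]),
    setIntegral_eq_integral_of_forall_compl_eq_zero
      (fun X hX => by rw [hz X (fun hh => hX (h.sub hh)), mul_zero])]
  refine integral_bilinear_hasLineDerivAt_right_eq_neg_left_of_integrable (v := e)
    (B := ContinuousLinearMap.mul ℝ ℝ) ?_ ?_ ?_ (fun X hX => hpd X (h.sub hX))
    (fun X _ => h.deriv X)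
  · exact integrable_mul_of_tsupport_subset hp' h.compact h.sub
      h.cont.aestronglyMeasurable h.bdd_fun hz
  · exact integrable_mul_of_tsupport_subset hpl h.compact h.sub h.meas h.bdd hz'
  · exact integrable_mul_of_tsupport_subset hpl h.compact h.sub
      h.cont.aestronglyMeasurable h.bdd_fun hz

open scoped Convolution

/-- The derivative of a mollification is the mollification of the derivative. -/
theorem IsLineTest.fderiv_convolution (h : IsLineTest μ U e ζ ζ') {k : E → ℝ}
    (hk : ContDiff ℝ ∞ k) (hkc : HasCompactSupport k) (X : E) :
    fderiv ℝ (k ⋆[ContinuousLinearMap.lsmul ℝ ℝ, μ] ζ) X e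
      = (k ⋆[ContinuousLinearMap.lsmul ℝ ℝ, μ] ζ') X := by
  have hk1 : ContDiff ℝ 1 k := hk.of_le (by exact_mod_cast le_top)
  have hζl : LocallyIntegrable ζ μ := h.cont.locallyIntegrable
  rw [(hkc.hasFDerivAt_convolution_left (ContinuousLinearMap.lsmul ℝ ℝ) hk1 hζl X).fderiv]
  have hint : Integrable (fun t => (ContinuousLinearMap.precompL E
      (ContinuousLinearMap.lsmul ℝ ℝ)) (fderiv ℝ k t) (ζ (X - t))) μ :=
    ((hkc.fderiv (𝕜 := ℝ)).convolutionExists_left _ (hk1.continuous_fderiv one_ne_zero)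
      hζl X)
  rw [convolution_def, ContinuousLinearMap.integral_apply hint, convolution_def]
  simp only [ContinuousLinearMap.precompL_apply, ContinuousLinearMap.lsmul_apply, smul_eq_mul]
  -- Integration by parts in `t` moves the derivative from the kernel to `ζ`. Since `t ↦ ζ (X - t)`
  -- has derivative `-ζ' (X - t)`, the two signs cancel.
  have key := integral_bilinear_hasLineDerivAt_right_eq_neg_left_of_integrable (μ := μ) (v := e)
    (B := ContinuousLinearMap.mul ℝ ℝ) (f := fun t => ζ (X - t)) (f' := fun t => -ζ' (X - t))
    (g := k) (g' := fun t => fderiv ℝ k t e) ?_ ?_ ?_ ?_ ?_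
  · simp only [ContinuousLinearMap.mul_apply', neg_mul, integral_neg, neg_neg] at key
    simpa [mul_comm] using key
  · have : Integrable (fun t => ζ' (X - t)) μ := by
      have h0 : Integrable ζ' μ := by
        have := integrable_mul_of_tsupport_subset (μ := μ) (h := fun _ => (1 : ℝ)) (U := univ)
          (locallyIntegrableOn_univ.2 continuous_const.locallyIntegrable) h.compact
          (subset_univ _) h.meas h.bdd (fun X hX => h.deriv_eq_zero hX)
        simpa using this
      exact h0.comp_sub_left X
    obtain ⟨C, hC⟩ := hkc.exists_bound_of_continuous hk.continuous
    exact this.neg.mul_bdd hk.continuous.aestronglyMeasurable (ae_of_all _ hC)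
  · exact Continuous.integrable_of_hasCompactSupport
      ((h.cont.comp (by fun_prop)).mul
        ((hk1.continuous_fderiv one_ne_zero).clm_apply continuous_const))
      ((hkc.fderiv_apply (𝕜 := ℝ) e).mul_left)
  · exact Continuous.integrable_of_hasCompactSupport
      ((h.cont.comp (by fun_prop)).mul hk.continuous) hkc.mul_left
  · intro t _
    have := h.deriv (X - t)
    unfold HasLineDerivAt at *
    have h2 : HasDerivAt (fun s : ℝ => -s) (-1) 0 := hasDerivAt_neg 0
    have h3 := HasDerivAt.scomp_of_eq (0 : ℝ) this h2 (by simp)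
    convert! h3 using 1
    · ext s; simp only [Function.comp]; congr 1; module
    · simp
  · intro t _
    exact ((hk1.differentiable one_ne_zero) t).hasFDerivAt.hasLineDerivAt e

/-- A weak derivative tested with smooth functions can be tested with functions that are only
differentiable in the given direction. -/
theorem IsLineTest.weak_extend (hU : IsOpen U) (h : IsLineTest μ U e ζ ζ') {p q : E → ℝ}
    (hp : LocallyIntegrableOn p U μ) (hq : LocallyIntegrableOn q U μ)
    (hweak : ∀ η : E → ℝ, ContDiff ℝ ∞ η → HasCompactSupport η → tsupport η ⊆ U →
      ∫ X in U, p X * fderiv ℝ η X e ∂μ = - ∫ X in U, q X * η X ∂μ) :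
    ∫ X in U, p X * ζ' X ∂μ = - ∫ X in U, q X * ζ X ∂μ := by
  obtain ⟨δ, hδ, hδU⟩ := h.compact.isCompact.exists_cthickening_subset_open hU h.sub
  set K := Metric.cthickening δ (tsupport ζ) with hK
  have hKc : IsCompact K := h.compact.isCompact.cthickening
  -- Radii at most `δ` keep the supports of all mollifications inside `K ⊆ U`. The fixed ratio of
  -- outer and inner radius is what almost everywhere convergence needs: `ζ'` is merely bounded and
  -- measurable, so convergence holds at Lebesgue points.
  let φ : ℕ → ContDiffBump (0 : E) := fun m =>
    ⟨δ / (m + 1) / 2, δ / (m + 1), by positivity, by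
      have : 0 < δ / (m + 1) := by positivity
      linarith⟩
  have hφ0 : Tendsto (fun m => (φ m).rOut) atTop (𝓝 0) :=
    tendsto_const_div_atTop_nhds_zero_nat δ |>.comp (tendsto_add_atTop_nat 1) |>.congr
      (fun m => by simp [φ])
  have hφK : ∀ᶠ m in atTop, (φ m).rOut ≤ 2 * (φ m).rIn :=
    Eventually.of_forall fun m => by simp only [φ]; linarith
  have hφδ : ∀ m, (φ m).rOut ≤ δ := fun m => by
    simp only [φ]
    exact div_le_self hδ.le (by linarith [Nat.cast_nonneg (α := ℝ) m])
  let k : ℕ → E → ℝ := fun m => (φ m).normed μ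
  have hk : ∀ m, ContDiff ℝ ∞ (k m) := fun m => (φ m).contDiff_normed
  have hkc : ∀ m, HasCompactSupport (k m) := fun m => (φ m).hasCompactSupport_normed
  let ζs : ℕ → E → ℝ := fun m => k m ⋆[ContinuousLinearMap.lsmul ℝ ℝ, μ] ζ
  let ζs' : ℕ → E → ℝ := fun m => k m ⋆[ContinuousLinearMap.lsmul ℝ ℝ, μ] ζ'
  have hζi : Integrable ζ' μ := by
    have := integrable_mul_of_tsupport_subset (μ := μ) (h := fun _ => (1 : ℝ)) (U := univ)
      (locallyIntegrableOn_univ.2 continuous_const.locallyIntegrable) h.compact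
      (subset_univ _) h.meas h.bdd (fun X hX => h.deriv_eq_zero hX)
    simpa using this
  have hsupp : ∀ (r : E → ℝ), (∀ X ∉ tsupport ζ, r X = 0) → ∀ m, ∀ X ∉ K,
      (k m ⋆[ContinuousLinearMap.lsmul ℝ ℝ, μ] r) X = 0 := by
    intro r hr m X hX
    rw [convolution_lsmul]
    refine integral_eq_zero_of_ae (ae_of_all _ fun t => ?_)
    by_cases ht : t ∈ Metric.ball (0 : E) (φ m).rOut
    · have : X - t ∉ tsupport ζ := by
        intro hmem
        apply hX
        refine Metric.mem_cthickening_of_dist_le X (X - t) δ _ hmem ?_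
        rw [dist_eq_norm]
        simp only [sub_sub_cancel]
        rw [mem_ball_zero_iff] at ht
        exact ht.le.trans (hφδ m)
      simp [hr _ this]
    · have : k m t = 0 := by
        have h1 : t ∉ Function.support (k m) := by
          rw [(φ m).support_normed_eq]; exact ht
        simpa using h1
      simp [this]
  have hbound : ∀ (r : E → ℝ) (C : ℝ), (∀ X, |r X| ≤ C) → ∀ m X,
      |(k m ⋆[ContinuousLinearMap.lsmul ℝ ℝ, μ] r) X| ≤ C := by
    intro r C hr m X
    rw [convolution_lsmul, ← Real.norm_eq_abs]
    calc ‖∫ t, k m t • r (X - t) ∂μ‖ ≤ ∫ t, k m t * C ∂μ := by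
          refine norm_integral_le_of_norm_le ((φ m).integrable_normed.mul_const C)
            (ae_of_all _ fun t => ?_)
          rw [norm_smul, Real.norm_of_nonneg ((φ m).nonneg_normed t)]
          exact mul_le_mul_of_nonneg_left (hr _) ((φ m).nonneg_normed t)
      _ = C := by rw [integral_mul_const, (φ m).integral_normed, one_mul]
  -- Dominated convergence with majorant `|s| C` on the common compact support `K`. It is used
  -- twice, for `ζ'` against `p` and for `ζ` against `q`.
  have hlim : ∀ (r s : E → ℝ), LocallyIntegrableOn s U μ → (∃ C, ∀ X, |r X| ≤ C) →
      Integrable r μ → (∀ X ∉ tsupport ζ, r X = 0) →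
      Tendsto (fun m => ∫ X in U, s X * (k m ⋆[ContinuousLinearMap.lsmul ℝ ℝ, μ] r) X ∂μ) atTop
        (𝓝 (∫ X in U, s X * r X ∂μ)) := by
    rintro r s hs ⟨C, hC⟩ hri hr
    have hKi : Integrable (K.indicator fun X => |s X| * C) μ :=
      (IntegrableOn.integrable_indicator
        ((hs.integrableOn_compact_subset hδU hKc).abs.mul_const C) hKc.measurableSet)
    refine tendsto_integral_of_dominated_convergence _ (fun m => ?_) hKi.restrict
      (fun m => ae_of_all _ fun X => ?_) ?_
    · refine (hs.aestronglyMeasurable).mul ?_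
      exact ((hkc m).contDiff_convolution_left (n := 0) (ContinuousLinearMap.lsmul ℝ ℝ)
        ((hk m).of_le (by simp))
        hri.locallyIntegrable).continuous.aestronglyMeasurable
    · by_cases hX : X ∈ K
      · rw [indicator_of_mem hX, norm_mul]
        exact mul_le_mul_of_nonneg_left (hbound r C hC m X) (abs_nonneg _)
      · rw [indicator_of_notMem hX, hsupp r hr m X hX]; simp
    · refine ae_restrict_of_ae ?_
      filter_upwards [ContDiffBump.ae_convolution_tendsto_right_of_locallyIntegrable hφ0 hφK
        hri.locallyIntegrable] with X hX
      exact hX.const_mul _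
  have h1 := hlim ζ' p hp h.bdd hζi (fun X hX => h.deriv_eq_zero hX)
  have h2 := hlim ζ q hq h.bdd_fun (h.cont.integrable_of_hasCompactSupport h.compact)
    (fun X hX => image_eq_zero_of_notMem_tsupport hX)
  refine tendsto_nhds_unique h1 (h2.neg.congr fun m => ?_)
  rw [← hweak (ζs m) ?_ ?_ ?_]
  · refine integral_congr_ae (ae_of_all _ fun X => ?_)
    simp only [ζs]
    rw [h.fderiv_convolution (hk m) (hkc m) X]
  · exact (hkc m).contDiff_convolution_left (ContinuousLinearMap.lsmul ℝ ℝ) (hk m)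
      h.cont.locallyIntegrable
  · exact (hkc m).convolution (ContinuousLinearMap.lsmul ℝ ℝ) h.compact
  · refine (closure_minimal ?_ Metric.isClosed_cthickening).trans hδU
    intro X hX
    by_contra hXK
    exact hX (hsupp ζ (fun X hX => image_eq_zero_of_notMem_tsupport hX) m X hXK)

end LineTests

/-! ### Defining functions of the domain, outer normal, tangent directions. -/

section BoundaryCharts

variable {n : ℕ}

theorem eventually_neg_of_hasDerivAt {f : ℝ → ℝ} {d : ℝ} (h0 : f 0 = 0) (hf : HasDerivAt f d 0)
    (hd : d < 0) : ∀ᶠ t : ℝ in 𝓝[>] 0, f t < 0 := by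
  have h := (hasDerivAt_iff_tendsto_slope.1 hf).mono_left
    (nhdsWithin_mono 0 (fun t (ht : 0 < t) => ht.ne') : 𝓝[>] (0 : ℝ) ≤ 𝓝[≠] 0)
  filter_upwards [h.eventually (gt_mem_nhds hd), self_mem_nhdsWithin] with t ht (ht0 : 0 < t)
  rw [slope_def_field, h0, sub_zero, sub_zero] at ht
  by_contra hc
  exact absurd ht (not_lt.2 (div_nonneg (not_lt.1 hc) ht0.le))

/-- `ρ` is a defining function of `Ω` in the ball of radius `r` about the boundary point `x₀`,
with gradient close to the unit vector `e`. -/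
structure BoundaryChart (Ω : Set (Hor n)) (x₀ e : Hor n) (ε r : ℝ) (ρ : Hor n → ℝ) : Prop where
  norm_e : ‖e‖ = 1
  r_pos : 0 < r
  mem_frontier : x₀ ∈ frontier Ω
  contDiffOn : ContDiffOn ℝ 2 ρ (Metric.ball x₀ r)
  grad_near : ∀ x ∈ Metric.ball x₀ r, ‖gradient ρ x - e‖ ≤ ε
  mem_iff : ∀ x ∈ Metric.ball x₀ r, x ∈ Ω ↔ ρ x < 0
  closure_iff : ∀ x ∈ Metric.ball x₀ r, x ∈ closure Ω ↔ ρ x ≤ 0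
  frontier_iff : ∀ x ∈ Metric.ball x₀ r, x ∈ frontier Ω ↔ ρ x = 0

theorem inner_gradient_eq {ρ : Hor n → ℝ} (x v : Hor n) : ⟪gradient ρ x, v⟫ = fderiv ℝ ρ x v := by
  simp [gradient]

theorem gradient_const_mul {ρ : Hor n → ℝ} (c : ℝ) {x : Hor n} (h : DifferentiableAt ℝ ρ x) :
    gradient (fun z => c * ρ z) x = c • gradient ρ x := by
  refine ext_inner_right ℝ fun v => ?_
  rw [inner_gradient_eq, inner_smul_left, inner_gradient_eq, fderiv_const_mul h]
  simp

theorem continuousOn_gradient {ρ : Hor n → ℝ} {s : Set (Hor n)} (hs : IsOpen s)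
    (h : ContDiffOn ℝ 2 ρ s) : ContinuousOn (gradient ρ) s :=
  (LinearIsometryEquiv.continuous _).comp_continuousOn
    (h.continuousOn_fderiv_of_isOpen hs (by norm_num))

/-- Dividing a defining function by the length of its gradient at `x₀` makes that gradient a unit
vector `e`; by continuity it stays `ε`-close to `e` on a smaller ball. The descriptions of the
closure and of the frontier use that the gradient has no zeros: from a zero of `ρ` some direction
leads at once into `ρ < 0`. -/
theorem IsHolderDomain.exists_boundaryChart {α : ℝ≥0} {Ω : Set (Hor n)}
    (hΩ : IsHolderDomain 4 α Ω) {x₀ : Hor n} (hx : x₀ ∈ frontier Ω) {ε : ℝ} (hε : 0 < ε) :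
    ∃ e r ρ, BoundaryChart Ω x₀ e ε r ρ := by
  obtain ⟨r, hr, ρ, hρ, -, hne, hset⟩ := hΩ.boundary x₀ hx
  have hρ2 : ContDiffOn ℝ 2 ρ (Metric.ball x₀ r) := hρ.of_le (by norm_num)
  have hdiff : ∀ x ∈ Metric.ball x₀ r, DifferentiableAt ℝ ρ x := fun x hx =>
    (hρ2.differentiableOn (by norm_num)).differentiableAt (Metric.isOpen_ball.mem_nhds hx)
  have hmem : ∀ x ∈ Metric.ball x₀ r, x ∈ Ω ↔ ρ x < 0 := fun x hx => by
    have := Set.ext_iff.1 hset x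
    simp only [mem_inter_iff, hx, and_true, mem_ofPred_eq, true_and] at this
    exact this
  have hcl : ∀ x ∈ Metric.ball x₀ r, x ∈ closure Ω ↔ ρ x ≤ 0 := by
    intro x hx
    constructor
    · intro hxc
      by_contra hpos
      push Not at hpos
      have h1 : ∀ᶠ z in 𝓝 x, 0 < ρ z := (hdiff x hx).continuousAt.eventually (lt_mem_nhds hpos)
      have h2 : ∀ᶠ z in 𝓝 x, z ∈ Metric.ball x₀ r := Metric.isOpen_ball.mem_nhds hx
      obtain ⟨z, hz, hz1, hz2⟩ := (mem_closure_iff_frequently.1 hxc).and_eventually (h1.and h2)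
        |>.exists
      exact absurd ((hmem z hz2).1 hz) (not_lt.2 hz1.le)
    · intro hle
      rcases hle.lt_or_eq with h | h
      · exact subset_closure ((hmem x hx).2 h)
      · obtain ⟨v, hv⟩ : ∃ v, fderiv ℝ ρ x v ≠ 0 := by
          by_contra hcon
          push Not at hcon
          exact hne x hx (ContinuousLinearMap.ext hcon)
        obtain ⟨v, hv⟩ : ∃ v, fderiv ℝ ρ x v < 0 := by
          rcases hv.lt_or_gt with h | h
          · exact ⟨v, h⟩
          · exact ⟨-v, by simpa using h⟩
        have hd : HasDerivAt (fun t : ℝ => ρ (x + t • v)) (fderiv ℝ ρ x v) 0 :=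
          (hdiff x hx).hasFDerivAt.hasLineDerivAt v
        have h1 := eventually_neg_of_hasDerivAt (by simpa using h) hd hv
        have hcont : Tendsto (fun t : ℝ => x + t • v) (𝓝[>] 0) (𝓝 x) := by
          have : Continuous (fun t : ℝ => x + t • v) := by fun_prop
          simpa using (this.tendsto 0).mono_left nhdsWithin_le_nhds
        refine mem_closure_of_tendsto hcont ?_
        filter_upwards [h1, hcont.eventually (Metric.isOpen_ball.mem_nhds hx)] with t ht1 ht2
        exact (hmem _ ht2).2 ht1
  have hfr : ∀ x ∈ Metric.ball x₀ r, x ∈ frontier Ω ↔ ρ x = 0 := by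
    intro x hx
    rw [frontier, hΩ.isOpen.interior_eq, Set.mem_sdiff, hcl x hx, hmem x hx, not_lt]
    exact ⟨fun h => le_antisymm h.1 h.2, fun h => ⟨h.le, h.ge⟩⟩
  have hx0 : x₀ ∈ Metric.ball x₀ r := Metric.mem_ball_self hr
  set c : ℝ := ‖gradient ρ x₀‖ with hc
  have hcpos : 0 < c := by
    rw [hc, norm_pos_iff]
    intro h0
    apply hne x₀ hx0
    ext v
    rw [← inner_gradient_eq, h0]; simp
  have hρc : ContDiffOn ℝ 2 (fun z => c⁻¹ * ρ z) (Metric.ball x₀ r) := contDiffOn_const.mul hρ2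
  have hcg := continuousOn_gradient Metric.isOpen_ball hρc
  have hg0 : gradient (fun z => c⁻¹ * ρ z) x₀ = c⁻¹ • gradient ρ x₀ :=
    gradient_const_mul _ (hdiff x₀ hx0)
  have hnear : ∀ᶠ x in 𝓝 x₀, ‖gradient (fun z => c⁻¹ * ρ z) x - c⁻¹ • gradient ρ x₀‖ < ε := by
    have h1 : ContinuousAt (gradient (fun z => c⁻¹ * ρ z)) x₀ :=
      hcg.continuousAt (Metric.isOpen_ball.mem_nhds hx0)
    have := Metric.continuousAt_iff'.1 h1 ε hε
    simpa [dist_eq_norm, hg0] using this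
  obtain ⟨r', hr', hr'n⟩ := Metric.eventually_nhds_iff_ball.1 hnear
  have hsub : Metric.ball x₀ (min r r') ⊆ Metric.ball x₀ r :=
    Metric.ball_subset_ball (min_le_left _ _)
  have hci : 0 < c⁻¹ := inv_pos.2 hcpos
  refine ⟨c⁻¹ • gradient ρ x₀, min r r', fun z => c⁻¹ * ρ z, ?_, lt_min hr hr', hx,
    hρc.mono hsub, fun x hx => (hr'n x (Metric.ball_subset_ball (min_le_right _ _) hx)).le,
    fun x hx => ?_, fun x hx => ?_, fun x hx => ?_⟩
  · rw [norm_smul, ← hc, norm_inv, Real.norm_of_nonneg hcpos.le, inv_mul_cancel₀ hcpos.ne']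
  · rw [hmem x (hsub hx)]
    constructor
    · intro h; nlinarith
    · intro h; by_contra h'; push Not at h'; nlinarith [mul_nonneg hci.le h']
  · rw [hcl x (hsub hx)]
    constructor
    · intro h; nlinarith
    · intro h; by_contra h'; push Not at h'; nlinarith [mul_pos hci h']
  · rw [hfr x (hsub hx)]
    simp [hcpos.ne']

variable {Ω : Set (Hor n)} {x₀ e : Hor n} {ε r : ℝ} {ρ : Hor n → ℝ}

namespace BoundaryChart

theorem differentiableAt (C : BoundaryChart Ω x₀ e ε r ρ) {x : Hor n}
    (hx : x ∈ Metric.ball x₀ r) : DifferentiableAt ℝ ρ x :=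
  (C.contDiffOn.differentiableOn (by norm_num)).differentiableAt (Metric.isOpen_ball.mem_nhds hx)

theorem zero (C : BoundaryChart Ω x₀ e ε r ρ) : ρ x₀ = 0 :=
  (C.frontier_iff x₀ (Metric.mem_ball_self C.r_pos)).1 C.mem_frontier

theorem gradient_ne_zero (C : BoundaryChart Ω x₀ e ε r ρ) (hε : ε < 1) {x : Hor n}
    (hx : x ∈ Metric.ball x₀ r) : gradient ρ x ≠ 0 := by
  intro h
  have := C.grad_near x hx
  rw [h, zero_sub, norm_neg, C.norm_e] at this
  linarith

/-- The defining function is almost affine. -/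
theorem abs_sub_le (C : BoundaryChart Ω x₀ e ε r ρ) {x z : Hor n}
    (hx : x ∈ Metric.ball x₀ r) (hz : z ∈ Metric.ball x₀ r) :
    |ρ x - ρ z - ⟪e, x - z⟫| ≤ ε * ‖x - z‖ := by
  have := (convex_ball x₀ r).norm_image_sub_le_of_norm_hasFDerivWithin_le' (f := ρ)
    (f' := fun w => fderiv ℝ ρ w) (φ := innerSL ℝ e) (C := ε) (x := z) (y := x)
    (fun w hw => (C.differentiableAt hw).hasFDerivAt.hasFDerivWithinAt) ?_ hz hx
  · simpa using this
  · intro w hw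
    have h1 := C.grad_near w hw
    have : fderiv ℝ ρ w - innerSL ℝ e = innerSL ℝ (gradient ρ w - e) := by
      ext v
      simp
    rw [this, innerSL_apply_norm]
    exact h1

/-- At a boundary point `ρ` vanishes, so the sign of the slope of `t ↦ ρ (x + t • v)` at `0`, a
positive multiple of the inner product of `v` with the normalized gradient, decides on which side
the ray starts. -/
theorem isOuterUnitNormal (C : BoundaryChart Ω x₀ e ε r ρ) (hε : ε < 1) {x : Hor n}
    (hx : x ∈ Metric.ball x₀ r) (hf : x ∈ frontier Ω) :
    IsOuterUnitNormal Ω x (‖gradient ρ x‖⁻¹ • gradient ρ x) := by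
  have hN := C.gradient_ne_zero hε hx
  have hNp : 0 < ‖gradient ρ x‖⁻¹ := inv_pos.2 (norm_pos_iff.2 hN)
  have h0 := (C.frontier_iff x hx).1 hf
  refine ⟨by rw [norm_smul, norm_inv, norm_norm, inv_mul_cancel₀ (norm_ne_zero_iff.2 hN)],
    fun v => ?_⟩
  have hd : HasDerivAt (fun t : ℝ => ρ (x + t • v)) (fderiv ℝ ρ x v) 0 :=
    (C.differentiableAt hx).hasFDerivAt.hasLineDerivAt v
  have hcont : Tendsto (fun t : ℝ => x + t • v) (𝓝[>] 0) (𝓝 x) := by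
    have : Continuous (fun t : ℝ => x + t • v) := by fun_prop
    simpa using (this.tendsto 0).mono_left nhdsWithin_le_nhds
  have hball := hcont.eventually (Metric.isOpen_ball.mem_nhds hx)
  have hinner : ⟪v, ‖gradient ρ x‖⁻¹ • gradient ρ x⟫ = ‖gradient ρ x‖⁻¹ * fderiv ℝ ρ x v := by
    rw [inner_smul_right, real_inner_comm, inner_gradient_eq]
  rw [hinner]
  constructor
  · intro h
    have hneg : fderiv ℝ ρ x v < 0 := by
      by_contra hc; push Not at hc; nlinarith [mul_nonneg hNp.le hc]
    filter_upwards [eventually_neg_of_hasDerivAt (by simpa using h0) hd hneg, hball] with t h1 h2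
    exact (C.mem_iff _ h2).2 h1
  · intro h
    have hpos : 0 < fderiv ℝ ρ x v := by
      by_contra hc; push Not at hc; nlinarith [mul_nonneg hNp.le (neg_nonneg.2 hc)]
    filter_upwards [eventually_neg_of_hasDerivAt (by simpa using h0) hd.fun_neg (by linarith), hball]
      with t h1 h2
    rw [C.closure_iff _ h2]
    linarith

theorem outerNormal_eq (C : BoundaryChart Ω x₀ e ε r ρ) (hε : ε < 1) {x : Hor n}
    (hx : x ∈ Metric.ball x₀ r) (hf : x ∈ frontier Ω) :
    outerNormal Ω x = ‖gradient ρ x‖⁻¹ • gradient ρ x := by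
  have h := C.isOuterUnitNormal hε hx hf
  have hex : ∃ ν, IsOuterUnitNormal Ω x ν := ⟨_, h⟩
  rw [outerNormal, dif_pos hex]
  exact hex.choose_spec.unique h

theorem continuousOn_gradient (C : BoundaryChart Ω x₀ e ε r ρ) :
    ContinuousOn (gradient ρ) (Metric.ball x₀ r) :=
  _root_.continuousOn_gradient Metric.isOpen_ball C.contDiffOn

/-- A point of the closure is moved into the domain, with room to spare, in the direction `-e`. -/
theorem mem_of_translate (C : BoundaryChart Ω x₀ e ε r ρ) {x v : Hor n}
    {t : ℝ} (hx : x ∈ Metric.ball x₀ r) (hxc : x ∈ closure Ω) (ht : 0 < t)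
    (hv : ‖v‖ * (1 + ε) < (1 - ε) * t) (hε : 0 ≤ ε) (hb : x - t • e + v ∈ Metric.ball x₀ r) :
    x - t • e + v ∈ Ω := by
  rw [C.mem_iff _ hb]
  -- Near-affinity gives `ρ (x - t e + v) ≤ ρ x - t + ⟪e, v⟫ + ε (t + ‖v‖)`. With `ρ x ≤ 0` and `⟪e,
  -- v⟫ ≤ ‖v‖` this is negative by `hv`.
  have h1 := (abs_le.1 (C.abs_sub_le hb hx)).2
  have h2 := (C.closure_iff x hx).1 hxc
  have h3 : x - t • e + v - x = -(t • e) + v := by abel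
  rw [h3, inner_add_right, inner_neg_right, inner_smul_right, real_inner_self_eq_norm_sq,
    C.norm_e] at h1
  have h4 : ‖-(t • e) + v‖ ≤ t + ‖v‖ := by
    refine (norm_add_le _ _).trans ?_
    rw [norm_neg, norm_smul, C.norm_e, Real.norm_of_nonneg ht.le, mul_one]
  have h5 : ⟪e, v⟫ ≤ ‖v‖ := by
    have := real_inner_le_norm e v
    rwa [C.norm_e, one_mul] at this
  have h6 := mul_le_mul_of_nonneg_left h4 hε
  have h7 := mul_nonneg hε (norm_nonneg v)
  nlinarith

end BoundaryChart

theorem IsHolderDomain.isCompact_closure {α : ℝ≥0} {k : ℕ} (hΩ : IsHolderDomain k α Ω) :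
    IsCompact (closure Ω) := hΩ.isBounded.isCompact_closure

theorem IsHolderDomain.isCompact_frontier {α : ℝ≥0} {k : ℕ} (hΩ : IsHolderDomain k α Ω) :
    IsCompact (frontier Ω) :=
  hΩ.isCompact_closure.of_isClosed_subset isClosed_frontier frontier_subset_closure

theorem IsHolderDomain.continuousOn_outerNormal {α : ℝ≥0} (hΩ : IsHolderDomain 4 α Ω) :
    ContinuousOn (outerNormal Ω) (frontier Ω) := by
  intro x hx
  obtain ⟨e, r, ρ, C⟩ := hΩ.exists_boundaryChart hx (ε := 1 / 2) (by norm_num)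
  have hb : Metric.ball x r ∈ 𝓝 x := Metric.ball_mem_nhds x C.r_pos
  have h1 : ContinuousAt (gradient ρ) x := C.continuousOn_gradient.continuousAt hb
  have h2 : ContinuousAt (fun z => ‖gradient ρ z‖⁻¹ • gradient ρ z) x :=
    (h1.norm.inv₀ (norm_ne_zero_iff.2 (C.gradient_ne_zero (by norm_num)
      (Metric.mem_ball_self C.r_pos)))).smul h1
  refine h2.continuousWithinAt.congr_of_eventuallyEq ?_
    (C.outerNormal_eq (by norm_num) (Metric.mem_ball_self C.r_pos) hx)
  filter_upwards [self_mem_nhdsWithin, mem_nhdsWithin_of_mem_nhds hb] with z hz hzb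
  exact C.outerNormal_eq (by norm_num) hzb hz

theorem IsHolderDomain.norm_outerNormal {α : ℝ≥0} (hΩ : IsHolderDomain 4 α Ω) {x : Hor n}
    (hx : x ∈ frontier Ω) : ‖outerNormal Ω x‖ = 1 := by
  obtain ⟨e, r, ρ, C⟩ := hΩ.exists_boundaryChart hx (ε := 1 / 2) (by norm_num)
  rw [C.outerNormal_eq (by norm_num) (Metric.mem_ball_self C.r_pos) hx]
  exact (C.isOuterUnitNormal (by norm_num) (Metric.mem_ball_self C.r_pos) hx).1

/-- The closure of the domain has unique derivatives. -/
theorem IsHolderDomain.uniqueDiffOn_closure {α : ℝ≥0} (hΩ : IsHolderDomain 4 α Ω) :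
    UniqueDiffOn ℝ (closure Ω) := by
  intro x hx
  by_cases hxΩ : x ∈ Ω
  · exact (hΩ.isOpen.uniqueDiffWithinAt hxΩ).mono subset_closure
  have hf : x ∈ frontier Ω := by
    rw [frontier, hΩ.isOpen.interior_eq]; exact ⟨hx, hxΩ⟩
  obtain ⟨e, r, ρ, C⟩ := hΩ.exists_boundaryChart hf (ε := 1 / 2) (by norm_num)
  have hxb := Metric.mem_ball_self (x := x) C.r_pos
  -- An open cone around `-e` consists of tangent directions, because `x + 2⁻ᵏ v` lies in the
  -- closure for large `k`. A set with nonempty interior spans the space.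
  have hcone : {v : Hor n | ⟪e, v⟫ < -(1 / 2) * ‖v‖} ⊆ tangentConeAt ℝ (closure Ω) x := by
    intro v hv
    change ⟪e, v⟫ < -(1 / 2) * ‖v‖ at hv
    refine mem_tangentConeAt_of_pow_smul (r := (1 / 2 : ℝ)) (by norm_num) (by norm_num) ?_
    have hcont : Tendsto (fun k : ℕ => x + (1 / 2 : ℝ) ^ k • v) atTop (𝓝 x) := by
      have h1 := tendsto_pow_atTop_nhds_zero_of_lt_one (r := (1 / 2 : ℝ)) (by norm_num)
        (by norm_num)
      simpa using tendsto_const_nhds.add (h1.smul_const v)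
    filter_upwards [hcont.eventually (Metric.ball_mem_nhds x C.r_pos)] with k hk
    rw [C.closure_iff _ hk]
    have h1 := (abs_le.1 (C.abs_sub_le hk hxb)).2
    rw [C.zero, sub_zero, add_sub_cancel_left, inner_smul_right, norm_smul,
      Real.norm_of_nonneg (by positivity)] at h1
    have : (0 : ℝ) < (1 / 2) ^ k := by positivity
    nlinarith
  have hopen : IsOpen {v : Hor n | ⟪e, v⟫ < -(1 / 2) * ‖v‖} :=
    isOpen_lt (by fun_prop) (by fun_prop)
  have hmem : -e ∈ {v : Hor n | ⟪e, v⟫ < -(1 / 2) * ‖v‖} := by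
    simp only [mem_ofPred_eq, inner_neg_right, real_inner_self_eq_norm_sq, C.norm_e, norm_neg]
    norm_num
  refine ⟨?_, subset_closure hx⟩
  have : (Submodule.span ℝ (tangentConeAt ℝ (closure Ω) x)) = ⊤ := by
    refine Submodule.eq_top_of_nonempty_interior' _ ⟨-e, ?_⟩
    rw [mem_interior_iff_mem_nhds]
    exact mem_of_superset (hopen.mem_nhds hmem) (hcone.trans Submodule.subset_span)
  rw [this]
  simp

end BoundaryCharts

/-! ### Comparison of Hausdorff measures and of integrals. -/

section HausdorffComparison

variable {X Y : Type*} [MetricSpace X] [MetricSpace Y] [MeasurableSpace X] [MeasurableSpace Y]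
  [BorelSpace X] [BorelSpace Y]

theorem LipschitzOnWith.euclideanHausdorffMeasure_image_le {K : ℝ≥0} {f : X → Y} {s : Set X}
    (h : LipschitzOnWith K f s) (d : ℕ) :
    μHE[d] (f '' s) ≤ (K : ℝ≥0∞) ^ d * μHE[d] s := by
  simp only [Measure.euclideanHausdorffMeasure_def, Measure.smul_apply]
  have := h.hausdorffMeasure_image_le (d := d) (Nat.cast_nonneg d)
  rw [ENNReal.rpow_natCast] at this
  calc _ ≤ _ := smul_le_smul_of_nonneg_left this zero_le
    _ = _ := by rw [mul_smul_comm]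

omit [MetricSpace X] [BorelSpace X] in
/-- If two measures are comparable up to a factor `1 + c`, then so are integrals. -/
theorem abs_integral_sub_integral_le {σ H : Measure X} {c : ℝ≥0} (h1 : σ ≤ H)
    (h2 : H ≤ (1 + c) • σ) {q : X → ℝ} (hq : Integrable q H) :
    |∫ x, q x ∂σ - ∫ x, q x ∂H| ≤ c * ∫ x, |q x| ∂H := by
  have hqσ : Integrable q σ := hq.mono_measure h1
  -- For nonnegative integrands both inequalities between the measures give bounds for the
  -- integrals; the general case follows by splitting into positive and negative part.
  have key : ∀ p : X → ℝ, Integrable p H → (∀ x, 0 ≤ p x) →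
      |∫ x, p x ∂σ - ∫ x, p x ∂H| ≤ c * ∫ x, p x ∂H := by
    intro p hp hp0
    have hpσ : Integrable p σ := hp.mono_measure h1
    have e1 : ∫ x, p x ∂σ ≤ ∫ x, p x ∂H :=
      integral_mono_measure h1 (ae_of_all _ hp0) hp
    have e2 : ∫ x, p x ∂H ≤ (1 + c) * ∫ x, p x ∂σ := by
      have := integral_mono_measure h2 (ae_of_all _ hp0) (hpσ.smul_measure_nnreal)
      rwa [integral_smul_nnreal_measure, NNReal.smul_def, smul_eq_mul, NNReal.coe_add,
        NNReal.coe_one] at this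
    rw [abs_sub_comm, abs_of_nonneg (by linarith)]
    have e3 : (0 : ℝ) ≤ c := c.2
    nlinarith
  have hsplit : ∀ τ : Measure X, Integrable q τ →
      ∫ x, q x ∂τ = ∫ x, max (q x) 0 ∂τ - ∫ x, max (-q x) 0 ∂τ := by
    intro τ hτ
    rw [← integral_sub hτ.pos_part hτ.neg_part]
    congr with x
    rcases le_total 0 (q x) with h | h
    · simp [h]
    · simp [h]
  have habs : ∫ x, |q x| ∂H = ∫ x, max (q x) 0 ∂H + ∫ x, max (-q x) 0 ∂H := by
    rw [← integral_add hq.pos_part hq.neg_part]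
    congr with x
    rcases le_total 0 (q x) with h | h
    · simp [h, abs_of_nonneg h]
    · simp [h, abs_of_nonpos h]
  have k1 := abs_le.1 (key _ hq.pos_part fun x => le_max_right _ _)
  have k2 := abs_le.1 (key _ hq.neg_part fun x => le_max_right _ _)
  rw [hsplit σ hqσ, hsplit H hq, habs, abs_le]
  constructor <;> linarith

end HausdorffComparison

/-! ### Orthogonal coordinates adapted to a unit vector. -/

section Coordinates

variable {n : ℕ}

/-- Coordinates centred at `x₀`: the hyperplane orthogonal to `e`, times the line along `e`. -/
def normalCoord (x₀ e : Hor n) (p : (ℝ ∙ e)ᗮ × ℝ) : Hor n := x₀ + (p.1 + p.2 • e)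

/-- The line spanned by the unit vector `e` is isometric to `ℝ`, and the orthogonal decomposition
based at `x₀` preserves volume. The swap only adjusts the order of the factors. -/
theorem measurePreserving_normalCoord (x₀ : Hor n) {e : Hor n} (he : ‖e‖ = 1) :
    MeasurePreserving (normalCoord x₀ e) := by
  have h1 : MeasurePreserving (LinearIsometryEquiv.toSpanUnitSingleton (𝕜 := ℝ) e he) :=
    LinearIsometryEquiv.measurePreserving _
  have h2 : MeasurePreserving
      (Prod.map (LinearIsometryEquiv.toSpanUnitSingleton (𝕜 := ℝ) e he)
        (id : (ℝ ∙ e)ᗮ → (ℝ ∙ e)ᗮ)) := h1.prod (MeasurePreserving.id _)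
  have h3 : MeasurePreserving (Prod.swap : (ℝ ∙ e)ᗮ × ℝ → ℝ × (ℝ ∙ e)ᗮ) :=
    Measure.measurePreserving_swap
  have h4 : MeasurePreserving (((ℝ ∙ e)).measurableEquivProd x₀).symm := by
    have := ((ℝ ∙ e).measurePreserving_measurableEquivProd x₀).symm
    rwa [InnerProductSpace.euclideanHausdorffMeasure_eq_volume] at this
  have h5 := h4.comp (h2.comp h3)
  convert h5 using 1
  ext1 p
  simp only [normalCoord, Function.comp, Prod.swap, Prod.map, id]
  rw [Submodule.measurableEquivProd_symm_apply]
  simp only [vadd_eq_add, LinearIsometryEquiv.toSpanUnitSingleton_apply]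
  abel

theorem continuous_normalCoord (x₀ e : Hor n) : Continuous (normalCoord x₀ e) := by
  unfold normalCoord; fun_prop

theorem measurableEmbedding_normalCoord (x₀ : Hor n) {e : Hor n} (he : ‖e‖ = 1) :
    MeasurableEmbedding (normalCoord x₀ e) := by
  refine (continuous_normalCoord x₀ e).measurableEmbedding ?_
  rintro ⟨z, s⟩ ⟨z', s'⟩ h
  simp only [normalCoord, add_right_inj] at h
  have hz : ∀ w : (ℝ ∙ e)ᗮ, ⟪e, (w : Hor n)⟫ = 0 := fun w =>
    (Submodule.mem_orthogonal_singleton_iff_inner_right.1 w.2)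
  have hs : s = s' := by
    have := congrArg (fun w => ⟪e, w⟫) h
    simpa [inner_add_right, hz, inner_smul_right, real_inner_self_eq_norm_sq, he] using this
  subst hs
  simpa using h

theorem inner_orthogonal_coord {e : Hor n} (w : (ℝ ∙ e)ᗮ) : ⟪e, (w : Hor n)⟫ = 0 :=
  Submodule.mem_orthogonal_singleton_iff_inner_right.1 w.2

theorem norm_coord_sq {e : Hor n} (he : ‖e‖ = 1) (z : (ℝ ∙ e)ᗮ) (s : ℝ) :
    ‖(z : Hor n) + s • e‖ ^ 2 = ‖z‖ ^ 2 + s ^ 2 := by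
  have h0 : ⟪(z : Hor n), e⟫ = 0 := by rw [real_inner_comm]; exact inner_orthogonal_coord z
  rw [norm_add_sq_real, inner_smul_right, h0, norm_smul, he]
  simp

theorem norm_coord_fst_le {e : Hor n} (he : ‖e‖ = 1) (z : (ℝ ∙ e)ᗮ) (s : ℝ) :
    ‖z‖ ≤ ‖(z : Hor n) + s • e‖ := by
  have := norm_coord_sq he z s
  nlinarith [norm_nonneg z, norm_nonneg ((z : Hor n) + s • e), sq_nonneg s]

theorem abs_coord_snd_le {e : Hor n} (he : ‖e‖ = 1) (z : (ℝ ∙ e)ᗮ) (s : ℝ) :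
    |s| ≤ ‖(z : Hor n) + s • e‖ := by
  have := norm_coord_sq he z s
  refine abs_le_of_sq_le_sq ?_ (norm_nonneg _)
  nlinarith [norm_nonneg z]

theorem norm_coord_le {e : Hor n} (he : ‖e‖ = 1) (z : (ℝ ∙ e)ᗮ) (s : ℝ) :
    ‖(z : Hor n) + s • e‖ ≤ ‖z‖ + |s| := by
  refine (norm_add_le _ _).trans ?_
  rw [norm_smul, he]; simp

theorem finrank_orthogonal_unit {e : Hor n} (he : ‖e‖ = 1) :
    Module.finrank ℝ (ℝ ∙ e)ᗮ = n - 1 := by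
  have h1 := (ℝ ∙ e).finrank_add_finrank_orthogonal
  rw [finrank_span_singleton (by rintro rfl; simp at he), finrank_euclideanSpace_fin] at h1
  omega

end Coordinates

/-! ### One-dimensional weights concentrating at an endpoint. -/

section OneDim

/-- A smooth cutoff, `0` on `(-∞, 1/2]` and `1` on `[1, ∞)`. -/
def cutoff (t : ℝ) : ℝ := Real.smoothTransition (2 * t - 1)

theorem contDiff_cutoff : ContDiff ℝ ∞ cutoff :=
  Real.smoothTransition.contDiff.comp (by fun_prop)

theorem cutoff_of_le {t : ℝ} (h : t ≤ 1 / 2) : cutoff t = 0 :=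
  Real.smoothTransition.zero_of_nonpos (by linarith)

theorem cutoff_of_ge {t : ℝ} (h : 1 ≤ t) : cutoff t = 1 :=
  Real.smoothTransition.one_of_one_le (by linarith)

theorem cutoff_nonneg (t : ℝ) : 0 ≤ cutoff t := Real.smoothTransition.nonneg _

theorem cutoff_le_one (t : ℝ) : cutoff t ≤ 1 := Real.smoothTransition.le_one _

theorem differentiable_cutoff : Differentiable ℝ cutoff :=
  contDiff_cutoff.differentiable (by simp)

theorem continuous_deriv_cutoff : Continuous (deriv cutoff) :=
  contDiff_cutoff.continuous_deriv (by simp)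

theorem monotone_cutoff : Monotone cutoff :=
  Real.smoothTransition.monotone.comp (fun a b h => by linarith)

theorem deriv_cutoff_nonneg (t : ℝ) : 0 ≤ deriv cutoff t := monotone_cutoff.deriv_nonneg

theorem deriv_cutoff_of_ge {t : ℝ} (h : 1 < t) : deriv cutoff t = 0 := by
  have : cutoff =ᶠ[𝓝 t] fun _ => 1 := by
    filter_upwards [lt_mem_nhds h] with s hs using cutoff_of_ge hs.le
  rw [this.deriv_eq]; simp

variable {R R' q : ℝ → ℝ} {a b c : ℝ}

/-- The integrand is the derivative of `s ↦ -cutoff (-R s / δ)`, which equals `-1` at `a` because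
`-R a ≥ δ`, and `0` at `b` because `R b = 0`. -/
theorem deriv_cutoff_weight (hab : a ≤ b)
    (hR : ∀ s ∈ Icc a b, HasDerivAt R (R' s) s) (hR' : ContinuousOn R' (Icc a b)) (hb : R b = 0)
    {δ : ℝ} (hδ : 0 < δ) (hδa : δ ≤ -R a) :
    ∫ s in a..b, deriv cutoff (-R s / δ) / δ * R' s = 1 := by
  have h := intervalIntegral.integral_eq_sub_of_hasDerivAt (a := a) (b := b)
    (f := fun s => -cutoff (-R s / δ)) (f' := fun s => deriv cutoff (-R s / δ) / δ * R' s) ?_ ?_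
  · rw [h, hb, cutoff_of_le (by simp), cutoff_of_ge]
    · norm_num
    · rw [le_div_iff₀ hδ]; linarith
  · intro s hs
    rw [uIcc_of_le hab] at hs
    have h1 : HasDerivAt (fun s => -R s / δ) (-R' s / δ) s := (hR s hs).fun_neg.div_const δ
    have h2 := ((differentiable_cutoff (-R s / δ)).hasDerivAt.comp s h1).fun_neg
    refine h2.congr_deriv ?_
    ring
  · refine ContinuousOn.intervalIntegrable ?_
    rw [uIcc_of_le hab]
    have hRc : ContinuousOn R (Icc a b) := fun s hs => (hR s hs).continuousAt.continuousWithinAt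
    exact ((continuous_deriv_cutoff.comp_continuousOn (hRc.neg.div_const δ)).div_const δ).mul hR'

/-- The weights concentrate at the zero `b` of `R`. -/
theorem tendsto_integral_cutoff (hab : a < b) (hc : 0 < c)
    (hR : ∀ s ∈ Icc a b, HasDerivAt R (R' s) s) (hR' : ContinuousOn R' (Icc a b))
    (hRc : ∀ s ∈ Icc a b, c ≤ R' s) (hb : R b = 0) (hq : ContinuousOn q (Icc a b))
    {δ : ℕ → ℝ} (hδ : ∀ m, 0 < δ m) (hδ0 : Tendsto δ atTop (𝓝 0)) :
    Tendsto (fun m => ∫ s in a..b, deriv cutoff (-R s / δ m) / δ m * R' s * q s) atTop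
      (𝓝 (q b)) := by
  have hcont : ContinuousOn R (Icc a b) := fun s hs => (hR s hs).continuousAt.continuousWithinAt
  -- The slope of `R` is at least `c` and `R b = 0`. Hence the weight of scale `δ` is carried by the
  -- interval `b - s ≤ δ / c`.
  have hlin : ∀ s ∈ Icc a b, c * (b - s) ≤ -R s := by
    intro s hs
    have := (convex_Icc a b).mul_sub_le_image_sub_of_le_deriv (f := R) (C := c) hcont
      (fun x hx => by
        rw [interior_Icc] at hx
        exact (hR x (Ioo_subset_Icc_self hx)).differentiableAt.differentiableWithinAt)
      (fun x hx => by
        rw [interior_Icc] at hx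
        rw [(hR x (Ioo_subset_Icc_self hx)).deriv]
        exact hRc x (Ioo_subset_Icc_self hx))
      s hs b (right_mem_Icc.2 hab.le) hs.2
    rw [hb] at this; linarith
  rw [Metric.tendsto_atTop]
  intro η hη
  obtain ⟨κ, hκ, hκq⟩ := Metric.continuousWithinAt_iff.1 (hq b (right_mem_Icc.2 hab.le)) (η / 2)
    (by positivity)
  -- Below `c κ` the weight vanishes where `b - s ≥ κ`; below `c (b - a)` its total mass is one.
  have hsmall : ∀ᶠ m in atTop, δ m < min (c * κ) (c * (b - a)) :=
    hδ0.eventually (gt_mem_nhds (lt_min (by positivity) (mul_pos hc (by linarith))))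
  obtain ⟨N, hN⟩ := eventually_atTop.1 hsmall
  refine ⟨N, fun m hm => ?_⟩
  have hm1 := (hN m hm).trans_le (min_le_left _ _)
  have hm2 := (hN m hm).trans_le (min_le_right _ _)
  have hwc : ContinuousOn (fun s => deriv cutoff (-R s / δ m) / δ m * R' s) (Icc a b) :=
    ((continuous_deriv_cutoff.comp_continuousOn (hcont.neg.div_const _)).div_const _).mul hR'
  have hw1 := deriv_cutoff_weight hab.le hR hR' hb (hδ m)
    (by have := hlin a (left_mem_Icc.2 hab.le); linarith)
  have hi1 : IntervalIntegrable (fun s => deriv cutoff (-R s / δ m) / δ m * R' s) volume a b :=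
    ContinuousOn.intervalIntegrable (by rwa [uIcc_of_le hab.le])
  have hi2 : IntervalIntegrable (fun s => deriv cutoff (-R s / δ m) / δ m * R' s * q s)
      volume a b := ContinuousOn.intervalIntegrable (by rw [uIcc_of_le hab.le]; exact hwc.mul hq)
  have hdiff : (∫ s in a..b, deriv cutoff (-R s / δ m) / δ m * R' s * q s) - q b
      = ∫ s in a..b, deriv cutoff (-R s / δ m) / δ m * R' s * (q s - q b) := by
    have : q b = ∫ s in a..b, deriv cutoff (-R s / δ m) / δ m * R' s * q b := by
      rw [intervalIntegral.integral_mul_const, hw1, one_mul]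
    nth_rewrite 1 [this]
    rw [← intervalIntegral.integral_sub hi2 (hi1.mul_const _)]
    simp only [mul_sub]
  rw [Real.dist_eq, hdiff, ← Real.norm_eq_abs]
  calc _ ≤ ∫ s in a..b, deriv cutoff (-R s / δ m) / δ m * R' s * (η / 2) := by
        refine intervalIntegral.norm_integral_le_of_norm_le hab.le ?_ (hi1.mul_const _)
        refine ae_of_all _ fun s hs => ?_
        have hs' : s ∈ Icc a b := Ioc_subset_Icc_self hs
        have hw0 : 0 ≤ deriv cutoff (-R s / δ m) / δ m * R' s :=
          mul_nonneg (div_nonneg (deriv_cutoff_nonneg _) (hδ m).le) (hc.le.trans (hRc s hs'))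
        rw [norm_mul, Real.norm_of_nonneg hw0]
        by_cases hsb : b - s < κ
        · refine mul_le_mul_of_nonneg_left (hκq hs' ?_).le hw0
          rw [Real.dist_eq, abs_sub_comm, abs_of_nonneg (by linarith [hs.2])]
          exact hsb
        · have : deriv cutoff (-R s / δ m) = 0 := by
            refine deriv_cutoff_of_ge ?_
            rw [lt_div_iff₀ (hδ m), one_mul]
            have := hlin s hs'
            push Not at hsb
            nlinarith
          simp [this]
    _ = η / 2 := by rw [intervalIntegral.integral_mul_const, hw1, one_mul]
    _ < η := by linarith

end OneDim

/-! ### The weak divergence tested with boundary layers in one chart. -/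

section LocalDivergence

variable {n : ℕ}

/-- `D` is the weak divergence of the vector field `P` on `Ω`. -/
def HasWeakDiv (Ω : Set (Hor n)) (P : Hor n → Hor n) (D : Hor n → ℝ) : Prop :=
  ∀ η : Hor n → ℝ, ContDiff ℝ 1 η → HasCompactSupport η → tsupport η ⊆ Ω →
    ∫ x in Ω, D x * η x = - ∫ x in Ω, fderiv ℝ η x (P x)

variable {Ω : Set (Hor n)} {x₀ e : Hor n} {ε r : ℝ} {ρ : Hor n → ℝ}

namespace BoundaryChart

theorem inner_grad_e (C : BoundaryChart Ω x₀ e ε r ρ) {x : Hor n} (hx : x ∈ Metric.ball x₀ r) :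
    |⟪gradient ρ x, e⟫ - 1| ≤ ε := by
  have h1 : ⟪gradient ρ x, e⟫ - 1 = ⟪gradient ρ x - e, e⟫ := by
    rw [inner_sub_left, real_inner_self_eq_norm_sq, C.norm_e]; norm_num
  rw [h1]
  refine (abs_real_inner_le_norm _ _).trans ?_
  rw [C.norm_e, mul_one]
  exact C.grad_near x hx

theorem abs_norm_grad (C : BoundaryChart Ω x₀ e ε r ρ) {x : Hor n} (hx : x ∈ Metric.ball x₀ r) :
    |‖gradient ρ x‖ - 1| ≤ ε := by
  rw [← C.norm_e]
  exact (abs_norm_sub_norm_le _ _).trans (C.grad_near x hx)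

/-- The box of base radius `r / 8` and half-height `r / 4` fits into the ball of radius `r / 2`,
since `r / 8 + r / 4 < r / 2`. The height is taken larger than the base so that a nearly flat
boundary crosses every vertical segment. -/
theorem mem_ball_coord (C : BoundaryChart Ω x₀ e ε r ρ) {z : (ℝ ∙ e)ᗮ} {s : ℝ}
    (hz : ‖z‖ < r / 8) (hs : |s| ≤ r / 4) : normalCoord x₀ e (z, s) ∈ Metric.ball x₀ (r / 2) := by
  rw [mem_ball_iff_norm, normalCoord, add_sub_cancel_left]
  have := norm_coord_le C.norm_e z s
  have := C.r_pos
  simp only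
  linarith

theorem mem_ball_coord' (C : BoundaryChart Ω x₀ e ε r ρ) {z : (ℝ ∙ e)ᗮ} {s : ℝ}
    (hz : ‖z‖ < r / 8) (hs : |s| ≤ r / 4) : normalCoord x₀ e (z, s) ∈ Metric.ball x₀ r :=
  Metric.ball_subset_ball (by linarith [C.r_pos]) (C.mem_ball_coord hz hs)

theorem abs_coord_sub_le (C : BoundaryChart Ω x₀ e ε r ρ) (hε : 0 ≤ ε) {z z' : (ℝ ∙ e)ᗮ} {s s' : ℝ}
    (hz : ‖z‖ < r / 8) (hs : |s| ≤ r / 4) (hz' : ‖z'‖ < r / 8) (hs' : |s'| ≤ r / 4) :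
    |ρ (normalCoord x₀ e (z, s)) - ρ (normalCoord x₀ e (z', s')) - (s - s')|
      ≤ ε * (‖z - z'‖ + |s - s'|) := by
  have h := C.abs_sub_le (C.mem_ball_coord' hz hs) (C.mem_ball_coord' hz' hs')
  have h1 : normalCoord x₀ e (z, s) - normalCoord x₀ e (z', s')
      = ((z - z' : (ℝ ∙ e)ᗮ) : Hor n) + (s - s') • e := by
    simp only [normalCoord, Submodule.coe_sub]; module
  rw [h1, inner_add_right, inner_orthogonal_coord, inner_smul_right, real_inner_self_eq_norm_sq,
    C.norm_e] at h
  simp only [one_pow, mul_one, zero_add] at h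
  exact h.trans (mul_le_mul_of_nonneg_left (norm_coord_le C.norm_e _ _) hε)

theorem hasDerivAt_coord (C : BoundaryChart Ω x₀ e ε r ρ) {z : (ℝ ∙ e)ᗮ} {s : ℝ}
    (hz : ‖z‖ < r / 8) (hs : |s| ≤ r / 4) :
    HasDerivAt (fun s => ρ (normalCoord x₀ e (z, s)))
      ⟪gradient ρ (normalCoord x₀ e (z, s)), e⟫ s := by
  have h1 := (C.differentiableAt (C.mem_ball_coord' hz hs)).hasFDerivAt
  have h2 : HasDerivAt (fun s : ℝ => normalCoord x₀ e (z, s)) e s := by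
    simp only [normalCoord]
    have := (((hasDerivAt_id s).smul_const e).const_add (z : Hor n)).const_add x₀
    simpa using this
  rw [inner_gradient_eq]
  exact h1.comp_hasDerivAt s h2

/-- The boundary is locally a Lipschitz graph. -/
theorem exists_graph (C : BoundaryChart Ω x₀ e ε r ρ) (hε : 0 ≤ ε) (hε4 : ε ≤ 1 / 4) :
    ∃ h : (ℝ ∙ e)ᗮ → ℝ, ∀ z, ‖z‖ < r / 8 → |h z| < r / 4 ∧ ρ (normalCoord x₀ e (z, h z)) = 0 ∧
      (∀ s, |s| ≤ r / 4 → (ρ (normalCoord x₀ e (z, s)) < 0 ↔ s < h z)) ∧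
      (∀ z', ‖z'‖ < r / 8 → |h z - h z'| ≤ 2 * ε * ‖z - z'‖) := by
  have hr := C.r_pos
  have key : ∀ z : (ℝ ∙ e)ᗮ, ‖z‖ < r / 8 →
      ∃ t, |t| < r / 4 ∧ ρ (normalCoord x₀ e (z, t)) = 0 := by
    intro z hz
    have h0 : ρ (normalCoord x₀ e (0, 0)) = 0 := by simpa [normalCoord] using C.zero
    have e1 := C.abs_coord_sub_le hε (z' := 0) (s' := 0) (s := r / 4) hz
      (by rw [abs_of_nonneg (by linarith)]) (by simpa using by linarith) (by simpa using by linarith)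
    have e2 := C.abs_coord_sub_le hε (z' := 0) (s' := 0) (s := -(r / 4)) hz
      (by rw [abs_neg, abs_of_nonneg (by linarith)]) (by simpa using by linarith)
      (by simpa using by linarith)
    rw [h0, sub_zero, sub_zero, sub_zero] at e1 e2
    rw [abs_neg, abs_of_nonneg (show 0 ≤ r / 4 by linarith)] at e2
    rw [abs_of_nonneg (show 0 ≤ r / 4 by linarith)] at e1
    -- At the two ends of the segment `ρ` differs from `± r / 4` by at most `3 r / 32`, so it
    -- changes sign.
    have e3 : ε * (‖z‖ + r / 4) ≤ 1 / 4 * (r / 8 + r / 4) :=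
      mul_le_mul hε4 (by linarith) (by positivity) (by norm_num)
    have e4 := (abs_le.1 e1).1
    have e5 := (abs_le.1 e2).2
    have hcont : ContinuousOn (fun s => ρ (normalCoord x₀ e (z, s))) (Icc (-(r / 4)) (r / 4)) :=
      fun s hs => (C.hasDerivAt_coord hz (abs_le.2 hs)).continuousAt.continuousWithinAt
    obtain ⟨t, ht, ht0⟩ := intermediate_value_Ioo (by linarith) hcont
      (show (0 : ℝ) ∈ Ioo _ _ from ⟨by linarith, by linarith⟩)
    exact ⟨t, abs_lt.2 ht, ht0⟩
  choose! h h1 h2 using key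
  refine ⟨h, fun z hz => ⟨h1 z hz, h2 z hz, fun s hs => ?_, fun z' hz' => ?_⟩⟩
  · have := C.abs_coord_sub_le hε hz hs hz (h1 z hz).le
    rw [h2 z hz, sub_zero, sub_self, norm_zero, zero_add] at this
    have h4 := abs_le.1 this
    constructor
    · intro hneg
      by_contra hge
      push Not at hge
      rw [abs_of_nonneg (by linarith)] at h4
      nlinarith
    · intro hlt
      rw [abs_of_neg (by linarith)] at h4
      nlinarith
  -- Both values of `ρ` are zero, which leaves `|h z - h z'| ≤ ε (‖z - z'‖ + |h z - h z'|)`.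
  -- Absorbing the last term costs a factor `1 / (1 - ε) ≤ 2`.
  · have := C.abs_coord_sub_le hε hz (h1 z hz).le hz' (h1 z' hz').le
    rw [h2 z hz, h2 z' hz', sub_zero, zero_sub, abs_neg] at this
    nlinarith [norm_nonneg (z - z'), abs_nonneg (h z - h z'), mul_nonneg hε (norm_nonneg (z - z'))]

variable {P : Hor n → Hor n} {D : Hor n → ℝ}

/-- Testing the weak divergence with cutoffs that concentrate at the boundary. -/
theorem tendsto_boundary_layer (C : BoundaryChart Ω x₀ e ε r ρ)
    (hP : ∀ x ∉ Metric.ball x₀ (r / 8), P x = 0) (hD : ∀ x ∉ Metric.ball x₀ (r / 8), D x = 0)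
    (hΩ : IsOpen Ω) (hDi : IntegrableOn D Ω) (hw : HasWeakDiv Ω P D) {δ : ℕ → ℝ}
    (hδ : ∀ m, 0 < δ m) (hδ0 : Tendsto δ atTop (𝓝 0)) :
    Tendsto (fun m => ∫ x in Ω, deriv cutoff (-ρ x / δ m) / δ m * ⟪gradient ρ x, P x⟫) atTop
      (𝓝 (∫ x in Ω, D x)) := by
  have hr := C.r_pos
  -- The bump equals one where `P` and `D` live, so its own gradient never contributes. Its only
  -- purpose is to make the cutoff of `ρ` a globally defined test function.
  let κ : ContDiffBump x₀ := ⟨r / 8, r / 2, by linarith, by linarith⟩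
  let η : ℕ → Hor n → ℝ := fun m x => κ x * cutoff (-ρ x / δ m)
  have hκ1 : ∀ x ∈ Metric.ball x₀ (r / 8), κ x = 1 := fun x hx =>
    κ.one_of_mem_closedBall (Metric.ball_subset_closedBall hx)
  have hκts : tsupport κ ⊆ Metric.closedBall x₀ (r / 2) := κ.tsupport_eq.subset
  have hts : ∀ m, tsupport (η m) ⊆ tsupport κ := fun m =>
    closure_mono fun x hx h0 => hx (by simp [η, h0])
  have hηc : ∀ m, HasCompactSupport (η m) := fun m =>
    κ.hasCompactSupport.mono fun x hx h0 => hx (by simp [η, h0])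
  have hball : Metric.closedBall x₀ (r / 2) ⊆ Metric.ball x₀ r :=
    Metric.closedBall_subset_ball (by linarith)
  have hηd : ∀ m, ContDiff ℝ 1 (η m) := by
    intro m
    rw [contDiff_iff_contDiffAt]
    intro x
    by_cases hx : x ∈ tsupport κ
    · have hxb := hball (hκts hx)
      have h1 : ContDiffAt ℝ 1 ρ x := (C.contDiffOn.contDiffAt
        (Metric.isOpen_ball.mem_nhds hxb)).of_le (by norm_num)
      have h2 : ContDiffAt ℝ 1 (fun x => cutoff (-ρ x / δ m)) x :=
        (contDiff_cutoff.of_le (by exact_mod_cast le_top)).contDiffAt.comp x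
          (h1.neg.div_const _)
      exact κ.contDiffAt.mul h2
    · refine (contDiffAt_const (c := (0 : ℝ))).congr_of_eventuallyEq ?_
      filter_upwards [notMem_tsupport_iff_eventuallyEq.1 hx] with z hz
      simp [η, hz]
  -- The cutoff vanishes as soon as `ρ > -δ m / 2`, in particular near every zero of `ρ`.
  have hηs : ∀ m, tsupport (η m) ⊆ Ω := by
    intro m x hx
    have hxb := hball (hκts (hts m hx))
    rw [C.mem_iff x hxb]
    by_contra hneg
    push Not at hneg
    have : ∀ᶠ z in 𝓝 x, -(δ m / 2) < ρ z :=
      (C.differentiableAt hxb).continuousAt.eventually (lt_mem_nhds (by linarith [hδ m]))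
    refine absurd hx (notMem_tsupport_iff_eventuallyEq.2 ?_)
    filter_upwards [this] with z hz
    have : cutoff (-ρ z / δ m) = 0 := by
      refine cutoff_of_le ?_
      rw [div_le_iff₀ (hδ m)]; linarith
    simp [η, this]
  have hlhs : Tendsto (fun m => ∫ x in Ω, D x * η m x) atTop (𝓝 (∫ x in Ω, D x)) := by
    refine tendsto_integral_of_dominated_convergence (fun x => |D x|) (fun m => ?_) hDi.abs
      (fun m => ae_of_all _ fun x => ?_) ?_
    · exact hDi.aestronglyMeasurable.mul (hηd m).continuous.aestronglyMeasurable
    · rw [norm_mul, Real.norm_eq_abs]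
      refine mul_le_of_le_one_right (abs_nonneg _) ?_
      rw [Real.norm_of_nonneg (mul_nonneg κ.nonneg (cutoff_nonneg _))]
      exact mul_le_one₀ κ.le_one (cutoff_nonneg _) (cutoff_le_one _)
    · filter_upwards [ae_restrict_mem hΩ.measurableSet] with x hx
      by_cases hxb : x ∈ Metric.ball x₀ (r / 8)
      · refine tendsto_const_nhds.congr' ?_
        have hneg := (C.mem_iff x (Metric.ball_subset_ball (by linarith) hxb)).1 hx
        filter_upwards [hδ0.eventually (gt_mem_nhds (show 0 < -ρ x by linarith))] with m hm
        have : cutoff (-ρ x / δ m) = 1 := by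
          refine cutoff_of_ge ?_
          rw [le_div_iff₀ (hδ m)]; linarith
        simp [η, this, hκ1 x hxb]
      · simp [hD x hxb]
  refine hlhs.congr fun m => ?_
  rw [hw (η m) (hηd m) (hηc m) (hηs m), ← integral_neg]
  refine integral_congr_ae (ae_of_all _ fun x => ?_)
  by_cases hxb : x ∈ Metric.ball x₀ (r / 8)
  · have hxr : x ∈ Metric.ball x₀ r := Metric.ball_subset_ball (by linarith) hxb
    have hev : η m =ᶠ[𝓝 x] fun z => cutoff (-ρ z / δ m) := by
      filter_upwards [Metric.isOpen_ball.mem_nhds hxb] with z hz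
      simp [η, hκ1 z hz]
    have h1 : HasFDerivAt (fun z => cutoff (-ρ z / δ m))
        (deriv cutoff (-ρ x / δ m) • ((δ m)⁻¹ • -fderiv ℝ ρ x)) x := by
      have h2 := ((C.differentiableAt hxr).hasFDerivAt.fun_neg).fun_const_smul (δ m)⁻¹
      have h3 := (differentiable_cutoff ((δ m)⁻¹ • -ρ x)).hasDerivAt.comp_hasFDerivAt x h2
      have h4 : ∀ z, (δ m)⁻¹ • -ρ z = -ρ z / δ m := fun z => by
        rw [smul_eq_mul, div_eq_inv_mul]
      simp only [Function.comp_def, h4] at h3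
      exact h3
    simp only [hev.fderiv_eq, h1.fderiv, inner_gradient_eq]
    simp
    ring
  · simp [hP x hxb]

end BoundaryChart

end LocalDivergence

/-! ### From boundary layers to surface integrals over a graph. -/

section LocalDivergence

variable {n : ℕ} {Ω : Set (Hor n)} {x₀ e : Hor n} {ε r : ℝ} {ρ : Hor n → ℝ}
variable {P : Hor n → Hor n} {D : Hor n → ℝ}

namespace BoundaryChart

/-- The boundary layer integrals converge to an integral over the graph. -/
theorem tendsto_graph_integral (C : BoundaryChart Ω x₀ e ε r ρ) (hε : 0 ≤ ε) (hε4 : ε ≤ 1 / 4)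
    {h : (ℝ ∙ e)ᗮ → ℝ} (hh : ∀ z, ‖z‖ < r / 8 → |h z| < r / 4 ∧ ρ (normalCoord x₀ e (z, h z)) = 0 ∧
      (∀ s, |s| ≤ r / 4 → (ρ (normalCoord x₀ e (z, s)) < 0 ↔ s < h z)) ∧
      (∀ z', ‖z'‖ < r / 8 → |h z - h z'| ≤ 2 * ε * ‖z - z'‖))
    (hPc : ContinuousOn P (closure Ω)) (hP : ∀ x ∉ Metric.ball x₀ (r / 8), P x = 0)
    (hΩ : IsOpen Ω) {δ : ℕ → ℝ} (hδ : ∀ m, 0 < δ m) (hδ0 : Tendsto δ atTop (𝓝 0)) :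
    Tendsto (fun m => ∫ x in Ω, deriv cutoff (-ρ x / δ m) / δ m * ⟪gradient ρ x, P x⟫) atTop
      (𝓝 (∫ z in Metric.ball (0 : (ℝ ∙ e)ᗮ) (r / 8),
        ⟪gradient ρ (normalCoord x₀ e (z, h z)), P (normalCoord x₀ e (z, h z))⟫
          / ⟪gradient ρ (normalCoord x₀ e (z, h z)), e⟫)) := by
  have hr := C.r_pos
  have hcl := C.closure_iff
  set B := Metric.ball (0 : (ℝ ∙ e)ᗮ) (r / 8) with hB
  have hmemB : ∀ z : (ℝ ∙ e)ᗮ, z ∈ B ↔ ‖z‖ < r / 8 := fun z => mem_ball_zero_iff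
  let Q : Hor n → ℝ := fun x => ⟪gradient ρ x, P x⟫
  let F : ℕ → Hor n → ℝ := fun m x => deriv cutoff (-ρ x / δ m) / δ m * Q x
  have hball : Metric.closedBall x₀ (r / 2) ⊆ Metric.ball x₀ r :=
    Metric.closedBall_subset_ball (by linarith)
  have hQ0 : ∀ x ∉ Metric.ball x₀ (r / 8), Q x = 0 := fun x hx => by simp [Q, hP x hx]
  have hQc : ContinuousOn Q (closure Ω ∩ Metric.ball x₀ r) :=
    (C.continuousOn_gradient.mono inter_subset_right).inner (hPc.mono inter_subset_left)
  have hρc : ContinuousOn ρ (Metric.ball x₀ r) := C.contDiffOn.continuousOn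
  have hFc : ∀ m, ContinuousOn (F m) (closure Ω ∩ Metric.ball x₀ r) := fun m =>
    ((continuous_deriv_cutoff.comp_continuousOn
      ((hρc.mono inter_subset_right).neg.div_const _)).div_const _).mul hQc
  set S := closure Ω ∩ Metric.closedBall x₀ (r / 2) with hS
  have hSc : IsCompact S := (isCompact_closedBall x₀ (r / 2)).inter_left isClosed_closure
  have hSsub : S ⊆ closure Ω ∩ Metric.ball x₀ r := inter_subset_inter_right _ hball
  have hFi : ∀ m, IntegrableOn (F m) Ω := by
    intro m
    have h1 : IntegrableOn (F m) S := ((hFc m).mono hSsub).integrableOn_compact hSc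
    have h2 : IntegrableOn (F m) (Ω ∩ Metric.ball x₀ (r / 8)) :=
      h1.mono_set (inter_subset_inter subset_closure
        ((Metric.ball_subset_ball (by linarith)).trans Metric.ball_subset_closedBall))
    refine h2.of_forall_sdiff_eq_zero hΩ.measurableSet fun x hx => ?_
    have : x ∉ Metric.ball x₀ (r / 8) := fun hb => hx.2 ⟨hx.1, hb⟩
    simp [F, hQ0 x this]
  -- Fubini in the coordinates along `e`: the layer integral becomes an integral over the base of
  -- one-dimensional integrals ending at the graph.
  let J : ℕ → (ℝ ∙ e)ᗮ → ℝ := fun m z =>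
    ∫ s, Ω.indicator (F m) (normalCoord x₀ e (z, s))
  have hprodi : ∀ m, Integrable (fun p => Ω.indicator (F m) (normalCoord x₀ e p)) := fun m =>
    ((measurePreserving_normalCoord x₀ C.norm_e).integrable_comp_emb
      (measurableEmbedding_normalCoord x₀ C.norm_e)).2
      ((hFi m).integrable_indicator hΩ.measurableSet)
  have hJ : ∀ m, ∫ x in Ω, F m x = ∫ z, J m z := by
    intro m
    rw [← integral_indicator hΩ.measurableSet,
      ← (measurePreserving_normalCoord x₀ C.norm_e).integral_comp
        (measurableEmbedding_normalCoord x₀ C.norm_e)]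
    exact integral_prod _ (hprodi m)
  have hJ0 : ∀ m, ∀ z ∉ B, J m z = 0 := by
    intro m z hz
    refine integral_eq_zero_of_ae (ae_of_all _ fun s => ?_)
    have : normalCoord x₀ e (z, s) ∉ Metric.ball x₀ (r / 8) := by
      rw [mem_ball_iff_norm, normalCoord, add_sub_cancel_left]
      intro hlt
      exact hz ((hmemB z).2 ((norm_coord_fst_le C.norm_e z s).trans_lt hlt))
    by_cases hx : normalCoord x₀ e (z, s) ∈ Ω
    · simp [hx, F, hQ0 _ this]
    · simp [hx]
  have hJ1 : ∀ m, ∀ z ∈ B, J m z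
      = ∫ s in (-(r / 4))..(h z), F m (normalCoord x₀ e (z, s)) := by
    intro m z hz
    have hz' := (hmemB z).1 hz
    obtain ⟨e1, -, e3, -⟩ := hh z hz'
    have hle : -(r / 4) ≤ h z := (abs_lt.1 e1).1.le
    rw [intervalIntegral.integral_of_le hle, integral_Ioc_eq_integral_Ioo,
      ← integral_indicator measurableSet_Ioo]
    refine integral_congr_ae (ae_of_all _ fun s => ?_)
    by_cases hs : |s| < r / 4
    · have hm : normalCoord x₀ e (z, s) ∈ Ω ↔ s ∈ Ioo (-(r / 4)) (h z) := by
        rw [C.mem_iff _ (C.mem_ball_coord' hz' hs.le), e3 s hs.le]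
        exact ⟨fun hlt => ⟨(abs_lt.1 hs).1, hlt⟩, fun hlt => hlt.2⟩
      by_cases hx : normalCoord x₀ e (z, s) ∈ Ω
      · simp [hx, hm.1 hx]
      · beta_reduce
        rw [indicator_of_notMem hx, indicator_of_notMem (fun hc => hx (hm.2 hc))]
    · have hn : normalCoord x₀ e (z, s) ∉ Metric.ball x₀ (r / 8) := by
        rw [mem_ball_iff_norm, normalCoord, add_sub_cancel_left]
        intro hlt
        have := (abs_coord_snd_le C.norm_e z s).trans_lt hlt
        exact hs (by linarith)
      have hF0 : F m (normalCoord x₀ e (z, s)) = 0 := by simp [F, hQ0 _ hn]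
      by_cases hx : normalCoord x₀ e (z, s) ∈ Ω
      · by_cases hs' : s ∈ Ioo (-(r / 4)) (h z)
        · simp [hx, hs']
        · simp [hx, hs', hF0]
      · by_cases hs' : s ∈ Ioo (-(r / 4)) (h z)
        · simp [hx, hs', hF0]
        · simp [hx, hs']
  have hge : ∀ x ∈ Metric.ball x₀ r, 3 / 4 ≤ ⟪gradient ρ x, e⟫ := fun x hx => by
    have := (abs_le.1 (C.inner_grad_e hx)).1
    linarith
  -- data along a vertical line
  have hline : ∀ z ∈ B, ∀ s ∈ Icc (-(r / 4)) (h z), |s| ≤ r / 4 := by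
    intro z hz s hs
    have := (abs_lt.1 (hh z ((hmemB z).1 hz)).1).2
    exact abs_le.2 ⟨hs.1, hs.2.trans this.le⟩
  have hlb : ∀ z ∈ B, ∀ s ∈ Icc (-(r / 4)) (h z), normalCoord x₀ e (z, s) ∈ S := by
    intro z hz s hs
    have hz' := (hmemB z).1 hz
    have h1 := C.mem_ball_coord hz' (hline z hz s hs)
    refine ⟨?_, Metric.ball_subset_closedBall h1⟩
    rw [hcl _ (Metric.ball_subset_ball (by linarith) h1)]
    obtain ⟨e1, e2, e3, -⟩ := hh z hz'
    rcases hs.2.lt_or_eq with hlt | heq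
    · exact ((e3 s (hline z hz s hs)).2 hlt).le
    · rw [heq, e2]
  have hcline : ∀ z : (ℝ ∙ e)ᗮ, Continuous fun s : ℝ => normalCoord x₀ e (z, s) := fun z =>
    (continuous_normalCoord x₀ e).comp (by fun_prop)
  have hqc : ContinuousOn (fun x => Q x / ⟪gradient ρ x, e⟫) (closure Ω ∩ Metric.ball x₀ r) :=
    hQc.div ((C.continuousOn_gradient.mono inter_subset_right).inner continuousOn_const)
      fun x hx => by have := hge x hx.2; linarith
  have hR' : ∀ z ∈ B, ContinuousOn (fun s => ⟪gradient ρ (normalCoord x₀ e (z, s)), e⟫)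
      (Icc (-(r / 4)) (h z)) := fun z hz =>
    (C.continuousOn_gradient.comp (hcline z).continuousOn
      fun s hs => (hSsub (hlb z hz s hs)).2).inner continuousOn_const
  have hq' : ∀ z ∈ B, ContinuousOn (fun s => Q (normalCoord x₀ e (z, s))
      / ⟪gradient ρ (normalCoord x₀ e (z, s)), e⟫) (Icc (-(r / 4)) (h z)) := fun z hz =>
    hqc.comp (hcline z).continuousOn fun s hs => hSsub (hlb z hz s hs)
  have hRd : ∀ z ∈ B, ∀ s ∈ Icc (-(r / 4)) (h z), HasDerivAt
      (fun s => ρ (normalCoord x₀ e (z, s))) ⟪gradient ρ (normalCoord x₀ e (z, s)), e⟫ s :=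
    fun z hz s hs => C.hasDerivAt_coord ((hmemB z).1 hz) (hline z hz s hs)
  have hlt : ∀ z ∈ B, -(r / 4) < h z := fun z hz => (abs_lt.1 (hh z ((hmemB z).1 hz)).1).1
  -- Multiplying and dividing by `⟪∇ρ, e⟫`, the derivative of `ρ` along the line, exhibits the
  -- one-dimensional weight. The quotient that remains is continuous up to the graph.
  have hJ2 : ∀ m, ∀ z ∈ B, J m z = ∫ s in (-(r / 4))..(h z),
      deriv cutoff (-ρ (normalCoord x₀ e (z, s)) / δ m) / δ m
        * ⟪gradient ρ (normalCoord x₀ e (z, s)), e⟫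
        * (Q (normalCoord x₀ e (z, s)) / ⟪gradient ρ (normalCoord x₀ e (z, s)), e⟫) := by
    intro m z hz
    rw [hJ1 m z hz]
    refine intervalIntegral.integral_congr fun s hs => ?_
    rw [uIcc_of_le (hlt z hz).le] at hs
    have := hge _ (hSsub (hlb z hz s hs)).2
    simp only [F]
    field_simp
  obtain ⟨M, hM⟩ := hSc.exists_bound_of_continuousOn (hqc.mono hSsub)
  simp only [Real.norm_eq_abs] at hM
  -- At the lower end `-ρ ≥ r / 4 - 3 r / 32 ≥ r / 8`. For `δ m < r / 8` the weights therefore have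
  -- mass one on every line, which gives a bound independent of `m` and `z`.
  have hbottom : ∀ z ∈ B, r / 8 ≤ -ρ (normalCoord x₀ e (z, -(r / 4))) := by
    intro z hz
    have h0 : ρ (normalCoord x₀ e (0, 0)) = 0 := by simpa [normalCoord] using C.zero
    have hz' := (hmemB z).1 hz
    have e2 := C.abs_coord_sub_le hε (z' := 0) (s' := 0) (s := -(r / 4)) hz'
      (by rw [abs_neg, abs_of_nonneg (by linarith)]) (by simpa using by linarith)
      (by simpa using by linarith)
    rw [h0, sub_zero, sub_zero, sub_zero, abs_neg, abs_of_nonneg (show 0 ≤ r / 4 by linarith)] at e2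
    have e3 : ε * (‖z‖ + r / 4) ≤ 1 / 4 * (r / 8 + r / 4) :=
      mul_le_mul hε4 (by linarith) (by positivity) (by norm_num)
    have e5 := (abs_le.1 e2).2
    linarith
  have hbound : ∀ m, δ m < r / 8 → ∀ z ∈ B, |J m z| ≤ M := by
    intro m hm z hz
    rw [hJ2 m z hz, ← Real.norm_eq_abs]
    have hw1 := deriv_cutoff_weight (hlt z hz).le (hRd z hz) (hR' z hz)
      (hh z ((hmemB z).1 hz)).2.1 (hδ m) (hm.le.trans (hbottom z hz))
    have hρl : ContinuousOn (fun s => ρ (normalCoord x₀ e (z, s))) (Icc (-(r / 4)) (h z)) :=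
      fun s hs => (hRd z hz s hs).continuousAt.continuousWithinAt
    have hwi : IntervalIntegrable (fun s => deriv cutoff (-ρ (normalCoord x₀ e (z, s)) / δ m) / δ m
        * ⟪gradient ρ (normalCoord x₀ e (z, s)), e⟫) volume (-(r / 4)) (h z) := by
      refine ContinuousOn.intervalIntegrable ?_
      rw [uIcc_of_le (hlt z hz).le]
      exact ((continuous_deriv_cutoff.comp_continuousOn (hρl.neg.div_const _)).div_const _).mul
        (hR' z hz)
    calc _ ≤ ∫ s in (-(r / 4))..(h z), deriv cutoff (-ρ (normalCoord x₀ e (z, s)) / δ m) / δ m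
        * ⟪gradient ρ (normalCoord x₀ e (z, s)), e⟫ * M := by
          refine intervalIntegral.norm_integral_le_of_norm_le (hlt z hz).le ?_ (hwi.mul_const _)
          refine ae_of_all _ fun s hs => ?_
          have hs' : s ∈ Icc (-(r / 4)) (h z) := Ioc_subset_Icc_self hs
          have hs'' := hlb z hz s hs'
          have hw0 : 0 ≤ deriv cutoff (-ρ (normalCoord x₀ e (z, s)) / δ m) / δ m
              * ⟪gradient ρ (normalCoord x₀ e (z, s)), e⟫ :=
            mul_nonneg (div_nonneg (deriv_cutoff_nonneg _) (hδ m).le)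
              (by have := hge _ (hSsub hs'').2; linarith)
          rw [norm_mul, Real.norm_of_nonneg hw0]
          exact mul_le_mul_of_nonneg_left (hM _ hs'') hw0
      _ = M := by rw [intervalIntegral.integral_mul_const, hw1, one_mul]
  have hfinal : Tendsto (fun m => ∫ z, J m z) atTop (𝓝 (∫ z, B.indicator (fun z =>
      Q (normalCoord x₀ e (z, h z)) / ⟪gradient ρ (normalCoord x₀ e (z, h z)), e⟫) z)) := by
    refine tendsto_integral_filter_of_dominated_convergence (B.indicator fun _ => M)
      (Eventually.of_forall fun m => (hprodi m).integral_prod_left.aestronglyMeasurable) ?_ ?_ ?_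
    · filter_upwards [hδ0.eventually (gt_mem_nhds (show 0 < r / 8 by linarith))] with m hm
      refine ae_of_all _ fun z => ?_
      by_cases hz : z ∈ B
      · rw [indicator_of_mem hz]; exact hbound m hm z hz
      · rw [indicator_of_notMem hz, hJ0 m z hz, norm_zero]
    · exact IntegrableOn.integrable_indicator
        (integrableOn_const (by exact measure_ball_lt_top.ne)) Metric.isOpen_ball.measurableSet
    · refine ae_of_all _ fun z => ?_
      by_cases hz : z ∈ B
      · rw [indicator_of_mem hz]
        simp only [hJ2 _ z hz]
        exact tendsto_integral_cutoff (q := fun s => Q (normalCoord x₀ e (z, s))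
          / ⟪gradient ρ (normalCoord x₀ e (z, s)), e⟫) (hlt z hz) (c := 3 / 4) (by norm_num)
          (hRd z hz) (hR' z hz)
          (fun s hs => hge _ (hSsub (hlb z hz s hs)).2) (hh z ((hmemB z).1 hz)).2.1 (hq' z hz)
          hδ hδ0
      · simp [hz, hJ0 _ z hz]
  rw [integral_indicator Metric.isOpen_ball.measurableSet] at hfinal
  exact hfinal.congr fun m => (hJ m).symm

/-- On a boundary piece, surface measure is comparable to Lebesgue measure in the tangent plane. -/
theorem graph_measure_comparison (C : BoundaryChart Ω x₀ e ε r ρ) (hε : 0 ≤ ε) (hε4 : ε ≤ 1 / 4)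
    {h : (ℝ ∙ e)ᗮ → ℝ} (hh : ∀ z, ‖z‖ < r / 8 → |h z| < r / 4 ∧ ρ (normalCoord x₀ e (z, h z)) = 0 ∧
      (∀ s, |s| ≤ r / 4 → (ρ (normalCoord x₀ e (z, s)) < 0 ↔ s < h z)) ∧
      (∀ z', ‖z'‖ < r / 8 → |h z - h z'| ≤ 2 * ε * ‖z - z'‖)) :
    ∃ S : Set (Hor n), MeasurableSet S ∧ S ⊆ frontier Ω ∩ Metric.ball x₀ r ∧
      frontier Ω ∩ Metric.ball x₀ (r / 8) ⊆ S ∧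
      AEMeasurable (fun z => normalCoord x₀ e (z, h z))
        (volume.restrict (Metric.ball (0 : (ℝ ∙ e)ᗮ) (r / 8))) ∧
      (volume.restrict (Metric.ball (0 : (ℝ ∙ e)ᗮ) (r / 8))).map
        (fun z => normalCoord x₀ e (z, h z)) ≤ μHE[n - 1].restrict S ∧
      μHE[n - 1].restrict S ≤ ((1 + 2 * ε.toNNReal) ^ (n - 1) : ℝ≥0) •
        (volume.restrict (Metric.ball (0 : (ℝ ∙ e)ᗮ) (r / 8))).map
          (fun z => normalCoord x₀ e (z, h z)) := by
  have hr := C.r_pos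
  set B := Metric.ball (0 : (ℝ ∙ e)ᗮ) (r / 8) with hB
  have hmemB : ∀ z : (ℝ ∙ e)ᗮ, z ∈ B ↔ ‖z‖ < r / 8 := fun z => mem_ball_zero_iff
  set γ : (ℝ ∙ e)ᗮ → Hor n := fun z => normalCoord x₀ e (z, h z) with hγ
  have hγL : LipschitzOnWith (1 + 2 * ε.toNNReal) γ B := by
    refine LipschitzOnWith.of_dist_le_mul fun z hz z' hz' => ?_
    rw [dist_eq_norm, dist_eq_norm]
    have h1 : γ z - γ z' = ((z - z' : (ℝ ∙ e)ᗮ) : Hor n) + (h z - h z') • e := by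
      simp only [hγ, normalCoord, Submodule.coe_sub]; module
    rw [h1]
    refine (norm_coord_le C.norm_e _ _).trans ?_
    have := (hh z ((hmemB z).1 hz)).2.2.2 z' ((hmemB z').1 hz')
    push_cast
    rw [Real.coe_toNNReal ε hε]
    linarith
  have hγc : ContinuousOn γ B := hγL.continuousOn
  have hγm : AEMeasurable γ (volume.restrict B) := hγc.aemeasurable Metric.isOpen_ball.measurableSet
  -- The projection inverts the graph map and does not increase distances, so surface measure is at
  -- least the push-forward of Lebesgue measure. The Lipschitz constant `1 + 2 ε` of the graph map
  -- gives the opposite bound, with the power `n - 1`. No area formula is needed.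
  let π : Hor n → (ℝ ∙ e)ᗮ := fun x => (ℝ ∙ e)ᗮ.orthogonalProjectionOnto (x - x₀)
  have hπγ : ∀ z, π (γ z) = z := by
    intro z
    have h1 : γ z - x₀ = (z : Hor n) + (h z) • e := by simp [hγ, normalCoord]
    simp only [π, h1, map_add, map_smul, Submodule.orthogonalProjectionOnto_mem_subspace_eq_self]
    have : (ℝ ∙ e)ᗮ.orthogonalProjectionOnto e = 0 :=
      Submodule.orthogonalProjectionOnto_orthogonal_apply_eq_zero (Submodule.mem_span_singleton_self e)
    simp [this]
  have hπL : LipschitzWith 1 π := by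
    refine LipschitzWith.of_dist_le_mul fun x y => ?_
    rw [dist_eq_norm, dist_eq_norm, NNReal.coe_one, one_mul]
    have : π x - π y = (ℝ ∙ e)ᗮ.orthogonalProjectionOnto (x - y) := by
      simp only [π, ← map_sub]; congr 1; abel
    rw [this]
    exact Submodule.norm_orthogonalProjectionOnto_apply_le _ _
  have hdecomp : ∀ x : Hor n, ∃ s : ℝ, x = normalCoord x₀ e (π x, s) := by
    intro x
    have h1 := (ℝ ∙ e).starProjection_add_starProjection_orthogonal (x - x₀)
    obtain ⟨s, hs⟩ := Submodule.mem_span_singleton.1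
      (Submodule.starProjection_apply_mem (ℝ ∙ e) (x - x₀))
    refine ⟨s, ?_⟩
    simp only [normalCoord, π]
    rw [hs]
    have h2 : ((ℝ ∙ e)ᗮ.orthogonalProjectionOnto (x - x₀) : Hor n)
      = (ℝ ∙ e)ᗮ.starProjection (x - x₀) := rfl
    rw [h2, add_comm ((ℝ ∙ e)ᗮ.starProjection (x - x₀)), h1]
    abel
  set S := γ '' B with hS
  -- The piece of graph is the part of the frontier in an open box. This makes it measurable and
  -- shows that it contains the frontier near `x₀`.
  have hSchar : S = frontier Ω ∩ {x | ‖π x‖ < r / 8 ∧ |⟪e, x - x₀⟫| < r / 4} := by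
    have hinner : ∀ z s, ⟪e, normalCoord x₀ e (z, s) - x₀⟫ = s := by
      intro z s
      rw [normalCoord, add_sub_cancel_left, inner_add_right, inner_orthogonal_coord,
        inner_smul_right, real_inner_self_eq_norm_sq, C.norm_e]
      simp
    ext x
    constructor
    · rintro ⟨z, hz, rfl⟩
      have hz' := (hmemB z).1 hz
      obtain ⟨e1, e2, -, -⟩ := hh z hz'
      refine ⟨(C.frontier_iff _ (C.mem_ball_coord' hz' e1.le)).2 e2, ?_, ?_⟩
      · rw [hπγ]; exact hz'
      · rw [hinner]; exact e1
    · rintro ⟨hf, h1, h2⟩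
      obtain ⟨s, hs⟩ := hdecomp x
      rw [hs, hinner] at h2
      refine ⟨π x, (hmemB _).2 h1, ?_⟩
      obtain ⟨e1, e2, e3, -⟩ := hh _ h1
      have hb := C.mem_ball_coord' h1 h2.le
      have h0 : ρ (normalCoord x₀ e (π x, s)) = 0 := by
        rw [← C.frontier_iff _ hb, ← hs]; exact hf
      have hge : h (π x) ≤ s := by
        by_contra hc
        push Not at hc
        have := (e3 s h2.le).2 hc
        linarith
      have hle : s ≤ h (π x) := by
        have hd := C.abs_coord_sub_le hε h1 h2.le h1 e1.le
        rw [h0, e2, sub_zero, sub_self, norm_zero, zero_add, zero_sub, abs_neg] at hd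
        by_contra hc
        push Not at hc
        rw [abs_of_pos (show 0 < s - h (π x) by linarith)] at hd
        nlinarith
      have : s = h (π x) := le_antisymm hle hge
      change normalCoord x₀ e (π x, h (π x)) = x
      rw [← this, ← hs]
  have hπc : Continuous π := hπL.continuous
  have hSm : MeasurableSet S := by
    rw [hSchar]
    refine isClosed_frontier.measurableSet.inter (IsOpen.measurableSet ?_)
    have o1 : IsOpen {x | ‖π x‖ < r / 8} := isOpen_lt hπc.norm continuous_const
    have o2 : IsOpen {x : Hor n | |⟪e, x - x₀⟫| < r / 4} :=
      isOpen_lt (by fun_prop) continuous_const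
    exact o1.inter o2
  have hvol : (volume : Measure (ℝ ∙ e)ᗮ) = μHE[n - 1] := by
    rw [← finrank_orthogonal_unit C.norm_e, InnerProductSpace.euclideanHausdorffMeasure_eq_volume]
  refine ⟨S, hSm, ?_, ?_, hγm, ?_, ?_⟩
  · rintro x ⟨z, hz, rfl⟩
    have hz' := (hmemB z).1 hz
    obtain ⟨e1, e2, -, -⟩ := hh z hz'
    exact ⟨(C.frontier_iff _ (C.mem_ball_coord' hz' e1.le)).2 e2, C.mem_ball_coord' hz' e1.le⟩
  · rintro x ⟨hf, hx⟩
    rw [hSchar]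
    rw [mem_ball_iff_norm] at hx
    refine ⟨hf, ?_, ?_⟩
    · exact (Submodule.norm_orthogonalProjectionOnto_apply_le _ _).trans_lt hx
    · refine (abs_real_inner_le_norm _ _).trans_lt ?_
      rw [C.norm_e]; linarith
  · refine Measure.le_iff.2 fun A hA => ?_
    rw [Measure.map_apply_of_aemeasurable hγm hA, Measure.restrict_apply' Metric.isOpen_ball.measurableSet,
      Measure.restrict_apply hA, hvol]
    have : γ ⁻¹' A ∩ B ⊆ π '' (A ∩ S) := by
      rintro z ⟨hzA, hzB⟩
      exact ⟨γ z, ⟨hzA, z, hzB, rfl⟩, hπγ z⟩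
    refine (measure_mono this).trans ?_
    have := (hπL.lipschitzOnWith (s := A ∩ S)).euclideanHausdorffMeasure_image_le (n - 1)
    simpa using this
  · refine Measure.le_iff.2 fun A hA => ?_
    rw [Measure.smul_apply, Measure.map_apply_of_aemeasurable hγm hA, Measure.restrict_apply' Metric.isOpen_ball.measurableSet,
      Measure.restrict_apply hA, hvol]
    have h1 : A ∩ S ⊆ γ '' (γ ⁻¹' A ∩ B) := by
      rintro x ⟨hxA, z, hz, rfl⟩
      exact ⟨z, ⟨hxA, hz⟩, rfl⟩
    refine (measure_mono h1).trans ?_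
    have := (hγL.mono (inter_subset_right (s := γ ⁻¹' A))).euclideanHausdorffMeasure_image_le (n - 1)
    refine this.trans (le_of_eq ?_)
    rw [ENNReal.smul_def, smul_eq_mul, ENNReal.coe_pow]

end BoundaryChart

end LocalDivergence

/-! ### The divergence theorem in the domain. -/

section Divergence

variable {n : ℕ} {Ω : Set (Hor n)}

/-- The divergence theorem up to a relative error `ε` for fields supported near `x₀`. -/
def ApproxDivAt (Ω : Set (Hor n)) (x₀ : Hor n) (r ε : ℝ) : Prop :=
  ∀ (P : Hor n → Hor n) (D : Hor n → ℝ), ContinuousOn P (closure Ω) →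
    (∀ x ∉ Metric.ball x₀ r, P x = 0) → (∀ x ∉ Metric.ball x₀ r, D x = 0) →
    IntegrableOn D Ω → HasWeakDiv Ω P D →
    |(∫ x in Ω, D x) - ∫ x in frontier Ω, ⟪P x, outerNormal Ω x⟫ ∂μHE[n - 1]|
      ≤ ε * ∫ x in frontier Ω, ‖P x‖ ∂μHE[n - 1]

/-- The boundary layer integrals have two limits, `∫ D` and the integral of `q = ⟪∇ρ, P⟫ / ⟪∇ρ, e⟫`
against the push-forward `σ` of Lebesgue measure to the graph. Two replacements remain. Passing from
`σ` to surface measure costs `(1 + 2ε)^(n-1) - 1` times `∫ |q| ≤ 2 ∫ ‖P‖`; passing from `q` to the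
normal component of `P` costs `4 ε ∫ ‖P‖`. -/
theorem BoundaryChart.approxDiv {x₀ e : Hor n} {ε r : ℝ} {ρ : Hor n → ℝ}
    (C : BoundaryChart Ω x₀ e ε r ρ) (hε : 0 ≤ ε) (hε4 : ε ≤ 1 / 4) (hΩ : IsOpen Ω)
    (hK : IsCompact (closure Ω)) :
    μHE[n - 1] (frontier Ω ∩ Metric.ball x₀ (r / 8)) < ⊤ ∧
      ApproxDivAt Ω x₀ (r / 8) (2 * ((1 + 2 * ε) ^ (n - 1) - 1) + 4 * ε) := by
  have hr := C.r_pos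
  obtain ⟨h, hh⟩ := C.exists_graph hε hε4
  obtain ⟨S, hSm, hSf, hSb, hγm, hle1, hle2⟩ := C.graph_measure_comparison hε hε4 hh
  set γ := fun z => normalCoord x₀ e (z, h z) with hγ
  set B := Metric.ball (0 : (ℝ ∙ e)ᗮ) (r / 8) with hB
  set σ := (volume.restrict B).map γ with hσ
  have hσfin : IsFiniteMeasure σ := by
    have : IsFiniteMeasure (volume.restrict B) := ⟨by
      rw [Measure.restrict_apply_univ]; exact measure_ball_lt_top⟩
    infer_instance
  have hSfin : IsFiniteMeasure (μHE[n - 1].restrict S) := by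
    have : IsFiniteMeasure (((1 + 2 * ε.toNNReal) ^ (n - 1) : ℝ≥0) • σ) := inferInstance
    exact isFiniteMeasure_of_le _ hle2
  have hSfin' : μHE[n - 1] S < ⊤ := by
    have := hSfin.measure_univ_lt_top
    rwa [Measure.restrict_apply_univ] at this
  refine ⟨(measure_mono hSb).trans_lt hSfin', ?_⟩
  intro P D hPc hP0 hD0 hDi hw
  have hδ : ∀ m : ℕ, (0 : ℝ) < 1 / (m + 1) := fun m => by positivity
  have hlim := tendsto_nhds_unique
    (C.tendsto_boundary_layer hP0 hD0 hΩ hDi hw hδ tendsto_one_div_add_atTop_nhds_zero_nat)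
    (C.tendsto_graph_integral hε hε4 hh hPc hP0 hΩ hδ tendsto_one_div_add_atTop_nhds_zero_nat)
  let q : Hor n → ℝ := fun x => ⟪gradient ρ x, P x⟫ / ⟪gradient ρ x, e⟫
  have hge : ∀ x ∈ Metric.ball x₀ r, 3 / 4 ≤ ⟪gradient ρ x, e⟫ := fun x hx => by
    have := (abs_le.1 (C.inner_grad_e hx)).1
    linarith
  have hPS : ContinuousOn P S := hPc.mono fun x hx => frontier_subset_closure (hSf hx).1
  have hNS : ContinuousOn (gradient ρ) S := C.continuousOn_gradient.mono fun x hx => (hSf hx).2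
  have hqc : ContinuousOn q S := (hNS.inner hPS).div (hNS.inner continuousOn_const)
    fun x hx => by have := hge x (hSf hx).2; linarith
  have hqm : AEStronglyMeasurable q (μHE[n - 1].restrict S) := hqc.aestronglyMeasurable hSm
  obtain ⟨M, hM⟩ := hK.exists_bound_of_continuousOn hPc
  have hPi : Integrable (fun x => ‖P x‖) (μHE[n - 1].restrict S) := by
    refine Integrable.of_bound (hPS.aestronglyMeasurable hSm).norm M ?_
    filter_upwards [ae_restrict_mem hSm] with x hx
    rw [norm_norm]
    exact hM x (frontier_subset_closure (hSf hx).1)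
  -- The quotient of `‖∇ρ‖ ≤ 5 / 4` by `⟪∇ρ, e⟫ ≥ 3 / 4` is at most `2`.
  have hq2 : ∀ x ∈ S, |q x| ≤ 2 * ‖P x‖ := by
    intro x hx
    have h1 := hge x (hSf hx).2
    have h2 := (abs_le.1 (C.abs_norm_grad (hSf hx).2)).2
    have h3 := abs_real_inner_le_norm (gradient ρ x) (P x)
    simp only [q]
    rw [abs_div, abs_of_nonneg (show 0 ≤ ⟪gradient ρ x, e⟫ by linarith), div_le_iff₀ (by linarith)]
    nlinarith [norm_nonneg (P x)]
  have hqi : Integrable q (μHE[n - 1].restrict S) := by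
    refine (hPi.const_mul 2).mono' hqm ?_
    filter_upwards [ae_restrict_mem hSm] with x hx using hq2 x hx
  have hqν : ∀ x ∈ S, |q x - ⟪P x, outerNormal Ω x⟫| ≤ 4 * ε * ‖P x‖ := by
    intro x hx
    have hb := (hSf hx).2
    have h1 := hge x hb
    have h2 := abs_le.1 (C.abs_norm_grad hb)
    have h2' := abs_le.1 (C.inner_grad_e hb)
    have h3 := abs_real_inner_le_norm (gradient ρ x) (P x)
    rw [C.outerNormal_eq (by linarith) hb (hSf hx).1, inner_smul_right, real_inner_comm]
    have hpos : 0 < ‖gradient ρ x‖ := by linarith [h2.1]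
    -- `‖∇ρ‖` and `⟪∇ρ, e⟫` both lie within `ε` of `1`, so the second factor is at most `2 ε / (3 /
    -- 4) ≤ 4 ε`, and the first is at most `‖P x‖`.
    have heq : q x - ‖gradient ρ x‖⁻¹ * ⟪gradient ρ x, P x⟫
        = (⟪gradient ρ x, P x⟫ / ‖gradient ρ x‖)
          * ((‖gradient ρ x‖ - ⟪gradient ρ x, e⟫) / ⟪gradient ρ x, e⟫) := by
      simp only [q]
      have : ⟪gradient ρ x, e⟫ ≠ 0 := by linarith
      field_simp
    rw [heq, abs_mul, mul_comm]
    refine mul_le_mul ?_ ?_ (abs_nonneg _) (by positivity)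
    · rw [abs_div, abs_of_nonneg (show 0 ≤ ⟪gradient ρ x, e⟫ by linarith), div_le_iff₀ (by linarith),
        abs_le]
      constructor <;> nlinarith [h2.1, h2.2, h2'.1, h2'.2]
    · rw [abs_div, abs_of_nonneg hpos.le, div_le_iff₀ hpos]
      linarith
  -- The subtraction is truncated, but the power is at least one, so nothing is lost.
  set c : ℝ≥0 := (1 + 2 * ε.toNNReal) ^ (n - 1) - 1 with hc
  have hc1 : (1 + 2 * ε.toNNReal) ^ (n - 1) = 1 + c := by
    rw [hc, add_tsub_cancel_of_le]
    exact one_le_pow₀ (by simp)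
  have hcr : (c : ℝ) = (1 + 2 * ε) ^ (n - 1) - 1 := by
    have := congrArg (fun t : ℝ≥0 => (t : ℝ)) hc1
    push_cast at this
    rw [Real.coe_toNNReal ε hε] at this
    linarith
  rw [hc1] at hle2
  have hcomp := abs_integral_sub_integral_le hle1 hle2 hqi
  have hmap : ∫ x, q x ∂σ = ∫ x in Ω, D x := by
    rw [hlim, hσ, integral_map hγm]
    exact hqm.mono_measure hle1
  have hfS : ∀ p : Hor n → ℝ, (∀ x ∉ Metric.ball x₀ (r / 8), p x = 0) →
      ∫ x in frontier Ω, p x ∂μHE[n - 1] = ∫ x in S, p x ∂μHE[n - 1] := by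
    intro p hp
    refine setIntegral_eq_of_subset_of_forall_sdiff_eq_zero isClosed_frontier.measurableSet
      (fun x hx => (hSf hx).1) fun x hx => hp x fun hb => hx.2 (hSb ⟨hx.1, hb⟩)
  rw [hfS _ (fun x hx => by simp [hP0 x hx]), hfS _ (fun x hx => by simp [hP0 x hx]), ← hmap]
  have e1 : ∫ x in S, |q x| ∂μHE[n - 1] ≤ 2 * ∫ x in S, ‖P x‖ ∂μHE[n - 1] := by
    rw [← integral_const_mul]
    exact setIntegral_mono_on hqi.abs (hPi.const_mul 2) hSm hq2
  have hνc : ContinuousOn (fun x => ⟪P x, outerNormal Ω x⟫) S := by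
    have : ContinuousOn (fun x => ⟪P x, ‖gradient ρ x‖⁻¹ • gradient ρ x⟫) S :=
      hPS.inner ((hNS.norm.inv₀ fun x hx =>
        norm_ne_zero_iff.2 (C.gradient_ne_zero (by linarith) (hSf hx).2)).smul hNS)
    exact this.congr fun x hx => by
      rw [C.outerNormal_eq (by linarith) (hSf hx).2 (hSf hx).1]
  have hνi : Integrable (fun x => ⟪P x, outerNormal Ω x⟫) (μHE[n - 1].restrict S) := by
    refine (hPi.const_mul 2).add (hPi.const_mul (4 * ε)) |>.mono' (hνc.aestronglyMeasurable hSm) ?_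
    filter_upwards [ae_restrict_mem hSm] with x hx
    have h1 := abs_le.1 (hq2 x hx)
    have h2 := abs_le.1 (hqν x hx)
    rw [Real.norm_eq_abs, abs_le]
    simp only [Pi.add_apply]
    constructor <;> linarith [h1.1, h1.2, h2.1, h2.2]
  have e2 : |∫ x in S, q x ∂μHE[n - 1] - ∫ x in S, ⟪P x, outerNormal Ω x⟫ ∂μHE[n - 1]|
      ≤ 4 * ε * ∫ x in S, ‖P x‖ ∂μHE[n - 1] := by
    rw [← integral_sub hqi hνi, ← integral_const_mul]
    refine (abs_integral_le_integral_abs).trans ?_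
    exact setIntegral_mono_on (hqi.sub hνi).abs (hPi.const_mul _) hSm hqν
  have e3 : (0 : ℝ) ≤ c := c.2
  have e4 := mul_le_mul_of_nonneg_left e1 e3
  rw [← hcr]
  calc _ ≤ |∫ x, q x ∂σ - ∫ x in S, q x ∂μHE[n - 1]|
        + |∫ x in S, q x ∂μHE[n - 1] - ∫ x in S, ⟪P x, outerNormal Ω x⟫ ∂μHE[n - 1]| :=
        _root_.abs_sub_le _ _ _
    _ ≤ c * (2 * ∫ x in S, ‖P x‖ ∂μHE[n - 1]) + 4 * ε * ∫ x in S, ‖P x‖ ∂μHE[n - 1] :=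
        add_le_add (hcomp.trans e4) e2
    _ = _ := by ring

/-- Near an interior point both sides vanish: the weak divergence is tested with a function equal to
one on the support of the field. Near a boundary point one takes a chart so flat that its error
constant drops below `ε`. -/
theorem IsHolderDomain.exists_approxDiv {α : ℝ≥0} (hΩ : IsHolderDomain 4 α Ω) {x : Hor n}
    (hx : x ∈ closure Ω) {ε : ℝ} (hε : 0 < ε) :
    ∃ r > 0, μHE[n - 1] (frontier Ω ∩ Metric.ball x r) < ⊤ ∧ ApproxDivAt Ω x r ε := by
  by_cases hxΩ : x ∈ Ω
  · obtain ⟨r, hr, hrΩ⟩ := Metric.isOpen_iff.1 hΩ.isOpen x hxΩ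
    have hdisj : ∀ z ∈ frontier Ω, z ∉ Metric.ball x r := fun z hz hzb => by
      rw [frontier, hΩ.isOpen.interior_eq] at hz
      exact hz.2 (hrΩ hzb)
    have hsub : Metric.ball x (r / 3) ⊆ Metric.ball x r := Metric.ball_subset_ball (by linarith)
    refine ⟨r / 3, by linarith, ?_, fun P D hPc hP0 hD0 hDi hw => ?_⟩
    · have : frontier Ω ∩ Metric.ball x (r / 3) = ∅ := by
        ext z
        simp only [mem_inter_iff, mem_empty_iff_false, iff_false, not_and]
        exact fun hz hzb => hdisj z hz (hsub hzb)
      simp [this]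
    · let κ : ContDiffBump x := ⟨r / 3, r / 2, by linarith, by linarith⟩
      have hκ1 : ∀ z ∈ Metric.ball x (r / 3), κ z = 1 := fun z hz =>
        κ.one_of_mem_closedBall (Metric.ball_subset_closedBall hz)
      have h1 := hw κ κ.contDiff κ.hasCompactSupport (by
        rw [κ.tsupport_eq]
        exact (Metric.closedBall_subset_ball (show r / 2 < r by linarith)).trans hrΩ)
      have h2 : ∀ z, fderiv ℝ κ z (P z) = 0 := by
        intro z
        by_cases hz : z ∈ Metric.ball x (r / 3)
        · have : (κ : Hor n → ℝ) =ᶠ[𝓝 z] fun _ => 1 := by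
            filter_upwards [Metric.isOpen_ball.mem_nhds hz] with w hw using hκ1 w hw
          simp [this.fderiv_eq]
        · simp [hP0 z hz]
      have h3 : ∀ z, D z * κ z = D z := by
        intro z
        by_cases hz : z ∈ Metric.ball x (r / 3)
        · simp [hκ1 z hz]
        · simp [hD0 z hz]
      simp only [h2, h3, integral_zero, neg_zero] at h1
      have h4 : ∫ z in frontier Ω, ⟪P z, outerNormal Ω z⟫ ∂μHE[n - 1] = 0 := by
        refine setIntegral_eq_zero_of_forall_eq_zero fun z hz => ?_
        rw [hP0 z fun hb => hdisj z hz (hsub hb), inner_zero_left]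
      rw [h1, h4, sub_zero, abs_zero]
      exact mul_nonneg hε.le (integral_nonneg fun _ => norm_nonneg _)
  · have hf : x ∈ frontier Ω := by
      rw [frontier, hΩ.isOpen.interior_eq]; exact ⟨hx, hxΩ⟩
    have hlim : Tendsto (fun t : ℝ => 2 * ((1 + 2 * t) ^ (n - 1) - 1) + 4 * t) (𝓝[>] 0) (𝓝 0) := by
      have : Continuous fun t : ℝ => 2 * ((1 + 2 * t) ^ (n - 1) - 1) + 4 * t := by fun_prop
      simpa using (this.tendsto 0).mono_left nhdsWithin_le_nhds
    obtain ⟨t, ht, ht4, ht0⟩ := ((hlim.eventually (gt_mem_nhds hε)).and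
      (((eventually_nhdsWithin_of_eventually_nhds
        (gt_mem_nhds (show (0 : ℝ) < 1 / 4 by norm_num)))).and self_mem_nhdsWithin)).exists
    have ht0' : 0 < t := ht0
    obtain ⟨e, r, ρ, C⟩ := hΩ.exists_boundaryChart hf ht0'
    obtain ⟨h1, h2⟩ := C.approxDiv ht0'.le ht4.le hΩ.isOpen hΩ.isCompact_closure
    refine ⟨r / 8, by linarith [C.r_pos], h1, fun P D hPc hP0 hD0 hDi hw => ?_⟩
    exact (h2 P D hPc hP0 hD0 hDi hw).trans
      (mul_le_mul_of_nonneg_right ht.le (integral_nonneg fun _ => norm_nonneg _))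

/-- Charts give local finiteness, and the frontier is compact. -/
theorem IsHolderDomain.isFiniteMeasure_frontier {α : ℝ≥0} (hΩ : IsHolderDomain 4 α Ω) :
    IsFiniteMeasure ((μHE[n - 1] : Measure (Hor n)).restrict (frontier Ω)) := by
  refine ⟨?_⟩
  rw [Measure.restrict_apply_univ]
  refine hΩ.isCompact_frontier.measure_lt_top_of_nhdsWithin fun x hx => ?_
  obtain ⟨r, hr, h1, -⟩ := hΩ.exists_approxDiv (frontier_subset_closure hx) one_pos
  exact ⟨_, inter_mem_nhdsWithin _ (Metric.ball_mem_nhds x hr), h1⟩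

open scoped Manifold in
/-- Finite smooth partitions of unity on a compact set, subordinate to balls. -/
theorem exists_finite_smooth_partition {E : Type*} [NormedAddCommGroup E] [NormedSpace ℝ E]
    [FiniteDimensional ℝ E] {K : Set E} (hK : IsCompact K) (r : E → ℝ) (hr : ∀ x ∈ K, 0 < r x) :
    ∃ (s : Finset E) (χ : E → E → ℝ), (∀ i ∈ s, i ∈ K) ∧
      (∀ i ∈ s, ContDiff ℝ ∞ (χ i) ∧ tsupport (χ i) ⊆ Metric.ball i (r i) ∧
        HasCompactSupport (χ i) ∧ ∀ x, 0 ≤ χ i x ∧ χ i x ≤ 1) ∧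
      ∀ x ∈ K, ∑ i ∈ s, χ i x = 1 := by
  classical
  obtain ⟨s, hsK, hcov⟩ := hK.elim_nhds_subcover (fun x => Metric.ball x (r x))
    fun x hx => Metric.ball_mem_nhds x (hr x hx)
  have hcov' : K ⊆ ⋃ i : s, Metric.ball (i : E) (r i) := by
    intro x hx
    obtain ⟨i, hi, hxi⟩ := mem_iUnion₂.1 (hcov hx)
    exact mem_iUnion.2 ⟨⟨i, hi⟩, hxi⟩
  obtain ⟨f, hf⟩ := SmoothPartitionOfUnity.exists_isSubordinate 𝓘(ℝ, E) hK.isClosed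
    (fun i : s => Metric.ball (i : E) (r i)) (fun i => Metric.isOpen_ball) hcov'
  refine ⟨s, fun i => if h : i ∈ s then f ⟨i, h⟩ else 0, hsK, fun i hi => ?_, fun x hx => ?_⟩
  · simp only [hi, dite_true]
    have hts := hf ⟨i, hi⟩
    refine ⟨(f ⟨i, hi⟩).contMDiff.contDiff, hts, ?_, fun x => ⟨f.nonneg _ _, f.le_one _ _⟩⟩
    exact (isCompact_closedBall i (r i)).of_isClosed_subset (isClosed_tsupport _)
      (hts.trans Metric.ball_subset_closedBall)
  · have h1 := f.sum_eq_one hx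
    rw [finsum_eq_sum_of_fintype] at h1
    rw [← h1, ← Finset.sum_coe_sort s]
    refine Finset.sum_congr rfl fun i _ => ?_
    simp

theorem HasWeakDiv.mul {P : Hor n → Hor n} {D : Hor n → ℝ} {χ : Hor n → ℝ}
    (h : HasWeakDiv Ω P D) (hK : IsCompact (closure Ω))
    (hP : ContinuousOn P (closure Ω)) (hD : IntegrableOn D Ω) (hχ : ContDiff ℝ 1 χ) :
    HasWeakDiv Ω (fun x => χ x • P x) (fun x => χ x * D x + fderiv ℝ χ x (P x)) := by
  intro η hη hηc hηs
  have hχc : ContinuousOn (fun x => fderiv ℝ χ x (P x)) (closure Ω) :=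
    (hχ.continuous_fderiv one_ne_zero).continuousOn.clm_apply hP
  have hηd : ContinuousOn (fun x => fderiv ℝ η x (P x)) (closure Ω) :=
    (hη.continuous_fderiv one_ne_zero).continuousOn.clm_apply hP
  have hint : ∀ p : Hor n → ℝ, ContinuousOn p (closure Ω) → IntegrableOn p Ω := fun p hp =>
    (hp.integrableOn_compact hK).mono_set subset_closure
  have h1 := h (fun x => χ x * η x) (hχ.mul hη) hηc.mul_left
    (tsupport_mul_subset_right.trans hηs)
  have hfd : ∀ x, fderiv ℝ (fun x => χ x * η x) x (P x)
      = χ x * fderiv ℝ η x (P x) + η x * fderiv ℝ χ x (P x) := by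
    intro x
    rw [fderiv_fun_mul (hχ.differentiable one_ne_zero x) (hη.differentiable one_ne_zero x)]
    simp
  simp only [hfd] at h1
  have i1 : IntegrableOn (fun x => χ x * fderiv ℝ η x (P x)) Ω := hint _ (hχ.continuous.continuousOn.mul hηd)
  have i2 : IntegrableOn (fun x => η x * fderiv ℝ χ x (P x)) Ω := hint _ (hη.continuous.continuousOn.mul hχc)
  rw [integral_add i1 i2] at h1
  have i3 : IntegrableOn (fun x => D x * (χ x * η x)) Ω := by
    obtain ⟨M, hM⟩ := (hηc.mul_left (f := χ)).exists_bound_of_continuous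
      (hχ.continuous.mul hη.continuous)
    exact hD.mul_bdd (hχ.continuous.mul hη.continuous).aestronglyMeasurable
      (ae_of_all _ fun x => hM x)
  have e1 : ∀ x, (χ x * D x + fderiv ℝ χ x (P x)) * η x
      = D x * (χ x * η x) + η x * fderiv ℝ χ x (P x) := fun x => by ring
  simp only [e1, map_smul, smul_eq_mul]
  rw [integral_add i3 i2, h1]
  ring

/-- **Divergence theorem** for continuous vector fields with integrable weak divergence. -/
theorem IsHolderDomain.integral_div {α : ℝ≥0} (hΩ : IsHolderDomain 4 α Ω)
    {P : Hor n → Hor n} {D : Hor n → ℝ} (hP : ContinuousOn P (closure Ω))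
    (hD : IntegrableOn D Ω) (h : HasWeakDiv Ω P D) :
    ∫ x in Ω, D x = ∫ x in frontier Ω, ⟪P x, outerNormal Ω x⟫ ∂μHE[n - 1] := by
  have hK := hΩ.isCompact_closure
  have hfin := hΩ.isFiniteMeasure_frontier
  have hfm : MeasurableSet (frontier Ω) := isClosed_frontier.measurableSet
  have hPf : ContinuousOn P (frontier Ω) := hP.mono frontier_subset_closure
  have hbi : ∀ p : Hor n → ℝ, ContinuousOn p (frontier Ω) → IntegrableOn p (frontier Ω) μHE[n - 1] := by
    intro p hp
    obtain ⟨M, hM⟩ := hΩ.isCompact_frontier.exists_bound_of_continuousOn hp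
    refine Integrable.of_bound (hp.aestronglyMeasurable hfm) M ?_
    filter_upwards [ae_restrict_mem hfm] with x hx using hM x hx
  rw [← sub_eq_zero, ← abs_nonpos_iff]
  set N := ∫ x in frontier Ω, ‖P x‖ ∂μHE[n - 1] with hN
  have hN0 : 0 ≤ N := integral_nonneg fun _ => norm_nonneg _
  -- Since the error is relative to `‖P‖`, the local errors of a partition of unity add up to `ε N`,
  -- however many charts are used.
  suffices H : ∀ ε > 0, |(∫ x in Ω, D x) - ∫ x in frontier Ω, ⟪P x, outerNormal Ω x⟫ ∂μHE[n - 1]|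
      ≤ ε * N by
    refine le_of_forall_pos_le_add fun ε hε => ?_
    refine (H (ε / (N + 1)) (by positivity)).trans ?_
    rw [zero_add, div_mul_eq_mul_div, div_le_iff₀ (by positivity)]
    nlinarith
  intro ε hε
  have hex : ∀ x ∈ closure Ω, ∃ r > 0, ApproxDivAt Ω x r ε := fun x hx => by
    obtain ⟨r, hr, -, h2⟩ := hΩ.exists_approxDiv hx hε
    exact ⟨r, hr, h2⟩
  choose! r hr happ using hex
  obtain ⟨s, χ, hsK, hχ, hsum⟩ := exists_finite_smooth_partition hK r hr
  have hχ1 : ∀ i ∈ s, ContDiff ℝ 1 (χ i) := fun i hi => (hχ i hi).1.of_le (by exact_mod_cast le_top)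
  let Pi : Hor n → Hor n → Hor n := fun i x => χ i x • P x
  let Di : Hor n → Hor n → ℝ := fun i x => χ i x * D x + fderiv ℝ (χ i) x (P x)
  have hDi : ∀ i ∈ s, IntegrableOn (Di i) Ω := by
    intro i hi
    refine Integrable.add ?_ ?_
    · refine Integrable.bdd_mul hD (hχ i hi).1.continuous.aestronglyMeasurable (c := 1)
        (ae_of_all _ fun x => ?_)
      rw [Real.norm_of_nonneg ((hχ i hi).2.2.2 x).1]
      exact ((hχ i hi).2.2.2 x).2
    · exact ((((hχ1 i hi).continuous_fderiv one_ne_zero).continuousOn.clm_apply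
        hP).integrableOn_compact hK).mono_set subset_closure
  have hPi : ∀ i ∈ s, ContinuousOn (Pi i) (closure Ω) := fun i hi =>
    (hχ i hi).1.continuous.continuousOn.smul hP
  have hloc : ∀ i ∈ s, |(∫ x in Ω, Di i x) - ∫ x in frontier Ω, ⟪Pi i x, outerNormal Ω x⟫ ∂μHE[n - 1]|
      ≤ ε * ∫ x in frontier Ω, ‖Pi i x‖ ∂μHE[n - 1] := by
    intro i hi
    have hz : ∀ x ∉ Metric.ball i (r i), x ∉ tsupport (χ i) := fun x hx ht =>
      hx ((hχ i hi).2.1 ht)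
    refine happ i (hsK i hi) _ _ (hPi i hi) (fun x hx => ?_) (fun x hx => ?_) (hDi i hi)
      (h.mul hK hP hD (hχ1 i hi))
    · simp [Pi, image_eq_zero_of_notMem_tsupport (hz x hx)]
    · have : fderiv ℝ (χ i) x = 0 := by
        rw [(notMem_tsupport_iff_eventuallyEq.1 (hz x hx)).fderiv_eq]; simp
      simp [Di, image_eq_zero_of_notMem_tsupport (hz x hx), this]
  have hsumD : ∫ x in Ω, D x = ∑ i ∈ s, ∫ x in Ω, Di i x := by
    rw [← integral_finsetSum s hDi]
    refine setIntegral_congr_fun hΩ.isOpen.measurableSet fun x hx => ?_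
    have h1 := hsum x (subset_closure hx)
    -- The partition sums to one on a neighbourhood of `x`, so the terms `∇χ i · P` produced by
    -- localization cancel.
    have h2 : ∑ i ∈ s, fderiv ℝ (χ i) x = 0 := by
      rw [← fderiv_fun_sum fun i hi => (hχ1 i hi).differentiable one_ne_zero x]
      have : (fun z => ∑ i ∈ s, χ i z) =ᶠ[𝓝 x] fun _ => 1 := by
        filter_upwards [hΩ.isOpen.mem_nhds hx] with z hz using hsum z (subset_closure hz)
      rw [this.fderiv_eq]; simp
    simp only [Di]
    rw [Finset.sum_add_distrib, ← Finset.sum_mul, h1, ← sum_apply, h2]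
    simp
  have hνc : ∀ i ∈ s, ContinuousOn (fun x => ⟪Pi i x, outerNormal Ω x⟫) (frontier Ω) := fun i hi =>
    ((hPi i hi).mono frontier_subset_closure).inner hΩ.continuousOn_outerNormal
  have hsumB : ∫ x in frontier Ω, ⟪P x, outerNormal Ω x⟫ ∂μHE[n - 1]
      = ∑ i ∈ s, ∫ x in frontier Ω, ⟪Pi i x, outerNormal Ω x⟫ ∂μHE[n - 1] := by
    rw [← integral_finsetSum s fun i hi => hbi _ (hνc i hi)]
    refine setIntegral_congr_fun hfm fun x hx => ?_
    have h1 := hsum x (frontier_subset_closure hx)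
    simp only [Pi, inner_smul_left]
    simp [← Finset.sum_mul, h1]
  have hsumN : N = ∑ i ∈ s, ∫ x in frontier Ω, ‖Pi i x‖ ∂μHE[n - 1] := by
    rw [← integral_finsetSum s fun i hi =>
      hbi _ ((hPi i hi).mono frontier_subset_closure).norm]
    refine setIntegral_congr_fun hfm fun x hx => ?_
    have h1 := hsum x (frontier_subset_closure hx)
    have h2 : ∀ i ∈ s, ‖Pi i x‖ = χ i x * ‖P x‖ := fun i hi => by
      simp only [Pi]
      rw [norm_smul, Real.norm_of_nonneg ((hχ i hi).2.2.2 x).1]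
    rw [Finset.sum_congr rfl h2, ← Finset.sum_mul, h1, one_mul]
  rw [hsumD, hsumB, hsumN, ← Finset.sum_sub_distrib, Finset.mul_sum]
  exact (Finset.abs_sum_le_sum_abs _ _).trans (Finset.sum_le_sum hloc)

end Divergence

/-! ### The divergence theorem for horizontal fields in the cylinder. -/

section Cylinder

variable {n : ℕ} {Ω : Set (Hor n)}

theorem restrict_cyl (Ω : Set (Hor n)) : (volume : Measure (Hor n × ℝ)).restrict (cyl Ω)
    = (volume.restrict Ω).prod (volume.restrict (Ioi (0 : ℝ))) :=
  (Measure.prod_restrict Ω (Ioi (0 : ℝ))).symm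

theorem isOpen_cyl (hΩ : IsOpen Ω) : IsOpen (cyl Ω) := hΩ.prod isOpen_Ioi

theorem cyl_subset_latCyl : cyl Ω ⊆ latCyl Ω := prod_mono subset_closure subset_rfl

theorem latCyl_subset_closedCyl : latCyl Ω ⊆ closedCyl Ω :=
  prod_mono subset_rfl Ioi_subset_Ici_self

theorem cyl_subset_closedCyl : cyl Ω ⊆ closedCyl Ω :=
  cyl_subset_latCyl.trans latCyl_subset_closedCyl

/-- A weight in the vertical variable, localized away from the bottom. -/
structure IsVertTest (θ : ℝ → ℝ) : Prop where
  contDiff : ContDiff ℝ ∞ θ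
  compact : HasCompactSupport θ
  sub : tsupport θ ⊆ Ioi 0

theorem IsVertTest.subset_Icc {θ : ℝ → ℝ} (h : IsVertTest θ) :
    ∃ δ R : ℝ, 0 < δ ∧ δ < R ∧ tsupport θ ⊆ Icc δ R := by
  rcases (tsupport θ).eq_empty_or_nonempty with he | hne
  · exact ⟨1, 2, one_pos, one_lt_two, by simp [he]⟩
  · obtain ⟨a, ha, hle⟩ := h.compact.isCompact.exists_isLeast hne
    obtain ⟨b, hb, hge⟩ := h.compact.isCompact.exists_isGreatest hne
    have h0 : 0 < a := h.sub ha
    exact ⟨a, b + 1, h0, by linarith [hle hb], fun y hy => ⟨hle hy, by linarith [hge hy]⟩⟩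

/-- Vertical weights exhausting the half-line. -/
theorem exists_vertTest_seq : ∃ θ : ℕ → ℝ → ℝ, (∀ m, IsVertTest (θ m)) ∧
    (∀ m y, 0 ≤ θ m y ∧ θ m y ≤ 1) ∧ ∀ y > 0, ∀ᶠ m in atTop, θ m y = 1 := by
  let θ : ℕ → ℝ → ℝ := fun m y => cutoff (y * (m + 1)) * cutoff ((m + 2 : ℝ) - y)
  have hts : ∀ m, tsupport (θ m) ⊆ Icc (1 / 2 / (m + 1 : ℝ)) (m + 2) := by
    intro m
    refine closure_minimal (fun y hy => ?_) isClosed_Icc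
    have hm : (0 : ℝ) < m + 1 := by positivity
    by_contra hc
    apply hy
    rw [mem_Icc, not_and_or, not_le, not_le] at hc
    rcases hc with hc | hc
    · rw [lt_div_iff₀ hm] at hc
      simp [θ, cutoff_of_le hc.le]
    · simp [θ, cutoff_of_le (show (m + 2 : ℝ) - y ≤ 1 / 2 by linarith)]
  refine ⟨θ, fun m => ⟨?_, ?_, ?_⟩, fun m y => ⟨?_, ?_⟩, fun y hy => ?_⟩
  · exact (contDiff_cutoff.comp (by fun_prop)).mul (contDiff_cutoff.comp (by fun_prop))
  · exact isCompact_Icc.of_isClosed_subset (isClosed_tsupport _) (hts m)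
  · refine (hts m).trans fun y hy => ?_
    have : (0 : ℝ) < 1 / 2 / (m + 1 : ℝ) := by positivity
    exact this.trans_le hy.1
  · exact mul_nonneg (cutoff_nonneg _) (cutoff_nonneg _)
  · exact mul_le_one₀ (cutoff_le_one _) (cutoff_nonneg _) (cutoff_le_one _)
  · have h1 : ∀ᶠ m : ℕ in atTop, 1 / y < m := (tendsto_natCast_atTop_atTop).eventually_gt_atTop _
    have h2 : ∀ᶠ m : ℕ in atTop, y < m := (tendsto_natCast_atTop_atTop).eventually_gt_atTop _
    filter_upwards [h1, h2] with m hm1 hm2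
    rw [div_lt_iff₀ hy] at hm1
    have e1 : cutoff (y * (m + 1)) = 1 := cutoff_of_ge (by nlinarith)
    have e2 : cutoff ((m + 2 : ℝ) - y) = 1 := cutoff_of_ge (by linarith)
    simp [θ, e1, e2]

/-- `D` is the weak horizontal divergence of the horizontal field `P` in the cylinder. -/
def HasWeakHorDiv (Ω : Set (Hor n)) (P : Hor n × ℝ → Hor n) (D : Hor n × ℝ → ℝ) : Prop :=
  ∀ (η : Hor n → ℝ) (θ : ℝ → ℝ), ContDiff ℝ 1 η → HasCompactSupport η → tsupport η ⊆ Ω →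
    IsVertTest θ →
    ∫ X in cyl Ω, D X * (η X.1 * θ X.2) = - ∫ X in cyl Ω, fderiv ℝ η X.1 (P X) * θ X.2

theorem isFiniteMeasure_restrict_of_isCompact_closure (hK : IsCompact (closure Ω)) :
    IsFiniteMeasure ((volume : Measure (Hor n)).restrict Ω) := ⟨by
  rw [Measure.restrict_apply_univ]
  exact (measure_mono subset_closure).trans_lt hK.measure_lt_top⟩

theorem IsHolderDomain.latMeasure_eq_restrict {α : ℝ≥0} (hΩ : IsHolderDomain 4 α Ω) :
    latMeasure Ω = (latMeasure Ω).restrict (frontier Ω ×ˢ Ioi (0 : ℝ)) := by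
  have hfin := hΩ.isFiniteMeasure_frontier
  rw [latMeasure, ← Measure.prod_restrict, Measure.restrict_restrict_of_subset subset_rfl,
    Measure.restrict_restrict_of_subset subset_rfl]

theorem IsHolderDomain.ae_latMeasure_mem {α : ℝ≥0} (hΩ : IsHolderDomain 4 α Ω) :
    ∀ᵐ X ∂(latMeasure Ω), X ∈ frontier Ω ×ˢ Ioi (0 : ℝ) := by
  rw [hΩ.latMeasure_eq_restrict]
  exact ae_restrict_mem (isClosed_frontier.measurableSet.prod measurableSet_Ioi)

/-- **Divergence theorem** in the cylinder, for horizontal fields. -/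
theorem IsHolderDomain.integral_horDiv {α : ℝ≥0} (hΩ : IsHolderDomain 4 α Ω)
    {P : Hor n × ℝ → Hor n} {D : Hor n × ℝ → ℝ} (hP : ContinuousOn P (latCyl Ω))
    {θ : ℝ → ℝ} (hθ : IsVertTest θ) (hD : IntegrableOn (fun X => D X * θ X.2) (cyl Ω))
    (h : HasWeakHorDiv Ω P D) :
    Integrable (fun X => ⟪P X, outerNormal Ω X.1⟫ * θ X.2) (latMeasure Ω) ∧
    ∫ X in cyl Ω, D X * θ X.2 = ∫ X, ⟪P X, outerNormal Ω X.1⟫ * θ X.2 ∂(latMeasure Ω) := by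
  have hK := hΩ.isCompact_closure
  have hfin := hΩ.isFiniteMeasure_frontier
  have hfinΩ := isFiniteMeasure_restrict_of_isCompact_closure hK
  have hfm : MeasurableSet (frontier Ω) := isClosed_frontier.measurableSet
  obtain ⟨δ, R, hδ, hδR, hts⟩ := hθ.subset_Icc
  have hθ0 : ∀ y ∉ Icc δ R, θ y = 0 := fun y hy =>
    image_eq_zero_of_notMem_tsupport fun hc => hy (hts hc)
  have hKc : IsCompact (closure Ω ×ˢ Icc δ R) := hK.prod isCompact_Icc
  have hKl : closure Ω ×ˢ Icc δ R ⊆ latCyl Ω := prod_mono subset_rfl fun y hy => hδ.trans_le hy.1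
  obtain ⟨M, hM⟩ := hKc.exists_bound_of_continuousOn (hP.mono hKl)
  have hθc : Continuous θ := hθ.contDiff.continuous
  obtain ⟨T, hT⟩ := hθ.compact.exists_bound_of_continuous hθc
  have hθi : Integrable θ := hθc.integrable_of_hasCompactSupport hθ.compact
  have hM0 : ∀ x ∈ closure Ω, ∀ y, ‖θ y • P (x, y)‖ ≤ M * ‖θ y‖ := by
    intro x hx y
    by_cases hy : y ∈ Icc δ R
    · rw [norm_smul, mul_comm]
      exact mul_le_mul_of_nonneg_right (hM _ ⟨hx, hy⟩) (norm_nonneg _)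
    · simp [hθ0 y hy]
  -- Testing with `η(x) θ(y)` for fixed `θ` says exactly that the average of `D` against `θ` is the
  -- weak divergence of the average of `P`. The averaged field is continuous on the closure, because
  -- `θ` stays away from the bottom, and the theorem in `Ω` applies.
  let Pb : Hor n → Hor n := fun x => ∫ y in Ioi (0 : ℝ), θ y • P (x, y)
  let Db : Hor n → ℝ := fun x => ∫ y in Ioi (0 : ℝ), D (x, y) * θ y
  have hslice : ∀ x ∈ closure Ω, ContinuousOn (fun y => P (x, y)) (Ioi (0 : ℝ)) := fun x hx =>
    hP.comp (f := fun y : ℝ => (x, y)) (by fun_prop) fun y hy => ⟨hx, hy⟩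
  have hslicem : ∀ x ∈ closure Ω,
      AEStronglyMeasurable (fun y => θ y • P (x, y)) (volume.restrict (Ioi (0 : ℝ))) := fun x hx =>
    (hθc.continuousOn.smul (hslice x hx)).aestronglyMeasurable measurableSet_Ioi
  have hslicei : ∀ x ∈ closure Ω,
      Integrable (fun y => θ y • P (x, y)) (volume.restrict (Ioi (0 : ℝ))) := fun x hx =>
    (hθi.restrict.norm.const_mul M).mono' (hslicem x hx) (ae_of_all _ (hM0 x hx))
  have hPbc : ContinuousOn Pb (closure Ω) := by
    refine continuousOn_of_dominated (bound := fun y => M * ‖θ y‖) hslicem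
      (fun x hx => ae_of_all _ (hM0 x hx)) (hθi.restrict.norm.const_mul M) ?_
    filter_upwards [ae_restrict_mem measurableSet_Ioi] with y hy
    exact ContinuousOn.const_smul
      (hP.comp (f := fun x : Hor n => (x, y)) (by fun_prop) fun x hx => ⟨hx, hy⟩) (θ y)
  have hDprod : Integrable (fun X : Hor n × ℝ => D X * θ X.2)
      ((volume.restrict Ω).prod (volume.restrict (Ioi (0 : ℝ)))) := by
    rw [← restrict_cyl]; exact hD
  have hDbi : IntegrableOn Db Ω := hDprod.integral_prod_left
  have hw : HasWeakDiv Ω Pb Db := by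
    intro η hη hηc hηs
    obtain ⟨N, hN⟩ := hηc.exists_bound_of_continuous hη.continuous
    obtain ⟨N', hN'⟩ := (hηc.fderiv (𝕜 := ℝ)).exists_bound_of_continuous
      (hη.continuous_fderiv one_ne_zero)
    have h1 := h η θ hη hηc hηs hθ
    rw [restrict_cyl] at h1
    rw [integral_prod, integral_prod] at h1
    · have e1 : ∀ x, ∫ y in Ioi (0 : ℝ), D (x, y) * (η x * θ y) = Db x * η x := by
        intro x
        rw [← integral_mul_const]
        congr with y; ring
      have e2 : ∫ x in Ω, ∫ y in Ioi (0 : ℝ), fderiv ℝ η x (P (x, y)) * θ y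
          = ∫ x in Ω, fderiv ℝ η x (Pb x) := by
        refine setIntegral_congr_fun hΩ.isOpen.measurableSet fun x hx => ?_
        simp only [Pb]
        rw [← ContinuousLinearMap.integral_comp_comm _ (hslicei x (subset_closure hx))]
        congr with y
        simp [mul_comm]
      simp only [e1, e2] at h1
      exact h1
    · rw [← restrict_cyl]
      have hm : ContinuousOn (fun X : Hor n × ℝ => fderiv ℝ η X.1 (P X) * θ X.2) (latCyl Ω) :=
        (((hη.continuous_fderiv one_ne_zero).comp continuous_fst).continuousOn.clm_apply hP).mul
          (hθc.comp continuous_snd).continuousOn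
      have hb : Integrable (fun X : Hor n × ℝ => N' * M * ‖θ X.2‖)
          ((volume : Measure (Hor n × ℝ)).restrict (cyl Ω)) := by
        rw [restrict_cyl]
        exact ((hθi.restrict (s := Ioi (0 : ℝ))).norm.comp_snd (volume.restrict Ω)).const_mul _
      refine hb.mono' ((hm.mono cyl_subset_latCyl).aestronglyMeasurable
        (isOpen_cyl hΩ.isOpen).measurableSet) ?_
      filter_upwards [ae_restrict_mem (isOpen_cyl hΩ.isOpen).measurableSet] with X hX
      by_cases hy : X.2 ∈ Icc δ R
      · rw [norm_mul]
        refine mul_le_mul_of_nonneg_right ?_ (norm_nonneg _)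
        refine (ContinuousLinearMap.le_opNorm _ _).trans ?_
        exact mul_le_mul (hN' _) (hM X ⟨subset_closure hX.1, hy⟩) (norm_nonneg _)
          ((norm_nonneg _).trans (hN' X.1))
      · simp [hθ0 _ hy]
    · have h2 : Integrable (fun X : Hor n × ℝ => η X.1 * (D X * θ X.2))
          ((volume.restrict Ω).prod (volume.restrict (Ioi (0 : ℝ)))) :=
        hDprod.bdd_mul (hη.continuous.comp continuous_fst).aestronglyMeasurable
          (ae_of_all _ fun X => hN X.1)
      refine h2.congr (ae_of_all _ fun X => ?_)
      ring
  have hmain := hΩ.integral_div hPbc hDbi hw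
  have hBi : Integrable (fun X : Hor n × ℝ => ⟪P X, outerNormal Ω X.1⟫ * θ X.2) (latMeasure Ω) := by
    have hsub : frontier Ω ×ˢ Ioi (0 : ℝ) ⊆ latCyl Ω := prod_mono frontier_subset_closure subset_rfl
    have hc : ContinuousOn (fun X : Hor n × ℝ => ⟪P X, outerNormal Ω X.1⟫ * θ X.2)
        (frontier Ω ×ˢ Ioi (0 : ℝ)) :=
      ((hP.mono hsub).inner (hΩ.continuousOn_outerNormal.comp continuousOn_fst fun X hX => hX.1)).mul
        (hθc.comp continuous_snd).continuousOn
    have hb : Integrable (fun X : Hor n × ℝ => M * ‖θ X.2‖) (latMeasure Ω) :=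
      ((hθi.restrict (s := Ioi (0 : ℝ))).norm.comp_snd (μHE[n - 1].restrict (frontier Ω))).const_mul _
    refine hb.mono' ?_ ?_
    · rw [hΩ.latMeasure_eq_restrict]
      exact hc.aestronglyMeasurable (hfm.prod measurableSet_Ioi)
    · filter_upwards [hΩ.ae_latMeasure_mem] with X hX
      by_cases hy : X.2 ∈ Icc δ R
      · rw [norm_mul]
        refine mul_le_mul_of_nonneg_right ?_ (norm_nonneg _)
        refine (abs_real_inner_le_norm _ _).trans ?_
        rw [hΩ.norm_outerNormal hX.1, mul_one]
        exact hM X ⟨frontier_subset_closure hX.1, hy⟩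
      · simp [hθ0 _ hy]
  refine ⟨hBi, ?_⟩
  rw [restrict_cyl, integral_prod _ hDprod, latMeasure, integral_prod _ hBi]
  refine hmain.trans ?_
  refine setIntegral_congr_fun hfm fun x hx => ?_
  simp only [Pb]
  rw [real_inner_comm, ← integral_inner (hslicei x (frontier_subset_closure hx))]
  congr with y
  rw [inner_smul_right, real_inner_comm, mul_comm]

end Cylinder

/-! ### Partial derivatives up to the lateral boundary. -/

section PartialDerivatives

variable {n : ℕ} {Ω : Set (Hor n)} {S : Set (Hor n × ℝ)} {v : Hor n × ℝ → ℝ} {X : Hor n × ℝ}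

theorem coordVec_castSucc (j : Fin n) :
    (coordVec j.castSucc : Hor n × ℝ) = (EuclideanSpace.single j (1 : ℝ), 0) := by
  simp [coordVec]

theorem coordVec_last : (coordVec (Fin.last n) : Hor n × ℝ) = (0, 1) := by
  simp [coordVec]

theorem sum_single (w : Hor n) : ∑ j, w j • EuclideanSpace.single j (1 : ℝ) = w := by
  have := (EuclideanSpace.basisFun (Fin n) ℝ).sum_repr w
  simpa using this

theorem sum_coordVec (w : Hor n) :
    ∑ j : Fin n, w j • (coordVec j.castSucc : Hor n × ℝ) = (w, 0) := by
  simp only [coordVec_castSucc, Prod.smul_mk, smul_zero]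
  refine Prod.ext ?_ ?_
  · simpa [Prod.fst_sum] using sum_single w
  · simp [Prod.snd_sum]

theorem IsHolderDomain.uniqueDiffOn_latCyl {α : ℝ≥0} (hΩ : IsHolderDomain 4 α Ω) :
    UniqueDiffOn ℝ (latCyl Ω) := hΩ.uniqueDiffOn_closure.prod (uniqueDiffOn_Ioi 0)

theorem IsHolderDomain.uniqueDiffOn_closedCyl {α : ℝ≥0} (hΩ : IsHolderDomain 4 α Ω) :
    UniqueDiffOn ℝ (closedCyl Ω) := hΩ.uniqueDiffOn_closure.prod (uniqueDiffOn_Ici 0)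

theorem latCyl_mem_nhds (hΩ : IsOpen Ω) (hX : X ∈ cyl Ω) : latCyl Ω ∈ 𝓝 X :=
  mem_of_superset ((isOpen_cyl hΩ).mem_nhds hX) cyl_subset_latCyl

theorem closedCyl_mem_nhds (hΩ : IsOpen Ω) (hX : X ∈ cyl Ω) : closedCyl Ω ∈ 𝓝 X :=
  mem_of_superset ((isOpen_cyl hΩ).mem_nhds hX) cyl_subset_closedCyl

theorem contDiffOn_pd {m k : WithTop ℕ∞} (hS : UniqueDiffOn ℝ S) (hv : ContDiffOn ℝ k v S)
    (hmk : m + 1 ≤ k) (i : Fin (n + 1)) : ContDiffOn ℝ m (pd S v i) S :=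
  (hv.fderivWithin hS hmk).clm_apply contDiffOn_const

theorem continuousOn_pd (hS : UniqueDiffOn ℝ S) (hv : ContDiffOn ℝ 1 v S)
    (i : Fin (n + 1)) : ContinuousOn (pd S v i) S :=
  (contDiffOn_pd (m := 0) hS hv (by norm_num) i).continuousOn

theorem continuousOn_grad (hS : UniqueDiffOn ℝ S) (hv : ContDiffOn ℝ 1 v S) :
    ContinuousOn (grad S v) S :=
  (PiLp.continuous_toLp 2 _).comp_continuousOn
    (continuousOn_pi.2 fun i => continuousOn_pd hS hv i)

theorem grad_apply (i : Fin (n + 1)) : grad S v X i = pd S v i X := rfl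

theorem gradX_apply (j : Fin n) : gradX S v X j = pd S v j.castSucc X := rfl

theorem continuousOn_gradX (hS : UniqueDiffOn ℝ S) (hv : ContDiffOn ℝ 1 v S) :
    ContinuousOn (gradX S v) S :=
  (PiLp.continuous_toLp 2 _).comp_continuousOn
    (continuousOn_pi.2 fun j => continuousOn_pd hS hv j.castSucc)

theorem hasFDerivAt_of_contDiffOn (hv : ContDiffOn ℝ 1 v S) (hX : S ∈ 𝓝 X) :
    HasFDerivAt v (fderivWithin ℝ v S X) X := by
  rw [fderivWithin_of_mem_nhds hX]
  exact ((hv.contDiffAt hX).differentiableAt one_ne_zero).hasFDerivAt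

theorem hasLineDerivAt_pd (hv : ContDiffOn ℝ 1 v S) (hX : S ∈ 𝓝 X) (i : Fin (n + 1)) :
    HasLineDerivAt ℝ v (pd S v i X) X (coordVec i) :=
  (hasFDerivAt_of_contDiffOn hv hX).hasLineDerivAt _

theorem dirDeriv_eq_sum (w : Hor n) :
    dirDeriv S v w X = ∑ j : Fin n, w j * pd S v j.castSucc X := by
  rw [dirDeriv, ← sum_coordVec w, map_sum]
  simp [pd]

theorem dirDeriv_eq_inner (w : Hor n) : dirDeriv S v w X = ⟪gradX S v X, w⟫ := by
  rw [dirDeriv_eq_sum, PiLp.inner_apply]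
  simp [gradX]

theorem norm_grad_sq : ‖grad S v X‖ ^ 2
    = ∑ j : Fin n, pd S v j.castSucc X ^ 2 + pd S v (Fin.last n) X ^ 2 := by
  rw [EuclideanSpace.norm_sq_eq, Fin.sum_univ_castSucc]
  simp [grad]

theorem norm_gradX_sq : ‖gradX S v X‖ ^ 2 = ∑ j : Fin n, pd S v j.castSucc X ^ 2 := by
  rw [EuclideanSpace.norm_sq_eq]
  simp [gradX]

theorem norm_gradX_le : ‖gradX S v X‖ ≤ ‖grad S v X‖ := by
  refine le_of_sq_le_sq ?_ (norm_nonneg _)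
  rw [norm_gradX_sq, norm_grad_sq]
  linarith [sq_nonneg (pd S v (Fin.last n) X)]

theorem abs_pd_le (i : Fin (n + 1)) : |pd S v i X| ≤ ‖grad S v X‖ := by
  have := PiLp.norm_apply_le (grad S v X) i
  simpa [grad] using this

theorem latCyl_subset_closure_cyl : latCyl Ω ⊆ closure (cyl Ω) := by
  rw [cyl, closure_prod_eq]
  exact prod_mono subset_rfl subset_closure

/-- Second derivatives up to the lateral boundary are symmetric. -/
theorem IsHolderDomain.uDD_symm {α : ℝ≥0} (hΩ : IsHolderDomain 4 α Ω) {u : Hor n × ℝ → ℝ}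
    (hu : ContDiffOn ℝ 2 u (latCyl Ω)) (i k : Fin (n + 1)) (hX : X ∈ latCyl Ω) :
    uDD Ω u i k X = uDD Ω u k i X := by
  have hU := hΩ.uniqueDiffOn_latCyl
  have h1 : ∀ i, ContDiffOn ℝ 1 (uD Ω u i) (latCyl Ω) := fun i =>
    contDiffOn_pd hU hu (by norm_num) i
  -- Symmetry is the classical theorem in the open cylinder; it extends to the lateral boundary by
  -- continuity and density.
  have hEq : EqOn (uDD Ω u i k) (uDD Ω u k i) (cyl Ω) := by
    intro Z hZ
    have hnear : ∀ᶠ W in 𝓝 Z, latCyl Ω ∈ 𝓝 W := by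
      filter_upwards [(isOpen_cyl hΩ.isOpen).mem_nhds hZ] with W hW
      exact latCyl_mem_nhds hΩ.isOpen hW
    have key : ∀ i k, uDD Ω u i k Z = fderiv ℝ (fderiv ℝ u) Z (coordVec k) (coordVec i) := by
      intro i k
      have h2 : uD Ω u i =ᶠ[𝓝 Z] fun W => fderiv ℝ u W (coordVec i) := by
        filter_upwards [hnear] with W hW
        rw [uD, pd, fderivWithin_of_mem_nhds hW]
      have h3 : DifferentiableAt ℝ (fderiv ℝ u) Z :=
        (((hu.contDiffAt hnear.self_of_nhds).fderiv_right (m := 1) (by norm_num)).differentiableAt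
          one_ne_zero)
      rw [uDD, pd, fderivWithin_of_mem_nhds hnear.self_of_nhds, h2.fderiv_eq,
        fderiv_clm_apply h3 (differentiableAt_const _)]
      simp
    rw [key i k, key k i]
    have := (hu.contDiffAt hnear.self_of_nhds).isSymmSndFDerivAt (by simp)
    exact this.eq _ _
  exact hEq.of_subset_closure (continuousOn_pd hU (h1 i) k) (continuousOn_pd hU (h1 k) i)
    cyl_subset_latCyl latCyl_subset_closure_cyl hX

end PartialDerivatives

/-! ### The flux and its derivative `ℬ`. -/

section Flux

variable {n : ℕ} {a : ℝ → ℝ → ℝ} {y : ℝ}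

/-- The derivative `ℬ(y,η)` of the flux `η ↦ a(y,|η|) η`. -/
def fluxDeriv (a : ℝ → ℝ → ℝ) (y : ℝ) (η : Full n) : Full n →L[ℝ] Full n :=
  a y ‖η‖ • ContinuousLinearMap.id ℝ (Full n) +
    (if η = 0 then 0 else deriv (a y) ‖η‖ / ‖η‖) • (innerSL ℝ η).smulRight η

theorem fluxDeriv_apply (η ξ : Full n) : fluxDeriv a y η ξ = a y ‖η‖ • ξ +
    ((if η = 0 then 0 else deriv (a y) ‖η‖ / ‖η‖) * ⟪η, ξ⟫) • η := by
  by_cases h : η = 0 <;> simp [fluxDeriv, h, smul_smul]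

theorem formB_eq (η ξ ζ : Full n) : formB a y η ξ ζ = ⟪fluxDeriv a y η ξ, ζ⟫ := by
  rw [fluxDeriv_apply]
  simp only [formB, matB, Matrix.mulVec, dotProduct, Matrix.of_apply]
  rw [PiLp.inner_apply]
  refine Finset.sum_congr rfl fun i _ => ?_
  have h1 : ∑ j, (a y ‖η‖ * (if i = j then 1 else 0) +
      if η = 0 then 0 else deriv (a y) ‖η‖ / ‖η‖ * η i * η j) * ξ j
      = a y ‖η‖ * ξ i + (if η = 0 then 0 else deriv (a y) ‖η‖ / ‖η‖) * ⟪η, ξ⟫ * η i := by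
    simp only [add_mul, Finset.sum_add_distrib]
    congr 1
    · simp
    · rw [PiLp.inner_apply]
      split_ifs with h
      · simp
      · rw [Finset.mul_sum, Finset.sum_mul]
        refine Finset.sum_congr rfl fun j _ => ?_
        simp only [RCLike.inner_apply, conj_trivial]
        ring
  rw [h1]
  simp only [PiLp.add_apply, PiLp.smul_apply, smul_eq_mul, RCLike.inner_apply, conj_trivial]
  ring

theorem fluxDeriv_symm (η ξ ζ : Full n) :
    ⟪fluxDeriv a y η ξ, ζ⟫ = ⟪fluxDeriv a y η ζ, ξ⟫ := by
  simp only [fluxDeriv_apply, inner_add_left, inner_smul_left, conj_trivial]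
  rw [real_inner_comm ζ ξ]
  ring

/-- The rank-one part of `ℬ` has size `|a_t| ‖η‖`, which `t |a_t| ≤ C a` controls by the weight
itself. All estimates of `ℬ` therefore reduce to the weight `a`. -/
theorem IsDiffusion.exists_norm_fluxDeriv_le (ha : IsDiffusion a) :
    ∃ C > 0, ∀ (y : ℝ), 0 < y → ∀ η ξ : Full n, ‖fluxDeriv a y η ξ‖ ≤ C * (a y ‖η‖ * ‖ξ‖) := by
  obtain ⟨C, hC, hb⟩ := ha.bound
  refine ⟨1 + C, by linarith, fun y hy η ξ => ?_⟩
  have hpos := ha.pos y hy ‖η‖ (norm_nonneg _)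
  have hbd := hb y hy ‖η‖ (norm_nonneg _)
  rw [fluxDeriv_apply]
  refine (norm_add_le _ _).trans ?_
  rw [norm_smul, norm_smul, Real.norm_of_nonneg hpos.le, norm_mul, add_mul, one_mul]
  refine add_le_add le_rfl ?_
  split_ifs with h
  · simp only [norm_zero, zero_mul]
    positivity
  · have hη : 0 < ‖η‖ := norm_pos_iff.2 h
    rw [norm_div, norm_norm, Real.norm_eq_abs, Real.norm_eq_abs]
    calc |deriv (a y) ‖η‖| / ‖η‖ * |⟪η, ξ⟫| * ‖η‖ = |deriv (a y) ‖η‖| * |⟪η, ξ⟫| := by field_simp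
      _ ≤ |deriv (a y) ‖η‖| * (‖η‖ * ‖ξ‖) :=
          mul_le_mul_of_nonneg_left (abs_real_inner_le_norm _ _) (abs_nonneg _)
      _ = ‖η‖ * |deriv (a y) ‖η‖| * ‖ξ‖ := by ring
      _ ≤ C * a y ‖η‖ * ‖ξ‖ := mul_le_mul_of_nonneg_right hbd (norm_nonneg _)
      _ = _ := by ring

theorem IsDiffusion.differentiableAt (ha : IsDiffusion a) {t : ℝ} (hy : 0 < y) (ht : 0 < t) :
    HasFDerivAt (Function.uncurry a) (fderiv ℝ (Function.uncurry a) (y, t)) (y, t) :=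
  ((ha.contDiff.differentiableOn one_ne_zero).differentiableAt
    ((isOpen_Ioi.prod isOpen_Ioi).mem_nhds
      (show ((y, t) : ℝ × ℝ) ∈ Ioi (0 : ℝ) ×ˢ Ioi (0 : ℝ) from ⟨hy, ht⟩))).hasFDerivAt

theorem IsDiffusion.hasDerivAt (ha : IsDiffusion a) {t : ℝ} (hy : 0 < y) (ht : 0 < t) :
    HasDerivAt (a y) (fderiv ℝ (Function.uncurry a) (y, t) (0, 1)) t := by
  have h1 : HasDerivAt (fun s : ℝ => (y, s)) ((0 : ℝ), (1 : ℝ)) t :=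
    (hasDerivAt_const t y).prodMk (hasDerivAt_id t)
  exact (ha.differentiableAt hy ht).comp_hasDerivAt t h1

/-- The flux is differentiable in the gradient variable, also where the gradient vanishes. -/
theorem IsDiffusion.hasFDerivAt_flux (ha : IsDiffusion a) (hy : 0 < y) (η : Full n) :
    HasFDerivAt (fun ξ : Full n => a y ‖ξ‖ • ξ) (fluxDeriv a y η) η := by
  by_cases h : η = 0
  · subst h
    have hcont : Tendsto (fun ξ : Full n => a y ‖ξ‖) (𝓝 0) (𝓝 (a y 0)) := by
      have h1 := ha.cont (y, 0) ⟨hy, le_refl (0 : ℝ)⟩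
      have h2 : Tendsto (fun ξ : Full n => (y, ‖ξ‖)) (𝓝 0) (𝓝[Ioi 0 ×ˢ Ici 0] (y, 0)) := by
        refine tendsto_nhdsWithin_iff.2 ⟨?_, Eventually.of_forall fun ξ => ⟨hy, norm_nonneg ξ⟩⟩
        have : Continuous fun ξ : Full n => (y, ‖ξ‖) := by fun_prop
        simpa using this.tendsto 0
      exact h1.tendsto.comp h2
    rw [hasFDerivAt_iff_isLittleO_nhds_zero, Asymptotics.isLittleO_iff]
    intro c hc
    filter_upwards [Metric.tendsto_nhds.1 hcont c hc] with ξ hξ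
    rw [Real.dist_eq] at hξ
    -- At `η = 0` the remainder is `(a(y,‖ξ‖) - a(y,0)) ξ`, which is `o(‖ξ‖)` by mere continuity of
    -- `a` at `t = 0`.
    have : a y ‖0 + ξ‖ • (0 + ξ) - a y ‖(0 : Full n)‖ • (0 : Full n) - fluxDeriv a y 0 ξ
        = (a y ‖ξ‖ - a y 0) • ξ := by
      rw [fluxDeriv_apply]; simp [sub_smul]
    rw [this, norm_smul]
    exact mul_le_mul_of_nonneg_right hξ.le (norm_nonneg _)
  · have hη : 0 < ‖η‖ := norm_pos_iff.2 h
    have hnorm : HasFDerivAt (fun ξ : Full n => ‖ξ‖) (‖η‖⁻¹ • innerSL ℝ η) η := by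
      have h1 := (hasStrictFDerivAt_norm_sq η).hasFDerivAt.sqrt (by positivity)
      simp only [Real.sqrt_sq (norm_nonneg _)] at h1
      refine h1.congr_fderiv ?_
      ext v
      simp
      field_simp
    have hd := ha.hasDerivAt hy hη
    have h2 : HasFDerivAt (fun ξ : Full n => a y ‖ξ‖)
        (deriv (a y) ‖η‖ • (‖η‖⁻¹ • innerSL ℝ η)) η := by
      rw [hd.deriv]
      exact hd.comp_hasFDerivAt η hnorm
    refine (h2.fun_smul (hasFDerivAt_id η)).congr_fderiv ?_
    ext1 v
    rw [fluxDeriv_apply, if_neg h]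
    simp [smul_smul, div_eq_mul_inv]

end Flux

/-! ### Continuity and measurability for regular solutions. -/

section Regularity

variable {n : ℕ} {α : ℝ≥0} {Ω : Set (Hor n)} {a : ℝ → ℝ → ℝ} {u : Hor n × ℝ → ℝ}
  {X : Hor n × ℝ}

theorem IsRegularSol.contDiffOn_uD (hu : IsRegularSol Ω a u) (hΩ : IsHolderDomain 4 α Ω)
    (i : Fin (n + 1)) : ContDiffOn ℝ 1 (uD Ω u i) (latCyl Ω) :=
  contDiffOn_pd hΩ.uniqueDiffOn_latCyl hu.contDiff (by norm_num) i

theorem IsRegularSol.continuousOn_uD (hu : IsRegularSol Ω a u) (hΩ : IsHolderDomain 4 α Ω)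
    (i : Fin (n + 1)) : ContinuousOn (uD Ω u i) (latCyl Ω) :=
  (hu.contDiffOn_uD hΩ i).continuousOn

theorem IsRegularSol.continuousOn_uDD (hu : IsRegularSol Ω a u) (hΩ : IsHolderDomain 4 α Ω)
    (i k : Fin (n + 1)) : ContinuousOn (uDD Ω u i k) (latCyl Ω) :=
  continuousOn_pd hΩ.uniqueDiffOn_latCyl (hu.contDiffOn_uD hΩ i) k

theorem IsRegularSol.contDiffOn_one (hu : IsRegularSol Ω a u) : ContDiffOn ℝ 1 u (latCyl Ω) :=
  hu.contDiff.of_le (by norm_num)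

theorem IsRegularSol.continuousOn_gradU (hu : IsRegularSol Ω a u) (hΩ : IsHolderDomain 4 α Ω) :
    ContinuousOn (gradU Ω u) (latCyl Ω) :=
  continuousOn_grad hΩ.uniqueDiffOn_latCyl hu.contDiffOn_one

theorem IsRegularSol.continuousOn_gradX (hu : IsRegularSol Ω a u) (hΩ : IsHolderDomain 4 α Ω) :
    ContinuousOn (gradX (latCyl Ω) u) (latCyl Ω) :=
  _root_.continuousOn_gradX hΩ.uniqueDiffOn_latCyl hu.contDiffOn_one

theorem IsRegularSol.continuousOn_grad_uD (hu : IsRegularSol Ω a u) (hΩ : IsHolderDomain 4 α Ω)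
    (i : Fin (n + 1)) : ContinuousOn (grad (latCyl Ω) (uD Ω u i)) (latCyl Ω) :=
  continuousOn_grad hΩ.uniqueDiffOn_latCyl (hu.contDiffOn_uD hΩ i)

theorem IsRegularSol.hasLineDerivAt_u (hu : IsRegularSol Ω a u) (hΩ : IsHolderDomain 4 α Ω)
    (i : Fin (n + 1)) (hX : X ∈ cyl Ω) : HasLineDerivAt ℝ u (uD Ω u i X) X (coordVec i) :=
  hasLineDerivAt_pd hu.contDiffOn_one (latCyl_mem_nhds hΩ.isOpen hX) i

theorem IsRegularSol.hasLineDerivAt_uD (hu : IsRegularSol Ω a u) (hΩ : IsHolderDomain 4 α Ω)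
    (i k : Fin (n + 1)) (hX : X ∈ cyl Ω) :
    HasLineDerivAt ℝ (uD Ω u i) (uDD Ω u i k X) X (coordVec k) :=
  hasLineDerivAt_pd (hu.contDiffOn_uD hΩ i) (latCyl_mem_nhds hΩ.isOpen hX) k

theorem IsRegularSol.continuousOn_wt (hu : IsRegularSol Ω a u) (hΩ : IsHolderDomain 4 α Ω)
    (ha : IsDiffusion a) : ContinuousOn (wt Ω a u) (latCyl Ω) :=
  ha.cont.comp (f := fun X : Hor n × ℝ => (X.2, ‖gradU Ω u X‖))
    (continuousOn_snd.prodMk (hu.continuousOn_gradU hΩ).norm)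
    fun _ hX => ⟨hX.2, norm_nonneg _⟩

theorem wt_pos (ha : IsDiffusion a) (hX : X ∈ latCyl Ω) : 0 < wt Ω a u X :=
  ha.pos X.2 hX.2 _ (norm_nonneg _)

/-- The vector `ℬ(y,∇u) ξ`. -/
def fluxU (Ω : Set (Hor n)) (a : ℝ → ℝ → ℝ) (u : Hor n × ℝ → ℝ) (X : Hor n × ℝ) :
    Full n →L[ℝ] Full n := fluxDeriv a X.2 (gradU Ω u X)

theorem exists_norm_fluxU_le (Ω : Set (Hor n)) (u : Hor n × ℝ → ℝ) (ha : IsDiffusion a) :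
    ∃ C > 0, ∀ X ∈ latCyl Ω, ∀ ξ, ‖fluxU Ω a u X ξ‖ ≤ C * (wt Ω a u X * ‖ξ‖) := by
  obtain ⟨C, hC, h⟩ := ha.exists_norm_fluxDeriv_le (n := n)
  exact ⟨C, hC, fun X hX ξ => h X.2 hX.2 _ ξ⟩

/-- Horizontal derivatives of the flux `a(y,|∇u|)∇u`. -/
theorem IsRegularSol.hasLineDerivAt_flux (hu : IsRegularSol Ω a u) (hΩ : IsHolderDomain 4 α Ω)
    (ha : IsDiffusion a) (j : Fin n) (i : Fin (n + 1)) (hX : X ∈ cyl Ω) :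
    HasLineDerivAt ℝ (fun Z => wt Ω a u Z * uD Ω u i Z)
      (fluxU Ω a u X (grad (latCyl Ω) (uD Ω u j.castSucc) X) i) X (coordVec j.castSucc) := by
  -- By symmetry of second derivatives, the derivative of `∇u` in direction `x_j` is `∇u_{x_j}`.
  have hl : HasDerivAt (fun s : ℝ => gradU Ω u (X + s • coordVec j.castSucc))
      (grad (latCyl Ω) (uD Ω u j.castSucc) X) 0 := by
    have hp : HasDerivAt (fun s : ℝ => fun k => uD Ω u k (X + s • coordVec j.castSucc))
        (fun k => uDD Ω u j.castSucc k X) 0 := by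
      rw [hasDerivAt_pi]
      intro k
      rw [hΩ.uDD_symm hu.contDiff _ _ (cyl_subset_latCyl hX)]
      exact hu.hasLineDerivAt_uD hΩ k j.castSucc hX
    exact ((PiLp.continuousLinearEquiv 2 ℝ (fun _ : Fin (n + 1) => ℝ)).symm :
      (Fin (n + 1) → ℝ) →L[ℝ] Full n).hasFDerivAt.comp_hasDerivAt 0 hp
  have h1 := ha.hasFDerivAt_flux (y := X.2) hX.2 (gradU Ω u X)
  have h2 := h1.comp_hasDerivAt_of_eq (0 : ℝ) hl (by simp)
  have h3 := (EuclideanSpace.proj (𝕜 := ℝ) i : Full n →L[ℝ] ℝ).hasFDerivAt.comp_hasDerivAt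
    (0 : ℝ) h2
  unfold HasLineDerivAt
  convert! h3 using 1
  ext s
  -- A horizontal displacement leaves `y` fixed, so only differentiability of the flux in the
  -- gradient variable enters.
  have hy : (X + s • (coordVec j.castSucc : Hor n × ℝ)).2 = X.2 := by simp [coordVec_castSucc]
  simp [wt, hy, gradU, grad, uD]

/-- Measurability of the singular coefficient of `ℬ(y,∇u)`. -/
theorem IsRegularSol.aestronglyMeasurable_coef (hu : IsRegularSol Ω a u)
    (hΩ : IsHolderDomain 4 α Ω) (ha : IsDiffusion a) :
    AEStronglyMeasurable (fun X => if gradU Ω u X = 0 then 0 else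
      deriv (a X.2) ‖gradU Ω u X‖ / ‖gradU Ω u X‖) (volume.restrict (cyl Ω)) := by
  have hg := (hu.continuousOn_gradU hΩ).mono (cyl_subset_latCyl (Ω := Ω))
  have hcm := (isOpen_cyl hΩ.isOpen).measurableSet
  -- On this open set the coefficient is continuous; on the rest of the cylinder it is zero.
  set A := cyl Ω ∩ gradU Ω u ⁻¹' {0}ᶜ with hA
  have hAo : IsOpen A := hg.isOpen_inter_preimage (isOpen_cyl hΩ.isOpen) isOpen_compl_singleton
  have hc : ContinuousOn (fun X => deriv (a X.2) ‖gradU Ω u X‖ / ‖gradU Ω u X‖) A := by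
    have h1 : ContinuousOn (fun X : Hor n × ℝ =>
        fderiv ℝ (Function.uncurry a) (X.2, ‖gradU Ω u X‖) (0, 1)) A := by
      refine ContinuousOn.clm_apply ?_ continuousOn_const
      exact (ha.contDiff.continuousOn_fderiv_of_isOpen (isOpen_Ioi.prod isOpen_Ioi) le_rfl).comp
        (f := fun X : Hor n × ℝ => (X.2, ‖gradU Ω u X‖))
        (continuousOn_snd.prodMk (hg.mono inter_subset_left).norm)
        fun X hX => ⟨hX.1.2, norm_pos_iff.2 hX.2⟩
    refine (h1.div (hg.mono inter_subset_left).norm fun X hX =>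
      (norm_pos_iff.2 hX.2).ne').congr fun X hX => ?_
    simp only [Pi.div_apply]
    rw [(ha.hasDerivAt hX.1.2 (norm_pos_iff.2 hX.2)).deriv]
  have h2 : AEStronglyMeasurable (A.indicator fun X =>
      deriv (a X.2) ‖gradU Ω u X‖ / ‖gradU Ω u X‖) (volume.restrict (cyl Ω)) := by
    rw [aestronglyMeasurable_indicator_iff hAo.measurableSet]
    exact (hc.aestronglyMeasurable hAo.measurableSet).mono_measure
      (Measure.restrict_mono_measure Measure.restrict_le_self _)
  refine h2.congr ?_
  filter_upwards [ae_restrict_mem hcm] with X hX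
  by_cases h : gradU Ω u X = 0
  · simp [hA, h]
  · rw [indicator_of_mem (show X ∈ A from ⟨hX, h⟩), if_neg h]

theorem IsRegularSol.aestronglyMeasurable_fluxU (hu : IsRegularSol Ω a u)
    (hΩ : IsHolderDomain 4 α Ω) (ha : IsDiffusion a) {ξ : Hor n × ℝ → Full n}
    (hξ : AEStronglyMeasurable ξ (volume.restrict (cyl Ω))) :
    AEStronglyMeasurable (fun X => fluxU Ω a u X (ξ X)) (volume.restrict (cyl Ω)) := by
  have hcm := (isOpen_cyl hΩ.isOpen).measurableSet
  have hg : AEStronglyMeasurable (gradU Ω u) (volume.restrict (cyl Ω)) :=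
    ((hu.continuousOn_gradU hΩ).mono cyl_subset_latCyl).aestronglyMeasurable hcm
  have hw : AEStronglyMeasurable (wt Ω a u) (volume.restrict (cyl Ω)) :=
    ((hu.continuousOn_wt hΩ ha).mono cyl_subset_latCyl).aestronglyMeasurable hcm
  simp only [fluxU, fluxDeriv_apply]
  exact (hw.smul hξ).add (((hu.aestronglyMeasurable_coef hΩ ha).mul (hg.inner hξ)).smul hg)

/-- On compact subsets of the cylinder the derivatives of the flux are bounded. -/
theorem IsRegularSol.exists_bound_fluxU (hu : IsRegularSol Ω a u) (hΩ : IsHolderDomain 4 α Ω)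
    (ha : IsDiffusion a) {ξ : Hor n × ℝ → Full n} (hξ : ContinuousOn ξ (latCyl Ω))
    {K : Set (Hor n × ℝ)} (hK : IsCompact K) (hKC : K ⊆ latCyl Ω) (i : Fin (n + 1)) :
    ∃ C, ∀ X ∈ K, |fluxU Ω a u X (ξ X) i| ≤ C := by
  obtain ⟨C, hC, h⟩ := exists_norm_fluxU_le Ω u ha
  obtain ⟨M, hM⟩ := hK.exists_bound_of_continuousOn
    (((hu.continuousOn_wt hΩ ha).mul hξ.norm).mono hKC)
  refine ⟨C * M, fun X hX => ?_⟩
  have h1 := PiLp.norm_apply_le (fluxU Ω a u X (ξ X)) i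
  have h2 := h X (hKC hX) (ξ X)
  have h3 := (le_abs_self _).trans (hM X hX)
  rw [Real.norm_eq_abs] at h1
  exact h1.trans (h2.trans (mul_le_mul_of_nonneg_left h3 hC.le))

/-- The flux in direction `i`, multiplied by a test function, is again a test function for
horizontal directions. -/
theorem IsRegularSol.isLineTest_flux (hu : IsRegularSol Ω a u) (hΩ : IsHolderDomain 4 α Ω)
    (ha : IsDiffusion a) (j : Fin n) (i : Fin (n + 1)) {ζ ζ' : Hor n × ℝ → ℝ}
    (hζ : IsLineTest volume (cyl Ω) (coordVec j.castSucc) ζ ζ') :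
    IsLineTest volume (cyl Ω) (coordVec j.castSucc) (fun X => wt Ω a u X * uD Ω u i X * ζ X)
      (fun X => fluxU Ω a u X (grad (latCyl Ω) (uD Ω u j.castSucc) X) i * ζ X
        + wt Ω a u X * uD Ω u i X * ζ' X) := by
  have hcm := (isOpen_cyl hΩ.isOpen).measurableSet
  refine hζ.mul_left (isOpen_cyl hΩ.isOpen)
    (((hu.continuousOn_wt hΩ ha).mul (hu.continuousOn_uD hΩ i)).mono cyl_subset_latCyl)
    (fun X hX => hu.hasLineDerivAt_flux hΩ ha j i hX) ?_ (fun K hK hKc =>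
      hu.exists_bound_fluxU hΩ ha (hu.continuousOn_grad_uD hΩ _) hKc (hK.trans cyl_subset_latCyl) i)
  have h1 : AEStronglyMeasurable (grad (latCyl Ω) (uD Ω u j.castSucc)) (volume.restrict (cyl Ω)) :=
    ((hu.continuousOn_grad_uD hΩ _).mono cyl_subset_latCyl).aestronglyMeasurable hcm
  exact (EuclideanSpace.proj (𝕜 := ℝ) i : Full n →L[ℝ] ℝ).continuous.comp_aestronglyMeasurable
    (hu.aestronglyMeasurable_fluxU hΩ ha h1)

end Regularity

/-! ### Weighted square integrability. -/

section WeightedL2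

variable {n : ℕ} {α : ℝ≥0} {Ω : Set (Hor n)} {a : ℝ → ℝ → ℝ} {u : Hor n × ℝ → ℝ}
variable {V : Type*} [NormedAddCommGroup V]

/-- Functions that are square integrable with the weight `a(y,|∇u|)` on bounded pieces. -/
structure WL2 (Ω : Set (Hor n)) (a : ℝ → ℝ → ℝ) (u : Hor n × ℝ → ℝ) (p : Hor n × ℝ → V) : Prop where
  meas : AEStronglyMeasurable p (volume.restrict (cyl Ω))
  int : ∀ R > 0, IntegrableOn (fun X => wt Ω a u X * ‖p X‖ ^ 2) (Ω ×ˢ Ioo 0 R)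

theorem slab_subset_cyl (R : ℝ) : Ω ×ˢ Ioo 0 R ⊆ cyl Ω := prod_mono subset_rfl fun _ h => h.1

theorem measurableSet_slab (hΩ : IsOpen Ω) (R : ℝ) : MeasurableSet (Ω ×ˢ Ioo 0 R) :=
  hΩ.measurableSet.prod measurableSet_Ioo

theorem IsRegularSol.aestronglyMeasurable_wt (hu : IsRegularSol Ω a u) (hΩ : IsHolderDomain 4 α Ω)
    (ha : IsDiffusion a) : AEStronglyMeasurable (wt Ω a u) (volume.restrict (cyl Ω)) :=
  ((hu.continuousOn_wt hΩ ha).mono cyl_subset_latCyl).aestronglyMeasurable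
    (isOpen_cyl hΩ.isOpen).measurableSet

theorem aestronglyMeasurable_cyl_of_continuousOn (hΩ : IsHolderDomain 4 α Ω)
    {p : Hor n × ℝ → V} (hp : ContinuousOn p (latCyl Ω)) [SecondCountableTopology V] :
    AEStronglyMeasurable p (volume.restrict (cyl Ω)) :=
  (hp.mono cyl_subset_latCyl).aestronglyMeasurable (isOpen_cyl hΩ.isOpen).measurableSet

section

variable (hu : IsRegularSol Ω a u) (hΩ : IsHolderDomain 4 α Ω) (ha : IsDiffusion a)

include hu hΩ ha

omit hu in
/-- Functions dominated by products of weighted square integrable functions are integrable. -/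
theorem WL2.integrableOn_of_le {W W' : Type*} [NormedAddCommGroup W] [NormedAddCommGroup W']
    {p : Hor n × ℝ → W} {q : Hor n × ℝ → W'} (hp : WL2 Ω a u p) (hq : WL2 Ω a u q)
    {w : Hor n × ℝ → ℝ} (hw : AEStronglyMeasurable w (volume.restrict (cyl Ω))) {C R : ℝ}
    (hR : 0 < R)
    (hle : ∀ᵐ X ∂(volume.restrict (cyl Ω)), |w X| ≤ C * (wt Ω a u X * (‖p X‖ * ‖q X‖))) :
    IntegrableOn w (Ω ×ˢ Ioo 0 R) := by
  refine (((hp.int R hR).add (hq.int R hR)).const_mul |C|).mono'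
    (hw.mono_measure (Measure.restrict_mono_set _ (slab_subset_cyl R))) ?_
  filter_upwards [ae_restrict_of_ae_restrict_of_subset (slab_subset_cyl R) hle,
    ae_restrict_mem (measurableSet_slab hΩ.isOpen R)] with X hX hXm
  have hpos := wt_pos (u := u) ha (cyl_subset_latCyl (slab_subset_cyl R hXm))
  refine (hX.trans (mul_le_mul_of_nonneg_right (le_abs_self C) (by positivity))).trans ?_
  refine mul_le_mul_of_nonneg_left ?_ (abs_nonneg C)
  simp only [Pi.add_apply]
  rw [← mul_add]
  refine mul_le_mul_of_nonneg_left ?_ hpos.le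
  nlinarith [sq_nonneg (‖p X‖ - ‖q X‖), norm_nonneg (p X), norm_nonneg (q X)]

theorem WL2.of_le {W : Type*} [NormedAddCommGroup W] {p : Hor n × ℝ → V} {q : Hor n × ℝ → W}
    (hq : WL2 Ω a u q) (hp : AEStronglyMeasurable p (volume.restrict (cyl Ω))) {C : ℝ}
    (hle : ∀ᵐ X ∂(volume.restrict (cyl Ω)), ‖p X‖ ≤ C * ‖q X‖) : WL2 Ω a u p := by
  refine ⟨hp, fun R hR => ?_⟩
  refine WL2.integrableOn_of_le hΩ ha hq hq (C := C ^ 2)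
    ((hu.aestronglyMeasurable_wt hΩ ha).mul (hp.norm.pow 2)) hR ?_
  filter_upwards [hle, ae_restrict_mem (isOpen_cyl hΩ.isOpen).measurableSet] with X hX hXm
  have hpos := wt_pos (u := u) ha (cyl_subset_latCyl hXm)
  simp only [Pi.mul_apply, Pi.pow_apply]
  rw [abs_of_nonneg (mul_nonneg hpos.le (sq_nonneg _))]
  calc wt Ω a u X * ‖p X‖ ^ 2 ≤ wt Ω a u X * (C * ‖q X‖) ^ 2 := by gcongr
    _ = _ := by ring

theorem WL2.add {p q : Hor n × ℝ → V} (hp : WL2 Ω a u p) (hq : WL2 Ω a u q) :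
    WL2 Ω a u (fun X => p X + q X) := by
  refine ⟨hp.meas.add hq.meas, fun R hR => ?_⟩
  refine (((hp.int R hR).add (hq.int R hR)).const_mul 2).mono'
    (((hu.aestronglyMeasurable_wt hΩ ha).mul ((hp.meas.add hq.meas).norm.pow 2)).mono_measure
      (Measure.restrict_mono_set _ (slab_subset_cyl R))) ?_
  filter_upwards [ae_restrict_mem (measurableSet_slab hΩ.isOpen R)] with X hXm
  have hpos := wt_pos (u := u) ha (cyl_subset_latCyl (slab_subset_cyl R hXm))
  simp only [Pi.add_apply]
  rw [Real.norm_of_nonneg (by positivity), ← mul_add, mul_left_comm]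
  refine mul_le_mul_of_nonneg_left ?_ hpos.le
  have := norm_add_le (p X) (q X)
  nlinarith [sq_nonneg (‖p X‖ - ‖q X‖), norm_nonneg (p X), norm_nonneg (q X),
    norm_nonneg (p X + q X)]

omit hu hΩ ha in
theorem WL2.zero : WL2 Ω a u (fun _ => (0 : V)) :=
  ⟨aestronglyMeasurable_const, fun R _ => by simp⟩

theorem WL2.sum {ι : Type*} (s : Finset ι) {p : ι → Hor n × ℝ → V}
    (hp : ∀ i ∈ s, WL2 Ω a u (p i)) : WL2 Ω a u (fun X => ∑ i ∈ s, p i X) := by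
  classical
  induction s using Finset.induction_on with
  | empty => simpa using WL2.zero
  | insert i s hi ih =>
    simp only [Finset.sum_insert hi]
    exact WL2.add hu hΩ ha (hp i (Finset.mem_insert_self _ _))
      (ih fun k hk => hp k (Finset.mem_insert_of_mem hk))

theorem WL2.bdd_smul [NormedSpace ℝ V] {p : Hor n × ℝ → V} (hp : WL2 Ω a u p)
    {b : Hor n × ℝ → ℝ} (hb : AEStronglyMeasurable b (volume.restrict (cyl Ω))) {M : ℝ}
    (hM : ∀ X ∈ cyl Ω, |b X| ≤ M) : WL2 Ω a u (fun X => b X • p X) := by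
  refine WL2.of_le hu hΩ ha hp (hb.smul hp.meas) (C := M) ?_
  filter_upwards [ae_restrict_mem (isOpen_cyl hΩ.isOpen).measurableSet] with X hXm
  rw [norm_smul]
  exact mul_le_mul_of_nonneg_right (hM X hXm) (norm_nonneg _)

theorem WL2.smul_bdd [NormedSpace ℝ V] {p : Hor n × ℝ → ℝ} (hp : WL2 Ω a u p)
    {b : Hor n × ℝ → V} (hb : AEStronglyMeasurable b (volume.restrict (cyl Ω))) {M : ℝ}
    (hM : ∀ X ∈ cyl Ω, ‖b X‖ ≤ M) : WL2 Ω a u (fun X => p X • b X) := by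
  refine WL2.of_le hu hΩ ha hp (hp.meas.smul hb) (C := M) ?_
  filter_upwards [ae_restrict_mem (isOpen_cyl hΩ.isOpen).measurableSet] with X hXm
  rw [norm_smul, mul_comm]
  exact mul_le_mul_of_nonneg_right (hM X hXm) (norm_nonneg _)

theorem WL2.of_dominated {p : Hor n × ℝ → V} (hp : AEStronglyMeasurable p (volume.restrict (cyl Ω)))
    {E : Hor n × ℝ → ℝ} (hE : ∀ R > 0, IntegrableOn (fun X => wt Ω a u X * E X) (Ω ×ˢ Ioo 0 R))
    (hle : ∀ X, ‖p X‖ ^ 2 ≤ E X) : WL2 Ω a u p := by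
  refine ⟨hp, fun R hR => ?_⟩
  refine (hE R hR).mono' (((hu.aestronglyMeasurable_wt hΩ ha).mul (hp.norm.pow 2)).mono_measure
      (Measure.restrict_mono_set _ (slab_subset_cyl R))) ?_
  filter_upwards [ae_restrict_mem (measurableSet_slab hΩ.isOpen R)] with X hXm
  have hpos := wt_pos (u := u) ha (cyl_subset_latCyl (slab_subset_cyl R hXm))
  rw [Real.norm_of_nonneg (mul_nonneg hpos.le (sq_nonneg _))]
  exact mul_le_mul_of_nonneg_left (hle X) hpos.le

theorem wL2_gradU : WL2 Ω a u (gradU Ω u) := by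
  obtain ⟨T, -, hT⟩ := hu.energy
  refine WL2.of_dominated hu hΩ ha
    (aestronglyMeasurable_cyl_of_continuousOn hΩ (hu.continuousOn_gradU hΩ)) hT fun X => ?_
  have h1 : 0 ≤ ∑ i : Fin n, ∑ j : Fin n, uDD Ω u i.castSucc j.castSucc X ^ 2 :=
    Finset.sum_nonneg fun i _ => Finset.sum_nonneg fun j _ => sq_nonneg _
  have h2 : 0 ≤ ∑ i : Fin n, uDD Ω u i.castSucc (Fin.last n) X ^ 2 :=
    Finset.sum_nonneg fun i _ => sq_nonneg _
  have h3 : 0 ≤ ∑ i : Fin n, ∑ j : Fin n, ‖T i j X‖ ^ 2 :=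
    Finset.sum_nonneg fun i _ => Finset.sum_nonneg fun j _ => sq_nonneg _
  linarith

/-- The components are `u_{x_j x_k}` and `u_{x_j y}`, all present in the energy. The derivative
`u_{yy}` is not controlled there and is not needed. -/
theorem wL2_grad_uD (j : Fin n) : WL2 Ω a u (grad (latCyl Ω) (uD Ω u j.castSucc)) := by
  obtain ⟨T, -, hT⟩ := hu.energy
  refine WL2.of_dominated hu hΩ ha
    (aestronglyMeasurable_cyl_of_continuousOn hΩ (hu.continuousOn_grad_uD hΩ j.castSucc)) hT
    fun X => ?_
  have h1 := Finset.single_le_sum (s := Finset.univ)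
    (f := fun i : Fin n => ∑ k : Fin n, uDD Ω u i.castSucc k.castSucc X ^ 2)
    (fun i _ => Finset.sum_nonneg fun j _ => sq_nonneg _) (Finset.mem_univ j)
  have h2 := Finset.single_le_sum (s := Finset.univ)
    (f := fun i : Fin n => uDD Ω u i.castSucc (Fin.last n) X ^ 2)
    (fun i _ => sq_nonneg _) (Finset.mem_univ j)
  have h3 : 0 ≤ ∑ i : Fin n, ∑ j : Fin n, ‖T i j X‖ ^ 2 :=
    Finset.sum_nonneg fun i _ => Finset.sum_nonneg fun j _ => sq_nonneg _
  have h4 : ‖grad (latCyl Ω) (uD Ω u j.castSucc) X‖ ^ 2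
      = ∑ k : Fin n, uDD Ω u j.castSucc k.castSucc X ^ 2
        + uDD Ω u j.castSucc (Fin.last n) X ^ 2 := norm_grad_sq
  rw [h4]
  have h0 := sq_nonneg ‖gradU Ω u X‖
  beta_reduce at h1 h2
  linarith

theorem wL2_uD (i : Fin (n + 1)) : WL2 Ω a u (uD Ω u i) :=
  WL2.of_le hu hΩ ha (wL2_gradU hu hΩ ha)
    (aestronglyMeasurable_cyl_of_continuousOn hΩ (hu.continuousOn_uD hΩ i)) (C := 1)
    (ae_of_all _ fun X => by rw [one_mul, Real.norm_eq_abs]; exact abs_pd_le i)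

theorem wL2_gradX : WL2 Ω a u (gradX (latCyl Ω) u) :=
  WL2.of_le hu hΩ ha (wL2_gradU hu hΩ ha)
    (aestronglyMeasurable_cyl_of_continuousOn hΩ (hu.continuousOn_gradX hΩ)) (C := 1)
    (ae_of_all _ fun X => by rw [one_mul]; exact norm_gradX_le)

theorem wL2_uDD (j : Fin n) (k : Fin (n + 1)) : WL2 Ω a u (uDD Ω u j.castSucc k) :=
  WL2.of_le hu hΩ ha (wL2_grad_uD hu hΩ ha j)
    (aestronglyMeasurable_cyl_of_continuousOn hΩ (hu.continuousOn_uDD hΩ j.castSucc k)) (C := 1)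
    (ae_of_all _ fun X => by rw [one_mul, Real.norm_eq_abs]; exact abs_pd_le k)

/-- Weak third derivatives, in weighted `L²`. -/
theorem exists_third_derivatives : ∃ T : Fin n → Fin n → Hor n × ℝ → Full n,
    (∀ i j, HasWeakGrad Ω (uDD Ω u i.castSucc j.castSucc) (T i j)) ∧
    ∀ i j, WL2 Ω a u (T i j) := by
  obtain ⟨T, hTw, hT⟩ := hu.energy
  refine ⟨T, hTw, fun i j => ?_⟩
  refine WL2.of_dominated hu hΩ ha (hTw i j).locInt_grad.aestronglyMeasurable hT fun X => ?_
  have h0 := sq_nonneg ‖gradU Ω u X‖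
  have h1 : 0 ≤ ∑ i : Fin n, ∑ j : Fin n, uDD Ω u i.castSucc j.castSucc X ^ 2 :=
    Finset.sum_nonneg fun i _ => Finset.sum_nonneg fun j _ => sq_nonneg _
  have h2 : 0 ≤ ∑ i : Fin n, uDD Ω u i.castSucc (Fin.last n) X ^ 2 :=
    Finset.sum_nonneg fun i _ => sq_nonneg _
  have h3 := Finset.single_le_sum (s := Finset.univ) (f := fun k : Fin n => ‖T i k X‖ ^ 2)
    (fun i _ => sq_nonneg _) (Finset.mem_univ j)
  have h4 := Finset.single_le_sum (s := Finset.univ)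
    (f := fun i : Fin n => ∑ k : Fin n, ‖T i k X‖ ^ 2)
    (fun i _ => Finset.sum_nonneg fun j _ => sq_nonneg _) (Finset.mem_univ i)
  beta_reduce at h3 h4
  linarith

end

end WeightedL2

/-! ### Traces on the bottom of the cylinder. -/

section BottomTraces

variable {n : ℕ} {Ω : Set (Hor n)} {p q : Hor n × ℝ → ℝ} {p₀ q₀ : Hor n → ℝ}

/-- A conull set meets every interval `(0, ε)`. This makes limits along the trace filter unique, so
that identities valid at positive heights pass to the bottom. -/
instance neBot_nhdsGT_inf_ae : (𝓝[>] (0 : ℝ) ⊓ ae volume).NeBot := by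
  rw [inf_neBot_iff]
  intro s hs t ht
  obtain ⟨ε, hε, hsub⟩ := mem_nhdsGT_iff_exists_Ioo_subset.1 hs
  have h1 : (volume : Measure ℝ) (Ioo 0 ε) ≠ 0 := by
    rw [Real.volume_Ioo]
    simpa using hε
  by_contra hne
  rw [not_nonempty_iff_eq_empty] at hne
  apply h1
  refine measure_mono_null (fun y hy => ?_) (mem_ae_iff.1 ht)
  intro hyt
  have : y ∈ s ∩ t := ⟨hsub hy, hyt⟩
  rw [hne] at this
  exact this

theorem eventually_trace_pos : ∀ᶠ y : ℝ in 𝓝[>] (0 : ℝ) ⊓ ae volume, 0 < y :=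
  (eventually_mem_nhdsWithin (a := (0 : ℝ)) (s := Ioi 0)).filter_mono inf_le_left

theorem continuousOn_slice {V : Type*} [TopologicalSpace V] {p : Hor n × ℝ → V}
    (hp : ContinuousOn p (latCyl Ω)) {y : ℝ} (hy : 0 < y) :
    ContinuousOn (fun x => p (x, y)) (closure Ω) :=
  hp.comp (f := fun x : Hor n => (x, y)) (by fun_prop) fun _ hx => ⟨hx, hy⟩

theorem aestronglyMeasurable_slice {V : Type*} [NormedAddCommGroup V] [SecondCountableTopology V]
    (hΩ : IsOpen Ω) {p : Hor n × ℝ → V} (hp : ContinuousOn p (latCyl Ω)) {y : ℝ} (hy : 0 < y) :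
    AEStronglyMeasurable (fun x => p (x, y)) (volume.restrict Ω) :=
  ((continuousOn_slice hp hy).mono subset_closure).aestronglyMeasurable hΩ.measurableSet

theorem HasBottomTrace.of_le {v : ℝ → Hor n → ℝ} (hp₀ : MemLp p₀ 2 (volume.restrict Ω))
    (hv : Tendsto (fun y => eLpNorm (v y) 2 (volume.restrict Ω)) (𝓝[>] 0 ⊓ ae volume) (𝓝 0))
    (hle : ∀ᶠ y in 𝓝[>] (0 : ℝ) ⊓ ae volume, ∀ᵐ x ∂(volume.restrict Ω),
      |p (x, y) - p₀ x| ≤ |v y x|) : HasBottomTrace Ω p p₀ := by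
  refine ⟨hp₀, tendsto_of_tendsto_of_tendsto_of_le_of_le' tendsto_const_nhds hv
    (Eventually.of_forall fun _ => zero_le) ?_⟩
  filter_upwards [hle] with y hy
  exact eLpNorm_mono_ae hy

theorem HasBottomTrace.add (hΩ : IsOpen Ω) (hp : HasBottomTrace Ω p p₀)
    (hq : HasBottomTrace Ω q q₀) (hpc : ContinuousOn p (latCyl Ω))
    (hqc : ContinuousOn q (latCyl Ω)) :
    HasBottomTrace Ω (fun X => p X + q X) (fun x => p₀ x + q₀ x) := by
  refine ⟨hp.1.add hq.1, ?_⟩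
  refine tendsto_of_tendsto_of_tendsto_of_le_of_le' tendsto_const_nhds
    (by simpa using hp.2.add hq.2) (Eventually.of_forall fun _ => zero_le) ?_
  filter_upwards [eventually_trace_pos] with y hy
  refine (le_of_eq ?_).trans (eLpNorm_add_le
    ((aestronglyMeasurable_slice hΩ hpc hy).sub hp.1.1)
    ((aestronglyMeasurable_slice hΩ hqc hy).sub hq.1.1) one_le_two)
  congr 1
  ext x
  simp only [Pi.add_apply]
  ring

theorem HasBottomTrace.zero : HasBottomTrace Ω (fun _ => 0) (fun _ => 0) := by
  refine ⟨MemLp.zero, ?_⟩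
  simp

/-- Uniform convergence of a continuous function to its bottom values. -/
theorem tendsto_bottom_uniform (hK : IsCompact (closure Ω)) {b : Hor n × ℝ → ℝ}
    (hb : ContinuousOn b (closedCyl Ω)) {ε : ℝ} (hε : 0 < ε) :
    ∀ᶠ y in 𝓝[>] (0 : ℝ), ∀ x ∈ closure Ω, |b (x, y) - b (x, 0)| ≤ ε := by
  have hc : IsCompact (closure Ω ×ˢ Icc (0 : ℝ) 1) := hK.prod isCompact_Icc
  have hu := hc.uniformContinuousOn_of_continuous
    (hb.mono (prod_mono subset_rfl fun y (hy : y ∈ Icc (0 : ℝ) 1) => hy.1))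
  obtain ⟨δ, hδ, h⟩ := Metric.uniformContinuousOn_iff.1 hu ε hε
  filter_upwards [Ioo_mem_nhdsGT (show (0 : ℝ) < min δ 1 by positivity)] with y hy x hx
  have h1 : y < δ := hy.2.trans_le (min_le_left _ _)
  have h2 : y < 1 := hy.2.trans_le (min_le_right _ _)
  refine (h (x, y) ⟨hx, hy.1.le, h2.le⟩ (x, 0) ⟨hx, le_rfl, zero_le_one⟩ ?_).le
  rw [Prod.dist_eq]
  simpa [Real.dist_eq, abs_of_pos hy.1] using ⟨hδ, h1⟩

/-- Write `p b - p₀ b₀ = (p - p₀) b + p₀ (b - b₀)`. Near the bottom `b` is bounded and converges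
uniformly, so both terms tend to zero in `L²`. -/
theorem HasBottomTrace.mul_continuousOn (hΩ : IsOpen Ω) (hK : IsCompact (closure Ω))
    (hp : HasBottomTrace Ω p p₀) (hpc : ContinuousOn p (latCyl Ω)) {b : Hor n × ℝ → ℝ}
    (hb : ContinuousOn b (closedCyl Ω)) :
    HasBottomTrace Ω (fun X => p X * b X) (fun x => p₀ x * b (x, 0)) := by
  have hb0 : ContinuousOn (fun x => b (x, 0)) (closure Ω) :=
    hb.comp (f := fun x : Hor n => (x, (0 : ℝ))) (by fun_prop) fun x hx => ⟨hx, le_refl (0 : ℝ)⟩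
  obtain ⟨M, hM⟩ := hK.exists_bound_of_continuousOn hb0
  have hM0 : ∀ᵐ x ∂(volume.restrict Ω), ‖b (x, 0)‖ ≤ M := by
    filter_upwards [ae_restrict_mem hΩ.measurableSet] with x hx using hM x (subset_closure hx)
  have hb0m : AEStronglyMeasurable (fun x => b (x, 0)) (volume.restrict Ω) :=
    (hb0.mono subset_closure).aestronglyMeasurable hΩ.measurableSet
  have hmem : MemLp (fun x => p₀ x * b (x, 0)) 2 (volume.restrict Ω) := by
    refine MemLp.of_le_mul (c := M) hp.1 (hp.1.1.mul hb0m) ?_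
    filter_upwards [hM0] with x hx
    rw [norm_mul, mul_comm]
    exact mul_le_mul_of_nonneg_right hx (norm_nonneg _)
  refine ⟨hmem, ?_⟩
  rw [ENNReal.tendsto_nhds_zero]
  intro ε hε
  -- One number `κ` serves as bound for the trace error of `p` and for the uniform error of `b`;
  -- then `|b| ≤ |M| + κ` near the bottom.
  obtain ⟨κ, hκ, hκε⟩ : ∃ κ : ℝ, 0 < κ ∧
      ENNReal.ofReal (|M| + κ) * ENNReal.ofReal κ
        + ENNReal.ofReal κ * eLpNorm p₀ 2 (volume.restrict Ω) ≤ ε := by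
    have hfin : eLpNorm p₀ 2 (volume.restrict Ω) ≠ ⊤ := hp.1.2.ne
    have hof : Tendsto (fun κ : ℝ => ENNReal.ofReal κ) (𝓝[>] 0) (𝓝 0) := by
      simpa using (ENNReal.continuous_ofReal.tendsto (0 : ℝ)).mono_left nhdsWithin_le_nhds
    have h0 : Tendsto (fun κ : ℝ => ENNReal.ofReal (|M| + κ) * ENNReal.ofReal κ
        + ENNReal.ofReal κ * eLpNorm p₀ 2 (volume.restrict Ω)) (𝓝[>] 0) (𝓝 0) := by
      have h1 : Tendsto (fun κ : ℝ => ENNReal.ofReal (|M| + κ)) (𝓝[>] 0)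
          (𝓝 (ENNReal.ofReal (|M| + 0))) :=
        ((ENNReal.continuous_ofReal.comp (continuous_const.add continuous_id)).tendsto
          (0 : ℝ)).mono_left nhdsWithin_le_nhds
      have h2 := ENNReal.Tendsto.mul h1 (Or.inr ENNReal.zero_ne_top) hof
        (Or.inr ENNReal.ofReal_ne_top)
      have h3 := ENNReal.Tendsto.mul_const (b := eLpNorm p₀ 2 (volume.restrict Ω)) hof
        (Or.inr hfin)
      simpa using h2.add h3
    obtain ⟨κ, h1, h2⟩ := (((ENNReal.tendsto_nhds_zero.1 h0) ε hε).and self_mem_nhdsWithin).exists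
    exact ⟨κ, h2, h1⟩
  have hev := (tendsto_bottom_uniform hK hb hκ).filter_mono
    (inf_le_left : 𝓝[>] (0 : ℝ) ⊓ ae volume ≤ _)
  have hev2 := (ENNReal.tendsto_nhds_zero.1 hp.2) (ENNReal.ofReal κ) (by simpa using hκ)
  filter_upwards [hev, hev2, eventually_trace_pos] with y hy hy2 hy0
  have hsl := aestronglyMeasurable_slice hΩ hpc hy0
  have hbs := aestronglyMeasurable_slice hΩ
    (hb.mono (prod_mono subset_rfl Ioi_subset_Ici_self)) hy0
  have e1 : (fun x => p (x, y) * b (x, y) - p₀ x * b (x, 0))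
      = (fun x => (p (x, y) - p₀ x) * b (x, y)) + fun x => p₀ x * (b (x, y) - b (x, 0)) := by
    ext x; simp only [Pi.add_apply]; ring
  rw [e1]
  refine (eLpNorm_add_le ((hsl.sub hp.1.1).mul hbs) (hp.1.1.mul (hbs.sub hb0m)) one_le_two).trans
    (le_trans (add_le_add ?_ ?_) hκε)
  · refine (eLpNorm_le_mul_eLpNorm_of_ae_le_mul (c := |M| + κ)
      (g := fun x => p (x, y) - p₀ x) ?_ 2).trans (mul_le_mul_right hy2 _)
    filter_upwards [ae_restrict_mem hΩ.measurableSet] with x hx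
    simp only [Pi.mul_apply, Pi.sub_apply]
    rw [norm_mul, mul_comm]
    refine mul_le_mul_of_nonneg_right ?_ (norm_nonneg _)
    have h1 := hy x (subset_closure hx)
    have h2 := hM x (subset_closure hx)
    rw [Real.norm_eq_abs] at h2 ⊢
    have h3 : |b (x, y)| ≤ |b (x, y) - b (x, 0)| + |b (x, 0)| := by
      simpa using abs_add_le (b (x, y) - b (x, 0)) (b (x, 0))
    linarith [le_abs_self M]
  · refine eLpNorm_le_mul_eLpNorm_of_ae_le_mul ?_ 2
    filter_upwards [ae_restrict_mem hΩ.measurableSet] with x hx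
    simp only [Pi.mul_apply, Pi.sub_apply]
    rw [norm_mul, mul_comm]
    exact mul_le_mul_of_nonneg_right (hy x (subset_closure hx)) (norm_nonneg _)

theorem HasBottomTrace.of_continuousOn (hΩ : IsOpen Ω) (hK : IsCompact (closure Ω))
    {b : Hor n × ℝ → ℝ} (hb : ContinuousOn b (closedCyl Ω)) :
    HasBottomTrace Ω b (fun x => b (x, 0)) := by
  have hfin := isFiniteMeasure_restrict_of_isCompact_closure hK
  have h1 : HasBottomTrace Ω (fun _ => (1 : ℝ)) (fun _ => 1) := ⟨memLp_const _, by simp⟩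
  simpa using h1.mul_continuousOn hΩ hK continuousOn_const hb

/-- Integrals of products pass to the traces. -/
theorem HasBottomTrace.tendsto_integral_mul (hΩ : IsOpen Ω) (hp : HasBottomTrace Ω p p₀)
    (hq : HasBottomTrace Ω q q₀) (hpc : ContinuousOn p (latCyl Ω))
    (hqc : ContinuousOn q (latCyl Ω)) :
    Tendsto (fun y => ∫ x in Ω, p (x, y) * q (x, y)) (𝓝[>] 0 ⊓ ae volume)
      (𝓝 (∫ x in Ω, p₀ x * q₀ x)) := by
  set μ := (volume : Measure (Hor n)).restrict Ω with hμ
  have hbound : ∀ᶠ y in 𝓝[>] (0 : ℝ) ⊓ ae volume,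
      eLpNorm (fun x => p (x, y) * q (x, y) - p₀ x * q₀ x) 1 μ ≤
        eLpNorm (fun x => p (x, y) - p₀ x) 2 μ *
          (eLpNorm (fun x => q (x, y) - q₀ x) 2 μ + eLpNorm q₀ 2 μ)
        + eLpNorm p₀ 2 μ * eLpNorm (fun x => q (x, y) - q₀ x) 2 μ := by
    filter_upwards [eventually_trace_pos] with y hy0
    have hps := aestronglyMeasurable_slice hΩ hpc hy0
    have hqs := aestronglyMeasurable_slice hΩ hqc hy0
    -- Hölder's inequality on each summand gives convergence of the products in `L¹`.
    have e1 : (fun x => p (x, y) * q (x, y) - p₀ x * q₀ x)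
        = (fun x => p (x, y) - p₀ x) • (fun x => q (x, y))
          + p₀ • (fun x => q (x, y) - q₀ x) := by
      ext x; simp only [Pi.add_apply, smul_eq_mul, Pi.mul_apply]; ring
    have e2 : (fun x => q (x, y)) = (fun x => q (x, y) - q₀ x) + q₀ := by
      ext x; simp
    rw [e1]
    refine (eLpNorm_add_le ((hps.sub hp.1.1).smul hqs) (hp.1.1.smul (hqs.sub hq.1.1))
      le_rfl).trans (add_le_add ?_ ?_)
    · refine (eLpNorm_smul_le_mul_eLpNorm (p := 2) (q := 2) hqs (hps.sub hp.1.1)).trans ?_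
      refine mul_le_mul_right ?_ _
      conv_lhs => rw [e2]
      exact eLpNorm_add_le (hqs.sub hq.1.1) hq.1.1 one_le_two
    · exact eLpNorm_smul_le_mul_eLpNorm (p := 2) (q := 2) (hqs.sub hq.1.1) hp.1.1
  have hlim : Tendsto (fun y => eLpNorm (fun x => p (x, y) * q (x, y) - p₀ x * q₀ x) 1 μ)
      (𝓝[>] 0 ⊓ ae volume) (𝓝 0) := by
    refine tendsto_of_tendsto_of_tendsto_of_le_of_le' tendsto_const_nhds ?_
      (Eventually.of_forall fun _ => zero_le) hbound
    have h1 := ENNReal.Tendsto.mul hp.2 (Or.inr (by simpa using hq.1.2.ne))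
      (hq.2.add_const (eLpNorm q₀ 2 μ)) (Or.inr ENNReal.zero_ne_top)
    have h2 := ENNReal.Tendsto.const_mul (a := eLpNorm p₀ 2 μ) hq.2 (Or.inr hp.1.2.ne)
    simpa using h1.add h2
  have hi0 : Integrable (fun x => p₀ x * q₀ x) μ := hp.1.integrable_mul hq.1
  refine tendsto_integral_of_L1' _ hi0.aestronglyMeasurable ?_ hlim
  filter_upwards [(ENNReal.tendsto_nhds_zero.1 hlim) 1 one_pos, eventually_trace_pos] with y hy hy0
  have hm : AEStronglyMeasurable (fun x => p (x, y) * q (x, y) - p₀ x * q₀ x) μ :=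
    ((aestronglyMeasurable_slice hΩ hpc hy0).mul (aestronglyMeasurable_slice hΩ hqc hy0)).sub
      hi0.aestronglyMeasurable
  have h2 : Integrable (fun x => p (x, y) * q (x, y) - p₀ x * q₀ x) μ :=
    memLp_one_iff_integrable.1 ⟨hm, hy.trans_lt ENNReal.one_lt_top⟩
  refine (h2.add hi0).congr (ae_of_all _ fun x => ?_)
  simp

theorem norm_le_sum_abs (d : Hor n) : ‖d‖ ≤ ∑ j, |d j| := by
  have h1 : d = ∑ j, d j • EuclideanSpace.single j (1 : ℝ) := (sum_single d).symm
  conv_lhs => rw [h1]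
  refine (norm_sum_le _ _).trans (Finset.sum_le_sum fun j _ => ?_)
  rw [norm_smul, PiLp.norm_single, norm_one, mul_one, Real.norm_eq_abs]

theorem tendsto_sum_abs_trace (hΩ : IsOpen Ω) {v : Fin n → Hor n × ℝ → ℝ} {w : Fin n → Hor n → ℝ}
    (h : ∀ j, HasBottomTrace Ω (v j) (w j)) (hc : ∀ j, ContinuousOn (v j) (latCyl Ω)) :
    Tendsto (fun y => eLpNorm (fun x => ∑ j, |v j (x, y) - w j x|) 2 (volume.restrict Ω))
      (𝓝[>] 0 ⊓ ae volume) (𝓝 0) := by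
  have h0 : Tendsto (fun y => ∑ j, eLpNorm (fun x => v j (x, y) - w j x) 2 (volume.restrict Ω))
      (𝓝[>] 0 ⊓ ae volume) (𝓝 0) := by
    have := tendsto_finsetSum (Finset.univ : Finset (Fin n)) fun j _ => (h j).2
    rwa [Finset.sum_const_zero] at this
  refine tendsto_of_tendsto_of_tendsto_of_le_of_le' tendsto_const_nhds h0
    (Eventually.of_forall fun _ => zero_le) ?_
  filter_upwards [eventually_trace_pos] with y hy
  have := eLpNorm_sum_le (μ := volume.restrict Ω) (p := 2) (s := Finset.univ)
    (f := fun j x => ‖v j (x, y) - w j x‖)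
    (fun j _ => ((aestronglyMeasurable_slice hΩ (hc j) hy).sub (h j).1.1).norm) one_le_two
  refine (le_of_eq ?_).trans (this.trans (Finset.sum_le_sum fun j _ => le_of_eq ?_))
  · congr 1
    ext x
    rw [Finset.sum_apply]
    rfl
  · exact eLpNorm_norm _

/-- The norm is 1-Lipschitz, so the error is at most the sum of the errors of the components. -/
theorem HasBottomTrace.norm_toLp (hΩ : IsOpen Ω) {v : Fin n → Hor n × ℝ → ℝ} {w : Fin n → Hor n → ℝ}
    (h : ∀ j, HasBottomTrace Ω (v j) (w j)) (hc : ∀ j, ContinuousOn (v j) (latCyl Ω)) :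
    HasBottomTrace Ω (fun X => ‖(WithLp.toLp 2 fun j => v j X : Hor n)‖)
      (fun x => ‖(WithLp.toLp 2 fun j => w j x : Hor n)‖) := by
  have hwm : AEStronglyMeasurable (fun x => (WithLp.toLp 2 fun j => w j x : Hor n))
      (volume.restrict Ω) :=
    (PiLp.continuous_toLp 2 _).comp_aestronglyMeasurable
      (aemeasurable_pi_iff.2 fun j => (h j).1.1.aemeasurable).aestronglyMeasurable
  have hmem : MemLp (fun x => ‖(WithLp.toLp 2 fun j => w j x : Hor n)‖) 2 (volume.restrict Ω) := by
    have : MemLp (fun x => ∑ j, |w j x|) 2 (volume.restrict Ω) :=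
      memLp_finsetSum _ fun j _ => (h j).1.abs
    refine this.mono hwm.norm (ae_of_all _ fun x => ?_)
    rw [norm_norm, Real.norm_of_nonneg (Finset.sum_nonneg fun j _ => abs_nonneg _)]
    exact norm_le_sum_abs _
  refine HasBottomTrace.of_le hmem (tendsto_sum_abs_trace hΩ h hc) ?_
  refine Eventually.of_forall fun y => ae_of_all _ fun x => ?_
  exact ((abs_norm_sub_norm_le _ _).trans (norm_le_sum_abs _)).trans (le_abs_self _)

end BottomTraces

/-! ### Weak gradients: products and limits. -/

section WeakGradients

variable {n : ℕ} {Ω : Set (Hor n)} {φ φ' : Hor n × ℝ → ℝ} {G G' : Hor n × ℝ → Full n}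

instance isAddHaarMeasure_volume_prod : (volume : Measure (Hor n × ℝ)).IsAddHaarMeasure :=
  inferInstanceAs (((volume : Measure (Hor n)).prod (volume : Measure ℝ)).IsAddHaarMeasure)

theorem MeasureTheory.LocallyIntegrableOn.coord {S : Set (Hor n × ℝ)} (hG : LocallyIntegrableOn G S)
    (i : Fin (n + 1)) : LocallyIntegrableOn (fun X => G X i) S := fun X hX => by
  obtain ⟨U, hU, hi⟩ := hG X hX
  exact ⟨U, hU, (EuclideanSpace.proj (𝕜 := ℝ) i : Full n →L[ℝ] ℝ).integrable_comp hi⟩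

theorem HasWeakGrad.add (h : HasWeakGrad Ω φ G) (h' : HasWeakGrad Ω φ' G') :
    HasWeakGrad Ω (fun X => φ X + φ' X) (fun X => G X + G' X) := by
  refine ⟨h.locInt.add h'.locInt, h.locInt_grad.add h'.locInt_grad, fun η hη hc hs i => ?_⟩
  have hL := IsLineTest.of_contDiff (μ := volume) (U := cyl Ω) (e := coordVec i)
    (hη.of_le (by exact_mod_cast le_top)) hc hs
  have hz : ∀ X ∉ tsupport η, η X = 0 := fun X hX => image_eq_zero_of_notMem_tsupport hX
  have hi : ∀ {r : Hor n × ℝ → ℝ}, LocallyIntegrableOn r (cyl Ω) →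
      IntegrableOn (fun X => r X * η X) (cyl Ω) := fun hr =>
    (integrable_mul_of_tsupport_subset hr hL.compact hL.sub hL.cont.aestronglyMeasurable
      hL.bdd_fun hz).integrableOn
  have hi' : ∀ {r : Hor n × ℝ → ℝ}, LocallyIntegrableOn r (cyl Ω) →
      IntegrableOn (fun X => r X * fderiv ℝ η X (coordVec i)) (cyl Ω) := fun hr =>
    (integrable_mul_of_tsupport_subset hr hL.compact hL.sub hL.meas
      hL.bdd fun X hX => hL.deriv_eq_zero hX).integrableOn
  simp only [add_mul, PiLp.add_apply]
  rw [integral_add (hi' h.locInt) (hi' h'.locInt), integral_add (hi (h.locInt_grad.coord i))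
    (hi (h'.locInt_grad.coord i)), h.integral_eq η hη hc hs i, h'.integral_eq η hη hc hs i]
  ring

theorem HasWeakGrad.zero : HasWeakGrad Ω (fun _ => 0) (fun _ => 0) :=
  ⟨locallyIntegrableOn_zero, locallyIntegrableOn_zero, fun η _ _ _ i => by simp⟩

theorem HasWeakGrad.of_contDiffOn {α : ℝ≥0} (hΩ : IsHolderDomain 4 α Ω) {p : Hor n × ℝ → ℝ}
    (hp : ContDiffOn ℝ 1 p (latCyl Ω)) : HasWeakGrad Ω p (grad (latCyl Ω) p) := by
  have hm := (isOpen_cyl hΩ.isOpen).measurableSet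
  have hg := (continuousOn_grad hΩ.uniqueDiffOn_latCyl hp).mono (cyl_subset_latCyl (Ω := Ω))
  have hpc := hp.continuousOn.mono (cyl_subset_latCyl (Ω := Ω))
  refine ⟨hpc.locallyIntegrableOn hm, hg.locallyIntegrableOn hm, fun η hη hc hs i => ?_⟩
  have hL := IsLineTest.of_contDiff (μ := volume) (U := cyl Ω) (e := coordVec i)
    (hη.of_le (by exact_mod_cast le_top)) hc hs
  refine hL.integral_by_parts (isOpen_cyl hΩ.isOpen) hpc (fun X hX =>
    hasLineDerivAt_pd hp (latCyl_mem_nhds hΩ.isOpen hX) i) ?_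
  exact ((hg.locallyIntegrableOn hm).coord i)

theorem pd_univ {v : Hor n × ℝ → ℝ} {i : Fin (n + 1)} {X : Hor n × ℝ} :
    pd univ v i X = fderiv ℝ v X (coordVec i) := by
  rw [pd, fderivWithin_univ]

theorem continuous_grad_univ {Ψ : Hor n × ℝ → ℝ} (hΨ : ContDiff ℝ 1 Ψ) :
    Continuous (grad univ Ψ) := by
  rw [← continuousOn_univ]
  exact continuousOn_grad uniqueDiffOn_univ hΨ.contDiffOn

theorem HasWeakGrad.mul_smooth (h : HasWeakGrad Ω φ G) {Ψ : Hor n × ℝ → ℝ} (hΨ : ContDiff ℝ ∞ Ψ)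
    (hΩ : IsOpen Ω) :
    HasWeakGrad Ω (fun X => φ X * Ψ X) (fun X => Ψ X • G X + φ X • grad univ Ψ X) := by
  have hΨ1 : ContDiff ℝ 1 Ψ := hΨ.of_le (by exact_mod_cast le_top)
  have ho := isOpen_cyl hΩ
  have hgl : LocallyIntegrableOn (fun X => φ X • grad univ Ψ X) (cyl Ω) :=
    h.locInt.smul_continuousOn ho.isLocallyClosed (continuous_grad_univ hΨ1).continuousOn
  refine ⟨?_, ?_, fun η hη hc hs i => ?_⟩
  · exact h.locInt.mul_continuousOn hΨ.continuous.continuousOn ho.isLocallyClosed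
  · exact (h.locInt_grad.continuousOn_smul ho.isLocallyClosed hΨ.continuous.continuousOn).add hgl
  · have hts : tsupport (fun X => Ψ X * η X) ⊆ tsupport η := tsupport_mul_subset_right
    have hL := IsLineTest.of_contDiff (μ := volume) (U := cyl Ω) (e := coordVec i)
      (hη.of_le (by exact_mod_cast le_top)) hc hs
    have hL' := IsLineTest.of_contDiff (μ := volume) (U := cyl Ω) (e := coordVec i)
      ((hΨ.mul hη).of_le (by exact_mod_cast le_top)) hc.mul_left (hts.trans hs)
    have hz : ∀ X ∉ tsupport η, η X = 0 := fun X hX => image_eq_zero_of_notMem_tsupport hX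
    -- The identity for `φ` is tested with `Ψ η`; the term `φ η ∇Ψ` so produced is the second
    -- summand of the new gradient.
    have h1 := h.integral_eq (fun X => Ψ X * η X) (hΨ.mul hη) hc.mul_left (hts.trans hs) i
    have e1 : ∀ X, fderiv ℝ (fun X => Ψ X * η X) X (coordVec i)
        = Ψ X * fderiv ℝ η X (coordVec i) + η X * fderiv ℝ Ψ X (coordVec i) := fun X => by
      rw [fderiv_fun_mul (hΨ1.differentiable one_ne_zero X)
        ((hη.differentiable (by simp)) X)]
      simp
    have i1 : IntegrableOn (fun X => φ X * fderiv ℝ (fun X => Ψ X * η X) X (coordVec i)) (cyl Ω) :=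
      (integrable_mul_of_tsupport_subset h.locInt hL'.compact hL'.sub hL'.meas hL'.bdd
        fun X hX => hL'.deriv_eq_zero hX).integrableOn
    have i2 : IntegrableOn (fun X => (φ X • grad univ Ψ X) i * η X) (cyl Ω) :=
      (integrable_mul_of_tsupport_subset (hgl.coord i) hL.compact hL.sub
        hL.cont.aestronglyMeasurable hL.bdd_fun hz).integrableOn
    have i3 : IntegrableOn (fun X => G X i * (Ψ X * η X)) (cyl Ω) :=
      (integrable_mul_of_tsupport_subset (h.locInt_grad.coord i) hL'.compact hL'.sub
        hL'.cont.aestronglyMeasurable hL'.bdd_fun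
        fun X hX => image_eq_zero_of_notMem_tsupport (f := fun X => Ψ X * η X) hX).integrableOn
    have e2 : ∫ X in cyl Ω, φ X * Ψ X * fderiv ℝ η X (coordVec i)
        = (∫ X in cyl Ω, φ X * fderiv ℝ (fun X => Ψ X * η X) X (coordVec i))
          - ∫ X in cyl Ω, (φ X • grad univ Ψ X) i * η X := by
      rw [← integral_sub i1 i2]
      refine integral_congr_ae (ae_of_all _ fun X => ?_)
      simp only [e1, PiLp.smul_apply, smul_eq_mul, grad_apply, pd_univ]
      ring
    have e3 : ∫ X in cyl Ω, (Ψ X • G X + φ X • grad univ Ψ X) i * η X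
        = (∫ X in cyl Ω, G X i * (Ψ X * η X)) + ∫ X in cyl Ω, (φ X • grad univ Ψ X) i * η X := by
      rw [← integral_add i3 i2]
      refine integral_congr_ae (ae_of_all _ fun X => ?_)
      simp only [PiLp.add_apply, PiLp.smul_apply, smul_eq_mul]
      ring
    rw [e2, e3, h1]
    ring

/-- Weak gradients pass to dominated pointwise limits. -/
theorem HasWeakGrad.of_tendsto (hΩ : IsOpen Ω) {φs : ℕ → Hor n × ℝ → ℝ}
    {Gs : ℕ → Hor n × ℝ → Full n} (h : ∀ m, HasWeakGrad Ω (φs m) (Gs m)) {b : Hor n × ℝ → ℝ}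
    (hb : LocallyIntegrableOn b (cyl Ω)) (hφb : ∀ m, ∀ X ∈ cyl Ω, |φs m X| ≤ b X)
    (hGb : ∀ m, ∀ X ∈ cyl Ω, ‖Gs m X‖ ≤ b X)
    (hφ : ∀ X ∈ cyl Ω, Tendsto (fun m => φs m X) atTop (𝓝 (φ X)))
    (hG : ∀ X ∈ cyl Ω, Tendsto (fun m => Gs m X) atTop (𝓝 (G X))) : HasWeakGrad Ω φ G := by
  have ho := isOpen_cyl hΩ
  have hmem := ae_restrict_mem (μ := (volume : Measure (Hor n × ℝ))) ho.measurableSet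
  have hφm : AEStronglyMeasurable φ (volume.restrict (cyl Ω)) :=
    aestronglyMeasurable_of_tendsto_ae atTop (fun m => (h m).locInt.aestronglyMeasurable)
      (hmem.mono fun X hX => hφ X hX)
  have hGm : AEStronglyMeasurable G (volume.restrict (cyl Ω)) :=
    aestronglyMeasurable_of_tendsto_ae atTop (fun m => (h m).locInt_grad.aestronglyMeasurable)
      (hmem.mono fun X hX => hG X hX)
  have hφb' : ∀ X ∈ cyl Ω, |φ X| ≤ b X := fun X hX =>
    le_of_tendsto (hφ X hX).abs (Eventually.of_forall fun m => hφb m X hX)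
  have hGb' : ∀ X ∈ cyl Ω, ‖G X‖ ≤ b X := fun X hX =>
    le_of_tendsto (hG X hX).norm (Eventually.of_forall fun m => hGb m X hX)
  have hloc : ∀ {V : Type} [NormedAddCommGroup V] {r : Hor n × ℝ → V},
      AEStronglyMeasurable r (volume.restrict (cyl Ω)) → (∀ X ∈ cyl Ω, ‖r X‖ ≤ b X) →
      LocallyIntegrableOn r (cyl Ω) := by
    intro V _ r hr hrb
    rw [locallyIntegrableOn_iff ho.isLocallyClosed] at hb ⊢
    refine fun k hk hkc => (hb k hk hkc).mono' (hr.mono_measure (Measure.restrict_mono_set _ hk)) ?_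
    exact ae_restrict_of_ae_restrict_of_subset hk (hmem.mono fun X hX => hrb X hX)
  refine ⟨hloc hφm hφb', hloc hGm hGb',
    fun η hη hc hs i => ?_⟩
  · have hL := IsLineTest.of_contDiff (μ := volume) (U := cyl Ω) (e := coordVec i)
      (hη.of_le (by exact_mod_cast le_top)) hc hs
    have hηm : AEStronglyMeasurable (fun X => fderiv ℝ η X (coordVec i)) (volume.restrict (cyl Ω)) :=
      hL.meas.restrict
    have h1 : Tendsto (fun m => ∫ X in cyl Ω, φs m X * fderiv ℝ η X (coordVec i)) atTop
        (𝓝 (∫ X in cyl Ω, φ X * fderiv ℝ η X (coordVec i))) := by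
      refine tendsto_integral_of_dominated_convergence
        (fun X => |b X * fderiv ℝ η X (coordVec i)|)
        (fun m => (h m).locInt.aestronglyMeasurable.mul hηm) ?_
        (fun m => hmem.mono fun X hX => ?_) (hmem.mono fun X hX => (hφ X hX).mul_const _)
      · exact (integrable_mul_of_tsupport_subset hb hL.compact hL.sub hL.meas hL.bdd
          fun X hX => hL.deriv_eq_zero hX).abs.integrableOn
      · rw [norm_mul, abs_mul]
        exact mul_le_mul_of_nonneg_right ((hφb m X hX).trans (le_abs_self _)) (abs_nonneg _)
    have h2 : Tendsto (fun m => ∫ X in cyl Ω, Gs m X i * η X) atTop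
        (𝓝 (∫ X in cyl Ω, G X i * η X)) := by
      refine tendsto_integral_of_dominated_convergence (fun X => |b X * η X|)
        (fun m => ((h m).locInt_grad.coord i).aestronglyMeasurable.mul
          hη.continuous.aestronglyMeasurable) ?_
        (fun m => hmem.mono fun X hX => ?_) (hmem.mono fun X hX => ?_)
      · exact (integrable_mul_of_tsupport_subset hb hL.compact hL.sub
          hL.cont.aestronglyMeasurable hL.bdd_fun
          fun X hX => image_eq_zero_of_notMem_tsupport hX).abs.integrableOn
      · rw [norm_mul, abs_mul]
        exact mul_le_mul_of_nonneg_right (((PiLp.norm_apply_le _ i).trans (hGb m X hX)).trans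
          (le_abs_self _)) (abs_nonneg _)
      · exact (((EuclideanSpace.proj (𝕜 := ℝ) i : Full n →L[ℝ] ℝ).continuous.tendsto _).comp
          (hG X hX)).mul_const _
    refine tendsto_nhds_unique h1 (h2.neg.congr fun m => ?_)
    exact ((h m).integral_eq η hη hc hs i).symm

end WeakGradients

/-! ### Continuous test functions and their products with smooth weights. -/

section TestFunctions

variable {n : ℕ} {α : ℝ≥0} {Ω : Set (Hor n)} {a : ℝ → ℝ → ℝ} {u : Hor n × ℝ → ℝ}

/-- Continuous functions with all properties of a test function except bounded support. -/
structure IsPreTest (Ω : Set (Hor n)) (a : ℝ → ℝ → ℝ) (u φ : Hor n × ℝ → ℝ)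
    (G : Hor n × ℝ → Full n) (φ₀ : Hor n → ℝ) : Prop where
  weakGrad : HasWeakGrad Ω φ G
  wL2 : WL2 Ω a u φ
  wL2_grad : WL2 Ω a u G
  cont : ContinuousOn φ (latCyl Ω)
  trace : HasBottomTrace Ω φ φ₀

theorem WL2.integrableOn_cyl {V : Type*} [NormedAddCommGroup V] {G : Hor n × ℝ → V}
    (hG : WL2 Ω a u G) (hΩ : IsOpen Ω) {R : ℝ} (hR : ∀ X ∈ cyl Ω, R ≤ X.2 → G X = 0) :
    IntegrableOn (fun X => wt Ω a u X * ‖G X‖ ^ 2) (cyl Ω) := by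
  refine IntegrableOn.of_forall_sdiff_eq_zero (hG.int (max R 1) (by positivity))
    (isOpen_cyl hΩ).measurableSet fun X hX => ?_
  have : R ≤ X.2 := by
    by_contra hc
    rw [not_le] at hc
    exact hX.2 ⟨hX.1.1, hX.1.2, hc.trans_le (le_max_left _ _)⟩
  simp [hR X hX.1 this]

theorem IsPreTest.isTest {φ : Hor n × ℝ → ℝ} {G : Hor n × ℝ → Full n} {φ₀ : Hor n → ℝ}
    (h : IsPreTest Ω a u φ G φ₀) (hΩ : IsOpen Ω) {R : ℝ} (hφ : ∀ X ∈ cyl Ω, R ≤ X.2 → φ X = 0)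
    (hG : ∀ X ∈ cyl Ω, R ≤ X.2 → G X = 0) : IsTest Ω a u φ G φ₀ :=
  ⟨h.weakGrad, ⟨R, (ae_restrict_mem (isOpen_cyl hΩ).measurableSet).mono fun X hX => hφ X hX⟩,
    h.wL2_grad.integrableOn_cyl hΩ hG, h.trace⟩

variable (hu : IsRegularSol Ω a u) (hΩ : IsHolderDomain 4 α Ω) (ha : IsDiffusion a)

include hu hΩ ha

theorem IsPreTest.add {φ φ' : Hor n × ℝ → ℝ} {G G' : Hor n × ℝ → Full n} {φ₀ φ₀' : Hor n → ℝ}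
    (h : IsPreTest Ω a u φ G φ₀) (h' : IsPreTest Ω a u φ' G' φ₀') :
    IsPreTest Ω a u (fun X => φ X + φ' X) (fun X => G X + G' X) (fun x => φ₀ x + φ₀' x) :=
  ⟨h.weakGrad.add h'.weakGrad, WL2.add hu hΩ ha h.wL2 h'.wL2,
    WL2.add hu hΩ ha h.wL2_grad h'.wL2_grad, h.cont.add h'.cont,
    h.trace.add hΩ.isOpen h'.trace h.cont h'.cont⟩

omit hu hΩ ha in
theorem IsPreTest.zero : IsPreTest Ω a u (fun _ => 0) (fun _ => 0) (fun _ => 0) :=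
  ⟨HasWeakGrad.zero, WL2.zero, WL2.zero, continuousOn_const, HasBottomTrace.zero⟩

theorem IsPreTest.sum {ι : Type*} (s : Finset ι) {φ : ι → Hor n × ℝ → ℝ}
    {G : ι → Hor n × ℝ → Full n} {φ₀ : ι → Hor n → ℝ}
    (h : ∀ i ∈ s, IsPreTest Ω a u (φ i) (G i) (φ₀ i)) :
    IsPreTest Ω a u (fun X => ∑ i ∈ s, φ i X) (fun X => ∑ i ∈ s, G i X)
      (fun x => ∑ i ∈ s, φ₀ i x) := by
  classical
  induction s using Finset.induction_on with
  | empty => simpa using IsPreTest.zero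
  | insert i s hi ih =>
    simp only [Finset.sum_insert hi]
    exact IsPreTest.add hu hΩ ha (h i (Finset.mem_insert_self _ _))
      (ih fun k hk => h k (Finset.mem_insert_of_mem hk))

theorem IsPreTest.mul_smooth {φ : Hor n × ℝ → ℝ} {G : Hor n × ℝ → Full n} {φ₀ : Hor n → ℝ}
    (h : IsPreTest Ω a u φ G φ₀) {Ψ : Hor n × ℝ → ℝ} (hΨ : ContDiff ℝ ∞ Ψ)
    (hc : HasCompactSupport Ψ) :
    IsPreTest Ω a u (fun X => φ X * Ψ X) (fun X => Ψ X • G X + φ X • grad univ Ψ X)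
      (fun x => φ₀ x * Ψ (x, 0)) := by
  have hΨ1 : ContDiff ℝ 1 Ψ := hΨ.of_le (by exact_mod_cast le_top)
  obtain ⟨M, hM⟩ := hc.exists_bound_of_continuous hΨ.continuous
  have hgc : HasCompactSupport (grad univ Ψ) := by
    refine hc.mono' fun X hX => ?_
    by_contra hn
    apply hX
    ext i
    rw [grad_apply, pd_univ, fderiv_of_notMem_tsupport ℝ hn]
    simp
  obtain ⟨M', hM'⟩ := hgc.exists_bound_of_continuous (continuous_grad_univ hΨ1)
  refine ⟨h.weakGrad.mul_smooth hΨ hΩ.isOpen, ?_, ?_, h.cont.mul hΨ.continuous.continuousOn, ?_⟩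
  · have := WL2.bdd_smul hu hΩ ha h.wL2 hΨ.continuous.aestronglyMeasurable fun X _ => hM X
    simpa [mul_comm] using this
  · exact WL2.add hu hΩ ha (WL2.bdd_smul hu hΩ ha h.wL2_grad hΨ.continuous.aestronglyMeasurable
      fun X _ => hM X) (WL2.smul_bdd hu hΩ ha h.wL2
        (continuous_grad_univ hΨ1).aestronglyMeasurable fun X _ => hM' X)
  · exact h.trace.mul_continuousOn hΩ.isOpen hΩ.isCompact_closure h.cont
      hΨ.continuous.continuousOn

theorem isPreTest_uD {j : Fin n} {w : Hor n → ℝ} (hw : HasBottomTrace Ω (uD Ω u j.castSucc) w) :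
    IsPreTest Ω a u (uD Ω u j.castSucc) (grad (latCyl Ω) (uD Ω u j.castSucc)) w :=
  ⟨HasWeakGrad.of_contDiffOn hΩ (hu.contDiffOn_uD hΩ _), wL2_uD hu hΩ ha _, wL2_grad_uD hu hΩ ha _,
    hu.continuousOn_uD hΩ _, hw⟩

theorem isPreTest_uDD {i j : Fin n} {w : Hor n → ℝ}
    (hw : HasBottomTrace Ω (uDD Ω u i.castSucc j.castSucc) w) {T : Hor n × ℝ → Full n}
    (hT : HasWeakGrad Ω (uDD Ω u i.castSucc j.castSucc) T) (hT2 : WL2 Ω a u T) :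
    IsPreTest Ω a u (uDD Ω u i.castSucc j.castSucc) T w :=
  ⟨hT, wL2_uDD hu hΩ ha i _, hT2, hu.continuousOn_uDD hΩ _ _, hw⟩

end TestFunctions

/-! ### The function `|∇ₓu|` as a factor of test functions. -/

section NormOfGradient

variable {n : ℕ} {α : ℝ≥0} {Ω : Set (Hor n)} {a : ℝ → ℝ → ℝ} {u : Hor n × ℝ → ℝ}
  {X : Hor n × ℝ}

theorem norm_gradX_eq_sqrt {S : Set (Hor n × ℝ)} {v : Hor n × ℝ → ℝ} :
    ‖gradX S v X‖ = √(∑ j : Fin n, pd S v j.castSucc X ^ 2) := by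
  rw [← norm_gradX_sq, Real.sqrt_sq (norm_nonneg _)]

theorem pd_of_hasFDerivAt {S : Set (Hor n × ℝ)} {v : Hor n × ℝ → ℝ} {L : Hor n × ℝ →L[ℝ] ℝ}
    (hv : HasFDerivAt v L X) (hS : S ∈ 𝓝 X) (i : Fin (n + 1)) : pd S v i X = L (coordVec i) := by
  rw [pd, fderivWithin_of_mem_nhds hS, hv.fderiv]

variable (hu : IsRegularSol Ω a u) (hΩ : IsHolderDomain 4 α Ω)

include hu hΩ

/-- Taking `c = 0` gives the derivative of `|∇ₓu|` away from its zeros; a constant `c > 0` gives a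
regularization that is differentiable everywhere in the cylinder. -/
theorem IsRegularSol.hasFDerivAt_sqrt {c : ℝ} (hX : X ∈ cyl Ω)
    (hpos : ∑ j : Fin n, uD Ω u j.castSucc X ^ 2 + c ≠ 0) :
    HasFDerivAt (fun Z => √(∑ j : Fin n, uD Ω u j.castSucc Z ^ 2 + c))
      ((√(∑ j : Fin n, uD Ω u j.castSucc X ^ 2 + c))⁻¹ •
        ∑ j : Fin n, uD Ω u j.castSucc X • fderivWithin ℝ (uD Ω u j.castSucc) (latCyl Ω) X) X := by
  have h1 : HasFDerivAt (fun Z => ∑ j : Fin n, uD Ω u j.castSucc Z ^ 2 + c)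
      ((2 : ℝ) • ∑ j : Fin n, uD Ω u j.castSucc X •
        fderivWithin ℝ (uD Ω u j.castSucc) (latCyl Ω) X) X := by
    refine HasFDerivAt.add_const c ?_
    rw [Finset.smul_sum]
    refine HasFDerivAt.fun_sum fun j _ => ?_
    have := (hasFDerivAt_of_contDiffOn (hu.contDiffOn_uD hΩ j.castSucc)
      (latCyl_mem_nhds hΩ.isOpen hX)).pow 2
    refine this.congr_fderiv ?_
    rw [smul_smul, pow_one, nsmul_eq_mul, Nat.cast_ofNat]
  refine (h1.sqrt hpos).congr_fderiv ?_
  rw [smul_smul]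
  congr 1
  field_simp

/-- The gradient of `|∇ₓu|`. -/
theorem IsRegularSol.grad_norm_gradX (hX : X ∈ cyl Ω) :
    grad (latCyl Ω) (fun Z => ‖gradX (latCyl Ω) u Z‖) X = ‖gradX (latCyl Ω) u X‖⁻¹ •
      ∑ j : Fin n, uD Ω u j.castSucc X • grad (latCyl Ω) (uD Ω u j.castSucc) X := by
  have hS := latCyl_mem_nhds hΩ.isOpen hX
  by_cases h0 : gradX (latCyl Ω) u X = 0
  -- At a zero of `∇ₓu` the norm has a minimum, so its derivative is zero, be it genuine or the
  -- default value. The right side is zero as well because `0⁻¹ = 0`; hence the formula needs no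
  -- case distinction.
  · rw [h0, norm_zero, inv_zero, zero_smul]
    ext i
    rw [grad_apply, pd, fderivWithin_of_mem_nhds hS]
    have hmin : IsLocalMin (fun Z => ‖gradX (latCyl Ω) u Z‖) X :=
      Eventually.of_forall fun Z => by simp [h0]
    rw [hmin.fderiv_eq_zero]
    rfl
  · have hne : ∑ j : Fin n, uD Ω u j.castSucc X ^ 2 + 0 ≠ 0 := by
      rw [add_zero]
      have : ‖gradX (latCyl Ω) u X‖ ^ 2 ≠ 0 := by simpa using h0
      rwa [norm_gradX_sq] at this
    have h1 := hu.hasFDerivAt_sqrt hΩ (c := 0) hX hne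
    simp only [add_zero] at h1
    have h2 : (fun Z => √(∑ j : Fin n, uD Ω u j.castSucc Z ^ 2))
        = fun Z => ‖gradX (latCyl Ω) u Z‖ := by
      ext Z; rw [norm_gradX_eq_sqrt]; rfl
    have h3 : √(∑ j : Fin n, uD Ω u j.castSucc X ^ 2) = ‖gradX (latCyl Ω) u X‖ := congrFun h2 X
    rw [h2, h3] at h1
    ext i
    rw [grad_apply, pd_of_hasFDerivAt h1 hS]
    simp [grad, pd]

/-- This is half the gradient of `|∇ₓu|²`. Unlike the formula for `∇|∇ₓu|` it contains no quotient,
and it identifies the cross term of the linearized equation with that of the stability form. -/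
theorem IsRegularSol.norm_gradX_smul_grad (hX : X ∈ cyl Ω) :
    ‖gradX (latCyl Ω) u X‖ • grad (latCyl Ω) (fun Z => ‖gradX (latCyl Ω) u Z‖) X =
      ∑ j : Fin n, uD Ω u j.castSucc X • grad (latCyl Ω) (uD Ω u j.castSucc) X := by
  rw [hu.grad_norm_gradX hΩ hX, smul_smul]
  by_cases h0 : gradX (latCyl Ω) u X = 0
  · have : ∀ j : Fin n, uD Ω u j.castSucc X = 0 := fun j => by
      have := congrArg (fun v : Hor n => v j) h0
      simpa [gradX_apply, uD] using this
    simp [this]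
  · rw [mul_inv_cancel₀ (norm_ne_zero_iff.2 h0), one_smul]

omit hu hΩ in
theorem abs_uD_le_norm_gradX (j : Fin n) : |uD Ω u j.castSucc X| ≤ ‖gradX (latCyl Ω) u X‖ := by
  have := PiLp.norm_apply_le (gradX (latCyl Ω) u X) j
  simpa [gradX_apply, uD] using this

theorem IsRegularSol.norm_grad_norm_gradX_le (hX : X ∈ cyl Ω) :
    ‖grad (latCyl Ω) (fun Z => ‖gradX (latCyl Ω) u Z‖) X‖
      ≤ ∑ j : Fin n, ‖grad (latCyl Ω) (uD Ω u j.castSucc) X‖ := by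
  rw [hu.grad_norm_gradX hΩ hX, norm_smul, norm_inv, norm_norm, ← div_eq_inv_mul]
  refine div_le_of_le_mul₀ (norm_nonneg _) (Finset.sum_nonneg fun _ _ => norm_nonneg _) ?_
  refine (norm_sum_le _ _).trans ?_
  rw [Finset.sum_mul]
  refine Finset.sum_le_sum fun j _ => ?_
  rw [norm_smul, mul_comm]
  exact mul_le_mul_of_nonneg_left (abs_uD_le_norm_gradX j) (norm_nonneg _)

/-- The weak gradient of `|∇ₓu| ψ`. -/
theorem IsRegularSol.hasWeakGrad_norm_mul {ψ : Hor n × ℝ → ℝ}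
    (hψ : ContDiffOn ℝ 1 ψ (closedCyl Ω)) :
    HasWeakGrad Ω (fun X => ‖gradX (latCyl Ω) u X‖ * ψ X)
      (fun X => ψ X • grad (latCyl Ω) (fun Z => ‖gradX (latCyl Ω) u Z‖) X
        + ‖gradX (latCyl Ω) u X‖ • grad (closedCyl Ω) ψ X) := by
  have hcm := (isOpen_cyl hΩ.isOpen).measurableSet
  have hψl : ContDiffOn ℝ 1 ψ (latCyl Ω) := hψ.mono latCyl_subset_closedCyl
  have hψg : ∀ X ∈ cyl Ω, grad (latCyl Ω) ψ X = grad (closedCyl Ω) ψ X := fun X hX => by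
    ext i
    rw [grad_apply, grad_apply, pd, pd, fderivWithin_of_mem_nhds (latCyl_mem_nhds hΩ.isOpen hX),
      fderivWithin_of_mem_nhds (closedCyl_mem_nhds hΩ.isOpen hX)]
  -- The norm is regularized to a function of class `C¹`. The regularized products have classical
  -- gradients, and these pass to the limit as weak gradients by domination.
  let N : ℕ → Hor n × ℝ → ℝ := fun m X => √(∑ j : Fin n, uD Ω u j.castSucc X ^ 2 + (1 / (m + 1 : ℝ)) ^ 2)
  have hp : ∀ m : ℕ, (0 : ℝ) < 1 / (m + 1 : ℝ) := fun m => by positivity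
  have hNpos : ∀ (m : ℕ) X, 0 < ∑ j : Fin n, uD Ω u j.castSucc X ^ 2 + (1 / (m + 1 : ℝ)) ^ 2 := fun m X =>
    add_pos_of_nonneg_of_pos (Finset.sum_nonneg fun j _ => sq_nonneg _) (pow_pos (hp m) 2)
  have hsum : ∀ X, ∑ j : Fin n, uD Ω u j.castSucc X ^ 2 = ‖gradX (latCyl Ω) u X‖ ^ 2 := fun X =>
    norm_gradX_sq.symm
  have hNge : ∀ m X, ‖gradX (latCyl Ω) u X‖ ≤ N m X := fun m X => by
    refine Real.le_sqrt_of_sq_le ?_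
    rw [hsum]
    linarith [sq_nonneg (1 / (m + 1 : ℝ))]
  have hNle : ∀ m X, N m X ≤ ‖gradX (latCyl Ω) u X‖ + 1 := fun m X => by
    refine Real.sqrt_le_iff.2 ⟨by positivity, ?_⟩
    rw [hsum]
    have h1 : 1 / (m + 1 : ℝ) ≤ 1 := by
      rw [div_le_one (by positivity)]; linarith [Nat.cast_nonneg (α := ℝ) m]
    nlinarith [norm_nonneg (gradX (latCyl Ω) u X), hp m]
  have hNc : ∀ m, ContDiffOn ℝ 1 (N m) (latCyl Ω) := fun m =>
    ((ContDiffOn.sum fun j _ => (hu.contDiffOn_uD hΩ _).pow 2).add contDiffOn_const).sqrt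
      fun X _ => (hNpos m X).ne'
  let Gs : ℕ → Hor n × ℝ → Full n := fun m X => ψ X • ((N m X)⁻¹ •
      ∑ j : Fin n, uD Ω u j.castSucc X • grad (latCyl Ω) (uD Ω u j.castSucc) X)
    + N m X • grad (closedCyl Ω) ψ X
  have hgrad : ∀ m, ∀ X ∈ cyl Ω, grad (latCyl Ω) (fun Z => N m Z * ψ Z) X = Gs m X := by
    intro m X hX
    have hS := latCyl_mem_nhds hΩ.isOpen hX
    have h1 := (hu.hasFDerivAt_sqrt hΩ hX (hNpos m X).ne').mul (hasFDerivAt_of_contDiffOn hψl hS)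
    ext i
    rw [grad_apply]
    refine (pd_of_hasFDerivAt h1 hS i).trans ?_
    simp only [Gs]
    rw [← hψg X hX]
    simp [grad, pd, N]
    ring
  have hgc : ContinuousOn (grad (closedCyl Ω) ψ) (latCyl Ω) :=
    (continuousOn_grad hΩ.uniqueDiffOn_closedCyl hψ).mono latCyl_subset_closedCyl
  -- A continuous majorant, uniform in `m`, because `N m ≤ |∇ₓu| + 1` and `|u_{x_j}| ≤ N m`.
  let b : Hor n × ℝ → ℝ := fun X => (‖gradX (latCyl Ω) u X‖ + 1) * |ψ X|
    + (|ψ X| * ∑ j : Fin n, ‖grad (latCyl Ω) (uD Ω u j.castSucc) X‖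
      + (‖gradX (latCyl Ω) u X‖ + 1) * ‖grad (closedCyl Ω) ψ X‖)
  have hbc : ContinuousOn b (latCyl Ω) := by
    have h1 := (hu.continuousOn_gradX hΩ).norm.add (continuousOn_const (c := (1 : ℝ)))
    have h2 : ContinuousOn (fun X => |ψ X|) (latCyl Ω) := hψl.continuousOn.abs
    have h3 : ContinuousOn (fun X => ∑ j : Fin n, ‖grad (latCyl Ω) (uD Ω u j.castSucc) X‖)
        (latCyl Ω) := continuousOn_finsetSum _ fun j _ => (hu.continuousOn_grad_uD hΩ _).norm
    exact (h1.mul h2).add ((h2.mul h3).add (h1.mul hgc.norm))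
  have hNlim : ∀ X, Tendsto (fun m => N m X) atTop (𝓝 ‖gradX (latCyl Ω) u X‖) := fun X => by
    have h1 : Tendsto (fun m : ℕ => 1 / (m + 1 : ℝ)) atTop (𝓝 0) :=
      tendsto_one_div_add_atTop_nhds_zero_nat
    have h2 := ((h1.pow 2).const_add (∑ j : Fin n, uD Ω u j.castSucc X ^ 2)).sqrt
    simpa [hsum, Real.sqrt_sq (norm_nonneg _), N] using h2
  refine HasWeakGrad.of_tendsto hΩ.isOpen (φs := fun m X => N m X * ψ X) (Gs := fun m => Gs m)
    (b := b) (fun m => ?_) ((hbc.mono cyl_subset_latCyl).locallyIntegrableOn hcm)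
    (fun m X hX => ?_) (fun m X hX => ?_) (fun X hX => (hNlim X).mul_const _) (fun X hX => ?_)
  · have h1 := HasWeakGrad.of_contDiffOn hΩ ((hNc m).mul hψl)
    refine ⟨h1.locInt, ?_, fun η hη hc hs i => ?_⟩
    · exact h1.locInt_grad.congr ((ae_restrict_mem hcm).mono fun X hX => hgrad m X hX)
    · rw [h1.integral_eq η hη hc hs i]
      congr 1
      refine setIntegral_congr_fun hcm fun X hX => ?_
      beta_reduce
      rw [hgrad m X hX]
  · rw [abs_mul, abs_of_nonneg (Real.sqrt_nonneg _)]
    have h1 := mul_le_mul_of_nonneg_right (hNle m X) (abs_nonneg (ψ X))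
    have h2 : 0 ≤ |ψ X| * ∑ j : Fin n, ‖grad (latCyl Ω) (uD Ω u j.castSucc) X‖
      + (‖gradX (latCyl Ω) u X‖ + 1) * ‖grad (closedCyl Ω) ψ X‖ := by positivity
    exact h1.trans (le_add_of_nonneg_right h2)
  · have h0 : 0 ≤ (‖gradX (latCyl Ω) u X‖ + 1) * |ψ X| := by positivity
    refine le_trans ?_ (le_add_of_nonneg_left h0)
    refine (norm_add_le _ _).trans (add_le_add ?_ ?_)
    · rw [norm_smul, Real.norm_eq_abs]
      refine mul_le_mul_of_nonneg_left ?_ (abs_nonneg _)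
      have hN0 : 0 < N m X := Real.sqrt_pos.2 (hNpos m X)
      rw [norm_smul, norm_inv, Real.norm_of_nonneg hN0.le, ← div_eq_inv_mul, div_le_iff₀ hN0,
        Finset.sum_mul]
      refine (norm_sum_le _ _).trans (Finset.sum_le_sum fun j _ => ?_)
      rw [norm_smul, mul_comm]
      exact mul_le_mul_of_nonneg_left ((abs_uD_le_norm_gradX j).trans (hNge m X))
        (norm_nonneg _)
    · rw [norm_smul, Real.norm_of_nonneg (Real.sqrt_nonneg _)]
      exact mul_le_mul_of_nonneg_right (hNle m X) (norm_nonneg _)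
  · refine Tendsto.add (Tendsto.const_smul ?_ _) ((hNlim X).smul_const _)
    -- At zeros of `∇ₓu` the sum vanishes for every `m`, so the divergence of `(N m)⁻¹` there is
    -- harmless.
    by_cases h0 : gradX (latCyl Ω) u X = 0
    · have h1 : ∀ j : Fin n, uD Ω u j.castSucc X = 0 := fun j => by
        have := congrArg (fun v : Hor n => v j) h0
        simpa [gradX_apply, uD] using this
      rw [hu.grad_norm_gradX hΩ hX]
      simp [h1]
    · rw [hu.grad_norm_gradX hΩ hX]
      exact ((hNlim X).inv₀ (norm_ne_zero_iff.2 h0)).smul_const _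

omit hu hΩ in
theorem grad_eq_zero_of_support {ψ : Hor n × ℝ → ℝ} {R : ℝ}
    (hR : ∀ X ∈ closedCyl Ω, R ≤ X.2 → ψ X = 0) (hX : X ∈ closedCyl Ω) (hXR : R < X.2) :
    grad (closedCyl Ω) ψ X = 0 := by
  have hev : ψ =ᶠ[𝓝[closedCyl Ω] X] fun _ => 0 := by
    have h1 : ∀ᶠ Z in 𝓝[closedCyl Ω] X, R < Z.2 :=
      nhdsWithin_le_nhds ((continuous_snd.tendsto X).eventually_const_lt hXR)
    filter_upwards [h1, self_mem_nhdsWithin] with Z hZ hZc using hR Z hZc hZ.le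
  ext i
  rw [grad_apply, pd, hev.fderivWithin_eq (hR X hX hXR.le)]
  simp

omit hu in
theorem exists_bound_of_support {ψ : Hor n × ℝ → ℝ} (hψ : ContDiffOn ℝ 1 ψ (closedCyl Ω)) {R : ℝ}
    (hR : ∀ X ∈ closedCyl Ω, R ≤ X.2 → ψ X = 0) :
    ∃ M, 0 ≤ M ∧ ∀ X ∈ closedCyl Ω, |ψ X| ≤ M ∧ ‖grad (closedCyl Ω) ψ X‖ ≤ M := by
  have hK : IsCompact (closure Ω ×ˢ Icc 0 R) := hΩ.isCompact_closure.prod isCompact_Icc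
  have hsub : closure Ω ×ˢ Icc 0 R ⊆ closedCyl Ω := prod_mono subset_rfl fun y hy => hy.1
  obtain ⟨M, hM⟩ := hK.exists_bound_of_continuousOn (hψ.continuousOn.mono hsub)
  obtain ⟨M', hM'⟩ := hK.exists_bound_of_continuousOn
    ((continuousOn_grad hΩ.uniqueDiffOn_closedCyl hψ).mono hsub)
  refine ⟨max 0 (max M M'), le_max_left _ _, fun X hX => ?_⟩
  rcases le_or_gt X.2 R with h | h
  · have hXK : X ∈ closure Ω ×ˢ Icc 0 R := ⟨hX.1, hX.2, h⟩
    exact ⟨(hM X hXK).trans ((le_max_left _ _).trans (le_max_right _ _)),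
      (hM' X hXK).trans ((le_max_right _ _).trans (le_max_right _ _))⟩
  · rw [hR X hX h.le, grad_eq_zero_of_support hR hX h]
    simp

omit hu hΩ in
theorem WL2.norm (hu : IsRegularSol Ω a u) (hΩ : IsHolderDomain 4 α Ω) (ha : IsDiffusion a)
    {V : Type*} [NormedAddCommGroup V] {p : Hor n × ℝ → V} (hp : WL2 Ω a u p) :
    WL2 Ω a u (fun X => ‖p X‖) :=
  WL2.of_le hu hΩ ha hp hp.meas.norm (C := 1) (ae_of_all _ fun X => by simp)

theorem wL2_grad_norm_gradX (ha : IsDiffusion a) :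
    WL2 Ω a u (grad (latCyl Ω) fun Z => ‖gradX (latCyl Ω) u Z‖) := by
  have hmem := ae_restrict_mem (μ := (volume : Measure (Hor n × ℝ)))
    (isOpen_cyl hΩ.isOpen).measurableSet
  refine WL2.of_le hu hΩ ha (q := fun X => ∑ j : Fin n, ‖grad (latCyl Ω) (uD Ω u j.castSucc) X‖)
    (WL2.sum hu hΩ ha _ fun j _ => WL2.norm hu hΩ ha (wL2_grad_uD hu hΩ ha j)) ?_ (C := 1)
    (hmem.mono fun X hX => ?_)
  · have h1 : AEStronglyMeasurable (fun X => ‖gradX (latCyl Ω) u X‖⁻¹ •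
        ∑ j : Fin n, uD Ω u j.castSucc X • grad (latCyl Ω) (uD Ω u j.castSucc) X)
        (volume.restrict (cyl Ω)) := by
      have h2 : ContinuousOn (fun X => ∑ j : Fin n, uD Ω u j.castSucc X •
          grad (latCyl Ω) (uD Ω u j.castSucc) X) (latCyl Ω) := continuousOn_finsetSum _ fun j _ =>
        (hu.continuousOn_uD hΩ _).smul (hu.continuousOn_grad_uD hΩ _)
      have h3 : AEStronglyMeasurable (fun X => ‖gradX (latCyl Ω) u X‖⁻¹)
          (volume.restrict (cyl Ω)) :=
        (aestronglyMeasurable_cyl_of_continuousOn hΩ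
          (hu.continuousOn_gradX hΩ).norm).aemeasurable.inv.aestronglyMeasurable
      exact h3.smul (aestronglyMeasurable_cyl_of_continuousOn hΩ h2)
    exact h1.congr (hmem.mono fun X hX => (hu.grad_norm_gradX hΩ hX).symm)
  · rw [one_mul, Real.norm_of_nonneg (Finset.sum_nonneg fun _ _ => norm_nonneg _)]
    exact hu.norm_grad_norm_gradX_le hΩ hX

/-- The function `|∇ₓu| ψ` is a test function. -/
theorem IsRegularSol.isTest_norm_mul (ha : IsDiffusion a) {ψ : Hor n × ℝ → ℝ}
    (hψ : ContDiffOn ℝ 1 ψ (closedCyl Ω)) {R : ℝ} (hR : ∀ X ∈ closedCyl Ω, R ≤ X.2 → ψ X = 0)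
    {w : Fin n → Hor n → ℝ} (hw : ∀ j : Fin n, HasBottomTrace Ω (uD Ω u j.castSucc) (w j)) :
    IsTest Ω a u (fun X => ‖gradX (latCyl Ω) u X‖ * ψ X)
      (fun X => ψ X • grad (latCyl Ω) (fun Z => ‖gradX (latCyl Ω) u Z‖) X
        + ‖gradX (latCyl Ω) u X‖ • grad (closedCyl Ω) ψ X)
      (fun x => ‖(WithLp.toLp 2 fun j => w j x : Hor n)‖ * ψ (x, 0)) := by
  obtain ⟨M, hM0, hM⟩ := exists_bound_of_support hΩ hψ hR
  have hψm := aestronglyMeasurable_cyl_of_continuousOn hΩ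
    (hψ.continuousOn.mono latCyl_subset_closedCyl)
  have hψg := aestronglyMeasurable_cyl_of_continuousOn hΩ
    ((continuousOn_grad hΩ.uniqueDiffOn_closedCyl hψ).mono latCyl_subset_closedCyl)
  refine ⟨hu.hasWeakGrad_norm_mul hΩ hψ, ⟨R, ?_⟩, ?_, ?_⟩
  · filter_upwards [ae_restrict_mem (isOpen_cyl hΩ.isOpen).measurableSet] with X hX hXR
    rw [hR X (cyl_subset_closedCyl hX) hXR, mul_zero]
  · have h1 := WL2.bdd_smul hu hΩ ha (wL2_grad_norm_gradX hu hΩ ha) hψm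
      fun X hX => (hM X (cyl_subset_closedCyl hX)).1
    have h2 := WL2.smul_bdd hu hΩ ha (WL2.norm hu hΩ ha (wL2_gradX hu hΩ ha)) hψg
      fun X hX => (hM X (cyl_subset_closedCyl hX)).2
    refine (WL2.add hu hΩ ha h1 h2).integrableOn_cyl hΩ.isOpen (R := R + 1) fun X hX hXR => ?_
    have hXc := cyl_subset_closedCyl hX
    rw [hR X hXc (by linarith), grad_eq_zero_of_support hR hXc (by linarith)]
    simp
  · exact (HasBottomTrace.norm_toLp hΩ.isOpen hw fun j => hu.continuousOn_uD hΩ _).mul_continuousOn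
      hΩ.isOpen hΩ.isCompact_closure (hu.continuousOn_gradX hΩ).norm hψ.continuousOn

end NormOfGradient

/-! ### Preimages of null sets, and averages of Lipschitz functions. -/

section LevelSets

variable {n : ℕ}

theorem coord_null {N : Set ℝ} (hN : (volume : Measure ℝ) N = 0) (j : Fin n) :
    (volume : Measure (Hor n)) {z | z j ∈ N} = 0 := by
  have h1 : (volume : Measure (Fin n → ℝ)) (Function.eval j ⁻¹' N) = 0 :=
    Measure.pi_eval_preimage_null (μ := fun _ : Fin n => (volume : Measure ℝ)) hN
  exact (PiLp.volume_preserving_ofLp (Fin n)).quasiMeasurePreserving.preimage_null h1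

/-- Preimages of null sets under a `C¹` function are null away from the critical points. -/
theorem preimage_null_of_fderiv_ne_zero {U : Set (Hor n)} (hU : IsOpen U) {v : Hor n → ℝ}
    (hv : ContDiffOn ℝ 1 v U) {N : Set ℝ} (hN : (volume : Measure ℝ) N = 0) :
    (volume : Measure (Hor n)) {x | x ∈ U ∧ fderiv ℝ v x ≠ 0 ∧ v x ∈ N} = 0 := by
  refine measure_null_of_locally_null _ fun x₀ hx₀ => ?_
  obtain ⟨hxU, hne, -⟩ := hx₀
  obtain ⟨j, hj⟩ : ∃ j : Fin n, fderiv ℝ v x₀ (EuclideanSpace.single j 1) ≠ 0 := by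
    by_contra hc
    push Not at hc
    apply hne
    ext w
    rw [← sum_single w, map_sum]
    simp [hc]
  set e : Hor n := EuclideanSpace.single j 1 with he
  -- Replacing the `j`-th coordinate by `v` is a local diffeomorphism where `∂_j v ≠ 0`. It carries
  -- the set in question into the null set `{z | z j ∈ N}`, and the differentiable local inverse
  -- maps null sets to null sets.
  let Φ : Hor n → Hor n := fun x => x + (v x - x j) • e
  have hvx : ContDiffAt ℝ 1 v x₀ := hv.contDiffAt (hU.mem_nhds hxU)
  have hΦ : ContDiffAt ℝ 1 Φ x₀ := by
    refine contDiffAt_id.add ((hvx.sub ?_).smul contDiffAt_const)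
    exact (EuclideanSpace.proj (𝕜 := ℝ) j : Hor n →L[ℝ] ℝ).contDiff.contDiffAt
  let L : Hor n →L[ℝ] Hor n := ContinuousLinearMap.id ℝ (Hor n) +
    (fderiv ℝ v x₀ - (EuclideanSpace.proj (𝕜 := ℝ) j : Hor n →L[ℝ] ℝ)).smulRight e
  have hL : HasFDerivAt Φ L x₀ := by
    refine (hasFDerivAt_id x₀).add (HasFDerivAt.smul_const ?_ e)
    exact (hvx.differentiableAt one_ne_zero).hasFDerivAt.sub
      (EuclideanSpace.proj (𝕜 := ℝ) j : Hor n →L[ℝ] ℝ).hasFDerivAt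
  have hLi : Function.Injective (L : Hor n →ₗ[ℝ] Hor n) := by
    rw [← LinearMap.ker_eq_bot, LinearMap.ker_eq_bot']
    intro ξ hξ
    have h1 : ξ + (fderiv ℝ v x₀ ξ - ξ j) • e = 0 := hξ
    have h2 : ξ = (-(fderiv ℝ v x₀ ξ - ξ j)) • e := by
      rw [neg_smul]; exact eq_neg_of_add_eq_zero_left h1
    set c := -(fderiv ℝ v x₀ ξ - ξ j) with hc
    have h3 : ξ j = c := by rw [h2, he]; simp
    have h4 : fderiv ℝ v x₀ ξ = c * fderiv ℝ v x₀ e := by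
      conv_lhs => rw [h2]
      rw [map_smul, smul_eq_mul]
    have h5 : c * fderiv ℝ v x₀ e = 0 := by rw [← h4]; linarith
    rcases mul_eq_zero.1 h5 with h6 | h6
    · rw [h2, h6, zero_smul]
    · exact absurd h6 hj
  let L' : Hor n ≃L[ℝ] Hor n := (LinearEquiv.ofInjectiveEndo _ hLi).toContinuousLinearEquiv
  have hL' : HasFDerivAt Φ (L' : Hor n →L[ℝ] Hor n) x₀ := by
    convert hL
    ext1 w
    rfl
  set ι := hΦ.localInverse hL' one_ne_zero with hι
  have hιd : ∀ᶠ z in 𝓝 (Φ x₀), DifferentiableAt ℝ ι z := by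
    filter_upwards [(hΦ.to_localInverse hL' one_ne_zero).eventually (by simp)] with z hz
    exact hz.differentiableAt one_ne_zero
  have hinv : ∀ᶠ x in 𝓝 x₀, ι (Φ x) = x :=
    (hΦ.hasStrictFDerivAt' hL' one_ne_zero).eventually_left_inverse
  have hd : ∀ᶠ x in 𝓝 x₀, DifferentiableAt ℝ ι (Φ x) := hΦ.continuousAt.eventually hιd
  refine ⟨{x | x ∈ U ∧ fderiv ℝ v x ≠ 0 ∧ v x ∈ N} ∩ {x | ι (Φ x) = x ∧ DifferentiableAt ℝ ι (Φ x)},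
    inter_mem_nhdsWithin _ (hinv.and hd), ?_⟩
  have hS : (volume : Measure (Hor n)) ({z | z j ∈ N} ∩ {z | DifferentiableAt ℝ ι z}) = 0 :=
    measure_mono_null inter_subset_left (coord_null hN j)
  refine measure_mono_null ?_ (addHaar_image_eq_zero_of_differentiableOn_of_addHaar_eq_zero volume
    (f := ι) (fun z hz => hz.2.differentiableWithinAt) hS)
  rintro x ⟨⟨-, -, hx⟩, hx1, hx2⟩
  refine ⟨Φ x, ⟨?_, hx2⟩, hx1⟩
  simp only [mem_ofPred_eq, Φ, he]
  simpa using hx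

theorem LocallyLipschitz.ae_differentiableAt {k : ℝ → ℝ} (hk : LocallyLipschitz k) :
    ∀ᵐ t, DifferentiableAt ℝ k t := by
  refine LocallyBoundedVariationOn.ae_differentiableAt fun s t _ _ => ?_
  obtain ⟨K, hK⟩ := hk.locallyLipschitzOn.exists_lipschitzOnWith_of_compact
    (isCompact_uIcc (a := s) (b := t))
  refine (hK.locallyBoundedVariationOn s t left_mem_uIcc right_mem_uIcc).mono fun z hz => ?_
  exact ⟨Icc_subset_uIcc hz.2, hz.2⟩

/-- Steklov averages: `C¹` approximations of a continuous function. -/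
def steklov (k : ℝ → ℝ) (m : ℕ) (t : ℝ) : ℝ := (m + 1) * ∫ s in t..(t + 1 / (m + 1 : ℝ)), k s

theorem hasDerivAt_steklov {k : ℝ → ℝ} (hk : Continuous k) (m : ℕ) (t : ℝ) :
    HasDerivAt (steklov k m) ((m + 1) * (k (t + 1 / (m + 1 : ℝ)) - k t)) t := by
  have hF : ∀ t, HasDerivAt (fun t => ∫ s in (0 : ℝ)..t, k s) (k t) t := fun t =>
    hk.integral_hasStrictDerivAt 0 t |>.hasDerivAt
  have h1 : steklov k m = fun t =>
      (m + 1) * ((∫ s in (0 : ℝ)..(t + 1 / (m + 1 : ℝ)), k s) - ∫ s in (0 : ℝ)..t, k s) := by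
    ext t
    rw [steklov, intervalIntegral.integral_interval_sub_left (hk.intervalIntegrable _ _)
      (hk.intervalIntegrable _ _)]
  rw [h1]
  have h2 : HasDerivAt (fun t => ∫ s in (0 : ℝ)..(t + 1 / (m + 1 : ℝ)), k s)
      (k (t + 1 / (m + 1 : ℝ))) t := (hF _).comp_add_const t (1 / (m + 1 : ℝ))
  exact (h2.sub (hF t)).const_mul _

theorem contDiff_steklov {k : ℝ → ℝ} (hk : Continuous k) (m : ℕ) : ContDiff ℝ 1 (steklov k m) := by
  rw [contDiff_one_iff_deriv]
  refine ⟨fun t => (hasDerivAt_steklov hk m t).differentiableAt, ?_⟩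
  have : deriv (steklov k m) = fun t => (m + 1) * (k (t + 1 / (m + 1 : ℝ)) - k t) :=
    funext fun t => (hasDerivAt_steklov hk m t).deriv
  rw [this]
  fun_prop

theorem tendsto_deriv_steklov {k : ℝ → ℝ} (hk : Continuous k) {t : ℝ}
    (ht : DifferentiableAt ℝ k t) :
    Tendsto (fun m => deriv (steklov k m) t) atTop (𝓝 (deriv k t)) := by
  have h1 := ht.hasDerivAt.tendsto_slope_zero_right
  have h2 : Tendsto (fun m : ℕ => 1 / (m + 1 : ℝ)) atTop (𝓝[>] 0) :=
    tendsto_nhdsWithin_iff.2 ⟨tendsto_one_div_add_atTop_nhds_zero_nat,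
      Eventually.of_forall fun m => show (0 : ℝ) < 1 / (m + 1 : ℝ) by positivity⟩
  refine (h1.comp h2).congr fun m => ?_
  rw [(hasDerivAt_steklov hk m t).deriv]
  simp

theorem tendsto_steklov {k : ℝ → ℝ} (hk : Continuous k) (t : ℝ) :
    Tendsto (fun m => steklov k m t) atTop (𝓝 (k t)) := by
  have h1 := (hk.integral_hasStrictDerivAt t t).hasDerivAt.tendsto_slope_zero_right
  have h2 : Tendsto (fun m : ℕ => 1 / (m + 1 : ℝ)) atTop (𝓝[>] 0) :=
    tendsto_nhdsWithin_iff.2 ⟨tendsto_one_div_add_atTop_nhds_zero_nat,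
      Eventually.of_forall fun m => show (0 : ℝ) < 1 / (m + 1 : ℝ) by positivity⟩
  refine (h1.comp h2).congr fun m => ?_
  simp [steklov]

/-- The derivative of an average is a difference quotient of `k`. The interval is enlarged by one
because the averaging window has length at most one. -/
theorem abs_deriv_steklov_le {k : ℝ → ℝ} (hk : Continuous k) {K : ℝ≥0} {M : ℝ}
    (hK : LipschitzOnWith K k (Icc (-M - 1) (M + 1))) (m : ℕ) {t : ℝ} (ht : |t| ≤ M) :
    |deriv (steklov k m) t| ≤ K := by
  obtain ⟨h1, h2⟩ := abs_le.1 ht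
  have hm : (0 : ℝ) < m + 1 := by positivity
  have hm1 : 1 / (m + 1 : ℝ) ≤ 1 := by
    rw [div_le_one hm]; linarith [Nat.cast_nonneg (α := ℝ) m]
  have hm0 : 0 < 1 / (m + 1 : ℝ) := by positivity
  rw [(hasDerivAt_steklov hk m t).deriv, abs_mul, abs_of_pos hm]
  have := hK.dist_le_mul (t + 1 / (m + 1 : ℝ)) ⟨by linarith, by linarith⟩ t
    ⟨by linarith, by linarith⟩
  rw [Real.dist_eq, Real.dist_eq, add_sub_cancel_left, abs_of_pos hm0] at this
  calc (m + 1 : ℝ) * |k (t + 1 / (m + 1 : ℝ)) - k t| ≤ (m + 1) * (K * (1 / (m + 1 : ℝ))) :=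
        mul_le_mul_of_nonneg_left this hm.le
    _ = K := by field_simp

theorem abs_steklov_le {k : ℝ → ℝ} {M B : ℝ}
    (hB : ∀ t ∈ Icc (-M - 1) (M + 1), |k t| ≤ B) (m : ℕ) {t : ℝ} (ht : |t| ≤ M) :
    |steklov k m t| ≤ B := by
  obtain ⟨h1, h2⟩ := abs_le.1 ht
  have hm : (0 : ℝ) < m + 1 := by positivity
  have hm1 : 1 / (m + 1 : ℝ) ≤ 1 := by
    rw [div_le_one hm]; linarith [Nat.cast_nonneg (α := ℝ) m]
  have hm0 : 0 < 1 / (m + 1 : ℝ) := by positivity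
  rw [steklov, abs_mul, abs_of_pos hm]
  have := intervalIntegral.norm_integral_le_of_norm_le_const (a := t) (b := t + 1 / (m + 1 : ℝ))
    (f := k) (C := B) fun s hs => by
      rw [uIoc_of_le (by linarith)] at hs
      exact hB s ⟨by linarith [hs.1], by linarith [hs.2]⟩
  rw [add_sub_cancel_left, abs_of_pos hm0] at this
  calc (m + 1 : ℝ) * |∫ s in t..(t + 1 / (m + 1 : ℝ)), k s| ≤ (m + 1) * (B * (1 / (m + 1 : ℝ))) :=
        mul_le_mul_of_nonneg_left this hm.le
    _ = B := by field_simp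

end LevelSets

/-! ### Integration by parts in a horizontal slice. -/

section Slices

variable {n : ℕ} {α : ℝ≥0} {Ω : Set (Hor n)} {a : ℝ → ℝ → ℝ} {u : Hor n × ℝ → ℝ}

/-- Classical divergences are weak divergences. -/
theorem HasWeakDiv.of_hasLineDerivAt (hΩ : IsOpen Ω) {P : Hor n → Hor n} {d : Fin n → Hor n → ℝ}
    (hP : ContinuousOn P Ω) (hd : ∀ j, ContinuousOn (d j) Ω)
    (h : ∀ j, ∀ x ∈ Ω, HasLineDerivAt ℝ (fun x => P x j) (d j x) x (EuclideanSpace.single j 1)) :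
    HasWeakDiv Ω P (fun x => ∑ j, d j x) := by
  intro η hη hc hs
  have hT : ∀ j, IsLineTest volume Ω (EuclideanSpace.single j (1 : ℝ) : Hor n) η
      fun x => fderiv ℝ η x (EuclideanSpace.single j 1) := fun j =>
    IsLineTest.of_contDiff hη hc hs
  have hPj : ∀ j, ContinuousOn (fun x => P x j) Ω := fun j =>
    (EuclideanSpace.proj (𝕜 := ℝ) j : Hor n →L[ℝ] ℝ).continuous.comp_continuousOn hP
  have i1 : ∀ j, IntegrableOn (fun x => d j x * η x) Ω := fun j =>
    (integrable_mul_of_tsupport_subset ((hd j).locallyIntegrableOn hΩ.measurableSet)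
      hc hs hη.continuous.aestronglyMeasurable (hT j).bdd_fun
      fun X hX => image_eq_zero_of_notMem_tsupport hX).integrableOn
  have i2 : ∀ j, IntegrableOn (fun x => P x j * fderiv ℝ η x (EuclideanSpace.single j 1)) Ω :=
    fun j => (integrable_mul_of_tsupport_subset ((hPj j).locallyIntegrableOn hΩ.measurableSet)
      hc hs (hT j).meas (hT j).bdd fun X hX => (hT j).deriv_eq_zero hX).integrableOn
  have e1 : ∀ x, fderiv ℝ η x (P x) = ∑ j, P x j * fderiv ℝ η x (EuclideanSpace.single j 1) :=
    fun x => by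
      conv_lhs => rw [← sum_single (P x)]
      rw [map_sum]
      simp
  simp only [Finset.sum_mul, e1]
  rw [integral_finsetSum _ fun j _ => i1 j, integral_finsetSum _ fun j _ => i2 j,
    ← Finset.sum_neg_distrib]
  refine Finset.sum_congr rfl fun j _ => ?_
  rw [(hT j).integral_by_parts hΩ (hPj j) (h j) ((hd j).locallyIntegrableOn hΩ.measurableSet),
    neg_neg]

/-- The horizontal divergence of `Ψ ∇ₓu`. -/
def divX (Ω : Set (Hor n)) (u Ψ : Hor n × ℝ → ℝ) (X : Hor n × ℝ) : ℝ :=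
  ∑ j : Fin n, (uDD Ω u j.castSucc j.castSucc X * Ψ X + uD Ω u j.castSucc X * pd univ Ψ j.castSucc X)

theorem HasLineDerivAt.slice {v : Hor n × ℝ → ℝ} {d : ℝ} {x : Hor n} {y : ℝ} {j : Fin n}
    (h : HasLineDerivAt ℝ v d (x, y) (coordVec j.castSucc)) :
    HasLineDerivAt ℝ (fun x => v (x, y)) d x (EuclideanSpace.single j 1) := by
  unfold HasLineDerivAt at *
  simpa [coordVec_castSucc] using h

theorem hasLineDerivAt_of_contDiff {Ψ : Hor n × ℝ → ℝ} (hΨ : ContDiff ℝ 1 Ψ) (X : Hor n × ℝ)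
    (i : Fin (n + 1)) : HasLineDerivAt ℝ Ψ (pd univ Ψ i X) X (coordVec i) := by
  rw [pd_univ]
  exact (hΨ.differentiable one_ne_zero X).hasFDerivAt.hasLineDerivAt _

theorem continuous_pd_univ {Ψ : Hor n × ℝ → ℝ} (hΨ : ContDiff ℝ 1 Ψ) (i : Fin (n + 1)) :
    Continuous (pd univ Ψ i) := by
  rw [← continuousOn_univ]
  exact continuousOn_pd uniqueDiffOn_univ hΨ.contDiffOn i

theorem IsRegularSol.continuousOn_divX (hu : IsRegularSol Ω a u) (hΩ : IsHolderDomain 4 α Ω)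
    {Ψ : Hor n × ℝ → ℝ} (hΨ : ContDiff ℝ 1 Ψ) : ContinuousOn (divX Ω u Ψ) (latCyl Ω) :=
  continuousOn_finsetSum _ fun _ _ =>
    ((hu.continuousOn_uDD hΩ _ _).mul hΨ.continuous.continuousOn).add
      ((hu.continuousOn_uD hΩ _).mul (continuous_pd_univ hΨ _).continuousOn)

/-- Integration by parts in a horizontal slice, using the Neumann condition. -/
theorem IsRegularSol.integral_slice (hu : IsRegularSol Ω a u) (hΩ : IsHolderDomain 4 α Ω)
    {Ψ : Hor n × ℝ → ℝ} (hΨ : ContDiff ℝ 1 Ψ) {k : ℝ → ℝ} (hk : ContDiff ℝ 1 k) {y : ℝ}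
    (hy : 0 < y) :
    ∫ x in Ω, k (u (x, y)) * divX Ω u Ψ (x, y)
      = - ∫ x in Ω, deriv k (u (x, y)) * ‖gradX (latCyl Ω) u (x, y)‖ ^ 2 * Ψ (x, y) := by
  have hK := hΩ.isCompact_closure
  have hkc : ContinuousOn (fun X => k (u X)) (latCyl Ω) :=
    hk.continuous.comp_continuousOn hu.contDiffOn_one.continuousOn
  have hkc' : ContinuousOn (fun X => deriv k (u X)) (latCyl Ω) :=
    (hk.continuous_deriv le_rfl).comp_continuousOn hu.contDiffOn_one.continuousOn
  have hgx := hu.continuousOn_gradX hΩ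
  -- The divergence of `k(u) Ψ ∇ₓu` is `k(u) div_x(Ψ∇ₓu) + k'(u) |∇ₓu|² Ψ`, and by the Neumann
  -- condition its normal component is zero.
  let P : Hor n → Hor n := fun x => (k (u (x, y)) * Ψ (x, y)) • gradX (latCyl Ω) u (x, y)
  let d : Fin n → Hor n → ℝ := fun j x =>
    deriv k (u (x, y)) * uD Ω u j.castSucc (x, y) * (Ψ (x, y) * uD Ω u j.castSucc (x, y))
      + k (u (x, y)) * (uDD Ω u j.castSucc j.castSucc (x, y) * Ψ (x, y)
        + uD Ω u j.castSucc (x, y) * pd univ Ψ j.castSucc (x, y))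
  have hPc : ContinuousOn P (closure Ω) :=
    continuousOn_slice ((hkc.mul hΨ.continuous.continuousOn).smul hgx) hy
  have hdc : ∀ j, ContinuousOn (d j) (closure Ω) := fun j => by
    have h1 := hu.continuousOn_uD hΩ j.castSucc
    have h2 := hu.continuousOn_uDD hΩ j.castSucc j.castSucc
    exact continuousOn_slice (((hkc'.mul h1).mul (hΨ.continuous.continuousOn.mul h1)).add
      (hkc.mul ((h2.mul hΨ.continuous.continuousOn).add
        (h1.mul (continuous_pd_univ hΨ _).continuousOn)))) hy
  have hw : HasWeakDiv Ω P (fun x => ∑ j, d j x) := by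
    refine HasWeakDiv.of_hasLineDerivAt hΩ.isOpen (hPc.mono subset_closure)
      (fun j => (hdc j).mono subset_closure) fun j x hx => ?_
    have hX : (x, y) ∈ cyl Ω := ⟨hx, hy⟩
    have h1 := hu.hasLineDerivAt_u hΩ j.castSucc hX
    have h2 := hu.hasLineDerivAt_uD hΩ j.castSucc j.castSucc hX
    have h3 := hasLineDerivAt_of_contDiff hΨ (x, y) j.castSucc
    have h4 : HasLineDerivAt ℝ (fun X => k (u X))
        (deriv k (u (x, y)) * uD Ω u j.castSucc (x, y)) (x, y) (coordVec j.castSucc) := by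
      unfold HasLineDerivAt at *
      have := ((hk.differentiable one_ne_zero) (u (x, y))).hasDerivAt.comp_of_eq (0 : ℝ) h1 (by simp)
      exact this
    have h5 := (h4.fun_mul (h3.fun_mul h2)).slice
    have h6 : (fun x => P x j) = fun x => k (u (x, y)) * (Ψ (x, y) * uD Ω u j.castSucc (x, y)) := by
      ext x
      simp only [P, PiLp.smul_apply, smul_eq_mul, gradX_apply, uD]
      ring
    rw [h6]
    convert h5 using 1
    simp only [d]
    ring
  have hint : ∀ r : Hor n → ℝ, ContinuousOn r (closure Ω) → IntegrableOn r Ω := fun r hr =>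
    (hr.integrableOn_compact hK).mono_set subset_closure
  have h1 := hΩ.integral_div hPc (hint _ (continuousOn_finsetSum _ fun j _ => hdc j)) hw
  have h2 : ∫ x in frontier Ω, ⟪P x, outerNormal Ω x⟫ ∂μHE[n - 1] = 0 := by
    rw [setIntegral_congr_fun (g := fun _ => 0) isClosed_frontier.measurableSet fun x hx => ?_]
    · simp
    · simp only [P]
      rw [inner_smul_left, ← dirDeriv_eq_inner, hu.neumann x hx y hy, mul_zero]
  rw [h2] at h1
  have h3 : ∀ x, ∑ j, d j x = k (u (x, y)) * divX Ω u Ψ (x, y)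
      + deriv k (u (x, y)) * ‖gradX (latCyl Ω) u (x, y)‖ ^ 2 * Ψ (x, y) := fun x => by
    simp only [d, Finset.sum_add_distrib, divX, norm_gradX_sq, ← Finset.mul_sum]
    rw [add_comm, Finset.mul_sum, Finset.sum_mul, ← Finset.sum_add_distrib]
    congr 1
    refine Finset.sum_congr rfl fun j _ => ?_
    simp only [uD]
    ring
  simp only [h3] at h1
  rw [integral_add] at h1
  · linarith
  · exact hint _ (continuousOn_slice (hkc.mul (hu.continuousOn_divX hΩ hΨ)) hy)
  · exact hint _ (continuousOn_slice ((hkc'.mul (hgx.norm.pow 2)).mul hΨ.continuous.continuousOn) hy)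

end Slices

/-! ### The reaction terms, and the weak formulation tested with `div_x(Ψ∇ₓu)`. -/

section Reactions

variable {n : ℕ} {α : ℝ≥0} {Ω : Set (Hor n)} {a g : ℝ → ℝ → ℝ} {f : ℝ → ℝ} {u : Hor n × ℝ → ℝ}
  {Ψ : Hor n × ℝ → ℝ}

theorem HasBottomTrace.sum (hΩ : IsOpen Ω) {ι : Type*} (s : Finset ι) {p : ι → Hor n × ℝ → ℝ}
    {p₀ : ι → Hor n → ℝ} (h : ∀ i ∈ s, HasBottomTrace Ω (p i) (p₀ i))
    (hc : ∀ i ∈ s, ContinuousOn (p i) (latCyl Ω)) :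
    HasBottomTrace Ω (fun X => ∑ i ∈ s, p i X) (fun x => ∑ i ∈ s, p₀ i x) := by
  classical
  induction s using Finset.induction_on with
  | empty => simpa using HasBottomTrace.zero
  | insert i s hi ih =>
    simp only [Finset.sum_insert hi]
    exact HasBottomTrace.add hΩ (h i (Finset.mem_insert_self _ _))
      (ih (fun k hk => h k (Finset.mem_insert_of_mem hk))
        fun k hk => hc k (Finset.mem_insert_of_mem hk)) (hc i (Finset.mem_insert_self _ _))
      (continuousOn_finsetSum _ fun k hk => hc k (Finset.mem_insert_of_mem hk))

/-- The trace of `divX`. -/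
def divXTrace (w w₂ : Fin n → Hor n → ℝ) (Ψ : Hor n × ℝ → ℝ) (x : Hor n) : ℝ :=
  ∑ j : Fin n, (w₂ j x * Ψ (x, 0) + w j x * pd univ Ψ j.castSucc (x, 0))

theorem IsRegularSol.hasBottomTrace_divX (hu : IsRegularSol Ω a u) (hΩ : IsHolderDomain 4 α Ω)
    (hΨ : ContDiff ℝ 1 Ψ) {w w₂ : Fin n → Hor n → ℝ}
    (hw : ∀ j : Fin n, HasBottomTrace Ω (uD Ω u j.castSucc) (w j))
    (hw₂ : ∀ j : Fin n, HasBottomTrace Ω (uDD Ω u j.castSucc j.castSucc) (w₂ j)) :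
    HasBottomTrace Ω (divX Ω u Ψ) (divXTrace w w₂ Ψ) := by
  have hK := hΩ.isCompact_closure
  refine HasBottomTrace.sum hΩ.isOpen _ (fun j _ => ?_) fun j _ => ?_
  · exact ((hw₂ j).mul_continuousOn hΩ.isOpen hK (hu.continuousOn_uDD hΩ _ _)
      hΨ.continuous.continuousOn).add hΩ.isOpen ((hw j).mul_continuousOn hΩ.isOpen hK
        (hu.continuousOn_uD hΩ _) (continuous_pd_univ hΨ _).continuousOn)
      ((hu.continuousOn_uDD hΩ _ _).mul hΨ.continuous.continuousOn)
      ((hu.continuousOn_uD hΩ _).mul (continuous_pd_univ hΨ _).continuousOn)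
  · exact ((hu.continuousOn_uDD hΩ _ _).mul hΨ.continuous.continuousOn).add
      ((hu.continuousOn_uD hΩ _).mul (continuous_pd_univ hΨ _).continuousOn)

/-- Integration by parts for the boundary reaction. -/
theorem IsRegularSol.integral_bottom (hu : IsRegularSol Ω a u) (hΩ : IsHolderDomain 4 α Ω)
    (hΨ : ContDiff ℝ 1 Ψ) (hf : ContDiff ℝ 1 f) {w w₂ : Fin n → Hor n → ℝ}
    (hw : ∀ j : Fin n, HasBottomTrace Ω (uD Ω u j.castSucc) (w j))
    (hw₂ : ∀ j : Fin n, HasBottomTrace Ω (uDD Ω u j.castSucc j.castSucc) (w₂ j)) :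
    ∫ x in Ω, f (u (x, 0)) * divXTrace w w₂ Ψ x
      = - ∫ x in Ω, deriv f (u (x, 0)) * ‖(WithLp.toLp 2 fun j => w j x : Hor n)‖ ^ 2
          * Ψ (x, 0) := by
  have hK := hΩ.isCompact_closure
  have hfc : ContinuousOn (fun X => f (u X)) (closedCyl Ω) :=
    hf.continuous.comp_continuousOn hu.cont
  have hfc' : ContinuousOn (fun X => deriv f (u X)) (closedCyl Ω) :=
    (hf.continuous_deriv le_rfl).comp_continuousOn hu.cont
  have hgc := (hu.continuousOn_gradX hΩ).norm
  have hb : ContinuousOn (fun X => deriv f (u X) * Ψ X) (closedCyl Ω) :=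
    hfc'.mul hΨ.continuous.continuousOn
  have hN : HasBottomTrace Ω (fun X => ‖gradX (latCyl Ω) u X‖)
      (fun x => ‖(WithLp.toLp 2 fun j => w j x : Hor n)‖) :=
    HasBottomTrace.norm_toLp hΩ.isOpen hw fun j => hu.continuousOn_uD hΩ _
  have h1 := (HasBottomTrace.of_continuousOn hΩ.isOpen hK hfc).tendsto_integral_mul hΩ.isOpen
    (hu.hasBottomTrace_divX hΩ hΨ hw hw₂) (hfc.mono latCyl_subset_closedCyl)
    (hu.continuousOn_divX hΩ hΨ)
  have h2 := hN.tendsto_integral_mul hΩ.isOpen (hN.mul_continuousOn hΩ.isOpen hK hgc hb) hgc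
    (hgc.mul (hb.mono latCyl_subset_closedCyl))
  -- The integrand is split into two factors that both have traces in `L²`.
  have h3 : ∫ x in Ω, deriv f (u (x, 0)) * ‖(WithLp.toLp 2 fun j => w j x : Hor n)‖ ^ 2 * Ψ (x, 0)
      = ∫ x in Ω, ‖(WithLp.toLp 2 fun j => w j x : Hor n)‖ *
        (‖(WithLp.toLp 2 fun j => w j x : Hor n)‖ * (deriv f (u (x, 0)) * Ψ (x, 0))) := by
    congr 1 with x
    ring
  rw [h3]
  -- The identity holds at every height `y > 0`, and both sides converge as `y → 0⁺`.
  refine tendsto_nhds_unique h1 (h2.neg.congr' ?_)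
  filter_upwards [eventually_trace_pos] with y hy
  rw [hu.integral_slice hΩ hΨ hf hy]
  congr 2 with x
  ring

/-- Integration by parts for the inner reaction, in a horizontal slice. -/
theorem IsRegularSol.integral_slice_inner (hu : IsRegularSol Ω a u) (hΩ : IsHolderDomain 4 α Ω)
    (hΨ : ContDiff ℝ 1 Ψ) (hg : IsInnerReaction g) {y : ℝ} (hy : 0 < y) :
    ∫ x in Ω, g y (u (x, y)) * divX Ω u Ψ (x, y)
      = - ∫ x in Ω, deriv (g y) (u (x, y)) * ‖gradX (latCyl Ω) u (x, y)‖ ^ 2 * Ψ (x, y) := by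
  have hK := hΩ.isCompact_closure
  have hm := hΩ.isOpen.measurableSet
  have hlip := hg.lip y hy
  have hgc : Continuous (g y) := hlip.continuous
  have hus := continuousOn_slice hu.contDiffOn_one.continuousOn hy
  have hφs := continuousOn_slice (hu.continuousOn_divX hΩ hΨ) hy
  have hns : ContinuousOn (fun x => ‖gradX (latCyl Ω) u (x, y)‖ ^ 2 * Ψ (x, y)) (closure Ω) :=
    continuousOn_slice (((hu.continuousOn_gradX hΩ).norm.pow 2).mul hΨ.continuous.continuousOn) hy
  obtain ⟨M, hM⟩ := hK.exists_bound_of_continuousOn hus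
  obtain ⟨K, hKl⟩ := (hlip.locallyLipschitzOn (s := Icc (-M - 1) (M + 1)))
    |>.exists_lipschitzOnWith_of_compact isCompact_Icc
  obtain ⟨B, hB⟩ := (isCompact_Icc (a := -M - 1) (b := M + 1)).exists_bound_of_continuousOn
    hgc.continuousOn
  have hint : ∀ r : Hor n → ℝ, ContinuousOn r (closure Ω) → IntegrableOn r Ω := fun r hr =>
    (hr.integrableOn_compact hK).mono_set subset_closure
  have hmem := ae_restrict_mem (μ := (volume : Measure (Hor n))) hm
  -- The slice identity requires a `C¹` reaction, so it is applied to the averages of `g y`. Their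
  -- derivatives are bounded by the Lipschitz constant on the range of `u(·,y)`, enlarged by one.
  have hsteklov : ∀ m, ContDiff ℝ 1 (steklov (g y) m) := contDiff_steklov hgc
  have h1 : Tendsto (fun m => ∫ x in Ω, steklov (g y) m (u (x, y)) * divX Ω u Ψ (x, y)) atTop
      (𝓝 (∫ x in Ω, g y (u (x, y)) * divX Ω u Ψ (x, y))) := by
    refine tendsto_integral_of_dominated_convergence (fun x => B * |divX Ω u Ψ (x, y)|)
      (fun m => ?_) ((hint _ hφs).abs.const_mul B) (fun m => hmem.mono fun x hx => ?_)
      (ae_of_all _ fun x => (tendsto_steklov hgc _).mul_const _)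
    · exact ((((hsteklov m).continuous.comp_continuousOn hus).mul hφs).mono
        subset_closure).aestronglyMeasurable hm
    · rw [norm_mul]
      exact mul_le_mul_of_nonneg_right (abs_steklov_le hB m (hM x (subset_closure hx)))
        (abs_nonneg _)
  -- The points where `g y` is not differentiable form a null set, so `u(·,y)` reaches them only on
  -- a null set or where `∇ₓu = 0`. In the latter case the factor `|∇ₓu|²` makes the value assigned
  -- to `g_u` irrelevant.
  have hnull : ∀ᵐ x ∂(volume.restrict Ω), gradX (latCyl Ω) u (x, y) = 0 ∨
      DifferentiableAt ℝ (g y) (u (x, y)) := by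
    have hv : ContDiffOn ℝ 1 (fun x => u (x, y)) Ω :=
      hu.contDiffOn_one.comp (contDiff_id.prodMk contDiff_const).contDiffOn
        fun x hx => ⟨subset_closure hx, hy⟩
    have h0 := preimage_null_of_fderiv_ne_zero hΩ.isOpen hv hlip.ae_differentiableAt
    rw [ae_restrict_iff' hm]
    filter_upwards [measure_eq_zero_iff_ae_notMem.1 h0] with x hx hxΩ
    by_contra hc
    push Not at hc
    refine hx ⟨hxΩ, fun hz => hc.1 ?_, hc.2⟩
    ext j
    have e1 := (hu.hasLineDerivAt_u hΩ j.castSucc (X := (x, y)) ⟨hxΩ, hy⟩).slice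
    have e2 := ((hv.differentiableOn one_ne_zero).differentiableAt
      (hΩ.isOpen.mem_nhds hxΩ)).hasFDerivAt.hasLineDerivAt (EuclideanSpace.single j (1 : ℝ))
    have e3 := e1.unique e2
    rw [hz] at e3
    simpa [gradX_apply, uD] using e3
  have h2 : Tendsto (fun m => ∫ x in Ω, deriv (steklov (g y) m) (u (x, y)) *
      ‖gradX (latCyl Ω) u (x, y)‖ ^ 2 * Ψ (x, y)) atTop
      (𝓝 (∫ x in Ω, deriv (g y) (u (x, y)) * ‖gradX (latCyl Ω) u (x, y)‖ ^ 2 * Ψ (x, y))) := by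
    refine tendsto_integral_of_dominated_convergence
      (fun x => K * |‖gradX (latCyl Ω) u (x, y)‖ ^ 2 * Ψ (x, y)|)
      (fun m => ?_) ((hint _ hns).abs.const_mul _) (fun m => hmem.mono fun x hx => ?_)
      (hnull.mono fun x hx => ?_)
    · have := ((((hsteklov m).continuous_deriv le_rfl).comp_continuousOn hus).mul hns).mono
        (subset_closure (s := Ω))
      refine (this.aestronglyMeasurable hm).congr (ae_of_all _ fun x => ?_)
      simp only [Pi.mul_apply, Function.comp]
      ring
    · rw [mul_assoc, norm_mul]
      exact mul_le_mul_of_nonneg_right (abs_deriv_steklov_le hgc hKl m (hM x (subset_closure hx)))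
        (abs_nonneg _)
    · rcases hx with hx | hx
      · simp [hx]
      · exact ((tendsto_deriv_steklov hgc hx).mul_const _).mul_const _
  refine tendsto_nhds_unique h1 (h2.neg.congr fun m => ?_)
  rw [hu.integral_slice hΩ hΨ (hsteklov m) hy]

theorem integral_cyl_eq {F : Hor n × ℝ → ℝ} (hF : IntegrableOn F (cyl Ω)) :
    ∫ X in cyl Ω, F X = ∫ y in Ioi (0 : ℝ), ∫ x in Ω, F (x, y) := by
  rw [IntegrableOn, restrict_cyl] at hF
  rw [restrict_cyl, integral_prod_symm _ hF]

/-- Integration by parts for the inner reaction. -/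
theorem IsRegularSol.integral_inner (hu : IsRegularSol Ω a u) (hΩ : IsHolderDomain 4 α Ω)
    (hΨ : ContDiff ℝ 1 Ψ) (hg : IsInnerReaction g)
    (h1 : IntegrableOn (fun X => g X.2 (u X) * divX Ω u Ψ X) (cyl Ω))
    (h2 : IntegrableOn (fun X => deriv (g X.2) (u X) * ‖gradX (latCyl Ω) u X‖ ^ 2 * Ψ X) (cyl Ω)) :
    ∫ X in cyl Ω, g X.2 (u X) * divX Ω u Ψ X
      = - ∫ X in cyl Ω, deriv (g X.2) (u X) * ‖gradX (latCyl Ω) u X‖ ^ 2 * Ψ X := by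
  rw [integral_cyl_eq h1, integral_cyl_eq h2, ← integral_neg]
  exact setIntegral_congr_fun measurableSet_Ioi fun y hy => hu.integral_slice_inner hΩ hΨ hg hy

theorem exists_fst_bound_of_hasCompactSupport (hc : HasCompactSupport Ψ) :
    ∃ R, ∀ X, R ≤ X.2 → Ψ X = 0 ∧ X ∉ tsupport Ψ := by
  obtain ⟨R, hR⟩ := (hc.isCompact.image continuous_snd).bddAbove
  refine ⟨R + 1, fun X hX => ?_⟩
  have : X ∉ tsupport Ψ := fun h => by
    have := hR ⟨X, h, rfl⟩
    linarith
  exact ⟨image_eq_zero_of_notMem_tsupport this, this⟩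

/-- The second variation of the inner reaction is integrable against `|∇ₓu|²`. -/
theorem IsStableSolution.integrableOn_inner (hu : IsStableSolution Ω a g f u)
    (hΩ : IsHolderDomain 4 α Ω) (ha : IsDiffusion a) {b : Hor n × ℝ → ℝ}
    (hb : AEStronglyMeasurable b (volume.restrict (cyl Ω))) {M R : ℝ}
    (hM : ∀ X ∈ cyl Ω, |b X| ≤ M) (hR : ∀ X ∈ cyl Ω, R ≤ X.2 → b X = 0) :
    IntegrableOn (fun X => deriv (g X.2) (u X) * ‖gradX (latCyl Ω) u X‖ ^ 2 * b X) (cyl Ω) := by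
  have hr := hu.solution.regular
  choose w hw using hr.trace_one
  -- This cutoff is one for `y ≤ R`, hence wherever `b` may be nonzero. Stability for `|∇ₓu| η`
  -- contains the integrability of `g_u |∇ₓu|² η²`, and multiplication by the bounded `b` preserves
  -- it.
  let η : Hor n × ℝ → ℝ := fun X => cutoff (R + 1 - X.2)
  have hη : ContDiff ℝ 1 η := (contDiff_cutoff.of_le (by exact_mod_cast le_top)).comp
    (contDiff_const.sub contDiff_snd)
  have hT := hr.isTest_norm_mul hΩ ha (ψ := η) hη.contDiffOn (R := R + 1) (fun X _ hX =>
    cutoff_of_le (by linarith)) hw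
  have h1 := (hu.stable _ _ _ hT).1.mul_bdd hb (c := M)
    ((ae_restrict_mem (isOpen_cyl hΩ.isOpen).measurableSet).mono fun X hX => hM X hX)
  refine h1.congr ((ae_restrict_mem (isOpen_cyl hΩ.isOpen).measurableSet).mono fun X hX => ?_)
  beta_reduce
  rcases le_or_gt R X.2 with h | h
  · rw [hR X hX h, mul_zero, mul_zero]
  · have : η X = 1 := cutoff_of_ge (by linarith)
    rw [this, mul_one]

/-- The weak gradient of `divX`, given those of `u_{x_j x_j}`. -/
def divXGrad (Ω : Set (Hor n)) (u Ψ : Hor n × ℝ → ℝ) (T : Fin n → Hor n × ℝ → Full n)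
    (X : Hor n × ℝ) : Full n :=
  ∑ j : Fin n, ((Ψ X • T j X + uDD Ω u j.castSucc j.castSucc X • grad univ Ψ X)
    + (pd univ Ψ j.castSucc X • grad (latCyl Ω) (uD Ω u j.castSucc) X
      + uD Ω u j.castSucc X • grad univ (pd univ Ψ j.castSucc) X))

theorem contDiff_pd_univ (hΨ : ContDiff ℝ ∞ Ψ) (i : Fin (n + 1)) : ContDiff ℝ ∞ (pd univ Ψ i) := by
  have := contDiffOn_pd (m := ∞) uniqueDiffOn_univ hΨ.contDiffOn (by simp) i
  rwa [contDiffOn_univ] at this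

/-- Here the regularity demanded of a solution is spent: `div_x(Ψ∇ₓu)` contains second derivatives,
whose traces are needed, and its gradient contains third ones, whose weighted square integrability
is needed. Two derivatives fall on `Ψ`, which is therefore taken smooth. -/
theorem isPreTest_divX (hr : IsRegularSol Ω a u) (hΩ : IsHolderDomain 4 α Ω) (ha : IsDiffusion a)
    (hΨ : ContDiff ℝ ∞ Ψ) (hc : HasCompactSupport Ψ) {w w₂ : Fin n → Hor n → ℝ}
    (hw : ∀ j : Fin n, HasBottomTrace Ω (uD Ω u j.castSucc) (w j))
    (hw₂ : ∀ j : Fin n, HasBottomTrace Ω (uDD Ω u j.castSucc j.castSucc) (w₂ j))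
    {T : Fin n → Hor n × ℝ → Full n}
    (hT : ∀ j, HasWeakGrad Ω (uDD Ω u j.castSucc j.castSucc) (T j)) (hT2 : ∀ j, WL2 Ω a u (T j)) :
    IsPreTest Ω a u (divX Ω u Ψ) (divXGrad Ω u Ψ T) (divXTrace w w₂ Ψ) := by
  have hcj : ∀ j : Fin n, HasCompactSupport (pd univ Ψ j.castSucc) := fun j => by
    have : pd univ Ψ j.castSucc = fun X => fderiv ℝ Ψ X (coordVec j.castSucc) :=
      funext fun X => pd_univ
    rw [this]
    exact hc.fderiv_apply (𝕜 := ℝ) _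
  exact IsPreTest.sum hr hΩ ha _ fun j _ => IsPreTest.add hr hΩ ha
    (IsPreTest.mul_smooth hr hΩ ha (isPreTest_uDD hr hΩ ha (hw₂ j) (hT j) (hT2 j)) hΨ hc)
    (IsPreTest.mul_smooth hr hΩ ha (isPreTest_uD hr hΩ ha (hw j)) (contDiff_pd_univ hΨ _) (hcj j))

theorem exists_vanishing_height (Ω : Set (Hor n)) (u : Hor n × ℝ → ℝ) (hc : HasCompactSupport Ψ) :
    ∃ R, ∀ X, R ≤ X.2 → Ψ X = 0 ∧ grad univ Ψ X = 0 ∧ divX Ω u Ψ X = 0 ∧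
      ∀ T, divXGrad Ω u Ψ T X = 0 := by
  obtain ⟨R, hR⟩ := exists_fst_bound_of_hasCompactSupport hc
  refine ⟨R, fun X hX => ?_⟩
  have hpd : ∀ j, pd univ Ψ j X = 0 := fun j => by
    rw [pd_univ, fderiv_of_notMem_tsupport ℝ (hR X hX).2]; rfl
  have hpd2 : ∀ j : Fin n, grad univ (pd univ Ψ j.castSucc) X = 0 := fun j => by
    have h1 : pd univ Ψ j.castSucc =ᶠ[𝓝 X] fun _ => 0 := by
      filter_upwards [(isClosed_tsupport Ψ).isOpen_compl.mem_nhds (hR X hX).2] with Z hZ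
      rw [pd_univ, fderiv_of_notMem_tsupport ℝ hZ]; rfl
    ext i
    rw [grad_apply, pd_univ, h1.fderiv_eq]
    simp
  have hgrad : grad univ Ψ X = 0 := by
    ext i
    exact hpd i
  exact ⟨(hR X hX).1, hgrad, by simp [divX, (hR X hX).1, hpd],
    fun T => by simp [divXGrad, (hR X hX).1, hpd, hpd2, hgrad]⟩

/-- The linearized weak formulation, before integration by parts in the diffusion term. -/
theorem IsStableSolution.weak_divX (hu : IsStableSolution Ω a g f u)
    (hΩ : IsHolderDomain 4 α Ω) (ha : IsDiffusion a) (hg : IsInnerReaction g)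
    (hf : ContDiff ℝ 1 f) (hΨ : ContDiff ℝ ∞ Ψ) (hc : HasCompactSupport Ψ)
    {w : Fin n → Hor n → ℝ} (hw : ∀ j : Fin n, HasBottomTrace Ω (uD Ω u j.castSucc) (w j))
    {T : Fin n → Hor n × ℝ → Full n}
    (hT : ∀ j, HasWeakGrad Ω (uDD Ω u j.castSucc j.castSucc) (T j)) (hT2 : ∀ j, WL2 Ω a u (T j)) :
    ∫ X in cyl Ω, wt Ω a u X * ⟪gradU Ω u X, divXGrad Ω u Ψ T X⟫
      = (∫ X in cyl Ω, deriv (g X.2) (u X) * ‖gradX (latCyl Ω) u X‖ ^ 2 * Ψ X)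
        - ∫ x in Ω, deriv f (u (x, 0)) * ‖(WithLp.toLp 2 fun j => w j x : Hor n)‖ ^ 2
          * Ψ (x, 0) := by
  have hr := hu.solution.regular
  have hΨ1 : ContDiff ℝ 1 Ψ := hΨ.of_le (by exact_mod_cast le_top)
  have hex : ∀ j : Fin n, ∃ w, HasBottomTrace Ω (uDD Ω u j.castSucc j.castSucc) w := fun j =>
    hr.trace_two j j
  choose w₂ hw₂ using hex
  obtain ⟨R, hR⟩ := exists_vanishing_height Ω u hc
  -- The weak formulation is tested with `div_x(Ψ∇ₓu)`; in both reaction terms the divergence is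
  -- then integrated by parts.
  have hTest := (isPreTest_divX hr hΩ ha hΨ hc hw hw₂ hT hT2).isTest hΩ.isOpen (R := R)
    (fun X _ hX => (hR X hX).2.2.1) (fun X _ hX => (hR X hX).2.2.2 T)
  obtain ⟨hi, heq⟩ := hu.solution.weak _ _ _ hTest
  obtain ⟨M, hM⟩ := hc.exists_bound_of_continuous hΨ.continuous
  have h2 := hu.integrableOn_inner hΩ ha hΨ.continuous.aestronglyMeasurable
    (fun X _ => hM X) (fun X _ hX => (hR X hX).1)
  rw [hr.integral_inner hΩ hΨ1 hg hi h2, hr.integral_bottom hΩ hΨ1 hf hw hw₂] at heq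
  linarith

end Reactions

/-! ### Integration by parts in the diffusion term. -/

section Diffusion

variable {n : ℕ} {α : ℝ≥0} {Ω : Set (Hor n)} {a : ℝ → ℝ → ℝ} {u Ψ : Hor n × ℝ → ℝ}

/-- Mixed weak derivatives: the weak derivative of `u_{x_j X_i}` in direction `x_j` is the weak
derivative of `u_{x_j x_j}` in direction `X_i`. -/
theorem IsRegularSol.weak_mixed (hu : IsRegularSol Ω a u) (hΩ : IsHolderDomain 4 α Ω) {j : Fin n}
    {T : Hor n × ℝ → Full n} (hT : HasWeakGrad Ω (uDD Ω u j.castSucc j.castSucc) T)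
    (i : Fin (n + 1)) {η : Hor n × ℝ → ℝ} (hη : ContDiff ℝ ∞ η) (hc : HasCompactSupport η)
    (hs : tsupport η ⊆ cyl Ω) :
    ∫ X in cyl Ω, uDD Ω u j.castSucc i X * fderiv ℝ η X (coordVec j.castSucc)
      = - ∫ X in cyl Ω, T X i * η X := by
  have ho := isOpen_cyl hΩ.isOpen
  have hη1 : ∀ k : Fin (n + 1), ContDiff ℝ 1 (fun X => fderiv ℝ η X (coordVec k)) := fun k =>
    ((hη.of_le (m := 2) ENat.LEInfty.out).fderiv_right (m := 1) (by norm_num)).clm_apply contDiff_const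
  have hts : ∀ k : Fin (n + 1), tsupport (fun X => fderiv ℝ η X (coordVec k)) ⊆ cyl Ω := fun k =>
    (tsupport_fderiv_apply_subset ℝ (coordVec k)).trans hs
  have hL : ∀ k l : Fin (n + 1), IsLineTest volume (cyl Ω) (coordVec l)
      (fun X => fderiv ℝ η X (coordVec k))
      (fun X => fderiv ℝ (fun X => fderiv ℝ η X (coordVec k)) X (coordVec l)) := fun k l =>
    IsLineTest.of_contDiff (hη1 k) (hc.fderiv_apply (𝕜 := ℝ) _) (hts k)
  have hpc := (hu.continuousOn_uD hΩ j.castSucc).mono (cyl_subset_latCyl (Ω := Ω))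
  -- Both `∫ u_{x_j X_i} ∂_{x_j} η` and `∫ u_{x_j x_j} ∂_{X_i} η` equal minus the integral of
  -- `u_{x_j}` against a mixed second derivative of the smooth `η`. The interchange of derivatives
  -- thus falls on `η`.
  have hip : ∀ k l : Fin (n + 1), ∫ X in cyl Ω, uD Ω u j.castSucc X *
      fderiv ℝ (fun X => fderiv ℝ η X (coordVec k)) X (coordVec l)
      = - ∫ X in cyl Ω, uDD Ω u j.castSucc l X * fderiv ℝ η X (coordVec k) := fun k l =>
    (hL k l).integral_by_parts ho hpc (fun X hX => hu.hasLineDerivAt_uD hΩ _ _ hX)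
      (((hu.continuousOn_uDD hΩ _ _).mono cyl_subset_latCyl).locallyIntegrableOn ho.measurableSet)
  have hsymm : ∀ X, fderiv ℝ (fun X => fderiv ℝ η X (coordVec i)) X (coordVec j.castSucc)
      = fderiv ℝ (fun X => fderiv ℝ η X (coordVec j.castSucc)) X (coordVec i) := fun X => by
    have hd : DifferentiableAt ℝ (fderiv ℝ η) X :=
      ((hη.of_le (m := 2) ENat.LEInfty.out).fderiv_right (m := 1) (by norm_num)).differentiable one_ne_zero X
    rw [fderiv_clm_apply hd (differentiableAt_const _),
      fderiv_clm_apply hd (differentiableAt_const _)]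
    have := (hη.contDiffAt (x := X)).isSymmSndFDerivAt (by simpa using ENat.LEInfty.out)
    simpa using this.eq _ _
  have h1 := hT.integral_eq η hη hc hs i
  have h2 := hip i j.castSucc
  have h3 := hip j.castSucc i
  simp only [hsymm] at h2
  rw [h2, neg_inj] at h3
  rw [← h3, h1]

/-- One component of the horizontal divergence of the field `a ∇u · ∇(u_{x_j} Ψ)`. -/
theorem IsRegularSol.integral_component (hu : IsRegularSol Ω a u) (hΩ : IsHolderDomain 4 α Ω)
    (ha : IsDiffusion a) (hΨ : ContDiff ℝ ∞ Ψ) {j : Fin n}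
    {T : Hor n × ℝ → Full n} (hT : HasWeakGrad Ω (uDD Ω u j.castSucc j.castSucc) T)
    (i : Fin (n + 1)) {ζ : Hor n × ℝ → ℝ} (hζ : ContDiff ℝ 1 ζ) (hc : HasCompactSupport ζ)
    (hs : tsupport ζ ⊆ cyl Ω) :
    let F : Hor n × ℝ → ℝ := fun X => wt Ω a u X * uD Ω u i X
    let H : Hor n × ℝ → ℝ := fun X =>
      uDD Ω u j.castSucc i X * Ψ X + uD Ω u j.castSucc X * pd univ Ψ i X
    let D : Hor n × ℝ → ℝ := fun X =>
      fluxU Ω a u X (grad (latCyl Ω) (uD Ω u j.castSucc) X) i * H X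
        + F X * (T X i * Ψ X + uDD Ω u j.castSucc i X * pd univ Ψ j.castSucc X
          + (uDD Ω u j.castSucc j.castSucc X * pd univ Ψ i X
            + uD Ω u j.castSucc X * pd univ (pd univ Ψ j.castSucc) i X))
    IntegrableOn (fun X => D X * ζ X) (cyl Ω) ∧
    IntegrableOn (fun X => F X * H X * fderiv ℝ ζ X (coordVec j.castSucc)) (cyl Ω) ∧
    ∫ X in cyl Ω, D X * ζ X
      = - ∫ X in cyl Ω, F X * H X * fderiv ℝ ζ X (coordVec j.castSucc) := by
  intro F H D
  have ho := isOpen_cyl hΩ.isOpen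
  have hΨ1 : ContDiff ℝ 1 Ψ := hΨ.of_le (by exact_mod_cast le_top)
  have hts : tsupport (fun X => Ψ X * ζ X) ⊆ cyl Ω := (tsupport_mul_subset_right).trans hs
  have hL := IsLineTest.of_contDiff (μ := volume) (U := cyl Ω) (e := coordVec j.castSucc) hζ hc hs
  have hLΨ := IsLineTest.of_contDiff (μ := volume) (U := cyl Ω) (e := coordVec j.castSucc)
    (hΨ1.mul hζ) hc.mul_left hts
  have h1 := hu.isLineTest_flux hΩ ha j i hLΨ
  have h2 := hu.isLineTest_flux hΩ ha j i hL
  have hlDD : ∀ k, LocallyIntegrableOn (uDD Ω u j.castSucc k) (cyl Ω) := fun k =>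
    ((hu.continuousOn_uDD hΩ _ k).mono cyl_subset_latCyl).locallyIntegrableOn ho.measurableSet
  have hlT : LocallyIntegrableOn (fun X => T X i) (cyl Ω) := hT.locInt_grad.coord i
  have hq : ContinuousOn (fun X => uD Ω u j.castSucc X * pd univ Ψ i X) (latCyl Ω) :=
    (hu.continuousOn_uD hΩ _).mul (continuous_pd_univ hΨ1 i).continuousOn
  have hpi1 : ContDiff ℝ 1 (pd univ Ψ i) := (contDiff_pd_univ hΨ i).of_le (by exact_mod_cast le_top)
  have hq' : ContinuousOn (fun X => uDD Ω u j.castSucc j.castSucc X * pd univ Ψ i X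
      + uD Ω u j.castSucc X * pd univ (pd univ Ψ i) j.castSucc X) (latCyl Ω) :=
    ((hu.continuousOn_uDD hΩ _ _).mul (continuous_pd_univ hΨ1 i).continuousOn).add
      ((hu.continuousOn_uD hΩ _).mul (continuous_pd_univ hpi1 _).continuousOn)
  have hql := (hq.mono (cyl_subset_latCyl (Ω := Ω))).locallyIntegrableOn ho.measurableSet
    (μ := volume)
  have hql' := (hq'.mono (cyl_subset_latCyl (Ω := Ω))).locallyIntegrableOn ho.measurableSet
    (μ := volume)
  -- The weak third derivative is tested with the flux component times `Ψ ζ`. This product is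
  -- differentiable in direction `x_j`, possibly in no other, which is why one-directional test
  -- functions are used. The part containing `∇Ψ` is classical and is treated in `e2`.
  have e1 := h1.weak_extend ho (hlDD i) hlT fun η hη hηc hηs => hu.weak_mixed hΩ hT i hη hηc hηs
  have e2 := h2.integral_by_parts ho (hq.mono cyl_subset_latCyl) (fun X hX =>
    (hu.hasLineDerivAt_uD hΩ _ _ hX).fun_mul (hasLineDerivAt_of_contDiff hpi1 X j.castSucc)) hql'
  have i1 := (integrable_mul_of_tsupport_subset (hlDD i) h1.compact h1.sub h1.meas h1.bdd
    fun X hX => h1.deriv_eq_zero hX).integrableOn (s := cyl Ω)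
  have i2 := (integrable_mul_of_tsupport_subset hlT h1.compact h1.sub h1.cont.aestronglyMeasurable
    h1.bdd_fun fun X hX => image_eq_zero_of_notMem_tsupport
      (f := fun X => wt Ω a u X * uD Ω u i X * (Ψ X * ζ X)) hX).integrableOn (s := cyl Ω)
  have i3 := (integrable_mul_of_tsupport_subset hql h2.compact h2.sub h2.meas h2.bdd
    fun X hX => h2.deriv_eq_zero hX).integrableOn (s := cyl Ω)
  have i4 := (integrable_mul_of_tsupport_subset hql' h2.compact h2.sub h2.cont.aestronglyMeasurable
    h2.bdd_fun fun X hX => image_eq_zero_of_notMem_tsupport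
      (f := fun X => wt Ω a u X * uD Ω u i X * ζ X) hX).integrableOn (s := cyl Ω)
  have hFH : ContinuousOn (fun X => F X * H X) (latCyl Ω) :=
    ((hu.continuousOn_wt hΩ ha).mul (hu.continuousOn_uD hΩ i)).mul
      (((hu.continuousOn_uDD hΩ _ i).mul hΨ.continuous.continuousOn).add hq)
  have i5 : IntegrableOn (fun X => F X * H X * fderiv ℝ ζ X (coordVec j.castSucc)) (cyl Ω) :=
    (integrable_mul_of_tsupport_subset ((hFH.mono cyl_subset_latCyl).locallyIntegrableOn
      ho.measurableSet) hL.compact hL.sub hL.meas hL.bdd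
      fun X hX => hL.deriv_eq_zero hX).integrableOn
  have hsymm : ∀ X, pd univ (pd univ Ψ i) j.castSucc X = pd univ (pd univ Ψ j.castSucc) i X := by
    intro X
    have hd : DifferentiableAt ℝ (fderiv ℝ Ψ) X :=
      ((hΨ.of_le (m := 2) ENat.LEInfty.out).fderiv_right (m := 1) (by norm_num)).differentiable one_ne_zero X
    have hp : ∀ k, pd univ Ψ k = fun X => fderiv ℝ Ψ X (coordVec k) := fun k =>
      funext fun X => pd_univ
    rw [pd_univ, pd_univ, hp, hp, fderiv_clm_apply hd (differentiableAt_const _),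
      fderiv_clm_apply hd (differentiableAt_const _)]
    have := (hΨ.contDiffAt (x := X)).isSymmSndFDerivAt (by simpa using ENat.LEInfty.out)
    simpa using this.eq _ _
  have e3 : ∀ X, fderiv ℝ (fun X => Ψ X * ζ X) X (coordVec j.castSucc)
      = Ψ X * fderiv ℝ ζ X (coordVec j.castSucc) + ζ X * pd univ Ψ j.castSucc X := fun X => by
    rw [fderiv_fun_mul (hΨ1.differentiable one_ne_zero X) (hζ.differentiable one_ne_zero X), pd_univ]
    simp
  have i6 := (i1.add i2).add (i3.add i4)
  -- By `e1` and `e2` the expression in the large bracket integrates to zero. It contains the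
  -- derivative of `ζ` once, multiplied by `F H`, and this is subtracted again.
  have key : ∀ X, D X * ζ X = (uDD Ω u j.castSucc i X *
        (fluxU Ω a u X (grad (latCyl Ω) (uD Ω u j.castSucc) X) i * (Ψ X * ζ X)
          + wt Ω a u X * uD Ω u i X * fderiv ℝ (fun X => Ψ X * ζ X) X (coordVec j.castSucc))
        + T X i * (wt Ω a u X * uD Ω u i X * (Ψ X * ζ X))
        + (uD Ω u j.castSucc X * pd univ Ψ i X *
          (fluxU Ω a u X (grad (latCyl Ω) (uD Ω u j.castSucc) X) i * ζ X
            + wt Ω a u X * uD Ω u i X * fderiv ℝ ζ X (coordVec j.castSucc))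
          + (uDD Ω u j.castSucc j.castSucc X * pd univ Ψ i X
            + uD Ω u j.castSucc X * pd univ (pd univ Ψ i) j.castSucc X) *
              (wt Ω a u X * uD Ω u i X * ζ X)))
        - F X * H X * fderiv ℝ ζ X (coordVec j.castSucc) := fun X => by
    simp only [D, H, F, e3, hsymm]
    ring
  refine ⟨(i6.sub i5).congr (ae_of_all _ fun X => (key X).symm), i5, ?_⟩
  rw [integral_congr_ae (ae_of_all _ key)]
  refine (integral_sub i6 i5).trans ?_
  have e4 := integral_add i1 i2
  have e5 := integral_add i3 i4
  have e6 := integral_add (i1.add i2) (i3.add i4)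
  simp only [Pi.add_apply] at e4 e5 e6 ⊢
  rw [e6, e4, e5, e1, e2]
  ring

/-- The field `a ∇u · ∇(u_{x_j} Ψ)`. -/
def diffusionField (Ω : Set (Hor n)) (a : ℝ → ℝ → ℝ) (u Ψ : Hor n × ℝ → ℝ) (X : Hor n × ℝ) :
    Hor n :=
  WithLp.toLp 2 fun j : Fin n => wt Ω a u X * ⟪gradU Ω u X,
    Ψ X • grad (latCyl Ω) (uD Ω u j.castSucc) X + uD Ω u j.castSucc X • grad univ Ψ X⟫

/-- The divergence of `diffusionField`. -/
def diffusionDiv (Ω : Set (Hor n)) (a : ℝ → ℝ → ℝ) (u Ψ : Hor n × ℝ → ℝ)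
    (T : Fin n → Hor n × ℝ → Full n) (X : Hor n × ℝ) : ℝ :=
  ∑ j : Fin n, ⟪fluxU Ω a u X (grad (latCyl Ω) (uD Ω u j.castSucc) X),
    Ψ X • grad (latCyl Ω) (uD Ω u j.castSucc) X + uD Ω u j.castSucc X • grad univ Ψ X⟫
  + wt Ω a u X * ⟪gradU Ω u X, divXGrad Ω u Ψ T X⟫

theorem IsVertTest.mul_horizontal {η : Hor n → ℝ} {θ : ℝ → ℝ} (hθ : IsVertTest θ)
    (hη : ContDiff ℝ 1 η) (hηc : HasCompactSupport η) (hηs : tsupport η ⊆ Ω) :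
    ContDiff ℝ 1 (fun X : Hor n × ℝ => η X.1 * θ X.2) ∧
    HasCompactSupport (fun X : Hor n × ℝ => η X.1 * θ X.2) ∧
    tsupport (fun X : Hor n × ℝ => η X.1 * θ X.2) ⊆ cyl Ω ∧
    ∀ (X : Hor n × ℝ) (j : Fin n), fderiv ℝ (fun X => η X.1 * θ X.2) X (coordVec j.castSucc)
      = fderiv ℝ η X.1 (EuclideanSpace.single j 1) * θ X.2 := by
  let ζ : Hor n × ℝ → ℝ := fun X => η X.1 * θ X.2
  have hζ : ContDiff ℝ 1 ζ := (hη.comp contDiff_fst).mul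
    ((hθ.contDiff.of_le (by exact_mod_cast le_top)).comp contDiff_snd)
  have hsub : tsupport ζ ⊆ tsupport η ×ˢ tsupport θ := by
    refine closure_minimal (fun X hX => ?_) ((isClosed_tsupport η).prod (isClosed_tsupport θ))
    refine ⟨subset_tsupport _ fun h => hX ?_, subset_tsupport _ fun h => hX ?_⟩ <;> simp [ζ, h]
  have hs : tsupport ζ ⊆ cyl Ω := hsub.trans (prod_mono hηs hθ.sub)
  have hc : HasCompactSupport ζ := (hηc.isCompact.prod hθ.compact.isCompact).of_isClosed_subset
    (isClosed_tsupport ζ) hsub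
  have hfd : ∀ X (j : Fin n), fderiv ℝ ζ X (coordVec j.castSucc)
      = fderiv ℝ η X.1 (EuclideanSpace.single j 1) * θ X.2 := fun X j => by
    have h1 := ((hζ.differentiable one_ne_zero X).hasFDerivAt.hasLineDerivAt
      (coordVec j.castSucc))
    have h2 : HasLineDerivAt ℝ ζ (fderiv ℝ η X.1 (EuclideanSpace.single j 1) * θ X.2) X
        (coordVec j.castSucc) := by
      have h3 := ((hη.differentiable one_ne_zero X.1).hasFDerivAt.hasLineDerivAt
        (EuclideanSpace.single j (1 : ℝ)))
      unfold HasLineDerivAt at *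
      simpa [coordVec_castSucc, ζ] using h3.mul_const (θ X.2)
    exact h1.unique h2
  exact ⟨hζ, hc, hs, hfd⟩

/-- The component identities are summed over `i` and `j`, with a test function of product form. The
terms carrying a derivative of the flux form the part with `ℬ`, the others the gradient of
`div_x(Ψ∇ₓu)`. -/
theorem IsRegularSol.hasWeakHorDiv_diffusion (hu : IsRegularSol Ω a u) (hΩ : IsHolderDomain 4 α Ω)
    (ha : IsDiffusion a) (hΨ : ContDiff ℝ ∞ Ψ) {T : Fin n → Hor n × ℝ → Full n}
    (hT : ∀ j, HasWeakGrad Ω (uDD Ω u j.castSucc j.castSucc) (T j)) :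
    HasWeakHorDiv Ω (diffusionField Ω a u Ψ) (diffusionDiv Ω a u Ψ T) := by
  intro η θ hη hηc hηs hθ
  let ζ : Hor n × ℝ → ℝ := fun X => η X.1 * θ X.2
  obtain ⟨hζ, hc, hs, hfd⟩ := hθ.mul_horizontal hη hηc hηs
  have hcomp := fun (j : Fin n) (i : Fin (n + 1)) =>
    hu.integral_component hΩ ha hΨ (hT j) i hζ hc hs
  have e1 : ∀ X, diffusionDiv Ω a u Ψ T X * (η X.1 * θ X.2) = ∑ j : Fin n, ∑ i : Fin (n + 1),
      (fluxU Ω a u X (grad (latCyl Ω) (uD Ω u j.castSucc) X) i *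
          (uDD Ω u j.castSucc i X * Ψ X + uD Ω u j.castSucc X * pd univ Ψ i X)
        + wt Ω a u X * uD Ω u i X * (T j X i * Ψ X + uDD Ω u j.castSucc i X * pd univ Ψ j.castSucc X
          + (uDD Ω u j.castSucc j.castSucc X * pd univ Ψ i X
            + uD Ω u j.castSucc X * pd univ (pd univ Ψ j.castSucc) i X))) * ζ X := fun X => by
    simp only [← Finset.sum_mul, ζ]
    congr 1
    simp only [diffusionDiv, divXGrad, inner_sum, Finset.mul_sum, ← Finset.sum_add_distrib]
    refine Finset.sum_congr rfl fun j _ => ?_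
    rw [PiLp.inner_apply, PiLp.inner_apply, Finset.mul_sum, ← Finset.sum_add_distrib]
    refine Finset.sum_congr rfl fun i _ => ?_
    simp only [PiLp.add_apply, PiLp.smul_apply, smul_eq_mul, grad_apply, gradU, RCLike.inner_apply,
      conj_trivial, uD, uDD]
    ring
  have e2 : ∀ X, fderiv ℝ η X.1 (diffusionField Ω a u Ψ X) * θ X.2 = ∑ j : Fin n,
      ∑ i : Fin (n + 1), wt Ω a u X * uD Ω u i X *
          (uDD Ω u j.castSucc i X * Ψ X + uD Ω u j.castSucc X * pd univ Ψ i X) *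
        fderiv ℝ ζ X (coordVec j.castSucc) := fun X => by
    conv_lhs => rw [← sum_single (diffusionField Ω a u Ψ X)]
    rw [map_sum, Finset.sum_mul]
    refine Finset.sum_congr rfl fun j _ => ?_
    rw [map_smul, smul_eq_mul, mul_assoc, ← hfd, ← Finset.sum_mul]
    congr 1
    simp only [diffusionField]
    rw [PiLp.inner_apply, Finset.mul_sum]
    refine Finset.sum_congr rfl fun i _ => ?_
    simp only [PiLp.add_apply, PiLp.smul_apply, smul_eq_mul, grad_apply, gradU, RCLike.inner_apply,
      conj_trivial, uD, uDD]
    ring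
  simp only [e1, e2]
  rw [integral_finsetSum _ fun j _ => integrable_finsetSum _ fun i _ => (hcomp j i).1,
    integral_finsetSum _ fun j _ => integrable_finsetSum _ fun i _ => (hcomp j i).2.1,
    ← Finset.sum_neg_distrib]
  refine Finset.sum_congr rfl fun j _ => ?_
  rw [integral_finsetSum _ fun i _ => (hcomp j i).1, integral_finsetSum _ fun i _ => (hcomp j i).2.1,
    ← Finset.sum_neg_distrib]
  exact Finset.sum_congr rfl fun i _ => (hcomp j i).2.2

theorem IsRegularSol.continuousOn_diffusionField (hu : IsRegularSol Ω a u)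
    (hΩ : IsHolderDomain 4 α Ω) (ha : IsDiffusion a) (hΨ : ContDiff ℝ 1 Ψ) :
    ContinuousOn (diffusionField Ω a u Ψ) (latCyl Ω) :=
  (PiLp.continuous_toLp 2 _).comp_continuousOn (continuousOn_pi.2 fun _ =>
    (hu.continuousOn_wt hΩ ha).mul ((hu.continuousOn_gradU hΩ).inner
      ((hΨ.continuous.continuousOn.smul (hu.continuousOn_grad_uD hΩ _)).add
        ((hu.continuousOn_uD hΩ _).smul (continuous_grad_univ hΨ).continuousOn))))

/-- On the lateral boundary only the derivatives of `u` contribute to the field. -/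
theorem IsRegularSol.inner_diffusionField (hu : IsRegularSol Ω a u) (hΩ : IsHolderDomain 4 α Ω)
    {X : Hor n × ℝ} (hX : X ∈ frontier Ω ×ˢ Ioi (0 : ℝ)) :
    ⟪diffusionField Ω a u Ψ X, outerNormal Ω X.1⟫ = wt Ω a u X * normalTerm Ω u X * Ψ X := by
  have hXl : X ∈ latCyl Ω := ⟨frontier_subset_closure hX.1, hX.2⟩
  -- The Neumann condition removes every term in which `Ψ` is differentiated.
  have hN : ∑ j : Fin n, outerNormal Ω X.1 j * uD Ω u j.castSucc X = 0 := by
    rw [← hu.neumann X.1 hX.1 X.2 hX.2, dirDeriv_eq_sum]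
    rfl
  -- Symmetry of the second derivatives turns `∑ ν_j ∇u·∇u_{x_j}` into `∇u·∂_ν∇u`.
  have h1 : ∑ j : Fin n, outerNormal Ω X.1 j * ⟪gradU Ω u X,
      grad (latCyl Ω) (uD Ω u j.castSucc) X⟫ = normalTerm Ω u X := by
    simp only [normalTerm, dirDeriv_eq_sum, PiLp.inner_apply, Finset.mul_sum]
    rw [Finset.sum_comm]
    refine Finset.sum_congr rfl fun i _ => Finset.sum_congr rfl fun j _ => ?_
    have : pd (latCyl Ω) (uD Ω u i) j.castSucc X = pd (latCyl Ω) (uD Ω u j.castSucc) i X :=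
      hΩ.uDD_symm hu.contDiff _ _ hXl
    rw [this]
    simp only [grad_apply, gradU, RCLike.inner_apply, conj_trivial, uD]
    ring
  rw [PiLp.inner_apply]
  have h2 : ∀ j : Fin n, inner ℝ (diffusionField Ω a u Ψ X j) (outerNormal Ω X.1 j)
      = wt Ω a u X * Ψ X * (outerNormal Ω X.1 j * ⟪gradU Ω u X,
        grad (latCyl Ω) (uD Ω u j.castSucc) X⟫)
      + wt Ω a u X * ⟪gradU Ω u X, grad univ Ψ X⟫ * (outerNormal Ω X.1 j * uD Ω u j.castSucc X) := by
    intro j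
    simp only [diffusionField, inner_add_right, inner_smul_right, RCLike.inner_apply, conj_trivial]
    ring
  simp only [h2, Finset.sum_add_distrib, ← Finset.mul_sum, hN, h1]
  ring

theorem IsRegularSol.integrableOn_flux_inner (hu : IsRegularSol Ω a u) (hΩ : IsHolderDomain 4 α Ω)
    (ha : IsDiffusion a) {p q : Hor n × ℝ → Full n} (hp : WL2 Ω a u p) (hq : WL2 Ω a u q) {R : ℝ}
    (hR : ∀ X ∈ cyl Ω, R ≤ X.2 → q X = 0) :
    IntegrableOn (fun X => ⟪fluxU Ω a u X (p X), q X⟫) (cyl Ω) := by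
  obtain ⟨C, hC, h⟩ := exists_norm_fluxU_le Ω u ha
  have hcm := (isOpen_cyl hΩ.isOpen).measurableSet
  have h1 : IntegrableOn (fun X => ⟪fluxU Ω a u X (p X), q X⟫) (Ω ×ˢ Ioo 0 (max R 1)) := by
    refine WL2.integrableOn_of_le hΩ ha hp hq (C := C)
      ((hu.aestronglyMeasurable_fluxU hΩ ha hp.meas).inner hq.meas) (by positivity) ?_
    filter_upwards [ae_restrict_mem hcm] with X hX
    refine (abs_real_inner_le_norm _ _).trans ?_
    have := mul_le_mul_of_nonneg_right (h X (cyl_subset_latCyl hX) (p X)) (norm_nonneg (q X))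
    calc _ ≤ _ := this
      _ = _ := by ring
  refine IntegrableOn.of_forall_sdiff_eq_zero h1 hcm fun X hX => ?_
  have : R ≤ X.2 := by
    by_contra hc
    rw [not_le] at hc
    exact hX.2 ⟨hX.1.1, hX.1.2, hc.trans_le (le_max_left _ _)⟩
  rw [hR X hX.1 this, inner_zero_right]

theorem IsRegularSol.integrableOn_wt_inner (hu : IsRegularSol Ω a u) (hΩ : IsHolderDomain 4 α Ω)
    (ha : IsDiffusion a) {p q : Hor n × ℝ → Full n} (hp : WL2 Ω a u p) (hq : WL2 Ω a u q) {R : ℝ}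
    (hR : ∀ X ∈ cyl Ω, R ≤ X.2 → q X = 0) :
    IntegrableOn (fun X => wt Ω a u X * ⟪p X, q X⟫) (cyl Ω) := by
  have hcm := (isOpen_cyl hΩ.isOpen).measurableSet
  have h1 : IntegrableOn (fun X => wt Ω a u X * ⟪p X, q X⟫) (Ω ×ˢ Ioo 0 (max R 1)) := by
    refine WL2.integrableOn_of_le hΩ ha hp hq (C := 1)
      ((hu.aestronglyMeasurable_wt hΩ ha).mul (hp.meas.inner hq.meas)) (by positivity) ?_
    filter_upwards [ae_restrict_mem hcm] with X hX
    have hw := wt_pos (u := u) ha (cyl_subset_latCyl hX)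
    simp only [Pi.mul_apply]
    rw [abs_mul, abs_of_pos hw, one_mul]
    exact mul_le_mul_of_nonneg_left (abs_real_inner_le_norm _ _) hw.le
  refine IntegrableOn.of_forall_sdiff_eq_zero h1 hcm fun X hX => ?_
  have : R ≤ X.2 := by
    by_contra hc
    rw [not_le] at hc
    exact hX.2 ⟨hX.1.1, hX.1.2, hc.trans_le (le_max_left _ _)⟩
  rw [hR X hX.1 this, inner_zero_right, mul_zero]

end Diffusion

/-! ### Curves in regular level sets. -/

section LevelCurve

variable {E : Type*} [NormedAddCommGroup E] [NormedSpace ℝ E] [CompleteSpace E]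

/-- Tangent vectors to a regular level set are velocities of curves in it. -/
theorem HasStrictFDerivAt.exists_levelCurve {ρ : E → ℝ} {L : E →L[ℝ] ℝ} {x τ : E}
    (h : HasStrictFDerivAt ρ L x) (hL : L ≠ 0) (hτ : L τ = 0) :
    ∃ γ : ℝ → E, γ 0 = x ∧ HasDerivAt γ τ 0 ∧ ∀ᶠ t in 𝓝 0, ρ (γ t) = ρ x := by
  have hs : (L : E →ₗ[ℝ] ℝ).range = ⊤ := LinearMap.range_eq_top.2
    (LinearMap.surjective fun h0 => hL (ContinuousLinearMap.coe_injective h0))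
  let v : (L : E →ₗ[ℝ] ℝ).ker := ⟨τ, hτ⟩
  have h1 := h.to_implicitFunction hs
  have hd : HasDerivAt (fun t : ℝ => t • v) v 0 := by
    simpa using (hasDerivAt_id (0 : ℝ)).smul_const v
  -- The implicit function parametrizes the level set by the kernel of `L`, and its derivative at
  -- the origin is the inclusion of that kernel.
  refine ⟨fun t => h.implicitFunction ρ L hs (ρ x) (t • v), ?_, ?_, ?_⟩
  · simp
  · have h2 : HasFDerivAt (h.implicitFunction ρ L hs (ρ x)) (L : E →ₗ[ℝ] ℝ).ker.subtypeL
        ((0 : ℝ) • v) := by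
      rw [zero_smul]; exact h1.hasFDerivAt
    exact h2.comp_hasDerivAt (0 : ℝ) hd
  · have h3 := h.map_implicitFunction_eq hs
    have h4 : Tendsto (fun t : ℝ => (ρ x, t • v)) (𝓝 0) (𝓝 (ρ x, 0)) := by
      refine tendsto_const_nhds.prodMk_nhds ?_
      simpa using hd.continuousAt.tendsto
    exact h4.eventually h3

end LevelCurve

/-! ### The Neumann condition differentiated along the boundary. -/

section BoundaryTerm

variable {n : ℕ} {α : ℝ≥0} {Ω : Set (Hor n)} {a : ℝ → ℝ → ℝ} {u : Hor n × ℝ → ℝ}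

theorem IsRegularSol.hasFDerivWithinAt_uD (hu : IsRegularSol Ω a u) (hΩ : IsHolderDomain 4 α Ω)
    (i : Fin (n + 1)) {X : Hor n × ℝ} (hX : X ∈ latCyl Ω) :
    HasFDerivWithinAt (uD Ω u i) (fderivWithin ℝ (uD Ω u i) (latCyl Ω) X) (latCyl Ω) X :=
  ((hu.contDiffOn_uD hΩ i).differentiableOn one_ne_zero X hX).hasFDerivWithinAt

/-- The Neumann condition may be differentiated in the vertical direction. -/
theorem IsRegularSol.neumann_vertical (hu : IsRegularSol Ω a u) (hΩ : IsHolderDomain 4 α Ω)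
    {x : Hor n} (hx : x ∈ frontier Ω) {y : ℝ} (hy : 0 < y) :
    ∑ j : Fin n, outerNormal Ω x j * uDD Ω u j.castSucc (Fin.last n) (x, y) = 0 := by
  have hX : (x, y) ∈ latCyl Ω := ⟨frontier_subset_closure hx, hy⟩
  have hc : HasDerivAt (fun s : ℝ => (x, s)) ((0 : Hor n), (1 : ℝ)) y :=
    (hasDerivAt_const y x).prodMk (hasDerivAt_id y)
  have hm : ∀ᶠ s in 𝓝 y, (x, s) ∈ latCyl Ω := by
    filter_upwards [lt_mem_nhds hy] with s hs
    exact ⟨frontier_subset_closure hx, hs⟩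
  have h1 : HasDerivAt (fun s : ℝ => ∑ j : Fin n, outerNormal Ω x j * uD Ω u j.castSucc (x, s))
      (∑ j : Fin n, outerNormal Ω x j * uDD Ω u j.castSucc (Fin.last n) (x, y)) y := by
    refine HasDerivAt.fun_sum fun j _ => HasDerivAt.const_mul _ ?_
    have := (hu.hasFDerivWithinAt_uD hΩ j.castSucc hX).comp_hasDerivAt y hc hm
    rw [uDD, pd, coordVec_last]
    exact this
  refine h1.unique ((hasDerivAt_const y (0 : ℝ)).congr_of_eventuallyEq ?_)
  filter_upwards [lt_mem_nhds hy] with s hs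
  rw [← hu.neumann x hx s hs, dirDeriv_eq_sum]
  rfl

/-- The boundary term is controlled by the second fundamental form of the boundary. -/
theorem IsRegularSol.abs_normalTerm_le_of_chart (hu : IsRegularSol Ω a u)
    (hΩ : IsHolderDomain 4 α Ω) {x₀ e : Hor n} {r : ℝ} {ρ : Hor n → ℝ}
    (C : BoundaryChart Ω x₀ e (1 / 2) r ρ) {x : Hor n} (hx : x ∈ Metric.ball x₀ r)
    (hf : x ∈ frontier Ω) {y : ℝ} (hy : 0 < y) {K : ℝ} (hK : ‖fderiv ℝ (fderiv ℝ ρ) x‖ ≤ K) :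
    |normalTerm Ω u (x, y)| ≤ 2 * K * ‖gradX (latCyl Ω) u (x, y)‖ ^ 2 := by
  have hX : (x, y) ∈ latCyl Ω := ⟨frontier_subset_closure hf, hy⟩
  set τ := gradX (latCyl Ω) u (x, y) with hτdef
  -- The Neumann condition, stated with the unnormalized normal `∇ρ`; in this form it can be
  -- differentiated with `ρ` of class `C²`.
  have hQ : ∀ z ∈ Metric.ball x₀ r, z ∈ frontier Ω →
      fderiv ℝ ρ z (gradX (latCyl Ω) u (z, y)) = 0 := by
    intro z hz hzf
    have h1 := hu.neumann z hzf y hy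
    rw [dirDeriv_eq_inner, C.outerNormal_eq (by norm_num) hz hzf, inner_smul_right,
      real_inner_comm, inner_gradient_eq] at h1
    exact (mul_eq_zero.1 h1).resolve_left
      (inv_ne_zero (norm_ne_zero_iff.2 (C.gradient_ne_zero (by norm_num) hz)))
  have hcd : ContDiffAt ℝ 2 ρ x := C.contDiffOn.contDiffAt (Metric.isOpen_ball.mem_nhds hx)
  have hne : fderiv ℝ ρ x ≠ 0 := by
    intro h0
    refine C.gradient_ne_zero (by norm_num) hx ?_
    simp [gradient, h0]
  -- By the Neumann condition `∇ₓu` is itself tangent to the boundary, so some boundary curve has it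
  -- as velocity. Moving within the closed domain also allows the one-sided derivatives of `u` to be
  -- composed with the curve.
  obtain ⟨γ, hγ0, hγ, hγρ⟩ := (hcd.hasStrictFDerivAt two_ne_zero).exists_levelCurve hne
    (hQ x hx hf)
  rw [← hτdef] at hγ
  have hγf : ∀ᶠ t in 𝓝 (0 : ℝ), γ t ∈ Metric.ball x₀ r ∧ γ t ∈ frontier Ω := by
    have hb : ∀ᶠ t in 𝓝 (0 : ℝ), γ t ∈ Metric.ball x₀ r :=
      hγ.continuousAt.eventually (by rw [hγ0]; exact Metric.isOpen_ball.mem_nhds hx)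
    filter_upwards [hb, hγρ] with t ht htρ
    exact ⟨ht, (C.frontier_iff _ ht).2 (htρ.trans ((C.frontier_iff x hx).1 hf))⟩
  have hD2 : HasDerivAt (fun t => fderiv ℝ ρ (γ t)) (fderiv ℝ (fderiv ℝ ρ) x τ) 0 := by
    have h1 : HasFDerivAt (fderiv ℝ ρ) (fderiv ℝ (fderiv ℝ ρ) x) (γ 0) := by
      rw [hγ0]
      exact ((hcd.fderiv_right (m := 1) (by norm_num)).differentiableAt one_ne_zero).hasFDerivAt
    exact h1.comp_hasDerivAt (0 : ℝ) hγ
  have hcurve : HasDerivAt (fun t => (γ t, y)) (τ, (0 : ℝ)) 0 :=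
    hγ.prodMk (hasDerivAt_const (0 : ℝ) y)
  have hdj : ∀ j : Fin n, HasDerivAt (fun t => uD Ω u j.castSucc (γ t, y))
      (dirDeriv (latCyl Ω) (uD Ω u j.castSucc) τ (x, y)) 0 := fun j => by
    have h1 : HasFDerivWithinAt (uD Ω u j.castSucc)
        (fderivWithin ℝ (uD Ω u j.castSucc) (latCyl Ω) (x, y)) (latCyl Ω) (γ 0, y) := by
      rw [hγ0]; exact hu.hasFDerivWithinAt_uD hΩ _ hX
    refine h1.comp_hasDerivAt (0 : ℝ) hcurve ?_
    filter_upwards [hγf] with t ht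
    exact ⟨frontier_subset_closure ht.2, hy⟩
  have hexp : ∀ (L : Hor n →L[ℝ] ℝ) (w : Hor n),
      L w = ∑ j, w j * L (EuclideanSpace.single j 1) := fun L w => by
    conv_lhs => rw [← sum_single w]
    simp
  have hsum : HasDerivAt (fun t => ∑ j : Fin n,
      uD Ω u j.castSucc (γ t, y) * fderiv ℝ ρ (γ t) (EuclideanSpace.single j 1))
      (∑ j : Fin n, (dirDeriv (latCyl Ω) (uD Ω u j.castSucc) τ (x, y) *
          fderiv ℝ ρ (γ 0) (EuclideanSpace.single j 1)
        + uD Ω u j.castSucc (γ 0, y) * fderiv ℝ (fderiv ℝ ρ) x τ (EuclideanSpace.single j 1))) 0 := by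
    refine HasDerivAt.fun_sum fun j _ => (hdj j).mul ?_
    simpa using hD2.clm_apply (hasDerivAt_const (0 : ℝ) (EuclideanSpace.single j (1 : ℝ)))
  -- With `τ = ∇ₓu`, the derivative of `∇ρ·∇ₓu = 0` along the curve reads `∇ρ·∂_τ∇ₓu + D²ρ(τ,τ) =
  -- 0`.
  have hzero := hsum.unique ((hasDerivAt_const (0 : ℝ) (0 : ℝ)).congr_of_eventuallyEq (by
    filter_upwards [hγf] with t ht
    rw [← hQ _ ht.1 ht.2, hexp]
    rfl))
  rw [hγ0, Finset.sum_add_distrib] at hzero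
  have hτ2 : ∑ j : Fin n, uD Ω u j.castSucc (x, y) *
      fderiv ℝ (fderiv ℝ ρ) x τ (EuclideanSpace.single j 1) = fderiv ℝ (fderiv ℝ ρ) x τ τ := by
    rw [hexp]
    rfl
  rw [hτ2] at hzero
  have hν : ∀ j, outerNormal Ω x j
      = ‖gradient ρ x‖⁻¹ * fderiv ℝ ρ x (EuclideanSpace.single j 1) := fun j => by
    rw [C.outerNormal_eq (by norm_num) hx hf, ← inner_gradient_eq, PiLp.smul_apply,
      smul_eq_mul, EuclideanSpace.inner_single_right]
    simp
  -- The vertical summand `u_y ∂_ν u_y` drops out, by the Neumann condition differentiated in `y`.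
  have hlast : dirDeriv (latCyl Ω) (uD Ω u (Fin.last n)) (outerNormal Ω x) (x, y) = 0 := by
    rw [dirDeriv_eq_sum, ← hu.neumann_vertical hΩ hf hy]
    exact Finset.sum_congr rfl fun j _ => congrArg _ (hΩ.uDD_symm hu.contDiff _ _ hX)
  -- Symmetry of second derivatives: `∇ₓu·∂_ν∇ₓu = ν·∂_τ∇ₓu`. The right side is the first term of
  -- the differentiated condition.
  have hN : normalTerm Ω u (x, y) = ‖gradient ρ x‖⁻¹ * ∑ j : Fin n,
      dirDeriv (latCyl Ω) (uD Ω u j.castSucc) τ (x, y) *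
          fderiv ℝ ρ x (EuclideanSpace.single j 1) := by
    rw [normalTerm, Fin.sum_univ_castSucc, hlast, mul_zero, add_zero, Finset.mul_sum]
    simp only [dirDeriv_eq_sum, Finset.mul_sum, Finset.sum_mul]
    rw [Finset.sum_comm]
    refine Finset.sum_congr rfl fun j _ => Finset.sum_congr rfl fun i _ => ?_
    have : pd (latCyl Ω) (uD Ω u i.castSucc) j.castSucc (x, y)
      = pd (latCyl Ω) (uD Ω u j.castSucc) i.castSucc (x, y) := hΩ.uDD_symm hu.contDiff _ _ hX
    rw [this, hν, hτdef, gradX_apply, uD]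
    ring
  rw [hN, eq_neg_of_add_eq_zero_left hzero, abs_mul, abs_neg]
  have hinv : |‖gradient ρ x‖⁻¹| ≤ 2 := by
    rw [abs_of_nonneg (by positivity)]
    have h1 := (abs_le.1 (C.abs_norm_grad hx)).1
    have h2 : (2 : ℝ)⁻¹ ≤ ‖gradient ρ x‖ := by linarith
    exact inv_le_of_inv_le₀ (by norm_num) h2
  have hq : |fderiv ℝ (fderiv ℝ ρ) x τ τ| ≤ K * ‖τ‖ ^ 2 := by
    refine ((fderiv ℝ (fderiv ℝ ρ) x).le_opNorm₂ τ τ).trans ?_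
    rw [mul_assoc, ← sq]
    exact mul_le_mul_of_nonneg_right hK (sq_nonneg _)
  calc _ ≤ 2 * (K * ‖τ‖ ^ 2) := mul_le_mul hinv hq (abs_nonneg _) (by norm_num)
    _ = _ := by ring

/-- The local constants are bounds for second derivatives of defining functions on smaller balls;
they do not depend on `y`, and compactness of the frontier makes them uniform. -/
theorem IsRegularSol.exists_abs_normalTerm_le (hu : IsRegularSol Ω a u)
    (hΩ : IsHolderDomain 4 α Ω) :
    ∃ K : ℝ, 0 ≤ K ∧ ∀ X ∈ frontier Ω ×ˢ Ioi (0 : ℝ),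
      |normalTerm Ω u X| ≤ K * ‖gradX (latCyl Ω) u X‖ ^ 2 := by
  -- The first membership is the one generalized to subsets `s` in the compactness induction; the
  -- second stays fixed, since the sets used there are full balls.
  have key : ∃ K : ℝ, 0 ≤ K ∧ ∀ x ∈ frontier Ω, x ∈ frontier Ω → ∀ y > 0,
      |normalTerm Ω u (x, y)| ≤ K * ‖gradX (latCyl Ω) u (x, y)‖ ^ 2 := by
    refine hΩ.isCompact_frontier.induction_on (p := fun s => ∃ K : ℝ, 0 ≤ K ∧ ∀ x ∈ s,
      x ∈ frontier Ω → ∀ y > 0, |normalTerm Ω u (x, y)| ≤ K * ‖gradX (latCyl Ω) u (x, y)‖ ^ 2)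
      ⟨0, le_rfl, fun x hx => hx.elim⟩ ?_ ?_ ?_
    · rintro s t hst ⟨K, hK, h⟩
      exact ⟨K, hK, fun x hx => h x (hst hx)⟩
    · rintro s t ⟨K, hK, h⟩ ⟨K', hK', h'⟩
      refine ⟨K + K', add_nonneg hK hK', fun x hx hxf y hy => ?_⟩
      have h0 := sq_nonneg ‖gradX (latCyl Ω) u (x, y)‖
      rcases hx with hx | hx
      · nlinarith [h x hx hxf y hy, mul_nonneg hK' h0]
      · nlinarith [h' x hx hxf y hy, mul_nonneg hK h0]
    · intro x₀ hx₀
      obtain ⟨e, r, ρ, C⟩ := hΩ.exists_boundaryChart hx₀ (ε := 1 / 2) (by norm_num)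
      have hr := C.r_pos
      have hsub : Metric.closedBall x₀ (r / 2) ⊆ Metric.ball x₀ r :=
        Metric.closedBall_subset_ball (by linarith)
      have hc : ContinuousOn (fderiv ℝ (fderiv ℝ ρ)) (Metric.closedBall x₀ (r / 2)) :=
        ((C.contDiffOn.fderiv_of_isOpen Metric.isOpen_ball (m := 1)
          (by norm_num)).continuousOn_fderiv_of_isOpen Metric.isOpen_ball le_rfl).mono hsub
      obtain ⟨K, hK⟩ := (isCompact_closedBall x₀ (r / 2)).exists_bound_of_continuousOn
        (f := fderiv ℝ (fderiv ℝ ρ)) hc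
      have hK0 : 0 ≤ K := (norm_nonneg _).trans (hK x₀ (Metric.mem_closedBall_self (by linarith)))
      refine ⟨Metric.closedBall x₀ (r / 2),
        mem_nhdsWithin_of_mem_nhds (Metric.closedBall_mem_nhds _ (by linarith)),
        2 * K, by positivity, fun x hx hxf y hy => ?_⟩
      exact hu.abs_normalTerm_le_of_chart hΩ C (hsub hx) hxf hy (hK x hx)
  obtain ⟨K, hK, h⟩ := key
  exact ⟨K, hK, fun X hX => h X.1 hX.1 hX.1 X.2 hX.2⟩

end BoundaryTerm

/-! ### Integrability on the lateral boundary down to the bottom. -/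

section LateralIntegrability

variable {n : ℕ} {α : ℝ≥0} {Ω : Set (Hor n)}

theorem IsHolderDomain.aestronglyMeasurable_lateral (hΩ : IsHolderDomain 4 α Ω)
    {G : Hor n × ℝ → ℝ} (hG : ContinuousOn G (frontier Ω ×ˢ Ioi (0 : ℝ))) :
    AEStronglyMeasurable G (latMeasure Ω) := by
  rw [hΩ.latMeasure_eq_restrict]
  exact hG.aestronglyMeasurable (isClosed_frontier.measurableSet.prod measurableSet_Ioi)

theorem IsHolderDomain.continuousOn_inner_outerNormal (hΩ : IsHolderDomain 4 α Ω)
    {P : Hor n × ℝ → Hor n} (hP : ContinuousOn P (latCyl Ω)) :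
    ContinuousOn (fun X => ⟪P X, outerNormal Ω X.1⟫) (frontier Ω ×ˢ Ioi (0 : ℝ)) :=
  (hP.mono (prod_mono frontier_subset_closure subset_rfl)).inner
    (hΩ.continuousOn_outerNormal.comp continuousOn_fst fun _ hX => hX.1)

theorem IsVertTest.mul_right {θ χ : ℝ → ℝ} (h : IsVertTest θ) (hχ : ContDiff ℝ ∞ χ) :
    IsVertTest (fun y => θ y * χ y) :=
  ⟨h.contDiff.mul hχ, h.compact.mul_right, tsupport_mul_subset_left.trans h.sub⟩

/-- A field with integrable divergence and nonnegative normal component has an integrable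
normal component. -/
theorem IsHolderDomain.integrableOn_lateral (hΩ : IsHolderDomain 4 α Ω)
    {P : Hor n × ℝ → Hor n} {D : Hor n × ℝ → ℝ} (hP : ContinuousOn P (latCyl Ω))
    (h : HasWeakHorDiv Ω P D) (hD : ∀ R > 0, IntegrableOn D (Ω ×ˢ Ioo 0 R))
    (hpos : ∀ X ∈ frontier Ω ×ˢ Ioi (0 : ℝ), 0 ≤ ⟪P X, outerNormal Ω X.1⟫) {R : ℝ} (hR : 0 < R) :
    IntegrableOn (fun X => ⟪P X, outerNormal Ω X.1⟫) (frontier Ω ×ˢ Ioo 0 R) (latMeasure Ω) := by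
  obtain ⟨θ, hθ, hθ01, hθ1⟩ := exists_vertTest_seq
  have hcm := (isOpen_cyl hΩ.isOpen).measurableSet
  have hSm : MeasurableSet (frontier Ω ×ˢ Ioo 0 R) :=
    isClosed_frontier.measurableSet.prod measurableSet_Ioo
  let χ : ℝ → ℝ := fun y => cutoff (R + 1 - y)
  have hχ : ContDiff ℝ ∞ χ := contDiff_cutoff.comp (by fun_prop)
  let G : Hor n × ℝ → ℝ := fun X => ⟪P X, outerNormal Ω X.1⟫
  -- Weights between zero and one, supported away from the bottom and below height `R + 1`. At each
  -- height in `(0, R)` they are eventually equal to one.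
  let τ : ℕ → ℝ → ℝ := fun m y => θ m y * χ y
  have hτ : ∀ m, IsVertTest (τ m) := fun m => (hθ m).mul_right hχ
  have hτ01 : ∀ m y, 0 ≤ τ m y ∧ τ m y ≤ 1 := fun m y =>
    ⟨mul_nonneg (hθ01 m y).1 (cutoff_nonneg _),
      mul_le_one₀ (hθ01 m y).2 (cutoff_nonneg _) (cutoff_le_one _)⟩
  have hDR := hD (R + 1) (by linarith)
  have hz : ∀ m, ∀ X ∈ cyl Ω \ (Ω ×ˢ Ioo 0 (R + 1)), D X * τ m X.2 = 0 := fun m X hX => by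
    have : R + 1 ≤ X.2 := by
      by_contra hc
      exact hX.2 ⟨hX.1.1, hX.1.2, not_le.1 hc⟩
    simp [τ, χ, cutoff_of_le (show R + 1 - X.2 ≤ 1 / 2 by linarith)]
  have hDs : ∀ m, IntegrableOn (fun X => D X * τ m X.2) (Ω ×ˢ Ioo 0 (R + 1)) := fun m =>
    hDR.mul_bdd (c := 1) ((hτ m).contDiff.continuous.comp continuous_snd).aestronglyMeasurable
      (ae_of_all _ fun X => by
        rw [Real.norm_of_nonneg (hτ01 m X.2).1]; exact (hτ01 m X.2).2)
  have hDi : ∀ m, IntegrableOn (fun X => D X * τ m X.2) (cyl Ω) := fun m =>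
    IntegrableOn.of_forall_sdiff_eq_zero (hDs m) hcm (hz m)
  have hmain := fun m => hΩ.integral_horDiv hP (hτ m) (hDi m) h
  set M : ℝ := ∫ X in Ω ×ˢ Ioo 0 (R + 1), |D X|
  -- The divergence theorem trades the boundary integral for one over the cylinder, whose bound does
  -- not depend on `m`.
  have hM : ∀ m, ∫ X, G X * τ m X.2 ∂(latMeasure Ω) ≤ M := fun m => by
    rw [← (hmain m).2, setIntegral_eq_of_subset_of_forall_sdiff_eq_zero hcm
      (prod_mono subset_rfl fun _ hy => hy.1) (hz m)]
    refine integral_mono (hDs m) hDR.abs fun X => ?_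
    refine (le_abs_self _).trans ?_
    rw [abs_mul, abs_of_nonneg (hτ01 m X.2).1]
    exact mul_le_of_le_one_right (abs_nonneg _) (hτ01 m X.2).2
  have hGm : AEStronglyMeasurable G (latMeasure Ω) :=
    hΩ.aestronglyMeasurable_lateral (hΩ.continuousOn_inner_outerNormal hP)
  have hGpos : ∀ᵐ X ∂(latMeasure Ω), 0 ≤ G X := by
    filter_upwards [hΩ.ae_latMeasure_mem] with X hX using hpos X hX
  refine ⟨hGm.restrict, ?_⟩
  rw [hasFiniteIntegral_iff_ofReal (ae_restrict_of_ae hGpos)]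
  -- Fatou's lemma removes the weights. This is where the sign of the normal component is used.
  have hfat : ∫⁻ X in frontier Ω ×ˢ Ioo 0 R, ENNReal.ofReal (G X) ∂(latMeasure Ω)
      ≤ ∫⁻ X, liminf (fun m => ENNReal.ofReal (G X * τ m X.2)) atTop ∂(latMeasure Ω) := by
    refine le_trans (le_of_eq ?_) (setLIntegral_le_lintegral (frontier Ω ×ˢ Ioo 0 R) _)
    refine setLIntegral_congr_fun hSm fun X hX => ?_
    refine (Tendsto.liminf_eq (tendsto_const_nhds.congr' ?_)).symm
    filter_upwards [hθ1 X.2 hX.2.1] with m hm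
    simp [τ, χ, hm, cutoff_of_ge (show 1 ≤ R + 1 - X.2 by linarith [hX.2.2])]
  refine (hfat.trans (lintegral_liminf_le' fun m => ?_)).trans_lt ?_
  · exact ((hmain m).1.aestronglyMeasurable.aemeasurable).ennreal_ofReal
  · refine lt_of_le_of_lt (b := ENNReal.ofReal M) ?_ ENNReal.ofReal_lt_top
    refine liminf_le_of_frequently_le' (Frequently.of_forall fun m => ?_)
    rw [← ofReal_integral_eq_lintegral_ofReal (hmain m).1
      (hGpos.mono fun X hX => mul_nonneg hX (hτ01 m X.2).1)]
    exact ENNReal.ofReal_le_ofReal (hM m)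

/-- Divergence theorem in the cylinder without vertical weights. -/
theorem IsHolderDomain.integral_horDiv_of_integrable (hΩ : IsHolderDomain 4 α Ω)
    {P : Hor n × ℝ → Hor n} {D : Hor n × ℝ → ℝ} (hP : ContinuousOn P (latCyl Ω))
    (h : HasWeakHorDiv Ω P D) (hD : IntegrableOn D (cyl Ω))
    (hB : Integrable (fun X => ⟪P X, outerNormal Ω X.1⟫) (latMeasure Ω)) :
    ∫ X in cyl Ω, D X = ∫ X, ⟪P X, outerNormal Ω X.1⟫ ∂(latMeasure Ω) := by
  obtain ⟨θ, hθ, hθ01, hθ1⟩ := exists_vertTest_seq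
  have hcm := (isOpen_cyl hΩ.isOpen).measurableSet
  have hθm : ∀ m, Continuous fun X : Hor n × ℝ => θ m X.2 := fun m =>
    (hθ m).contDiff.continuous.comp continuous_snd
  have hle : ∀ (F : Hor n × ℝ → ℝ) m X, ‖F X * θ m X.2‖ ≤ ‖F X‖ := fun F m X => by
    rw [norm_mul, Real.norm_of_nonneg (hθ01 m X.2).1]
    exact mul_le_of_le_one_right (norm_nonneg _) (hθ01 m X.2).2
  have hlim : ∀ (F : Hor n × ℝ → ℝ) (X : Hor n × ℝ), 0 < X.2 →
      Tendsto (fun m => F X * θ m X.2) atTop (𝓝 (F X)) := fun F X hX =>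
    tendsto_const_nhds.congr' (by filter_upwards [hθ1 X.2 hX] with m hm; rw [hm, mul_one])
  have h1 : Tendsto (fun m => ∫ X in cyl Ω, D X * θ m X.2) atTop (𝓝 (∫ X in cyl Ω, D X)) := by
    refine tendsto_integral_of_dominated_convergence (fun X => ‖D X‖)
      (fun m => hD.aestronglyMeasurable.mul (hθm m).aestronglyMeasurable) hD.norm
      (fun m => ae_of_all _ (hle D m)) ?_
    filter_upwards [ae_restrict_mem hcm] with X hX using hlim D X hX.2
  have h2 : Tendsto (fun m => ∫ X, ⟪P X, outerNormal Ω X.1⟫ * θ m X.2 ∂(latMeasure Ω)) atTop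
      (𝓝 (∫ X, ⟪P X, outerNormal Ω X.1⟫ ∂(latMeasure Ω))) := by
    refine tendsto_integral_of_dominated_convergence (fun X => ‖⟪P X, outerNormal Ω X.1⟫‖)
      (fun m => hB.aestronglyMeasurable.mul (hθm m).aestronglyMeasurable) hB.norm
      (fun m => ae_of_all _ (hle (fun X => ⟪P X, outerNormal Ω X.1⟫) m)) ?_
    filter_upwards [hΩ.ae_latMeasure_mem] with X hX using
      hlim (fun X => ⟪P X, outerNormal Ω X.1⟫) X hX.2
  refine tendsto_nhds_unique h1 (h2.congr fun m => ?_)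
  refine (hΩ.integral_horDiv hP (hθ m) ?_ h).2.symm
  exact hD.norm.mono' (hD.aestronglyMeasurable.mul (hθm m).aestronglyMeasurable)
    (ae_of_all _ (hle D m))

/-- There is a smooth field that is uniformly transversal to the boundary. -/
theorem IsHolderDomain.exists_transversal (hΩ : IsHolderDomain 4 α Ω) :
    ∃ V : Hor n → Hor n, ContDiff ℝ 1 V ∧
      ∀ x ∈ frontier Ω, 1 / 3 ≤ ⟪V x, outerNormal Ω x⟫ := by
  have hch : ∀ x ∈ frontier Ω, ∃ e r ρ, BoundaryChart Ω x e (1 / 2) r ρ := fun x hx =>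
    hΩ.exists_boundaryChart hx (by norm_num)
  choose! e r ρ C using hch
  obtain ⟨s, χ, hs, hχ, hsum⟩ := exists_finite_smooth_partition hΩ.isCompact_frontier r
    fun x hx => (C x hx).r_pos
  refine ⟨fun x => ∑ i ∈ s, χ i x • e i, ?_, fun x hx => ?_⟩
  · exact ContDiff.sum fun i hi =>
      ((hχ i hi).1.of_le (by exact_mod_cast le_top)).smul contDiff_const
  · have hthird : (1 / 3 : ℝ) = ∑ i ∈ s, χ i x * (1 / 3) := by
      rw [← Finset.sum_mul, hsum x hx, one_mul]
    rw [hthird, sum_inner]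
    refine Finset.sum_le_sum fun i hi => ?_
    rw [inner_smul_left, conj_trivial]
    by_cases h0 : χ i x = 0
    · simp [h0]
    refine mul_le_mul_of_nonneg_left ?_ ((hχ i hi).2.2.2 x).1
    have hb : x ∈ Metric.ball i (r i) := (hχ i hi).2.1 (subset_tsupport _ h0)
    have Ci := C i (hs i hi)
    rw [Ci.outerNormal_eq (by norm_num) hb hx, inner_smul_right, real_inner_comm]
    -- In a chart with `ε = 1 / 2` the vector `e` satisfies `⟪e, ν⟫ = ⟪∇ρ, e⟫ / ‖∇ρ‖ ≥ (1 / 2) / (3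
    -- / 2) = 1 / 3`, and averaging over the partition of unity preserves this lower bound.
    have h1 := (abs_le.1 (Ci.inner_grad_e hb)).1
    have h2 := (abs_le.1 (Ci.abs_norm_grad hb)).2
    have h3 : 0 < ‖gradient (ρ i) x‖ := norm_pos_iff.2 (Ci.gradient_ne_zero (by norm_num) hb)
    rw [inv_mul_eq_div, div_le_div_iff₀ (by norm_num) h3]
    linarith

end LateralIntegrability

/-! ### Finite energy of `∇ₓu` on the lateral boundary. -/

section BoundaryEnergy

variable {n : ℕ} {α : ℝ≥0} {Ω : Set (Hor n)} {a : ℝ → ℝ → ℝ} {u : Hor n × ℝ → ℝ}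

/-- The density `a u_{x_j}² b` is read as the flux component `a u_{x_j}` times `u_{x_j} b`. The
weight `a` alone may fail to be differentiable where `∇u = 0`, whereas the flux is differentiable in
horizontal directions. -/
theorem IsRegularSol.integral_energy_component (hu : IsRegularSol Ω a u)
    (hΩ : IsHolderDomain 4 α Ω) (ha : IsDiffusion a) {b : Hor n → ℝ} (hb : ContDiff ℝ 1 b)
    (j k : Fin n) {ζ : Hor n × ℝ → ℝ} (hζ : ContDiff ℝ 1 ζ) (hc : HasCompactSupport ζ)
    (hs : tsupport ζ ⊆ cyl Ω) :
    let D : Hor n × ℝ → ℝ := fun X =>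
      fluxU Ω a u X (grad (latCyl Ω) (uD Ω u k.castSucc) X) j.castSucc * (uD Ω u j.castSucc X * b X.1)
        + wt Ω a u X * uD Ω u j.castSucc X * (uDD Ω u j.castSucc k.castSucc X * b X.1
          + uD Ω u j.castSucc X * fderiv ℝ b X.1 (EuclideanSpace.single k 1))
    let P : Hor n × ℝ → ℝ := fun X => wt Ω a u X * uD Ω u j.castSucc X ^ 2 * b X.1
    IntegrableOn (fun X => D X * ζ X) (cyl Ω) ∧
    IntegrableOn (fun X => P X * fderiv ℝ ζ X (coordVec k.castSucc)) (cyl Ω) ∧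
    ∫ X in cyl Ω, D X * ζ X = - ∫ X in cyl Ω, P X * fderiv ℝ ζ X (coordVec k.castSucc) := by
  intro D P
  have ho := isOpen_cyl hΩ.isOpen
  have hL := IsLineTest.of_contDiff (μ := volume) (U := cyl Ω) (e := coordVec k.castSucc) hζ hc hs
  have h2 := hu.isLineTest_flux hΩ ha k j.castSucc hL
  have hb1 : ContDiff ℝ 1 (fun X : Hor n × ℝ => b X.1) := hb.comp contDiff_fst
  have hq : ContinuousOn (fun X => uD Ω u j.castSucc X * b X.1) (latCyl Ω) :=
    (hu.continuousOn_uD hΩ _).mul hb1.continuous.continuousOn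
  have hbk : Continuous fun X : Hor n × ℝ => fderiv ℝ b X.1 (EuclideanSpace.single k 1) :=
    ((hb.continuous_fderiv one_ne_zero).comp continuous_fst).clm_apply continuous_const
  have hq' : ContinuousOn (fun X => uDD Ω u j.castSucc k.castSucc X * b X.1
      + uD Ω u j.castSucc X * fderiv ℝ b X.1 (EuclideanSpace.single k 1)) (latCyl Ω) :=
    ((hu.continuousOn_uDD hΩ _ _).mul hb1.continuous.continuousOn).add
      ((hu.continuousOn_uD hΩ _).mul hbk.continuousOn)
  have hql := (hq.mono (cyl_subset_latCyl (Ω := Ω))).locallyIntegrableOn ho.measurableSet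
    (μ := volume)
  have hql' := (hq'.mono (cyl_subset_latCyl (Ω := Ω))).locallyIntegrableOn ho.measurableSet
    (μ := volume)
  have hbd : ∀ X : Hor n × ℝ, HasLineDerivAt ℝ (fun X : Hor n × ℝ => b X.1)
      (fderiv ℝ b X.1 (EuclideanSpace.single k 1)) X (coordVec k.castSucc) := fun X => by
    have h3 := (hb.differentiable one_ne_zero X.1).hasFDerivAt.hasLineDerivAt
      (EuclideanSpace.single k (1 : ℝ))
    unfold HasLineDerivAt at *
    simpa [coordVec_castSucc] using h3
  have e2 := h2.integral_by_parts ho (hq.mono cyl_subset_latCyl) (fun X hX =>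
    (hu.hasLineDerivAt_uD hΩ _ _ hX).fun_mul (hbd X)) hql'
  have i3 := (integrable_mul_of_tsupport_subset hql h2.compact h2.sub h2.meas h2.bdd
    fun X hX => h2.deriv_eq_zero hX).integrableOn (s := cyl Ω)
  have i4 := (integrable_mul_of_tsupport_subset hql' h2.compact h2.sub h2.cont.aestronglyMeasurable
    h2.bdd_fun fun X hX => image_eq_zero_of_notMem_tsupport
      (f := fun X => wt Ω a u X * uD Ω u j.castSucc X * ζ X) hX).integrableOn (s := cyl Ω)
  have hPc : ContinuousOn P (latCyl Ω) :=
    ((hu.continuousOn_wt hΩ ha).mul ((hu.continuousOn_uD hΩ _).pow 2)).mul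
      hb1.continuous.continuousOn
  have i5 : IntegrableOn (fun X => P X * fderiv ℝ ζ X (coordVec k.castSucc)) (cyl Ω) :=
    (integrable_mul_of_tsupport_subset ((hPc.mono cyl_subset_latCyl).locallyIntegrableOn
      ho.measurableSet) hL.compact hL.sub hL.meas hL.bdd
      fun X hX => hL.deriv_eq_zero hX).integrableOn
  have key : ∀ X, D X * ζ X = (uD Ω u j.castSucc X * b X.1 *
        (fluxU Ω a u X (grad (latCyl Ω) (uD Ω u k.castSucc) X) j.castSucc * ζ X
          + wt Ω a u X * uD Ω u j.castSucc X * fderiv ℝ ζ X (coordVec k.castSucc))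
        + (uDD Ω u j.castSucc k.castSucc X * b X.1
          + uD Ω u j.castSucc X * fderiv ℝ b X.1 (EuclideanSpace.single k 1)) *
            (wt Ω a u X * uD Ω u j.castSucc X * ζ X))
        - P X * fderiv ℝ ζ X (coordVec k.castSucc) := fun X => by
    simp only [D, P]
    ring
  refine ⟨((i3.add i4).sub i5).congr (ae_of_all _ fun X => (key X).symm), i5, ?_⟩
  rw [integral_congr_ae (ae_of_all _ key)]
  refine (integral_sub (i3.add i4) i5).trans ?_
  have e5 := integral_add i3 i4
  simp only [Pi.add_apply] at e5 ⊢
  rw [e5, e2]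
  ring

/-- The divergence of the field `a |∇_x u|² V`. -/
def energyDiv (Ω : Set (Hor n)) (a : ℝ → ℝ → ℝ) (u : Hor n × ℝ → ℝ) (V : Hor n → Hor n)
    (X : Hor n × ℝ) : ℝ :=
  ∑ k : Fin n, ∑ j : Fin n,
    (fluxU Ω a u X (grad (latCyl Ω) (uD Ω u k.castSucc) X) j.castSucc
        * (uD Ω u j.castSucc X * V X.1 k)
      + wt Ω a u X * uD Ω u j.castSucc X * (uDD Ω u j.castSucc k.castSucc X * V X.1 k
        + uD Ω u j.castSucc X * fderiv ℝ (fun x => V x k) X.1 (EuclideanSpace.single k 1)))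

theorem IsRegularSol.hasWeakHorDiv_energy (hu : IsRegularSol Ω a u) (hΩ : IsHolderDomain 4 α Ω)
    (ha : IsDiffusion a) {V : Hor n → Hor n} (hV : ContDiff ℝ 1 V) :
    HasWeakHorDiv Ω (fun X => (wt Ω a u X * ‖gradX (latCyl Ω) u X‖ ^ 2) • V X.1)
      (energyDiv Ω a u V) := by
  intro η θ hη hηc hηs hθ
  obtain ⟨hζ, hc, hs, hfd⟩ := hθ.mul_horizontal hη hηc hηs
  have hcomp := fun (k j : Fin n) =>
    hu.integral_energy_component hΩ ha (contDiff_euclidean.1 hV k) j k hζ hc hs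
  have e2 : ∀ X : Hor n × ℝ,
      fderiv ℝ η X.1 ((wt Ω a u X * ‖gradX (latCyl Ω) u X‖ ^ 2) • V X.1) * θ X.2
      = ∑ k : Fin n, ∑ j : Fin n, wt Ω a u X * uD Ω u j.castSucc X ^ 2 * V X.1 k *
        fderiv ℝ (fun X => η X.1 * θ X.2) X (coordVec k.castSucc) := fun X => by
    conv_lhs => rw [← sum_single (V X.1)]
    rw [map_smul, map_sum, smul_eq_mul, Finset.mul_sum, Finset.sum_mul]
    refine Finset.sum_congr rfl fun k _ => ?_
    rw [map_smul, smul_eq_mul, hfd, norm_gradX_sq, Finset.mul_sum, Finset.sum_mul, Finset.sum_mul]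
    refine Finset.sum_congr rfl fun j _ => ?_
    rw [uD]
    ring
  simp only [e2, energyDiv, Finset.sum_mul]
  rw [integral_finsetSum _ fun k _ => integrable_finsetSum _ fun j _ => (hcomp k j).1,
    integral_finsetSum _ fun k _ => integrable_finsetSum _ fun j _ => (hcomp k j).2.1,
    ← Finset.sum_neg_distrib]
  refine Finset.sum_congr rfl fun k _ => ?_
  rw [integral_finsetSum _ fun j _ => (hcomp k j).1, integral_finsetSum _ fun j _ => (hcomp k j).2.1,
    ← Finset.sum_neg_distrib]
  exact Finset.sum_congr rfl fun j _ => (hcomp k j).2.2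

theorem IsRegularSol.integrableOn_energyDiv (hu : IsRegularSol Ω a u) (hΩ : IsHolderDomain 4 α Ω)
    (ha : IsDiffusion a) {V : Hor n → Hor n} (hV : ContDiff ℝ 1 V) {R : ℝ} (hR : 0 < R) :
    IntegrableOn (energyDiv Ω a u V) (Ω ×ˢ Ioo 0 R) := by
  have hcm := (isOpen_cyl hΩ.isOpen).measurableSet
  obtain ⟨C, hC, hflux⟩ := exists_norm_fluxU_le Ω u ha
  refine integrable_finsetSum _ fun k _ => integrable_finsetSum _ fun j _ => ?_
  have hVk : ContDiff ℝ 1 fun x => V x k := contDiff_euclidean.1 hV k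
  have hdV : Continuous fun x => fderiv ℝ (fun x => V x k) x (EuclideanSpace.single k 1) :=
    (hVk.continuous_fderiv one_ne_zero).clm_apply continuous_const
  obtain ⟨M, hM⟩ := hΩ.isCompact_closure.exists_bound_of_continuousOn hVk.continuous.continuousOn
  obtain ⟨M', hM'⟩ := hΩ.isCompact_closure.exists_bound_of_continuousOn hdV.continuousOn
  have hpj := wL2_uD hu hΩ ha j.castSucc
  have hgk := wL2_grad_uD hu hΩ ha k
  have hjk := wL2_uDD hu hΩ ha j k.castSucc
  have hwm := hu.aestronglyMeasurable_wt hΩ ha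
  have hVm : AEStronglyMeasurable (fun X : Hor n × ℝ => V X.1 k) (volume.restrict (cyl Ω)) :=
    (hVk.continuous.comp continuous_fst).aestronglyMeasurable
  have hdVm : AEStronglyMeasurable (fun X : Hor n × ℝ =>
      fderiv ℝ (fun x => V x k) X.1 (EuclideanSpace.single k 1)) (volume.restrict (cyl Ω)) :=
    (hdV.comp continuous_fst).aestronglyMeasurable
  have hfm : AEStronglyMeasurable (fun X =>
      fluxU Ω a u X (grad (latCyl Ω) (uD Ω u k.castSucc) X) j.castSucc)
      (volume.restrict (cyl Ω)) :=
    (EuclideanSpace.proj (𝕜 := ℝ) j.castSucc : Full n →L[ℝ] ℝ).continuous.comp_aestronglyMeasurable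
      (hu.aestronglyMeasurable_fluxU hΩ ha hgk.meas)
  have t1 : IntegrableOn (fun X => fluxU Ω a u X (grad (latCyl Ω) (uD Ω u k.castSucc) X) j.castSucc
        * (uD Ω u j.castSucc X * V X.1 k)) (Ω ×ˢ Ioo 0 R) := by
    refine WL2.integrableOn_of_le hΩ ha hgk hpj (C := C * M) (hfm.mul (hpj.meas.mul hVm)) hR ?_
    filter_upwards [ae_restrict_mem hcm] with X hX
    have h1 := (PiLp.norm_apply_le _ j.castSucc).trans (hflux X (cyl_subset_latCyl hX)
      (grad (latCyl Ω) (uD Ω u k.castSucc) X))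
    have h2 := hM X.1 (subset_closure hX.1)
    rw [Real.norm_eq_abs] at h1 h2
    simp only [Pi.mul_apply]
    rw [abs_mul, abs_mul]
    have hw := wt_pos (u := u) ha (cyl_subset_latCyl hX)
    calc _ ≤ _ := mul_le_mul h1 (mul_le_mul_of_nonneg_left h2 (abs_nonneg _)) (by positivity)
          (by positivity)
      _ = _ := by rw [Real.norm_eq_abs]; ring
  have t2 : IntegrableOn (fun X => wt Ω a u X * uD Ω u j.castSucc X *
      (uDD Ω u j.castSucc k.castSucc X * V X.1 k)) (Ω ×ˢ Ioo 0 R) := by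
    refine WL2.integrableOn_of_le hΩ ha hpj hjk (C := M)
      ((hwm.mul hpj.meas).mul (hjk.meas.mul hVm)) hR ?_
    filter_upwards [ae_restrict_mem hcm] with X hX
    have h2 := hM X.1 (subset_closure hX.1)
    have hw := wt_pos (u := u) ha (cyl_subset_latCyl hX)
    simp only [Pi.mul_apply]
    rw [abs_mul, abs_mul, abs_mul, abs_of_pos hw]
    calc _ = |V X.1 k| * (wt Ω a u X * (|uD Ω u j.castSucc X| * |uDD Ω u j.castSucc k.castSucc X|)) := by
          ring
      _ ≤ _ := mul_le_mul_of_nonneg_right h2 (by positivity)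
  have t3 : IntegrableOn (fun X => wt Ω a u X * uD Ω u j.castSucc X *
      (uD Ω u j.castSucc X * fderiv ℝ (fun x => V x k) X.1 (EuclideanSpace.single k 1)))
      (Ω ×ˢ Ioo 0 R) := by
    refine WL2.integrableOn_of_le hΩ ha hpj hpj (C := M')
      ((hwm.mul hpj.meas).mul (hpj.meas.mul hdVm)) hR ?_
    filter_upwards [ae_restrict_mem hcm] with X hX
    have h2 := hM' X.1 (subset_closure hX.1)
    have hw := wt_pos (u := u) ha (cyl_subset_latCyl hX)
    simp only [Pi.mul_apply]
    rw [abs_mul, abs_mul, abs_mul, abs_of_pos hw]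
    calc _ = |fderiv ℝ (fun x => V x k) X.1 (EuclideanSpace.single k 1)| *
            (wt Ω a u X * (|uD Ω u j.castSucc X| * |uD Ω u j.castSucc X|)) := by ring
      _ ≤ _ := mul_le_mul_of_nonneg_right h2 (by positivity)
  refine (t1.add (t2.add t3)).congr (ae_of_all _ fun X => ?_)
  simp only [Pi.add_apply]
  ring

/-- The boundary energy of `∇_x u` is locally finite. -/
theorem IsRegularSol.integrableOn_boundary_energy (hu : IsRegularSol Ω a u)
    (hΩ : IsHolderDomain 4 α Ω) (ha : IsDiffusion a) {R : ℝ} (hR : 0 < R) :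
    IntegrableOn (fun X => wt Ω a u X * ‖gradX (latCyl Ω) u X‖ ^ 2) (frontier Ω ×ˢ Ioo 0 R)
      (latMeasure Ω) := by
  obtain ⟨V, hV, hVν⟩ := hΩ.exists_transversal
  have hE : ContinuousOn (fun X => wt Ω a u X * ‖gradX (latCyl Ω) u X‖ ^ 2) (latCyl Ω) :=
    (hu.continuousOn_wt hΩ ha).mul ((hu.continuousOn_gradX hΩ).norm.pow 2)
  have hsub : frontier Ω ×ˢ Ioi (0 : ℝ) ⊆ latCyl Ω := prod_mono frontier_subset_closure subset_rfl
  have hE0 : ∀ X ∈ frontier Ω ×ˢ Ioi (0 : ℝ), 0 ≤ wt Ω a u X * ‖gradX (latCyl Ω) u X‖ ^ 2 :=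
    fun X hX => mul_nonneg (wt_pos ha (hsub hX)).le (sq_nonneg _)
  -- The field `a|∇ₓu|² V` with `V` transversal has integrable divergence on slabs and a normal
  -- component between which and `a|∇ₓu|²` there is only a factor `3`.
  have h := hΩ.integrableOn_lateral
    (P := fun X => (wt Ω a u X * ‖gradX (latCyl Ω) u X‖ ^ 2) • V X.1)
    (hE.smul (hV.continuous.comp continuous_fst).continuousOn)
    (hu.hasWeakHorDiv_energy hΩ ha hV) (fun R hR => hu.integrableOn_energyDiv hΩ ha hV hR)
    (fun X hX => by
      rw [inner_smul_left, conj_trivial]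
      exact mul_nonneg (hE0 X hX) (by linarith [hVν X.1 hX.1])) hR
  refine (h.norm.const_mul 3).mono'
    (hΩ.aestronglyMeasurable_lateral (hE.mono hsub)).restrict ?_
  filter_upwards [ae_restrict_of_ae hΩ.ae_latMeasure_mem] with X hX
  simp only [inner_smul_left, conj_trivial, norm_mul (wt Ω a u X * ‖gradX (latCyl Ω) u X‖ ^ 2)]
  have h1 : 1 / 3 ≤ ‖⟪V X.1, outerNormal Ω X.1⟫‖ := (hVν X.1 hX.1).trans (Real.le_norm_self _)
  nlinarith [norm_nonneg (wt Ω a u X * ‖gradX (latCyl Ω) u X‖ ^ 2)]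

/-- The boundary term is integrable against bounded weights with bounded vertical support. -/
theorem IsRegularSol.integrable_normalTerm (hu : IsRegularSol Ω a u)
    (hΩ : IsHolderDomain 4 α Ω) (ha : IsDiffusion a) {b : Hor n × ℝ → ℝ}
    (hb : ContinuousOn b (closedCyl Ω)) {M R : ℝ} (hM : ∀ X ∈ closedCyl Ω, |b X| ≤ M)
    (hR : ∀ X ∈ closedCyl Ω, R ≤ X.2 → b X = 0) :
    Integrable (fun X => wt Ω a u X * normalTerm Ω u X * b X) (latMeasure Ω) := by
  obtain ⟨K, hK, hN⟩ := hu.exists_abs_normalTerm_le hΩ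
  have hsub : frontier Ω ×ˢ Ioi (0 : ℝ) ⊆ latCyl Ω := prod_mono frontier_subset_closure subset_rfl
  have hν : ContinuousOn (fun X : Hor n × ℝ => outerNormal Ω X.1) (frontier Ω ×ˢ Ioi (0 : ℝ)) :=
    hΩ.continuousOn_outerNormal.comp continuousOn_fst fun _ hX => hX.1
  have hNc : ContinuousOn (normalTerm Ω u) (frontier Ω ×ˢ Ioi (0 : ℝ)) := by
    refine continuousOn_finsetSum _ fun i _ => ((hu.continuousOn_uD hΩ i).mono hsub).mul ?_
    simp only [dirDeriv_eq_sum]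
    refine continuousOn_finsetSum _ fun j _ => ContinuousOn.mul ?_
      ((hu.continuousOn_uDD hΩ i j.castSucc).mono hsub)
    exact (PiLp.continuous_apply 2 _ j).comp_continuousOn hν
  have hm : AEStronglyMeasurable (fun X => wt Ω a u X * normalTerm Ω u X * b X) (latMeasure Ω) :=
    hΩ.aestronglyMeasurable_lateral ((((hu.continuousOn_wt hΩ ha).mono hsub).mul hNc).mul
      (hb.mono (hsub.trans latCyl_subset_closedCyl)))
  have hE := hu.integrableOn_boundary_energy hΩ ha (R := max R 1) (by positivity)
  have h1 : IntegrableOn (fun X => wt Ω a u X * normalTerm Ω u X * b X)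
      (frontier Ω ×ˢ Ioo 0 (max R 1)) (latMeasure Ω) := by
    refine (hE.const_mul (K * M)).mono' hm.restrict ?_
    filter_upwards [ae_restrict_of_ae hΩ.ae_latMeasure_mem] with X hX
    have hw := wt_pos (u := u) ha (hsub hX)
    rw [norm_mul, norm_mul, Real.norm_of_nonneg hw.le]
    calc _ ≤ wt Ω a u X * (K * ‖gradX (latCyl Ω) u X‖ ^ 2) * M :=
          mul_le_mul (mul_le_mul_of_nonneg_left (hN X hX) hw.le)
            (hM X (latCyl_subset_closedCyl (hsub hX))) (abs_nonneg _) (by positivity)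
      _ = _ := by ring
  rw [hΩ.latMeasure_eq_restrict]
  refine IntegrableOn.of_forall_sdiff_eq_zero h1
    (isClosed_frontier.measurableSet.prod measurableSet_Ioi) fun X hX => ?_
  have : R ≤ X.2 := by
    by_contra hc
    rw [not_le] at hc
    exact hX.2 ⟨hX.1.1, hX.1.2, hc.trans_le (le_max_left _ _)⟩
  rw [hR X (latCyl_subset_closedCyl (hsub hX.1)) this, mul_zero]

end BoundaryEnergy

/-! ### The linearized equation for smooth weights, and its continuity in the weight. -/

section LinearizedForm

variable {n : ℕ} {α : ℝ≥0} {Ω : Set (Hor n)} {a g : ℝ → ℝ → ℝ} {f : ℝ → ℝ} {u : Hor n × ℝ → ℝ}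

/-- The density `∑ⱼ ⟨ℬ ∇u_{x_j}, ∇u_{x_j}⟩`. -/
def hessTerm (Ω : Set (Hor n)) (a : ℝ → ℝ → ℝ) (u : Hor n × ℝ → ℝ) (X : Hor n × ℝ) : ℝ :=
  ∑ j : Fin n, ⟪fluxU Ω a u X (grad (latCyl Ω) (uD Ω u j.castSucc) X),
    grad (latCyl Ω) (uD Ω u j.castSucc) X⟫

/-- The field `∑ⱼ u_{x_j} ℬ ∇u_{x_j}`. -/
def crossTerm (Ω : Set (Hor n)) (a : ℝ → ℝ → ℝ) (u : Hor n × ℝ → ℝ) (X : Hor n × ℝ) : Full n :=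
  fluxU Ω a u X (∑ j : Fin n, uD Ω u j.castSucc X • grad (latCyl Ω) (uD Ω u j.castSucc) X)

/-- The linearized equation for the derivatives `u_{x_j}`, tested with `u_{x_j} p` and summed;
here `G` stands for the gradient of `p` and `w` for the trace of `∇ₓu`. -/
def linearizedForm (Ω : Set (Hor n)) (a g : ℝ → ℝ → ℝ) (f : ℝ → ℝ) (u : Hor n × ℝ → ℝ)
    (w : Fin n → Hor n → ℝ) (p : Hor n × ℝ → ℝ) (G : Hor n × ℝ → Full n) : ℝ :=
  (∫ X in cyl Ω, (hessTerm Ω a u X * p X + ⟪crossTerm Ω a u X, G X⟫))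
    + (∫ X in cyl Ω, deriv (g X.2) (u X) * ‖gradX (latCyl Ω) u X‖ ^ 2 * p X)
    - (∫ x in Ω, deriv f (u (x, 0)) * ‖(WithLp.toLp 2 fun j => w j x : Hor n)‖ ^ 2 * p (x, 0))
    - ∫ X, wt Ω a u X * normalTerm Ω u X * p X ∂(latMeasure Ω)

theorem hessTerm_crossTerm {X : Hor n × ℝ} {c : ℝ} {v : Full n} :
    ∑ j : Fin n, ⟪fluxU Ω a u X (grad (latCyl Ω) (uD Ω u j.castSucc) X),
      c • grad (latCyl Ω) (uD Ω u j.castSucc) X + uD Ω u j.castSucc X • v⟫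
      = hessTerm Ω a u X * c + ⟪crossTerm Ω a u X, v⟫ := by
  simp only [hessTerm, crossTerm, map_sum, map_smul, sum_inner, Finset.sum_mul, inner_add_right,
    inner_smul_right, inner_smul_left, conj_trivial, Finset.sum_add_distrib]
  congr 1
  exact Finset.sum_congr rfl fun j _ => mul_comm _ _

/-- The divergence of `diffusionField` is the sum of `∑⟨ℬ∇u_{x_j},∇(u_{x_j}Ψ)⟩` and
`a∇u·∇(div_x(Ψ∇ₓu))`. Its integral is the lateral term, and the integral of the second summand is
known from the weak formulation (`IsStableSolution.weak_divX`). -/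
theorem IsStableSolution.linearizedForm_smooth (hu : IsStableSolution Ω a g f u)
    (hΩ : IsHolderDomain 4 α Ω) (ha : IsDiffusion a) (hg : IsInnerReaction g)
    (hf : ContDiff ℝ 1 f) {Ψ : Hor n × ℝ → ℝ} (hΨ : ContDiff ℝ ∞ Ψ) (hc : HasCompactSupport Ψ)
    {w : Fin n → Hor n → ℝ} (hw : ∀ j : Fin n, HasBottomTrace Ω (uD Ω u j.castSucc) (w j)) :
    linearizedForm Ω a g f u w Ψ (grad univ Ψ) = 0 := by
  have hr := hu.solution.regular
  have hΨ1 : ContDiff ℝ 1 Ψ := hΨ.of_le (by exact_mod_cast le_top)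
  obtain ⟨T', hT', hT2'⟩ := exists_third_derivatives hr hΩ ha
  have hT := fun j => hT' j j
  have hT2 := fun j => hT2' j j
  have hex : ∀ j : Fin n, ∃ w, HasBottomTrace Ω (uDD Ω u j.castSucc j.castSucc) w := fun j =>
    hr.trace_two j j
  choose w₂ hw₂ using hex
  obtain ⟨R, hR⟩ := exists_vanishing_height Ω u hc
  obtain ⟨M, hM⟩ := hc.exists_bound_of_continuous hΨ.continuous
  have hgc : HasCompactSupport (grad univ Ψ) := by
    refine hc.of_isClosed_subset (isClosed_tsupport _) (closure_minimal (fun X hX => ?_)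
      (isClosed_tsupport Ψ))
    by_contra h
    refine hX ?_
    ext i
    rw [grad_apply, pd_univ, fderiv_of_notMem_tsupport ℝ h]
    simp
  obtain ⟨M', hM'⟩ := hgc.exists_bound_of_continuous (continuous_grad_univ hΨ1)
  have h1 : ∀ j : Fin n, WL2 Ω a u (fun X => Ψ X • grad (latCyl Ω) (uD Ω u j.castSucc) X
      + uD Ω u j.castSucc X • grad univ Ψ X) := fun j =>
    WL2.add hr hΩ ha (WL2.bdd_smul hr hΩ ha (wL2_grad_uD hr hΩ ha j)
        hΨ.continuous.aestronglyMeasurable fun X _ => hM X)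
      (WL2.smul_bdd hr hΩ ha (wL2_uD hr hΩ ha j.castSucc)
        (continuous_grad_univ hΨ1).aestronglyMeasurable fun X _ => hM' X)
  have i1 : IntegrableOn (fun X => ∑ j : Fin n,
      ⟪fluxU Ω a u X (grad (latCyl Ω) (uD Ω u j.castSucc) X),
        Ψ X • grad (latCyl Ω) (uD Ω u j.castSucc) X + uD Ω u j.castSucc X • grad univ Ψ X⟫)
      (cyl Ω) := integrable_finsetSum _ fun j _ =>
    hr.integrableOn_flux_inner hΩ ha (wL2_grad_uD hr hΩ ha j) (h1 j) (R := R) fun X _ hX => by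
      simp [(hR X hX).1, (hR X hX).2.1]
  have i2 : IntegrableOn (fun X => wt Ω a u X * ⟪gradU Ω u X,
      divXGrad Ω u Ψ (fun j => T' j j) X⟫) (cyl Ω) :=
    hr.integrableOn_wt_inner hΩ ha (wL2_gradU hr hΩ ha)
      (isPreTest_divX hr hΩ ha hΨ hc hw hw₂ hT hT2).wL2_grad (R := R)
      fun X _ hX => (hR X hX).2.2.2 _
  have hνi : ∀ᵐ X ∂(latMeasure Ω), ⟪diffusionField Ω a u Ψ X, outerNormal Ω X.1⟫
      = wt Ω a u X * normalTerm Ω u X * Ψ X := by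
    filter_upwards [hΩ.ae_latMeasure_mem] with X hX using hr.inner_diffusionField hΩ hX
  have hB := hr.integrable_normalTerm hΩ ha (b := Ψ) hΨ.continuous.continuousOn
    (fun X _ => hM X) fun X _ hX => (hR X hX).1
  have hmain := hΩ.integral_horDiv_of_integrable (hr.continuousOn_diffusionField hΩ ha hΨ1)
    (hr.hasWeakHorDiv_diffusion hΩ ha hΨ hT) (i1.add i2) (hB.congr (hνi.mono fun X hX => hX.symm))
  rw [integral_congr_ae hνi] at hmain
  simp only [diffusionDiv] at hmain
  rw [integral_add i1 i2, hu.weak_divX hΩ ha hg hf hΨ hc hw hT hT2] at hmain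
  simp only [hessTerm_crossTerm] at hmain
  rw [linearizedForm]
  linarith

/-- Dominated convergence in the cylinder for functions vanishing above a fixed height. -/
theorem tendsto_integral_cyl (hΩ : IsOpen Ω) {F : ℕ → Hor n × ℝ → ℝ} {F₀ B : Hor n × ℝ → ℝ} {R : ℝ}
    (hF : ∀ m, AEStronglyMeasurable (F m) (volume.restrict (cyl Ω)))
    (hB : IntegrableOn B (Ω ×ˢ Ioo 0 R)) (hle : ∀ m, ∀ X ∈ cyl Ω, X.2 < R → |F m X| ≤ B X)
    (hz : ∀ m, ∀ X ∈ cyl Ω, R ≤ X.2 → F m X = 0)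
    (hlim : ∀ X ∈ cyl Ω, Tendsto (fun m => F m X) atTop (𝓝 (F₀ X))) :
    Tendsto (fun m => ∫ X in cyl Ω, F m X) atTop (𝓝 (∫ X in cyl Ω, F₀ X)) := by
  have hcm := (isOpen_cyl hΩ).measurableSet
  have hsm := measurableSet_slab hΩ R
  refine tendsto_integral_of_dominated_convergence ((Ω ×ˢ Ioo 0 R).indicator B) hF
    ((integrable_indicator_iff hsm).2 (hB.mono_measure Measure.restrict_le_self)) (fun m => ?_) ?_
  · filter_upwards [ae_restrict_mem hcm] with X hX
    rcases lt_or_ge X.2 R with h | h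
    · rw [indicator_of_mem (show X ∈ Ω ×ˢ Ioo 0 R from ⟨hX.1, hX.2, h⟩)]
      exact hle m X hX h
    · rw [hz m X hX h, indicator_of_notMem fun hc => absurd hc.2.2 (not_lt.2 h), norm_zero]
  · filter_upwards [ae_restrict_mem hcm] with X hX using hlim X hX

theorem IsRegularSol.integrableOn_hessTerm (hu : IsRegularSol Ω a u) (hΩ : IsHolderDomain 4 α Ω)
    (ha : IsDiffusion a) {R : ℝ} (hR : 0 < R) :
    IntegrableOn (hessTerm Ω a u) (Ω ×ˢ Ioo 0 R) := by
  obtain ⟨C, hC, h⟩ := exists_norm_fluxU_le Ω u ha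
  refine integrable_finsetSum _ fun j _ => ?_
  have hj := wL2_grad_uD hu hΩ ha j
  refine WL2.integrableOn_of_le hΩ ha hj hj (C := C)
    ((hu.aestronglyMeasurable_fluxU hΩ ha hj.meas).inner hj.meas) hR ?_
  filter_upwards [ae_restrict_mem (isOpen_cyl hΩ.isOpen).measurableSet] with X hX
  refine (abs_real_inner_le_norm _ _).trans ?_
  calc _ ≤ _ := mul_le_mul_of_nonneg_right (h X (cyl_subset_latCyl hX) _) (norm_nonneg _)
    _ = _ := by ring

theorem IsRegularSol.aestronglyMeasurable_crossTerm (hu : IsRegularSol Ω a u)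
    (hΩ : IsHolderDomain 4 α Ω) (ha : IsDiffusion a) :
    AEStronglyMeasurable (crossTerm Ω a u) (volume.restrict (cyl Ω)) :=
  hu.aestronglyMeasurable_fluxU hΩ ha (Finset.aestronglyMeasurable_fun_sum _ fun j _ =>
    (wL2_uD hu hΩ ha j.castSucc).meas.smul (wL2_grad_uD hu hΩ ha j).meas)

/-- The sum to which `ℬ` is applied equals `|∇ₓu| ∇|∇ₓu|`, a product of two weighted square
integrable factors. -/
theorem IsRegularSol.integrableOn_crossTerm (hu : IsRegularSol Ω a u) (hΩ : IsHolderDomain 4 α Ω)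
    (ha : IsDiffusion a) {R : ℝ} (hR : 0 < R) :
    IntegrableOn (fun X => ‖crossTerm Ω a u X‖) (Ω ×ˢ Ioo 0 R) := by
  obtain ⟨C, hC, h⟩ := exists_norm_fluxU_le Ω u ha
  refine WL2.integrableOn_of_le hΩ ha (wL2_gradX hu hΩ ha) (wL2_grad_norm_gradX hu hΩ ha) (C := C)
    (hu.aestronglyMeasurable_crossTerm hΩ ha).norm hR ?_
  filter_upwards [ae_restrict_mem (isOpen_cyl hΩ.isOpen).measurableSet] with X hX
  rw [abs_norm]
  refine (h X (cyl_subset_latCyl hX) _).trans (le_of_eq ?_)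
  rw [← hu.norm_gradX_smul_grad hΩ hX, norm_smul, norm_norm]

/-- Bounded pointwise convergence of functions and of their derivatives, with uniformly bounded
vertical support. -/
structure IsBoundedApprox (Ω : Set (Hor n)) (Φ : ℕ → Hor n × ℝ → ℝ) (p : Hor n × ℝ → ℝ)
    (p' : Hor n × ℝ → (Hor n × ℝ →L[ℝ] ℝ)) : Prop where
  contDiff : ∀ m, ContDiff ℝ 1 (Φ m)
  compact : ∀ m, HasCompactSupport (Φ m)
  bdd : ∃ M, ∀ m, ∀ X ∈ closedCyl Ω, |Φ m X| ≤ M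
  height : ∃ R, ∀ m, ∀ X ∈ closedCyl Ω, R ≤ X.2 → Φ m X = 0
  tendsto : ∀ X ∈ closedCyl Ω, Tendsto (fun m => Φ m X) atTop (𝓝 (p X))
  bdd_fderiv : ∃ M, ∀ m, ∀ X ∈ cyl Ω, ‖fderiv ℝ (Φ m) X‖ ≤ M
  tendsto_fderiv : ∀ X ∈ cyl Ω, Tendsto (fun m => fderiv ℝ (Φ m) X) atTop (𝓝 (p' X))

/-- The coordinates of a linear form, as a vector. -/
def coordMap (n : ℕ) : (Hor n × ℝ →L[ℝ] ℝ) →L[ℝ] Full n :=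
  LinearMap.toContinuousLinearMap
    { toFun := fun L => WithLp.toLp 2 fun i => L (coordVec i)
      map_add' := fun _ _ => rfl
      map_smul' := fun _ _ => rfl }

theorem grad_eq_coordMap (S : Set (Hor n × ℝ)) (v : Hor n × ℝ → ℝ) (X : Hor n × ℝ) :
    grad S v X = coordMap n (fderivWithin ℝ v S X) := rfl

/-- In each of the four integrals the weight or its gradient multiplies a fixed density that is
integrable up to any finite height, so bounded pointwise convergence suffices. In particular no
approximation in a weighted Sobolev norm is required. -/
theorem IsStableSolution.tendsto_linearizedForm (hu : IsStableSolution Ω a g f u)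
    (hΩ : IsHolderDomain 4 α Ω) (ha : IsDiffusion a) (hf : ContDiff ℝ 1 f)
    {w : Fin n → Hor n → ℝ} (hw : ∀ j : Fin n, HasBottomTrace Ω (uD Ω u j.castSucc) (w j))
    {Φ : ℕ → Hor n × ℝ → ℝ} {p : Hor n × ℝ → ℝ} {p' : Hor n × ℝ → (Hor n × ℝ →L[ℝ] ℝ)}
    (h : IsBoundedApprox Ω Φ p p') :
    Tendsto (fun m => linearizedForm Ω a g f u w (Φ m) (grad univ (Φ m))) atTop
      (𝓝 (linearizedForm Ω a g f u w p fun X => coordMap n (p' X))) := by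
  have hr := hu.solution.regular
  have hcm := (isOpen_cyl hΩ.isOpen).measurableSet
  obtain ⟨M, hM⟩ := h.bdd
  obtain ⟨M', hM'⟩ := h.bdd_fderiv
  obtain ⟨R₀, hR₀⟩ := h.height
  -- Positive, and strictly above `R₀`, so that the gradients vanish from height `R` on as well.
  set R := max R₀ 0 + 1 with hRdef
  have hR : 0 < R := by positivity
  have hR₀R : R₀ < R := (le_max_left _ _).trans_lt (lt_add_one _)
  have hΦR : ∀ m, ∀ X ∈ closedCyl Ω, R ≤ X.2 → Φ m X = 0 := fun m X hX hXR =>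
    hR₀ m X hX (hR₀R.le.trans hXR)
  have hgradR : ∀ m, ∀ X ∈ cyl Ω, R ≤ X.2 → grad univ (Φ m) X = 0 := fun m X hX hXR => by
    have hev : Φ m =ᶠ[𝓝 X] fun _ => 0 := by
      filter_upwards [(isOpen_cyl hΩ.isOpen).mem_nhds hX,
        (continuous_snd.tendsto X).eventually_const_lt (hR₀R.trans_le hXR)] with Z hZ hZR
      exact hR₀ m Z (cyl_subset_closedCyl hZ) hZR.le
    ext i
    rw [grad_apply, pd_univ, hev.fderiv_eq]
    simp
  have hgradM : ∀ m, ∀ X ∈ cyl Ω, ‖grad univ (Φ m) X‖ ≤ ‖coordMap n‖ * M' := fun m X hX => by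
    rw [grad_eq_coordMap, fderivWithin_univ]
    exact ((coordMap n).le_opNorm _).trans (mul_le_mul_of_nonneg_left (hM' m X hX) (norm_nonneg _))
  have hgradlim : ∀ X ∈ cyl Ω, Tendsto (fun m => grad univ (Φ m) X) atTop
      (𝓝 (coordMap n (p' X))) := fun X hX => by
    simp only [grad_eq_coordMap, fderivWithin_univ]
    exact ((coordMap n).continuous.tendsto _).comp (h.tendsto_fderiv X hX)
  have hΦc := fun m => (h.contDiff m).continuous
  have hQ := hr.integrableOn_hessTerm hΩ ha hR
  have hE := hr.integrableOn_crossTerm hΩ ha hR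
  have hQm : AEStronglyMeasurable (hessTerm Ω a u) (volume.restrict (cyl Ω)) :=
    Finset.aestronglyMeasurable_fun_sum _ fun j _ =>
      (hr.aestronglyMeasurable_fluxU hΩ ha (wL2_grad_uD hr hΩ ha j).meas).inner
        (wL2_grad_uD hr hΩ ha j).meas
  have t1 : Tendsto (fun m => ∫ X in cyl Ω,
      (hessTerm Ω a u X * Φ m X + ⟪crossTerm Ω a u X, grad univ (Φ m) X⟫)) atTop
      (𝓝 (∫ X in cyl Ω, (hessTerm Ω a u X * p X + ⟪crossTerm Ω a u X, coordMap n (p' X)⟫))) := by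
    refine tendsto_integral_cyl hΩ.isOpen (R := R)
      (B := fun X => |hessTerm Ω a u X| * M + ‖crossTerm Ω a u X‖ * (‖coordMap n‖ * M'))
      (fun m => (hQm.mul (hΦc m).aestronglyMeasurable).add
        ((hr.aestronglyMeasurable_crossTerm hΩ ha).inner
          (continuous_grad_univ (h.contDiff m)).aestronglyMeasurable))
      ((hQ.abs.mul_const _).add (hE.mul_const _)) (fun m X hX _ => ?_) (fun m X hX hXR => ?_)
      fun X hX => ?_
    · refine (abs_add_le _ _).trans (add_le_add ?_ ?_)
      · rw [abs_mul]
        exact mul_le_mul_of_nonneg_left (hM m X (cyl_subset_closedCyl hX)) (abs_nonneg _)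
      · exact (abs_real_inner_le_norm _ _).trans
          (mul_le_mul_of_nonneg_left (hgradM m X hX) (norm_nonneg _))
    · rw [hΦR m X (cyl_subset_closedCyl hX) hXR, hgradR m X hX hXR]
      simp
    · exact ((h.tendsto X (cyl_subset_closedCyl hX)).const_mul _).add
        (tendsto_const_nhds.inner (hgradlim X hX))
  -- The densities with `g_u` and on the lateral boundary are known to be integrable only against
  -- weights of bounded height. This one is equal to one for `y ≤ R` and supplies a common majorant.
  let b : Hor n × ℝ → ℝ := fun X => cutoff (R + 1 - X.2)
  have hbc : Continuous b := contDiff_cutoff.continuous.comp (by fun_prop)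
  have hb1 : ∀ X : Hor n × ℝ, X.2 ≤ R → b X = 1 := fun X hX => cutoff_of_ge (by linarith)
  have hb0 : ∀ X : Hor n × ℝ, R + 1 ≤ X.2 → b X = 0 := fun X hX => cutoff_of_le (by linarith)
  have hbM : ∀ X, |b X| ≤ 1 := fun X => by
    rw [abs_of_nonneg (cutoff_nonneg _)]; exact cutoff_le_one _
  have hle : ∀ (c : ℝ) m, ∀ X ∈ closedCyl Ω, |c * Φ m X| ≤ |c * b X| * M := fun c m X hX => by
    rcases le_or_gt X.2 R with hXR | hXR
    · rw [hb1 X hXR, mul_one, abs_mul]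
      exact mul_le_mul_of_nonneg_left (hM m X hX) (abs_nonneg _)
    · rw [hΦR m X hX hXR.le, mul_zero, abs_zero]
      exact mul_nonneg (abs_nonneg _) ((abs_nonneg _).trans (hM m X hX))
  have t2 : Tendsto (fun m => ∫ X in cyl Ω,
      deriv (g X.2) (u X) * ‖gradX (latCyl Ω) u X‖ ^ 2 * Φ m X) atTop
      (𝓝 (∫ X in cyl Ω, deriv (g X.2) (u X) * ‖gradX (latCyl Ω) u X‖ ^ 2 * p X)) := by
    have hB := hu.integrableOn_inner hΩ ha (b := b) hbc.aestronglyMeasurable (M := 1)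
      (fun X _ => hbM X) (R := R + 1) fun X _ hX => hb0 X hX
    refine tendsto_integral_of_dominated_convergence _ (fun m => (hu.integrableOn_inner hΩ ha
      (b := Φ m) (hΦc m).aestronglyMeasurable (fun X hX => hM m X (cyl_subset_closedCyl hX))
      fun X hX => hΦR m X (cyl_subset_closedCyl hX)).aestronglyMeasurable)
      (hB.abs.mul_const M) (fun m => ?_) ?_
    · filter_upwards [ae_restrict_mem hcm] with X hX using hle _ m X (cyl_subset_closedCyl hX)
    · filter_upwards [ae_restrict_mem hcm] with X hX using
        (h.tendsto X (cyl_subset_closedCyl hX)).const_mul _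
  have t4 : Tendsto (fun m => ∫ X, wt Ω a u X * normalTerm Ω u X * Φ m X ∂(latMeasure Ω)) atTop
      (𝓝 (∫ X, wt Ω a u X * normalTerm Ω u X * p X ∂(latMeasure Ω))) := by
    have hB := hr.integrable_normalTerm hΩ ha (b := b) hbc.continuousOn (M := 1)
      (fun X _ => hbM X) (R := R + 1) fun X _ hX => hb0 X hX
    have hsub : frontier Ω ×ˢ Ioi (0 : ℝ) ⊆ closedCyl Ω :=
      prod_mono frontier_subset_closure Ioi_subset_Ici_self
    refine tendsto_integral_of_dominated_convergence _ (fun m => (hr.integrable_normalTerm hΩ ha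
      (b := Φ m) (hΦc m).continuousOn (hM m) (hΦR m)).aestronglyMeasurable)
      (hB.abs.mul_const M) (fun m => ?_) ?_
    · filter_upwards [hΩ.ae_latMeasure_mem] with X hX using hle _ m X (hsub hX)
    · filter_upwards [hΩ.ae_latMeasure_mem] with X hX using (h.tendsto X (hsub hX)).const_mul _
  have t3 : Tendsto (fun m => ∫ x in Ω,
      deriv f (u (x, 0)) * ‖(WithLp.toLp 2 fun j => w j x : Hor n)‖ ^ 2 * Φ m (x, 0)) atTop
      (𝓝 (∫ x in Ω, deriv f (u (x, 0)) * ‖(WithLp.toLp 2 fun j => w j x : Hor n)‖ ^ 2 *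
        p (x, 0))) := by
    have hmem : ∀ x ∈ closure Ω, (x, (0 : ℝ)) ∈ closedCyl Ω := fun x hx => ⟨hx, le_refl (0 : ℝ)⟩
    have hwL := (HasBottomTrace.norm_toLp hΩ.isOpen hw fun j => hr.continuousOn_uD hΩ _).1
    have hfc : ContinuousOn (fun x => deriv f (u (x, 0))) (closure Ω) :=
      (hf.continuous_deriv le_rfl).comp_continuousOn
        (hr.cont.comp (f := fun x : Hor n => (x, (0 : ℝ))) (by fun_prop) hmem)
    obtain ⟨K, hK⟩ := hΩ.isCompact_closure.exists_bound_of_continuousOn hfc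
    have hfm : AEStronglyMeasurable (fun x => deriv f (u (x, 0))) (volume.restrict Ω) :=
      (hfc.mono subset_closure).aestronglyMeasurable hΩ.isOpen.measurableSet
    have hB : IntegrableOn
        (fun x => deriv f (u (x, 0)) * ‖(WithLp.toLp 2 fun j => w j x : Hor n)‖ ^ 2) Ω :=
      (hwL.integrable_sq).bdd_mul hfm
        ((ae_restrict_mem hΩ.isOpen.measurableSet).mono fun x hx => hK x (subset_closure hx))
    refine tendsto_integral_of_dominated_convergence _ (fun m => hB.aestronglyMeasurable.mul
      ((hΦc m).comp (by fun_prop : Continuous fun x : Hor n => (x, (0 : ℝ)))).aestronglyMeasurable)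
      (hB.abs.mul_const M) (fun m => ?_) ?_
    · filter_upwards [ae_restrict_mem hΩ.isOpen.measurableSet] with x hx
      rw [norm_mul]
      exact mul_le_mul_of_nonneg_left (hM m _ (hmem x (subset_closure hx))) (norm_nonneg _)
    · filter_upwards [ae_restrict_mem hΩ.isOpen.measurableSet] with x hx using
        (h.tendsto _ (hmem x (subset_closure hx))).const_mul _
  exact ((t1.add t2).sub t3).sub t4

end LinearizedForm

/-! ### Approximation of weights that are `C¹` up to the boundary. -/

section Approximation

variable {n : ℕ} {α : ℝ≥0} {Ω : Set (Hor n)}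

theorem IsBoundedApprox.congr {Φ : ℕ → Hor n × ℝ → ℝ} {p q : Hor n × ℝ → ℝ}
    {p' q' : Hor n × ℝ → (Hor n × ℝ →L[ℝ] ℝ)} (h : IsBoundedApprox Ω Φ p p')
    (hpq : EqOn p q (closedCyl Ω)) (hpq' : EqOn p' q' (cyl Ω)) : IsBoundedApprox Ω Φ q q' :=
  { h with
    tendsto := fun X hX => hpq hX ▸ h.tendsto X hX
    tendsto_fderiv := fun X hX => hpq' hX ▸ h.tendsto_fderiv X hX }

theorem IsBoundedApprox.zero : IsBoundedApprox Ω (fun _ _ => 0) (fun _ => 0) (fun _ => 0) where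
  contDiff _ := contDiff_const
  compact _ := HasCompactSupport.zero
  bdd := ⟨0, by simp⟩
  height := ⟨0, by simp⟩
  tendsto _ _ := tendsto_const_nhds
  bdd_fderiv := ⟨0, by simp⟩
  tendsto_fderiv _ _ := by simp

theorem IsBoundedApprox.add {Φ Φ' : ℕ → Hor n × ℝ → ℝ} {p q : Hor n × ℝ → ℝ}
    {p' q' : Hor n × ℝ → (Hor n × ℝ →L[ℝ] ℝ)} (h : IsBoundedApprox Ω Φ p p')
    (h' : IsBoundedApprox Ω Φ' q q') :
    IsBoundedApprox Ω (fun m X => Φ m X + Φ' m X) (fun X => p X + q X) (fun X => p' X + q' X) := by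
  have hfd : ∀ m X, fderiv ℝ (fun X => Φ m X + Φ' m X) X = fderiv ℝ (Φ m) X + fderiv ℝ (Φ' m) X :=
    fun m X => fderiv_fun_add ((h.contDiff m).differentiable one_ne_zero X)
      ((h'.contDiff m).differentiable one_ne_zero X)
  refine ⟨fun m => (h.contDiff m).add (h'.contDiff m), fun m => (h.compact m).add (h'.compact m),
    ?_, ?_, fun X hX => (h.tendsto X hX).add (h'.tendsto X hX), ?_, fun X hX => ?_⟩
  · obtain ⟨M, hM⟩ := h.bdd
    obtain ⟨M', hM'⟩ := h'.bdd
    exact ⟨M + M', fun m X hX => (abs_add_le _ _).trans (add_le_add (hM m X hX) (hM' m X hX))⟩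
  · obtain ⟨R, hR⟩ := h.height
    obtain ⟨R', hR'⟩ := h'.height
    refine ⟨max R R', fun m X hX hXR => ?_⟩
    rw [hR m X hX ((le_max_left _ _).trans hXR), hR' m X hX ((le_max_right _ _).trans hXR), add_zero]
  · obtain ⟨M, hM⟩ := h.bdd_fderiv
    obtain ⟨M', hM'⟩ := h'.bdd_fderiv
    refine ⟨M + M', fun m X hX => ?_⟩
    rw [hfd]
    exact (norm_add_le _ _).trans (add_le_add (hM m X hX) (hM' m X hX))
  · simp only [hfd]
    exact (h.tendsto_fderiv X hX).add (h'.tendsto_fderiv X hX)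

theorem IsBoundedApprox.sum {ι : Type*} (s : Finset ι) {Φ : ι → ℕ → Hor n × ℝ → ℝ}
    {p : ι → Hor n × ℝ → ℝ} {p' : ι → Hor n × ℝ → (Hor n × ℝ →L[ℝ] ℝ)}
    (h : ∀ i ∈ s, IsBoundedApprox Ω (Φ i) (p i) (p' i)) :
    IsBoundedApprox Ω (fun m X => ∑ i ∈ s, Φ i m X) (fun X => ∑ i ∈ s, p i X)
      (fun X => ∑ i ∈ s, p' i X) := by
  classical
  induction s using Finset.induction_on with
  | empty => simpa using IsBoundedApprox.zero
  | insert i s hi ih =>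
    simp only [Finset.sum_insert hi]
    exact (h i (Finset.mem_insert_self _ _)).add (ih fun k hk => h k (Finset.mem_insert_of_mem hk))

theorem fderiv_normed_convolution {E : Type*} [NormedAddCommGroup E] [NormedSpace ℝ E]
    [FiniteDimensional ℝ E] [MeasurableSpace E] [BorelSpace E] {μ : Measure E}
    [μ.IsAddHaarMeasure] (φ : ContDiffBump (0 : E)) {Ψ : E → ℝ} (hΨ : ContDiff ℝ 1 Ψ)
    (hc : HasCompactSupport Ψ) (x : E) :
    fderiv ℝ (convolution (φ.normed μ) Ψ (ContinuousLinearMap.lsmul ℝ ℝ) μ) x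
      = convolution (φ.normed μ) (fderiv ℝ Ψ) (ContinuousLinearMap.lsmul ℝ ℝ) μ x := by
  rw [(hc.hasFDerivAt_convolution_right (ContinuousLinearMap.lsmul ℝ ℝ)
    (φ.continuous_normed.locallyIntegrable) hΨ x).fderiv]
  simp only [convolution_def]
  refine integral_congr_ae (ae_of_all _ fun t => ?_)
  ext v
  simp [ContinuousLinearMap.precompR_apply]

/-- Mollification of compactly supported functions. -/
theorem exists_mollification {Ψ : Hor n × ℝ → ℝ} (hΨ : ContDiff ℝ 1 Ψ) (hc : HasCompactSupport Ψ) :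
    ∃ Φ : ℕ → Hor n × ℝ → ℝ, (∀ m, ContDiff ℝ ∞ (Φ m)) ∧ IsBoundedApprox Ω Φ Ψ (fderiv ℝ Ψ) := by
  let φ : ℕ → ContDiffBump (0 : Hor n × ℝ) := fun m =>
    ⟨1 / (m + 2), 1 / (m + 1), by positivity,
      one_div_lt_one_div_of_lt (by positivity) (by linarith)⟩
  have hφ0 : Tendsto (fun m => (φ m).rOut) atTop (𝓝 0) := tendsto_one_div_add_atTop_nhds_zero_nat
  have hφ1 : ∀ m, (φ m).rOut ≤ 1 := fun m => by
    change 1 / ((m : ℝ) + 1) ≤ 1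
    rw [div_le_one (by positivity)]
    linarith [(Nat.cast_nonneg m : (0 : ℝ) ≤ m)]
  let L := ContinuousLinearMap.lsmul ℝ ℝ (E := ℝ)
  let Φ : ℕ → Hor n × ℝ → ℝ := fun m => convolution ((φ m).normed volume) Ψ L volume
  have hΦ : ∀ m, ContDiff ℝ ∞ (Φ m) := fun m =>
    (φ m).hasCompactSupport_normed.contDiff_convolution_left L (φ m).contDiff_normed
      hΨ.continuous.locallyIntegrable
  -- The constant is the bound `M` plus the oscillation `2 M`. The codomain is kept general because
  -- the estimate serves both `Ψ` and its derivative.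
  have hbound : ∀ {F : Type} [NormedAddCommGroup F] [NormedSpace ℝ F] [CompleteSpace F]
      {G : Hor n × ℝ → F} (_ : Continuous G) {M : ℝ} (_ : ∀ X, ‖G X‖ ≤ M) (m : ℕ) (X : Hor n × ℝ),
      ‖convolution ((φ m).normed volume) G (ContinuousLinearMap.lsmul ℝ ℝ) volume X‖ ≤ 3 * M := by
    intro F _ _ _ G hG M hM m X
    have h1 := (φ m).dist_normed_convolution_le (μ := volume) (x₀ := X) (ε := 2 * M)
      hG.aestronglyMeasurable fun Z _ => by
        rw [dist_eq_norm]
        refine (norm_sub_le _ _).trans ?_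
        linarith [hM Z, hM X]
    rw [dist_eq_norm] at h1
    have h2 := norm_le_norm_add_norm_sub' (convolution ((φ m).normed volume) G
      (ContinuousLinearMap.lsmul ℝ ℝ) volume X) (G X)
    linarith [hM X]
  have hdc := hΨ.continuous_fderiv one_ne_zero
  obtain ⟨M, hM⟩ := hc.exists_bound_of_continuous hΨ.continuous
  obtain ⟨M', hM'⟩ := (hc.fderiv (𝕜 := ℝ)).exists_bound_of_continuous hdc
  -- The mollification radius is at most one, hence the height grows by at most one.
  obtain ⟨R, hR⟩ := exists_fst_bound_of_hasCompactSupport hc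
  refine ⟨Φ, hΦ, fun m => (hΦ m).of_le (by exact_mod_cast le_top),
    fun m => (φ m).hasCompactSupport_normed.convolution L hc,
    ⟨3 * M, fun m X _ => hbound hΨ.continuous hM m X⟩, ⟨R + 1, fun m X _ hX => ?_⟩,
    fun X _ => ContDiffBump.convolution_tendsto_right_of_continuous hφ0 hΨ.continuous X,
    ⟨3 * M', fun m X _ => ?_⟩, fun X _ => ?_⟩
  · have h1 := (φ m).dist_normed_convolution_le (μ := volume) (x₀ := X) (g := Ψ) (ε := 0)
      hΨ.continuous.aestronglyMeasurable fun Z hZ => by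
        have h2 : |Z.2 - X.2| < 1 := by
          refine lt_of_le_of_lt ?_ ((Metric.mem_ball.1 hZ).trans_le (hφ1 m))
          rw [← Real.dist_eq]
          exact le_max_right _ _
        rw [(hR Z (by linarith [(abs_lt.1 h2).1])).1, (hR X (by linarith)).1, dist_self]
    rw [(hR X (by linarith)).1] at h1
    exact dist_le_zero.1 h1
  · rw [fderiv_normed_convolution _ hΨ hc]
    exact hbound hdc hM' m X
  · simp only [Φ, L, fderiv_normed_convolution _ hΨ hc]
    exact ContDiffBump.convolution_tendsto_right_of_continuous hφ0 hdc X

theorem exists_smooth_cutoff {E : Type*} [NormedAddCommGroup E] [NormedSpace ℝ E]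
    [FiniteDimensional ℝ E] {K U : Set E} (hK : IsCompact K) (hU : IsOpen U) (hKU : K ⊆ U) :
    ∃ κ : E → ℝ, ContDiff ℝ ∞ κ ∧ HasCompactSupport κ ∧ tsupport κ ⊆ U ∧ ∀ x ∈ K, κ x = 1 := by
  have h : ∀ x ∈ K, ∃ r, 0 < r ∧ Metric.ball x r ⊆ U := fun x hx =>
    Metric.isOpen_iff.1 hU x (hKU hx)
  choose! r hr hrU using h
  obtain ⟨s, χ, hs, hχ, hsum⟩ := exists_finite_smooth_partition hK r hr
  have hsub : tsupport (fun x => ∑ i ∈ s, χ i x) ⊆ ⋃ i ∈ s, tsupport (χ i) := by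
    refine closure_minimal (fun x hx => ?_)
      (s.finite_toSet.isClosed_biUnion fun i _ => isClosed_tsupport _)
    obtain ⟨i, hi, hne⟩ := Finset.exists_ne_zero_of_sum_ne_zero hx
    exact mem_biUnion hi (subset_tsupport _ hne)
  refine ⟨fun x => ∑ i ∈ s, χ i x, ContDiff.sum fun i hi => (hχ i hi).1, ?_, ?_, hsum⟩
  · exact (s.isCompact_biUnion fun i hi => (hχ i hi).2.2.1.isCompact).of_isClosed_subset
      (isClosed_tsupport _) hsub
  · exact hsub.trans (iUnion₂_subset fun i hi => (hχ i hi).2.1.trans (hrU i (hs i hi)))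

/-- Functions localized where a translation moves the closed domain into its interior. -/
theorem IsHolderDomain.exists_approx_of_translate (hΩ : IsHolderDomain 4 α Ω) {F : Hor n × ℝ → ℝ}
    (hF : ContDiffOn ℝ 1 F (closedCyl Ω)) {R : ℝ} (hR : ∀ X ∈ closedCyl Ω, R ≤ X.2 → F X = 0)
    {B K : Set (Hor n)} (hB : IsOpen B) (hK : IsCompact K) (hKB : K ⊆ B)
    (hFK : ∀ X : Hor n × ℝ, X.1 ∉ K → F X = 0) {v : Hor n}
    (hv : ∀ x, ∀ t > (0 : ℝ), x ∈ closure Ω → x ∈ B → x - t • v ∈ B → x - t • v ∈ Ω) :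
    ∃ Φ : ℕ → Hor n × ℝ → ℝ, IsBoundedApprox Ω Φ F (fderiv ℝ F) := by
  obtain ⟨δ, hδ, hδB⟩ := hK.exists_cthickening_subset_open hB hKB
  have ho := isOpen_cyl hΩ.isOpen
  -- Chosen so that `t m * ‖v‖ ≤ δ`: a point that is moved into `K` has started in `B`, where the
  -- inward translation property holds. The summand `1` covers `v = 0`.
  let t : ℕ → ℝ := fun m => δ / (‖v‖ + 1) * (1 / (m + 1))
  have ht : ∀ m, 0 < t m := fun m => by positivity
  have htv : ∀ m, t m * ‖v‖ ≤ δ := fun m => by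
    have h1 : 1 / ((m : ℝ) + 1) ≤ 1 := by
      rw [div_le_one (by positivity)]; linarith [(Nat.cast_nonneg m : (0 : ℝ) ≤ m)]
    have h2 : δ / (‖v‖ + 1) * ‖v‖ ≤ δ := by
      rw [div_mul_eq_mul_div, div_le_iff₀ (by positivity)]
      nlinarith [norm_nonneg v]
    calc _ = (1 / ((m : ℝ) + 1)) * (δ / (‖v‖ + 1) * ‖v‖) := by simp only [t]; ring
      _ ≤ 1 * δ := mul_le_mul h1 h2 (by positivity) one_pos.le
      _ = δ := one_mul δ
  have ht0 : Tendsto t atTop (𝓝 0) := by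
    simpa only [mul_zero] using
      (tendsto_one_div_add_atTop_nhds_zero_nat (𝕜 := ℝ)).const_mul (δ / (‖v‖ + 1))
  -- The shift points into the domain and also upwards, so that points of the bottom land in the
  -- open cylinder too.
  let z : ℕ → Hor n × ℝ := fun m => (-(t m • v), t m)
  have hz0 : ∀ X, Tendsto (fun m => X + z m) atTop (𝓝 X) := fun X => by
    have : Tendsto z atTop (𝓝 ((0 : Hor n), (0 : ℝ))) := by
      refine Tendsto.prodMk_nhds ?_ ht0
      simpa using (ht0.smul_const v).neg
    have h := (tendsto_const_nhds (x := X)).add this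
    rwa [Prod.mk_zero_zero, add_zero] at h
  have hfst : ∀ m (X : Hor n × ℝ), (X + z m).1 = X.1 - t m • v := fun m X => by
    simp [z, sub_eq_add_neg]
  have hsnd : ∀ m (X : Hor n × ℝ), (X + z m).2 = X.2 + t m := fun m X => rfl
  have hmem : ∀ m, ∀ X ∈ closedCyl Ω, X.1 ∈ B → (X + z m).1 ∈ B → X + z m ∈ cyl Ω :=
    fun m X hX h1 h2 => ⟨by
      rw [hfst] at h2 ⊢
      exact hv _ _ (ht m) hX.1 h1 h2, by
      rw [mem_Ioi, hsnd]
      exact add_pos_of_nonneg_of_pos hX.2 (ht m)⟩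
  have hmemK : ∀ m, ∀ X ∈ closedCyl Ω, (X + z m).1 ∈ K → X + z m ∈ cyl Ω := fun m X hX h => by
    refine hmem m X hX (hδB (Metric.mem_cthickening_of_dist_le _ _ _ _ h ?_)) (hKB h)
    rw [hfst, dist_eq_norm, sub_sub_cancel, norm_smul, Real.norm_of_nonneg (ht m).le]
    exact htv m
  have hFz : ∀ X : Hor n × ℝ, X.1 ∉ K → F =ᶠ[𝓝 X] fun _ => 0 := fun X hX => by
    filter_upwards [continuous_fst.continuousAt.eventually (hK.isClosed.isOpen_compl.mem_nhds hX)]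
      with Z hZ using hFK Z hZ
  -- On this open neighbourhood of the closed cylinder the shifted function is `C¹`: the shifted
  -- point lies in the open cylinder, or off `K`, where `F` vanishes locally.
  let U : ℕ → Set (Hor n × ℝ) := fun m => (fun X => X + z m) ⁻¹' (cyl Ω ∪ Prod.fst ⁻¹' Kᶜ)
  have hUo : ∀ m, IsOpen (U m) := fun m =>
    (ho.union (hK.isClosed.isOpen_compl.preimage continuous_fst)).preimage (by fun_prop)
  have hsubU : ∀ m, closedCyl Ω ⊆ U m := fun m X hX => by
    by_cases h : (X + z m).1 ∈ K
    · exact Or.inl (hmemK m X hX h)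
    · exact Or.inr h
  have hqd : ∀ m, ∀ X ∈ U m, ContDiffAt ℝ 1 (fun X => F (X + z m)) X := fun m X hX => by
    have h1 : ContDiffAt ℝ 1 F (X + z m) := by
      rcases hX with h | h
      · exact hF.contDiffAt (closedCyl_mem_nhds hΩ.isOpen h)
      · exact contDiffAt_const.congr_of_eventuallyEq (hFz _ h)
    exact h1.comp (f := fun X => X + z m) X (by fun_prop)
  have hKR : IsCompact (closure Ω ×ˢ Icc (0 : ℝ) R) := hΩ.isCompact_closure.prod isCompact_Icc
  have hKRs : closure Ω ×ˢ Icc (0 : ℝ) R ⊆ closedCyl Ω := prod_mono subset_rfl fun y hy => hy.1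
  -- The cutoff turns the shifted function into a compactly supported one on the whole space,
  -- without changing it on the closed cylinder, where it vanishes above height `R`.
  choose κ hκd hκc hκU hκ1 using fun m => exists_smooth_cutoff hKR (hUo m) (hKRs.trans (hsubU m))
  have hqR : ∀ m, ∀ X ∈ closedCyl Ω, R ≤ X.2 → F (X + z m) = 0 := fun m X hX hXR => by
    by_cases h : (X + z m).1 ∈ K
    · exact hR _ (cyl_subset_closedCyl (hmemK m X hX h)) (by rw [hsnd]; linarith [ht m])
    · exact hFK _ h
  have hΦq : ∀ m, ∀ X ∈ closedCyl Ω, κ m X * F (X + z m) = F (X + z m) := fun m X hX => by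
    rcases le_total X.2 R with h | h
    · rw [hκ1 m X ⟨hX.1, hX.2, h⟩, one_mul]
    · rw [hqR m X hX h, mul_zero]
  have hfd : ∀ m, ∀ X ∈ cyl Ω, fderiv ℝ (fun X => κ m X * F (X + z m)) X = fderiv ℝ F (X + z m) :=
    fun m X hX => by
      have hev : (fun X => κ m X * F (X + z m)) =ᶠ[𝓝 X] fun X => F (X + z m) := by
        filter_upwards [ho.mem_nhds hX] with Z hZ using hΦq m Z (cyl_subset_closedCyl hZ)
      rw [hev.fderiv_eq, fderiv_comp_add_right]
  obtain ⟨M, hM0, hM⟩ := exists_bound_of_support hΩ hF hR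
  obtain ⟨M', hM'⟩ := hKR.exists_bound_of_continuousOn
    ((hF.continuousOn_fderivWithin hΩ.uniqueDiffOn_closedCyl le_rfl).mono hKRs)
  have hdM : ∀ X ∈ cyl Ω, ‖fderiv ℝ F X‖ ≤ max M' 0 := fun X hX => by
    rcases le_or_gt X.2 R with h | h
    · rw [← fderivWithin_of_mem_nhds (closedCyl_mem_nhds hΩ.isOpen hX)]
      exact (hM' X ⟨subset_closure hX.1, le_of_lt hX.2, h⟩).trans (le_max_left _ _)
    · have hev : F =ᶠ[𝓝 X] fun _ => 0 := by
        filter_upwards [ho.mem_nhds hX, (continuous_snd.tendsto X).eventually_const_lt h]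
          with Z hZ hZR using hR Z (cyl_subset_closedCyl hZ) hZR.le
      rw [hev.fderiv_eq]
      simp
  refine ⟨fun m X => κ m X * F (X + z m), fun m => ?_, fun m => (hκc m).mul_right,
    ⟨M, fun m X hX => ?_⟩, ⟨R, fun m X hX hXR => ?_⟩, fun X hX => ?_,
    ⟨max M' 0, fun m X hX => ?_⟩, fun X hX => ?_⟩
  · rw [contDiff_iff_contDiffAt]
    intro X
    by_cases h : X ∈ tsupport (κ m)
    · exact ((hκd m).of_le (by exact_mod_cast le_top)).contDiffAt.mul (hqd m X (hκU m h))
    · refine (contDiffAt_const (c := (0 : ℝ))).congr_of_eventuallyEq ?_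
      filter_upwards [(isClosed_tsupport (κ m)).isOpen_compl.mem_nhds h] with Z hZ
      rw [image_eq_zero_of_notMem_tsupport hZ, zero_mul]
  · rw [hΦq m X hX]
    by_cases h : (X + z m).1 ∈ K
    · exact (hM _ (cyl_subset_closedCyl (hmemK m X hX h))).1
    · rw [hFK _ h, abs_zero]; exact hM0
  · rw [hqR m X hX hXR, mul_zero]
  · simp only [fun m => hΦq m X hX]
    by_cases h : X.1 ∈ B
    · refine (hF.continuousOn X hX).tendsto.comp (tendsto_nhdsWithin_iff.2 ⟨hz0 X, ?_⟩)
      filter_upwards [(hz0 X).eventually ((hB.preimage continuous_fst).mem_nhds h)] with m hm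
      exact cyl_subset_closedCyl (hmem m X hX h hm)
    · have hX1 : X.1 ∉ K := fun hc => h (hKB hc)
      refine tendsto_const_nhds.congr' ?_
      filter_upwards [(hz0 X).eventually (hFz X hX1)] with m hm
      rw [hm, hFK X hX1]
  · rw [hfd m X hX]
    by_cases h : (X + z m).1 ∈ K
    · exact hdM _ (hmemK m X (cyl_subset_closedCyl hX) h)
    · rw [(hFz _ h).fderiv_eq]
      simp
  · simp only [fun m => hfd m X hX]
    have hc : ContinuousAt (fderiv ℝ F) X :=
      ((hF.mono cyl_subset_closedCyl).continuousOn_fderiv_of_isOpen ho le_rfl).continuousAt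
        (ho.mem_nhds hX)
    exact hc.tendsto.comp (hz0 X)

/-- At a boundary point `v` is the unit vector of a chart, and the condition of `mem_of_translate`
reduces to `0 < t / 2`. In the interior no movement is needed and `v = 0`. -/
theorem IsHolderDomain.exists_inward_translation (hΩ : IsHolderDomain 4 α Ω) {x₀ : Hor n}
    (hx₀ : x₀ ∈ closure Ω) : ∃ r > 0, ∃ v : Hor n, ∀ x, ∀ t > (0 : ℝ), x ∈ closure Ω →
      x ∈ Metric.ball x₀ r → x - t • v ∈ Metric.ball x₀ r → x - t • v ∈ Ω := by
  by_cases h : x₀ ∈ Ω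
  · obtain ⟨r, hr, hsub⟩ := Metric.isOpen_iff.1 hΩ.isOpen x₀ h
    exact ⟨r, hr, 0, fun x t _ _ _ hx => hsub hx⟩
  · have hf : x₀ ∈ frontier Ω := ⟨hx₀, by rwa [hΩ.isOpen.interior_eq]⟩
    obtain ⟨e, r, ρ, C⟩ := hΩ.exists_boundaryChart hf (ε := 1 / 2) (by norm_num)
    refine ⟨r, C.r_pos, e, fun x t ht hxc hx hxt => ?_⟩
    have := C.mem_of_translate (v := 0) hx hxc ht (by norm_num [ht]) (by norm_num)
      (by simpa using hxt)
    simpa using this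

/-- Functions of class `C¹` up to the boundary are approximated by globally defined ones. -/
theorem IsHolderDomain.exists_approx (hΩ : IsHolderDomain 4 α Ω) {p : Hor n × ℝ → ℝ}
    (hp : ContDiffOn ℝ 1 p (closedCyl Ω)) {R : ℝ} (hR : ∀ X ∈ closedCyl Ω, R ≤ X.2 → p X = 0) :
    ∃ Φ : ℕ → Hor n × ℝ → ℝ, IsBoundedApprox Ω Φ p (fderiv ℝ p) := by
  choose! r hr v hv using fun x (hx : x ∈ closure Ω) => hΩ.exists_inward_translation hx
  obtain ⟨s, χ, hs, hχ, hsum⟩ := exists_finite_smooth_partition hΩ.isCompact_closure r hr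
  have hχ1 : ∀ i ∈ s, ContDiff ℝ 1 fun X : Hor n × ℝ => χ i X.1 := fun i hi =>
    ((hχ i hi).1.of_le (by exact_mod_cast le_top)).comp contDiff_fst
  have hF : ∀ i ∈ s, ContDiffOn ℝ 1 (fun X => χ i X.1 * p X) (closedCyl Ω) := fun i hi =>
    (hχ1 i hi).contDiffOn.mul hp
  have hex : ∀ i ∈ s, ∃ Φ : ℕ → Hor n × ℝ → ℝ, IsBoundedApprox Ω Φ (fun X => χ i X.1 * p X)
      (fderiv ℝ fun X => χ i X.1 * p X) := fun i hi =>
    hΩ.exists_approx_of_translate (hF i hi) (R := R) (fun X hX hXR => by rw [hR X hX hXR, mul_zero])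
      Metric.isOpen_ball (hχ i hi).2.2.1.isCompact (hχ i hi).2.1
      (fun X hX => by rw [image_eq_zero_of_notMem_tsupport hX, zero_mul]) (hv i (hs i hi))
  choose! Φ hΦ using hex
  have hone : ∀ X ∈ closedCyl Ω, ∑ i ∈ s, χ i X.1 * p X = p X := fun X hX => by
    rw [← Finset.sum_mul, hsum X.1 hX.1, one_mul]
  refine ⟨_, (IsBoundedApprox.sum s hΦ).congr hone fun X hX => ?_⟩
  have hd : ∀ i ∈ s, DifferentiableAt ℝ (fun X => χ i X.1 * p X) X := fun i hi =>
    ((hF i hi).contDiffAt (closedCyl_mem_nhds hΩ.isOpen hX)).differentiableAt one_ne_zero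
  have hev : (fun X => ∑ i ∈ s, χ i X.1 * p X) =ᶠ[𝓝 X] p := by
    filter_upwards [closedCyl_mem_nhds hΩ.isOpen hX] with Z hZ using hone Z hZ
  rw [← hev.fderiv_eq, fderiv_fun_sum hd]

end Approximation

/-! ### The linearized equation for `C¹` weights. -/

section LinearizedEquation

variable {n : ℕ} {α : ℝ≥0} {Ω : Set (Hor n)} {a g : ℝ → ℝ → ℝ} {f : ℝ → ℝ} {u : Hor n × ℝ → ℝ}

/-- The linearized equation, for functions of class `C¹` up to the boundary. -/
theorem IsStableSolution.linearizedForm_eq_zero (hu : IsStableSolution Ω a g f u)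
    (hΩ : IsHolderDomain 4 α Ω) (ha : IsDiffusion a) (hg : IsInnerReaction g)
    (hf : ContDiff ℝ 1 f) {w : Fin n → Hor n → ℝ}
    (hw : ∀ j : Fin n, HasBottomTrace Ω (uD Ω u j.castSucc) (w j)) {p : Hor n × ℝ → ℝ}
    (hp : ContDiffOn ℝ 1 p (closedCyl Ω)) {R : ℝ} (hR : ∀ X ∈ closedCyl Ω, R ≤ X.2 → p X = 0) :
    linearizedForm Ω a g f u w p (fun X => coordMap n (fderiv ℝ p X)) = 0 := by
  obtain ⟨Φ, hΦ⟩ := hΩ.exists_approx hp hR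
  refine tendsto_nhds_unique (hu.tendsto_linearizedForm hΩ ha hf hw hΦ)
    (tendsto_const_nhds.congr fun m => ?_)
  -- Two nested limits: each global `C¹` approximation is mollified, so the form vanishes on it by
  -- the smooth case, and then `m` tends to infinity.
  obtain ⟨Φ', hΦs, hΦ'⟩ := exists_mollification (Ω := Ω) (hΦ.contDiff m) (hΦ.compact m)
  have h := hu.tendsto_linearizedForm hΩ ha hf hw hΦ'
  have hg' : grad univ (Φ m) = fun X => coordMap n (fderiv ℝ (Φ m) X) := by
    funext X
    rw [grad_eq_coordMap, fderivWithin_univ]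
  rw [hg']
  exact tendsto_nhds_unique (tendsto_const_nhds.congr fun k =>
    (hu.linearizedForm_smooth hΩ ha hg hf (hΦs k) (hΦ'.compact k) hw).symm) h

end LinearizedEquation

/-! ### The stability form of `|∇ₓu| ψ`. -/

section StabilityInequality

variable {n : ℕ} {α : ℝ≥0} {Ω : Set (Hor n)} {a g : ℝ → ℝ → ℝ} {f : ℝ → ℝ} {u ψ : Hor n × ℝ → ℝ}

theorem coordMap_fderiv_sq (hΩ : IsOpen Ω) (hψ : ContDiffOn ℝ 1 ψ (closedCyl Ω)) {X : Hor n × ℝ}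
    (hX : X ∈ cyl Ω) :
    coordMap n (fderiv ℝ (fun X => ψ X ^ 2) X) = (2 * ψ X) • grad (closedCyl Ω) ψ X := by
  have hS := closedCyl_mem_nhds hΩ hX
  have hd := (hψ.contDiffAt hS).differentiableAt one_ne_zero
  rw [grad_eq_coordMap, fderivWithin_of_mem_nhds hS, fderiv_fun_pow 2 hd, ← map_smul]
  simp

/-- Bilinear expansion. With `N = |∇ₓu|`, the pure term `ψ² ⟨ℬ∇N,∇N⟩` is the Hessian term minus the
geometric term. By symmetry of `ℬ` the mixed terms add up to `2 N ψ ⟨ℬ∇N,∇ψ⟩ = ⟨ℬ(N∇N), ∇ψ²⟩`, which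
is the cross term of the linearized equation with weight `ψ²`. -/
theorem IsRegularSol.formB_grad_norm_mul (hu : IsRegularSol Ω a u) (hΩ : IsHolderDomain 4 α Ω)
    (hψ : ContDiffOn ℝ 1 ψ (closedCyl Ω)) {X : Hor n × ℝ} (hX : X ∈ cyl Ω) :
    let G := ψ X • grad (latCyl Ω) (fun Z => ‖gradX (latCyl Ω) u Z‖) X
        + ‖gradX (latCyl Ω) u X‖ • grad (closedCyl Ω) ψ X
    formB a X.2 (gradU Ω u X) G G
      = (hessTerm Ω a u X * ψ X ^ 2
          + ⟪crossTerm Ω a u X, coordMap n (fderiv ℝ (fun X => ψ X ^ 2) X)⟫)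
        - geomTerm Ω a u X * ψ X ^ 2
        + formB a X.2 (gradU Ω u X) (grad (closedCyl Ω) ψ X) (grad (closedCyl Ω) ψ X)
          * ‖gradX (latCyl Ω) u X‖ ^ 2 := by
  intro G
  rw [coordMap_fderiv_sq hΩ.isOpen hψ hX, crossTerm, ← hu.norm_gradX_smul_grad hΩ hX]
  simp only [G, geomTerm, hessTerm, fluxU, formB_eq, map_add, map_smul, inner_add_left,
    inner_add_right, inner_smul_left, inner_smul_right, conj_trivial]
  rw [fluxDeriv_symm _ (grad (closedCyl Ω) ψ X)]
  ring

theorem IsRegularSol.integrableOn_stability_terms (hu : IsRegularSol Ω a u)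
    (hΩ : IsHolderDomain 4 α Ω) (ha : IsDiffusion a) (hψ : ContDiffOn ℝ 1 ψ (closedCyl Ω)) {R : ℝ}
    (hR : ∀ X ∈ closedCyl Ω, R ≤ X.2 → ψ X = 0) :
    IntegrableOn (fun X => hessTerm Ω a u X * ψ X ^ 2
      + ⟪crossTerm Ω a u X, coordMap n (fderiv ℝ (fun X => ψ X ^ 2) X)⟫) (cyl Ω) ∧
    IntegrableOn (fun X => geomTerm Ω a u X * ψ X ^ 2) (cyl Ω) ∧
    IntegrableOn (fun X => formB a X.2 (gradU Ω u X) (grad (closedCyl Ω) ψ X)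
      (grad (closedCyl Ω) ψ X) * ‖gradX (latCyl Ω) u X‖ ^ 2) (cyl Ω) := by
  have hmem := ae_restrict_mem (μ := (volume : Measure (Hor n × ℝ)))
    (isOpen_cyl hΩ.isOpen).measurableSet
  obtain ⟨M, hM0, hM⟩ := exists_bound_of_support hΩ hψ hR
  have hψm := aestronglyMeasurable_cyl_of_continuousOn hΩ
    (hψ.continuousOn.mono latCyl_subset_closedCyl)
  have hψg := aestronglyMeasurable_cyl_of_continuousOn hΩ
    ((continuousOn_grad hΩ.uniqueDiffOn_closedCyl hψ).mono latCyl_subset_closedCyl)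
  have hψ0 : ∀ X ∈ cyl Ω, R + 1 ≤ X.2 → ψ X = 0 := fun X hX hXR =>
    hR X (cyl_subset_closedCyl hX) (by linarith)
  have hN := wL2_grad_norm_gradX hu hΩ ha
  have hsq : ∀ {p : Hor n × ℝ → Full n}, WL2 Ω a u p →
      IntegrableOn (fun X => ⟪fluxU Ω a u X (p X), p X⟫ * ψ X ^ 2) (cyl Ω) := fun {p} hp => by
    have hpψ := WL2.bdd_smul hu hΩ ha hp hψm fun X hX => (hM X (cyl_subset_closedCyl hX)).1
    refine (hu.integrableOn_flux_inner hΩ ha hpψ hpψ (R := R + 1) fun X hX hXR => by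
      rw [hψ0 X hX hXR, zero_smul]).congr (ae_of_all _ fun X => ?_)
    simp only [map_smul, inner_smul_left, inner_smul_right, conj_trivial]
    ring
  have hNψ := WL2.smul_bdd hu hΩ ha (WL2.norm hu hΩ ha (wL2_gradX hu hΩ ha)) hψg
    fun X hX => (hM X (cyl_subset_closedCyl hX)).2
  have hNψ0 : ∀ X ∈ cyl Ω, R + 1 ≤ X.2 →
      ‖gradX (latCyl Ω) u X‖ • grad (closedCyl Ω) ψ X = 0 := fun X hX hXR => by
    rw [grad_eq_zero_of_support hR (cyl_subset_closedCyl hX) (by linarith), smul_zero]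
  have hH : IntegrableOn (fun X => hessTerm Ω a u X * ψ X ^ 2) (cyl Ω) := by
    simp only [hessTerm, Finset.sum_mul]
    exact integrable_finsetSum _ fun j _ => hsq (wL2_grad_uD hu hΩ ha j)
  refine ⟨hH.add ?_, ?_, ?_⟩
  · have hNs := WL2.bdd_smul hu hΩ ha hN hψm fun X hX => (hM X (cyl_subset_closedCyl hX)).1
    refine ((hu.integrableOn_flux_inner hΩ ha hNs hNψ hNψ0).const_mul 2).congr
      (hmem.mono fun X hX => ?_)
    beta_reduce
    rw [coordMap_fderiv_sq hΩ.isOpen hψ hX, crossTerm, ← hu.norm_gradX_smul_grad hΩ hX]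
    simp only [map_smul, inner_smul_left, inner_smul_right, conj_trivial]
    ring
  · refine (hH.sub (hsq hN)).congr (ae_of_all _ fun X => ?_)
    simp only [Pi.sub_apply, geomTerm, hessTerm, formB_eq, fluxU]
    ring
  · refine (hu.integrableOn_flux_inner hΩ ha hNψ hNψ hNψ0).congr (ae_of_all _ fun X => ?_)
    simp only [formB_eq, fluxU, map_smul, inner_smul_left, inner_smul_right, conj_trivial]
    ring

end StabilityInequality

end

theorem theorem1p1 {n : ℕ} (hn : 1 ≤ n) (α : ℝ≥0) (hα₀ : 0 < α) (hα₁ : α < 1)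
    (Ω : Set (Hor n)) (hΩ : IsHolderDomain 4 α Ω)
    (a g : ℝ → ℝ → ℝ) (f : ℝ → ℝ)
    (ha : IsDiffusion a) (hg : IsInnerReaction g) (hf : IsBoundaryReaction α f)
    (u : Hor n × ℝ → ℝ) (hu : IsStableSolution Ω a g f u)
    (ψ : Hor n × ℝ → ℝ) (hψ : ContDiffOn ℝ 1 ψ (closedCyl Ω))
    (hψ_supp : ∃ R : ℝ, ∀ X ∈ closedCyl Ω, R ≤ X.2 → ψ X = 0)
    (hψ_test : ∀ j : Fin n, ∃ G φ₀, IsTest Ω a u (pd (closedCyl Ω) ψ j.castSucc) G φ₀) :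
    IntegrableOn (fun X => geomTerm Ω a u X * ψ X ^ 2) (cyl Ω) ∧
    Integrable (fun X => wt Ω a u X * normalTerm Ω u X * ψ X ^ 2) (latMeasure Ω) ∧
    IntegrableOn (fun X => formB a X.2 (gradU Ω u X) (grad (closedCyl Ω) ψ X)
      (grad (closedCyl Ω) ψ X) * ‖gradX (latCyl Ω) u X‖ ^ 2) (cyl Ω) ∧
    (∫ X in cyl Ω, geomTerm Ω a u X * ψ X ^ 2)
        - (∫ X, wt Ω a u X * normalTerm Ω u X * ψ X ^ 2 ∂(latMeasure Ω))
      ≤ ∫ X in cyl Ω, formB a X.2 (gradU Ω u X) (grad (closedCyl Ω) ψ X)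
          (grad (closedCyl Ω) ψ X) * ‖gradX (latCyl Ω) u X‖ ^ 2 := by
  obtain ⟨R, hR⟩ := hψ_supp
  have hr := hu.solution.regular
  choose w hw using hr.trace_one
  obtain ⟨M, hM0, hM⟩ := exists_bound_of_support hΩ hψ hR
  obtain ⟨i1, i2, i3⟩ := hr.integrableOn_stability_terms hΩ ha hψ hR
  have hψ2 : ContDiffOn ℝ 1 (fun X => ψ X ^ 2) (closedCyl Ω) := hψ.pow 2
  have hR2 : ∀ X ∈ closedCyl Ω, R ≤ X.2 → ψ X ^ 2 = 0 := fun X hX hXR => by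
    rw [hR X hX hXR, zero_pow two_ne_zero]
  have hB := hr.integrable_normalTerm hΩ ha (b := fun X => ψ X ^ 2) hψ2.continuousOn (M := M ^ 2)
    (fun X hX => by rw [abs_pow]; exact pow_le_pow_left₀ (abs_nonneg _) (hM X hX).1 2) hR2
  refine ⟨i2, hB, i3, ?_⟩
  -- The linearized equation with weight `ψ²` and stability with `|∇ₓu| ψ`. The same `w`, the trace
  -- of `∇ₓu`, is used in both, so that the bottom terms agree literally.
  have hlin := hu.linearizedForm_eq_zero hΩ ha hg (hf.contDiff.of_le (by norm_num)) hw hψ2 hR2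
  have hst := (hu.stable _ _ _ (hr.isTest_norm_mul hΩ ha hψ hR hw)).2
  rw [setIntegral_congr_fun (isOpen_cyl hΩ.isOpen).measurableSet
    fun X hX => hr.formB_grad_norm_mul hΩ hψ hX] at hst
  -- Splitting the integral of the expanded form isolates the part common to the linearized
  -- equation. After subtraction all reaction terms cancel and the lateral term remains.
  have e1 := integral_add (i1.sub i2) i3
  simp only [Pi.sub_apply] at e1
  rw [e1, integral_sub i1 i2] at hst
  simp only [mul_pow, ← mul_assoc] at hst
  rw [linearizedForm] at hlin
  linarith
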